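/- **Setting.** Let $f:\mathbb R^2\to\mathbb R$ be smooth, $2\pi$-periodic in $y$, zero for $|x|>R$ (for some $R>0$), even in $x$ and even in $y$, with $\int_{\mathbb R}\int_0^{2\pi}f\,dy\,dx>0$. Put $f_j(x)=\int_0^{2\pi}e^{-ijy}f(x,y)\,dy$ and $\tilde f_j(\xi)=\int_{\mathbb R}e^{-i\xi x}f_j(x)\,dx$ for $j\in\mathbb Z$. For $0<\beta<1/2$ and real $\mu$ with $\mu^2<1-2\beta$ let $$\kappa=\sqrt{1-2\beta},\quad k_0=\sqrt{1-2\beta-\mu^2},\quad \gamma=\frac{(1-\beta)^2-\mu^2}{4\pi},\quad k_m=\sqrt{(\beta+m)^2-(1-\beta)^2+\mu^2}\ (m\ne0,-1),$$ $$H_0(x)=\frac{i}{2k_0}e^{ik_0|x|},\qquad H_{-1}(x)=\frac{e^{-\mu|x|}-1}{2\mu}\ \Big(=-\tfrac{|x|}{2}\text{ if }\mu=0\Big),\qquad H_m(x)=\frac{1}{2k_m}e^{-k_m|x|}\ (m\neq 0,-1).$$ Let $\mathcal A$ be the Banach space of square-summable sequences $\mathbf A=(A_m)_{m\in\mathbb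 Z}$ in $C([-R,R];\mathbb C)$ with the sup norm, and let $(\hat T\mathbf A)_m=2\gamma\sum_{n\in\mathbb Z}(H_n*A_n)f_{m-n}$ on $[-R,R]$, where $A_n$ is extended by $0$. With $\mathbf g^{(1)}_m=e^{ik_0x}f_m$, $\mathbf g^{(2)}_m=f_{m+1}$ and $\langle h\rangle=\int_{-R}^R h\,dx$, let $$F=\big\langle((1-\varepsilon\hat T)^{-1}\mathbf g^{(2)})_{-1}\big\rangle,\quad Q=\big\langle((1-\varepsilon\hat T)^{-1}\mathbf g^{(1)})_{-1}\big\rangle,\quad P^\pm=\big\langle((1-\varepsilon\hat T)^{-1}\mathbf g^{(1)})_{0}\,e^{\pm ik_0x}\big\rangle,$$ and, with all functions evaluated at $\mu=\varepsilon\nu$, $$a=\frac{i\varepsilon\gamma}{k_0}\big\{(\nu-\gamma F)P^++\gamma Q^2\big\},\qquad b=\nu-\gamma F+\frac{i\varepsilon\gamma}{k_0}\big\{(\nu-\gamma F)P^-+\gamma Q^2\big\}.$$ *Scattering problem.* In the strip $\Pi=\mathbb R\times(0,2\pi)$ consider, with $\omega^2=(1-\beta)^2-\mu^2$, $$-\nabla^2\Psi=\omega^2(1+\varepsilon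 f)\Psi,\qquad \Psi(x,2\pi)=e^{2\pi i\beta}\Psi(x,0),\quad \Psi_y(x,2\pi)=e^{2\pi i\beta}\Psi_y(x,0).$$ Let $H_1^\beta(\Pi)$ be the completion, in the norm $\|\Phi\|_{L^2(\Pi)}+\|\nabla\Phi\|_{L^2(\Pi)}$, of the smooth functions that satisfy these boundary conditions and vanish for large $|x|$. A solution with reflection coefficient $\mathcal R$ and transmission coefficient $\mathcal T$ is a function $\Psi$ such that $$\Psi-\chi(x)\mathcal T e^{i\beta y+ik_0x}-\chi(-x)\big(e^{i\beta y+ik_0x}+\mathcal R e^{i\beta y-ik_0x}\big)\in H_1^\beta(\Pi),$$ where $\chi$ is a smooth cut-off equal to $1$ for $x>1$ and to $0$ for $x<0$, and $\int_\Pi\nabla\Psi\cdot\nabla\overline\Phi=\omega^2\int_\Pi(1+\varepsilon f)\Psi\overline\Phi$ for all smooth $\Phi$ satisfying the boundary conditions and vanishing for large $|x|$. **Theorem.** Let $U$ be the set of $\beta\in(0,1/2)$ with $\tilde f_1(\kappa)\ne0$ and $\tilde f_0(2\kappa)\neq0$. There are an open set $\Omega\subset\mathbb R\times U$ containing $\{0\}\times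 U$ and real-valued functions $\nu_a,\nu_b$ of $(\varepsilon,\beta)$, real-analytic on $\Omega$, such that: 1. For all $(\varepsilon,\beta)\in\Omega$: for $\nu=\nu_a(\varepsilon,\beta)$ and for $\nu=\nu_b(\varepsilon,\beta)$, with $\mu=\varepsilon\nu$, one has $\mu^2<1-2\beta$ and $1-\varepsilon\hat T$ is bijective on $\mathcal A$; moreover $a=0$ at $\nu=\nu_a(\varepsilon,\beta)$, $b=0$ at $\nu=\nu_b(\varepsilon,\beta)$, and $\nu_a(\varepsilon,\beta)\ne\nu_b(\varepsilon,\beta)$. 2. For every $\beta\in U$, as $\varepsilon\to0$, $$\nu_a=\frac{(1-\beta)^2}{4\pi}\Big(\tilde f_0(0)-\frac{\tilde f_1(\kappa)^2}{\tilde f_0(2\kappa)}\Big)+O(\varepsilon),\qquad \nu_b=\frac{(1-\beta)^2}{4\pi}\tilde f_0(0)+O(\varepsilon).$$ 3. If $\beta\in U$ and $\nu_a(0,\beta)>0$, then for all sufficiently small $\varepsilon>0$ the scattering problem is solvable for $\mu=\varepsilon\nu_a(\varepsilon,\beta)$ and for $\mu=\varepsilon\nu_b(\varepsilon,\beta)$;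 every solution for $\mu=\varepsilon\nu_a$ has $\mathcal R=0$ (total transmission), and every solution for $\mu=\varepsilon\nu_b$ has $\mathcal T=0$ (total reflection). -/

import Mathlib

open scoped ContDiff Topology Asymptotics

noncomputable section

namespace RBScattering

/-! The perturbation and its Fourier data -/

/-- Fourier coefficient in `y`: `f_j(x) = ∫_0^{2π} e^{-ijy} f(x,y) dy`. -/
def fCoeff (f : ℝ × ℝ → ℝ) (j : ℤ) (x : ℝ) : ℂ :=
  ∫ y in (0 : ℝ)..(2 * Real.pi), Complex.exp (-(Complex.I * j * y)) * (f (x, y) : ℂ)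

/-- Fourier transform in `x` of the `j`-th coefficient: `∫ e^{-iξx} f_j(x) dx`. -/
def fTilde (f : ℝ × ℝ → ℝ) (j : ℤ) (ξ : ℝ) : ℂ :=
  ∫ x : ℝ, Complex.exp (-(Complex.I * ξ * x)) * fCoeff f j x

/-- `κ(β) = √(1 - 2β)`. -/
def kappa (β : ℝ) : ℝ := √(1 - 2 * β)

/-- The wavenumbers `β ∈ (0,1/2)` with `f̃₁(κ) ≠ 0` and `f̃₀(2κ) ≠ 0`. -/
def goodBeta (f : ℝ × ℝ → ℝ) : Set ℝ :=
  {β | 0 < β ∧ β < 1 / 2 ∧ fTilde f 1 (kappa β) ≠ 0 ∧ fTilde f 0 (2 * kappa β) ≠ 0}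

/-! The infinite system -/

/-- `γ = ω²/(4π)` with `ω² = (1-β)² - μ²`. -/
def gam (μ β : ℝ) : ℝ := ((1 - β) ^ 2 - μ ^ 2) / (4 * Real.pi)

/-- Wavenumber of the propagating mode. -/
def kZero (μ β : ℝ) : ℝ := √(1 - 2 * β - μ ^ 2)

/-- Decay rate of the `m`-th mode, `m ≠ 0, -1`. -/
def kMode (μ β : ℝ) (m : ℤ) : ℝ := √((β + m) ^ 2 - (1 - β) ^ 2 + μ ^ 2)

/-- The kernels `H_n`: the outgoing Green function for `n = 0`, the exponentially decaying one for
`n ≠ 0, -1`, and for `n = -1` the regularized one `(e^{-μ|x|} - 1)/(2μ)`, continued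
analytically to `μ = 0`. -/
def kernelH (μ β : ℝ) (n : ℤ) (x : ℝ) : ℂ :=
  if n = 0 then
    Complex.I / (2 * (kZero μ β : ℂ)) * Complex.exp (Complex.I * (kZero μ β : ℂ) * (|x| : ℝ))
  else if n = -1 then
    (if μ = 0 then ((-|x| / 2 : ℝ) : ℂ) else (((Real.exp (-μ * |x|) - 1) / (2 * μ) : ℝ) : ℂ))
  else ((Real.exp (-(kMode μ β n) * |x|) / (2 * kMode μ β n) : ℝ) : ℂ)

/-- The Banach space of square-summable sequences of continuous functions on `[-R,R]`. -/
abbrev SeqSpace (R : ℝ) : Type := lp (fun _ : ℤ => C(Set.Icc (-R) R, ℂ)) 2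

/-- Lebesgue measure on `[-R,R]`. -/
def segMeasure (R : ℝ) : MeasureTheory.Measure (Set.Icc (-R) R) :=
  MeasureTheory.volume.comap (fun x : Set.Icc (-R) R => (x : ℝ))

/-- `(h ∗ u)(x)`, the function `u` being extended by zero outside `[-R,R]`. -/
def conv {R : ℝ} (h : ℝ → ℂ) (u : C(Set.Icc (-R) R, ℂ)) (x : ℝ) : ℂ :=
  ∫ ξ : Set.Icc (-R) R, h (x - (ξ : ℝ)) * u ξ ∂(segMeasure R)

/-- `(T̂ A)_m(x) = 2γ ∑_n (H_n ∗ A_n)(x) f_{m-n}(x)`. -/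
def opT (f : ℝ × ℝ → ℝ) (R μ β : ℝ) (A : SeqSpace R) (m : ℤ) (x : ℝ) : ℂ :=
  2 * (gam μ β : ℂ) * ∑' n : ℤ, conv (kernelH μ β n) (A n) x * fCoeff f (m - n) x

/-- `(1 - ε T̂) A = g` on `[-R,R]`. -/
def Solves (f : ℝ × ℝ → ℝ) (R ε μ β : ℝ) (g : ℤ → Set.Icc (-R) R → ℂ) (A : SeqSpace R) : Prop :=
  ∀ (m : ℤ) (x : Set.Icc (-R) R), A m x - (ε : ℂ) * opT f R μ β A m x = g m x

/-- The parameters are regular: the mode `0` propagates and `1 - ε T̂` is bijective on the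
space `SeqSpace R`. -/
def Regular (f : ℝ × ℝ → ℝ) (R ε μ β : ℝ) : Prop :=
  0 < 1 - 2 * β - μ ^ 2 ∧
    ∀ G : SeqSpace R, ∃! A : SeqSpace R, Solves f R ε μ β (fun m x => G m x) A

/-- `(1 - ε T̂)⁻¹ g`, the solution `A` of `(1 - ε T̂) A = g` (unique for regular parameters). -/
def resolv (f : ℝ × ℝ → ℝ) (R ε μ β : ℝ) (g : ℤ → Set.Icc (-R) R → ℂ) : SeqSpace R :=
  Classical.epsilon (Solves f R ε μ β g)

/-- `g⁽¹⁾_m = e^{i k₀ x} f_m`. -/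
def gOne (f : ℝ × ℝ → ℝ) (R μ β : ℝ) (m : ℤ) (x : Set.Icc (-R) R) : ℂ :=
  Complex.exp (Complex.I * (kZero μ β : ℂ) * ((x : ℝ) : ℂ)) * fCoeff f m x

/-- `g⁽²⁾_m = f_{m+1}`. -/
def gTwo (f : ℝ × ℝ → ℝ) (R : ℝ) (m : ℤ) (x : Set.Icc (-R) R) : ℂ := fCoeff f (m + 1) x

/-- `F = ⟨((1 - εT̂)⁻¹ g⁽²⁾)_{-1}⟩`. -/
def funF (f : ℝ × ℝ → ℝ) (R ε μ β : ℝ) : ℂ :=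
  ∫ x : Set.Icc (-R) R, resolv f R ε μ β (gTwo f R) (-1) x ∂(segMeasure R)

/-- `Q = ⟨((1 - εT̂)⁻¹ g⁽¹⁾)_{-1}⟩`. -/
def funQ (f : ℝ × ℝ → ℝ) (R ε μ β : ℝ) : ℂ :=
  ∫ x : Set.Icc (-R) R, resolv f R ε μ β (gOne f R μ β) (-1) x ∂(segMeasure R)

/-- `P⁺ = ⟨((1 - εT̂)⁻¹ g⁽¹⁾)_0 e^{i k₀ x}⟩`. -/
def funPplus (f : ℝ × ℝ → ℝ) (R ε μ β : ℝ) : ℂ :=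
  ∫ x : Set.Icc (-R) R, resolv f R ε μ β (gOne f R μ β) 0 x *
    Complex.exp (Complex.I * (kZero μ β : ℂ) * ((x : ℝ) : ℂ)) ∂(segMeasure R)

/-- `P⁻ = ⟨((1 - εT̂)⁻¹ g⁽¹⁾)_0 e^{-i k₀ x}⟩`. -/
def funPminus (f : ℝ × ℝ → ℝ) (R ε μ β : ℝ) : ℂ :=
  ∫ x : Set.Icc (-R) R, resolv f R ε μ β (gOne f R μ β) 0 x *
    Complex.exp (-(Complex.I * (kZero μ β : ℂ) * ((x : ℝ) : ℂ))) ∂(segMeasure R)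

/-- `ℓ = ν - γF`, with `μ = εν`. -/
def funEll (f : ℝ × ℝ → ℝ) (R ε ν β : ℝ) : ℂ :=
  (ν : ℂ) - (gam (ε * ν) β : ℂ) * funF f R ε (ε * ν) β

/-- `a = i k₀⁻¹ ε γ {(ν - γF) P⁺ + γ Q²}`, with `μ = εν`. -/
def funA (f : ℝ × ℝ → ℝ) (R ε ν β : ℝ) : ℂ :=
  Complex.I * (kZero (ε * ν) β : ℂ)⁻¹ * (ε : ℂ) * (gam (ε * ν) β : ℂ) *
    (funEll f R ε ν β * funPplus f R ε (ε * ν) β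
      + (gam (ε * ν) β : ℂ) * funQ f R ε (ε * ν) β ^ 2)

/-- `b = ν - γF + i k₀⁻¹ ε γ {(ν - γF) P⁻ + γ Q²}`, with `μ = εν`. -/
def funB (f : ℝ × ℝ → ℝ) (R ε ν β : ℝ) : ℂ :=
  funEll f R ε ν β +
    Complex.I * (kZero (ε * ν) β : ℂ)⁻¹ * (ε : ℂ) * (gam (ε * ν) β : ℂ) *
      (funEll f R ε ν β * funPminus f R ε (ε * ν) β
        + (gam (ε * ν) β : ℂ) * funQ f R ε (ε * ν) β ^ 2)

/-! The scattering problem in the strip `ℝ × (0, 2π)` -/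

/-- Lebesgue measure on the strip `Π = ℝ × (0, 2π)`. -/
def stripMeasure : MeasureTheory.Measure (ℝ × ℝ) :=
  MeasureTheory.volume.restrict (Set.univ ×ˢ Set.Ioo (0 : ℝ) (2 * Real.pi))

/-- Partial derivative in `x`. -/
def dX (u : ℝ × ℝ → ℂ) (p : ℝ × ℝ) : ℂ := deriv (fun s : ℝ => u (s, p.2)) p.1

/-- Partial derivative in `y`. -/
def dY (u : ℝ × ℝ → ℂ) (p : ℝ × ℝ) : ℂ := deriv (fun s : ℝ => u (p.1, s)) p.2

/-- Smooth functions satisfying the quasiperiodic boundary conditions on the strip and vanishing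
for large `|x|`. -/
structure IsTest (β : ℝ) (Φ : ℝ × ℝ → ℂ) : Prop where
  smooth : ContDiff ℝ ∞ Φ
  bc : ∀ x : ℝ, Φ (x, 2 * Real.pi) = Complex.exp (2 * Real.pi * Complex.I * β) * Φ (x, 0)
  bc_dY : ∀ x : ℝ,
    dY Φ (x, 2 * Real.pi) = Complex.exp (2 * Real.pi * Complex.I * β) * dY Φ (x, 0)
  vanish : ∃ M : ℝ, ∀ x y : ℝ, M < |x| → Φ (x, y) = 0

/-- `w` belongs to the completion of the test functions in the norm
`‖w‖_{L²} + ‖∇w‖_{L²}` over the strip, and `(wx, wy)` is its gradient. -/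
def InH1 (β : ℝ) (w wx wy : ℝ × ℝ → ℂ) : Prop :=
  MeasureTheory.MemLp w 2 stripMeasure ∧ MeasureTheory.MemLp wx 2 stripMeasure ∧
  MeasureTheory.MemLp wy 2 stripMeasure ∧
  ∃ φ : ℕ → ℝ × ℝ → ℂ, (∀ n, IsTest β (φ n)) ∧
    Filter.Tendsto (fun n => MeasureTheory.eLpNorm (φ n - w) 2 stripMeasure)
      Filter.atTop (𝓝 0) ∧
    Filter.Tendsto (fun n => MeasureTheory.eLpNorm (dX (φ n) - wx) 2 stripMeasure)
      Filter.atTop (𝓝 0) ∧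
    Filter.Tendsto (fun n => MeasureTheory.eLpNorm (dY (φ n) - wy) 2 stripMeasure)
      Filter.atTop (𝓝 0)

/-- The radiating part
`χ(x) 𝓣 e^{iβy+ik₀x} + χ(-x) (e^{iβy+ik₀x} + 𝓡 e^{iβy-ik₀x})`, where `χ` is a smooth cut-off
function equal to `1` for `x > 1` and to `0` for `x < 0`. -/
def farField (β k : ℝ) (refl trans : ℂ) (p : ℝ × ℝ) : ℂ :=
  (Real.smoothTransition p.1 : ℂ) * (trans * Complex.exp (Complex.I * (β * p.2 + k * p.1)))
  + (Real.smoothTransition (-p.1) : ℂ) *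
      (Complex.exp (Complex.I * (β * p.2 + k * p.1))
        + refl * Complex.exp (Complex.I * (β * p.2 - k * p.1)))

/-- `Ψ` solves the scattering problem for
`-∇²Ψ = ω² (1 + ε f) Ψ`, `ω² = (1-β)² - μ²`, in the strip with quasiperiodic boundary conditions
(in the sense of the integral identity), for a wave of unit amplitude incident from the left,
with reflection coefficient `refl` and transmission coefficient `trans`. -/
def IsScatteringSolution (f : ℝ × ℝ → ℝ) (ε μ β : ℝ) (Ψ : ℝ × ℝ → ℂ) (refl trans : ℂ) : Prop :=
  ∃ wx wy : ℝ × ℝ → ℂ,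
    InH1 β (fun p => Ψ p - farField β (kZero μ β) refl trans p) wx wy ∧
    ∀ Φ : ℝ × ℝ → ℂ, IsTest β Φ →
      ∫ p, ((dX (farField β (kZero μ β) refl trans) p + wx p) * (starRingEnd ℂ) (dX Φ p)
          + (dY (farField β (kZero μ β) refl trans) p + wy p) * (starRingEnd ℂ) (dY Φ p))
          ∂stripMeasure
        = (((1 - β) ^ 2 - μ ^ 2 : ℝ) : ℂ) *
          ∫ p, (1 + (ε : ℂ) * (f p : ℂ)) * Ψ p * (starRingEnd ℂ) (Φ p) ∂stripMeasure

end RBScattering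

end

noncomputable section

namespace RBScattering

open MeasureTheory

section

variable {R : ℝ}

/-! ### Operators on the sequence space -/

/-! Expand the field as Σ u_n(x) e^{i(β+n)y}. The perturbation acts on mode m through the source A_m
= 2γε Σ_n f_{m-n} u_n, and each u_n is recovered from A_n by convolution with a Green function. Mode
-1 decays only at the rate μ = εν, so its Green function e^{-μ|x|}/(2μ) is singular at μ = 0. It is
split into the regular kernel H_{-1} and the constant 1/(2μ), and the constant sees only the mean of
A_{-1}. The system becomes A = 2γε (1 - εT̂)⁻¹(g⁽¹⁾ + s g⁽²⁾) with one scalar unknown s, fixed by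
s(ν - γF) = γQ, and the scattering coefficients are 𝓡 = a/(ν - γF) and 𝓣 = b/(ν - γF).

A complex equation for a real ν is overdetermined; the symmetries of f make a = 0 and b = 0
solvable. The outgoing kernel of mode 0 is the real kernel -sin(k₀|x-ξ|)/(2k₀) plus the kernel i
cos(k₀(x-ξ))/(2k₀) of rank two. The system without the rank two part is real, symmetric for the
bilinear pairing Σ ∫ A_n B_n, and invariant under x ↦ -x. So its resolvent has real matrix elements
F_r, q, C, D between 1, cos k₀x and sin k₀x, and the sine decouples from the even functions
(`resZ_symm`, `resZ_real`, `resZ_sin_left`). Put t = εγ/k₀ and λ = ν - γF_r. Eliminating the rank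
two part (`rank_two_solve`) gives (1-itC)(1-itD) a = it {λ(C-D) + γq²} and (1-itC)(1-itD) b =
λ(1+t²CD) + t²γq²D (`funA_eq`, `funB_eq`). The factors on the left cannot vanish since t, C, D are
real, so a and b are each governed by one real equation.

Both equations have the form ν = G(ε, εν, β) with G analytic near (0, 0, β₀), and the implicit
function theorem applies because the right-hand side does not depend on ν at ε = 0. At ε = 0 one has
F_r = f̃₀(0), q = f̃₁(κ) and C - D = f̃₀(2κ), which gives the leading terms and the inequality of
ν_a and ν_b. Local solutions are glued over U by uniqueness among bounded solutions
(`exists_global_solution`). Analyticity of G needs uniformity in the mode number: the kernels of all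
modes together are one element of a Banach algebra of bounded functions, and this element is
analytic in (μ, β) (`exists_analytic_kernel`).

For the scattering statement, ν - γF ≠ 0 when ε ≠ 0 and q ≠ 0 (`funEll_ne_zero`), so the system
yields a genuine solution with the coefficients above (`exists_scattering`). Conversely, the
difference of two solutions is a field without incident wave; its energy flux is both zero and
proportional to |δ𝓡|² + |δ𝓣|², δ denoting the difference of the coefficients, so the coefficients
are unique even though the field might not be (`scattering_unique`). -/

/-- Continuous complex functions on the segment `[-R, R]`. -/
abbrev SegFun (R : ℝ) : Type := C(Set.Icc (-R) R, ℂ)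

/-- The Banach algebra of bounded families of continuous kernels on `[-R, R]²`. -/
abbrev KerAlg (R : ℝ) : Type :=
  BoundedContinuousFunction (ℤ × Set.Icc (-R) R × Set.Icc (-R) R) ℂ

instance instIsFiniteMeasureSegMeasure : IsFiniteMeasure (segMeasure R) := by
  constructor
  have h : segMeasure R Set.univ = volume (Set.Icc (-R) R) := by
    rw [segMeasure, (MeasurableEmbedding.subtype_coe measurableSet_Icc).comap_apply]
    rw [Set.image_univ, Subtype.range_coe]
  rw [h]
  exact measure_Icc_lt_top

/-- Length of the segment. -/
def segLen (R : ℝ) : ℝ := (segMeasure R).real Set.univ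

theorem segLen_nonneg : 0 ≤ segLen R := measureReal_nonneg

theorem integrable_segFun (φ : SegFun R) : Integrable (fun x => φ x) (segMeasure R) := by
  refine Integrable.of_bound φ.continuous.aestronglyMeasurable ‖φ‖ ?_
  exact Filter.Eventually.of_forall fun x => φ.norm_coe_le_norm x

theorem norm_integral_seg_le {g : Set.Icc (-R) R → ℂ} {C : ℝ} (hg : ∀ x, ‖g x‖ ≤ C) :
    ‖∫ x, g x ∂(segMeasure R)‖ ≤ C * segLen R :=
  norm_integral_le_of_norm_le_const (Filter.Eventually.of_forall hg)

theorem integral_seg_eq (g : ℝ → ℂ) :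
    ∫ x : Set.Icc (-R) R, g x ∂(segMeasure R) = ∫ x in Set.Icc (-R) R, g x :=
  integral_subtype_comap measurableSet_Icc g

theorem seqSpace_summable_sq (A : SeqSpace R) : Summable fun n => ‖A n‖ ^ 2 := by
  have h := (lp.memℓp A).summable (by norm_num)
  simpa using h

theorem seqSpace_norm_sq (A : SeqSpace R) : ‖A‖ ^ 2 = ∑' n, ‖A n‖ ^ 2 := by
  have h := lp.norm_rpow_eq_tsum (p := 2) (by norm_num) A
  simpa using h

theorem memℓp_two_of_summable {φ : ℤ → SegFun R} (h : Summable fun n => ‖φ n‖ ^ 2) :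
    Memℓp φ 2 := by
  refine memℓp_gen ?_
  simpa using h

/-- A weighted permutation: `(A)_m ↦ L_m A_{σ m}`. -/
def permDiag (σ : Equiv.Perm ℤ) (L : ℤ → SegFun R →L[ℂ] SegFun R) (C : ℝ)
    (hL : ∀ n, ‖L n‖ ≤ C) : SeqSpace R →L[ℂ] SeqSpace R :=
  have hC : 0 ≤ C := le_trans (norm_nonneg (L 0)) (hL 0)
  have key : ∀ (A : SeqSpace R) n, ‖L n (A (σ n))‖ ^ 2 ≤ C ^ 2 * ‖A (σ n)‖ ^ 2 := fun A n => by
    rw [← mul_pow]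
    exact pow_le_pow_left₀ (norm_nonneg _) ((L n).le_of_opNorm_le (hL n) _) 2
  have hs : ∀ A : SeqSpace R, Summable fun n => C ^ 2 * ‖A (σ n)‖ ^ 2 := fun A =>
    (((Equiv.summable_iff σ).2 (seqSpace_summable_sq A))).mul_left _
  have hs' : ∀ A : SeqSpace R, Summable fun n => ‖L n (A (σ n))‖ ^ 2 := fun A =>
    Summable.of_nonneg_of_le (fun _ => by positivity) (key A) (hs A)
  LinearMap.mkContinuous
    { toFun := fun A => ⟨fun n => L n (A (σ n)), memℓp_two_of_summable (hs' A)⟩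
      map_add' := fun A B => by
        ext n x
        simp only [lp.coeFn_add, Pi.add_apply, map_add]
      map_smul' := fun c A => by
        ext n x
        simp only [lp.coeFn_smul, Pi.smul_apply, map_smul, RingHom.id_apply] } C fun A => by
    refine lp.norm_le_of_tsum_le (by norm_num) (by positivity) ?_
    have h1 : ∑' n, ‖L n (A (σ n))‖ ^ 2 ≤ C ^ 2 * ‖A‖ ^ 2 := by
      refine ((hs' A).tsum_le_tsum (key A) (hs A)).trans ?_
      rw [tsum_mul_left, seqSpace_norm_sq, Equiv.tsum_eq σ (fun n => ‖A n‖ ^ 2)]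
    simpa [mul_pow] using h1

theorem norm_permDiag_le (σ : Equiv.Perm ℤ) (L : ℤ → SegFun R →L[ℂ] SegFun R) (C : ℝ)
    (hL : ∀ n, ‖L n‖ ≤ C) : ‖permDiag σ L C hL‖ ≤ C := by
  unfold permDiag
  exact LinearMap.mkContinuous_norm_le _ (le_trans (norm_nonneg (L 0)) (hL 0)) _

/-- `(A)_m ↦ g A_{m-j}`. -/
def shiftMul (g : SegFun R) (j : ℤ) : SeqSpace R →L[ℂ] SeqSpace R :=
  permDiag (Equiv.subRight j) (fun _ => ContinuousLinearMap.mul ℂ (SegFun R) g) ‖g‖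
    fun _ => ContinuousLinearMap.opNorm_mul_apply_le ℂ (SegFun R) g

theorem shiftMul_apply (g : SegFun R) (j : ℤ) (A : SeqSpace R) (m : ℤ) :
    shiftMul g j A m = g * A (m - j) := rfl

theorem norm_shiftMul_le (g : SegFun R) (j : ℤ) : ‖shiftMul g j‖ ≤ ‖g‖ := norm_permDiag_le _ _ _ _

/-- The integral operator with kernel `K(n, ·, ·)`. -/
def kerInt (K : KerAlg R) (n : ℤ) : SegFun R →L[ℂ] SegFun R :=
  have hb : ∀ (φ : SegFun R) x, ‖∫ ξ, K (n, x, ξ) * φ ξ ∂(segMeasure R)‖ ≤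
      (‖K‖ * segLen R) * ‖φ‖ := fun φ x => by
    refine (norm_integral_seg_le (C := ‖K‖ * ‖φ‖) fun ξ => ?_).trans (le_of_eq (by ring))
    rw [norm_mul]
    exact mul_le_mul (K.norm_coe_le_norm _) (φ.norm_coe_le_norm _) (norm_nonneg _) (norm_nonneg _)
  have hi : ∀ (φ : SegFun R) x, Integrable (fun ξ => K (n, x, ξ) * φ ξ) (segMeasure R) :=
    fun φ x => by
      refine integrable_segFun (⟨fun ξ => K (n, x, ξ) * φ ξ, ?_⟩ : SegFun R)
      fun_prop
  LinearMap.mkContinuous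
    { toFun := fun φ => ⟨fun x => ∫ ξ, K (n, x, ξ) * φ ξ ∂(segMeasure R), by
        have h := continuous_parametric_integral_of_continuous (μ := segMeasure R)
          (f := fun x ξ => K (n, x, ξ) * φ ξ) (by fun_prop) isCompact_univ
        simpa using h⟩
      map_add' := fun φ ψ => by
        ext x
        simp only [ContinuousMap.add_apply, ContinuousMap.coe_mk, mul_add]
        exact integral_add (hi φ x) (hi ψ x)
      map_smul' := fun c φ => by
        ext x
        simp only [ContinuousMap.smul_apply, ContinuousMap.coe_mk, smul_eq_mul, RingHom.id_apply]
        rw [← integral_const_mul]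
        congr 1
        ext ξ
        ring } (‖K‖ * segLen R) fun φ => by
    refine (ContinuousMap.norm_le _ (mul_nonneg (mul_nonneg (norm_nonneg _) segLen_nonneg)
      (norm_nonneg _))).2 fun x => hb φ x

theorem kerInt_apply (K : KerAlg R) (n : ℤ) (φ : SegFun R) (x : Set.Icc (-R) R) :
    kerInt K n φ x = ∫ ξ, K (n, x, ξ) * φ ξ ∂(segMeasure R) := rfl

theorem norm_kerInt_le (K : KerAlg R) (n : ℤ) : ‖kerInt K n‖ ≤ ‖K‖ * segLen R := by
  unfold kerInt
  exact LinearMap.mkContinuous_norm_le _ (mul_nonneg (norm_nonneg _) segLen_nonneg) _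

theorem integrable_kernel_mul (K : KerAlg R) (n : ℤ) (φ : SegFun R) (x : Set.Icc (-R) R) :
    Integrable (fun ξ => K (n, x, ξ) * φ ξ) (segMeasure R) := by
  refine integrable_segFun (⟨fun ξ => K (n, x, ξ) * φ ξ, ?_⟩ : SegFun R)
  fun_prop

/-- The diagonal operator `(A)_n ↦ K_n A_n`. -/
def kerDiag (K : KerAlg R) : SeqSpace R →L[ℂ] SeqSpace R :=
  permDiag (Equiv.refl ℤ) (kerInt K) (‖K‖ * segLen R) (norm_kerInt_le K)

theorem kerDiag_apply (K : KerAlg R) (A : SeqSpace R) (n : ℤ) :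
    kerDiag K A n = kerInt K n (A n) := rfl

theorem norm_kerDiag_le (K : KerAlg R) : ‖kerDiag K‖ ≤ segLen R * ‖K‖ :=
  (norm_permDiag_le _ _ _ (norm_kerInt_le K)).trans_eq (mul_comm _ _)

/-- The diagonal operator `(A)_n ↦ K_n A_n`, linear in the kernel. -/
def kerOp : KerAlg R →L[ℂ] (SeqSpace R →L[ℂ] SeqSpace R) :=
  LinearMap.mkContinuous
    { toFun := fun K => kerDiag K
      map_add' := fun K K' => by
        ext A n x
        simp only [kerDiag_apply, _root_.add_apply, lp.coeFn_add, Pi.add_apply,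
          ContinuousMap.add_apply, kerInt_apply, BoundedContinuousFunction.add_apply, add_mul]
        exact integral_add (integrable_kernel_mul K n _ x) (integrable_kernel_mul K' n _ x)
      map_smul' := fun c K => by
        ext A n x
        simp only [kerDiag_apply, _root_.smul_apply, lp.coeFn_smul, Pi.smul_apply,
          ContinuousMap.smul_apply, kerInt_apply, BoundedContinuousFunction.smul_apply,
          RingHom.id_apply, smul_eq_mul]
        rw [← integral_const_mul]
        congr 1
        ext ξ
        ring } (segLen R) norm_kerDiag_le

theorem kerOp_apply (K : KerAlg R) (A : SeqSpace R) (n : ℤ) : kerOp K A n = kerInt K n (A n) := rfl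

/-- Discrete convolution with the sequence `c`. -/
def mulOp (c : ℤ → SegFun R) : SeqSpace R →L[ℂ] SeqSpace R := ∑' j, shiftMul (c j) j

theorem summable_shiftMul {c : ℤ → SegFun R} (hc : Summable fun j => ‖c j‖) :
    Summable fun j => shiftMul (c j) j := by
  have h : Summable fun j => ‖shiftMul (c j) j‖ :=
    Summable.of_nonneg_of_le (fun j => norm_nonneg (shiftMul (c j) j))
      (fun j => norm_shiftMul_le (c j) j) hc
  exact Summable.of_norm (f := fun j => shiftMul (c j) j) h

/-- Evaluation at `(n, x)`. -/
def evalAt (n : ℤ) (x : Set.Icc (-R) R) : SeqSpace R →L[ℂ] ℂ :=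
  (ContinuousMap.evalCLM ℂ x).comp (lp.evalCLM ℂ (fun _ : ℤ => SegFun R) 2 n)

theorem evalAt_apply (n : ℤ) (x : Set.Icc (-R) R) (A : SeqSpace R) : evalAt n x A = A n x := rfl

/-- The series of shifts converges in operator norm, hence can be evaluated at a point; the
substitution j = m - n brings it to the form used in `opT`. -/
theorem hasSum_mulOp {c : ℤ → SegFun R} (hc : Summable fun j => ‖c j‖) (A : SeqSpace R) (m : ℤ)
    (x : Set.Icc (-R) R) : HasSum (fun n => A n x * c (m - n) x) (mulOp c A m x) := by
  have h1 := (summable_shiftMul hc).hasSum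
  have h2 : HasSum (fun j => evalAt m x (shiftMul (c j) j A)) (evalAt m x (mulOp c A)) :=
    (h1.mapL (ContinuousLinearMap.apply ℂ (SeqSpace R) A)).mapL (evalAt m x)
  rw [← (Equiv.subLeft m).hasSum_iff] at h2
  convert h2 using 2 with n
  · simp [evalAt_apply, shiftMul_apply, mul_comm]
  · rfl

/-- The linear functional `A ↦ ∫ A_n h`. -/
def pairAt (n : ℤ) (h : SegFun R) : SeqSpace R →L[ℂ] ℂ :=
  LinearMap.mkContinuous
    { toFun := fun A => ∫ x, A n x * h x ∂(segMeasure R)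
      map_add' := fun A B => by
        simp only [lp.coeFn_add, Pi.add_apply, ContinuousMap.add_apply, add_mul]
        exact integral_add (integrable_segFun (A n * h)) (integrable_segFun (B n * h))
      map_smul' := fun c A => by
        simp only [lp.coeFn_smul, Pi.smul_apply, ContinuousMap.smul_apply, smul_eq_mul,
          RingHom.id_apply, mul_assoc]
        rw [integral_const_mul] } (‖h‖ * segLen R) fun A => by
    refine (norm_integral_seg_le (C := ‖A n‖ * ‖h‖) fun x => ?_).trans ?_
    · rw [norm_mul]
      exact mul_le_mul ((A n).norm_coe_le_norm _) (h.norm_coe_le_norm _) (norm_nonneg _)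
        (norm_nonneg _)
    · have h1 : ‖A n‖ ≤ ‖A‖ := lp.norm_apply_le_norm (by norm_num) A n
      calc ‖A n‖ * ‖h‖ * segLen R = (‖h‖ * segLen R) * ‖A n‖ := by ring
        _ ≤ (‖h‖ * segLen R) * ‖A‖ :=
          mul_le_mul_of_nonneg_left h1 (mul_nonneg (norm_nonneg _) segLen_nonneg)

theorem pairAt_apply (n : ℤ) (h : SegFun R) (A : SeqSpace R) :
    pairAt n h A = ∫ x, A n x * h x ∂(segMeasure R) := rfl

theorem norm_pairAt_le (n : ℤ) (h : SegFun R) : ‖pairAt n h‖ ≤ ‖h‖ * segLen R := by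
  unfold pairAt
  exact LinearMap.mkContinuous_norm_le _ (mul_nonneg (norm_nonneg _) segLen_nonneg) _

/-- The functional `A ↦ ∫ A_n h` depends linearly on `h`. -/
def pairL (n : ℤ) : SegFun R →L[ℂ] (SeqSpace R →L[ℂ] ℂ) :=
  LinearMap.mkContinuous
    { toFun := fun h => pairAt n h
      map_add' := fun h h' => by
        ext A
        simp only [pairAt_apply, _root_.add_apply, ContinuousMap.add_apply, mul_add]
        exact integral_add (integrable_segFun (A n * h)) (integrable_segFun (A n * h'))
      map_smul' := fun c h => by
        ext A
        simp only [pairAt_apply, _root_.smul_apply, ContinuousMap.smul_apply,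
          smul_eq_mul, RingHom.id_apply]
        rw [← integral_const_mul]
        congr 1
        ext x
        ring } (segLen R) fun h => (norm_pairAt_le n h).trans_eq (mul_comm _ _)

theorem pairL_apply (n : ℤ) (h : SegFun R) (A : SeqSpace R) :
    pairL n h A = ∫ x, A n x * h x ∂(segMeasure R) := rfl

/-! ### The bilinear pairing -/

theorem summable_norm_mul_norm (A B : SeqSpace R) : Summable fun n => ‖A n‖ * ‖B n‖ := by
  refine Summable.of_nonneg_of_le (fun _ => by positivity) (fun n => ?_)
    ((seqSpace_summable_sq A).add (seqSpace_summable_sq B))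
  nlinarith [sq_nonneg (‖A n‖ - ‖B n‖), sq_nonneg (‖A n‖), sq_nonneg (‖B n‖)]

theorem norm_integral_mul_le (φ ψ : SegFun R) :
    ‖∫ x, φ x * ψ x ∂(segMeasure R)‖ ≤ segLen R * (‖φ‖ * ‖ψ‖) := by
  refine (norm_integral_seg_le (C := ‖φ‖ * ‖ψ‖) fun x => ?_).trans (le_of_eq (mul_comm _ _))
  rw [norm_mul]
  exact mul_le_mul (φ.norm_coe_le_norm _) (ψ.norm_coe_le_norm _) (norm_nonneg _) (norm_nonneg _)

theorem summable_integral_mul (A B : SeqSpace R) :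
    Summable fun n => ∫ x, A n x * B n x ∂(segMeasure R) :=
  Summable.of_norm_bounded ((summable_norm_mul_norm A B).mul_left (segLen R))
    fun _ => norm_integral_mul_le _ _

theorem tsum_norm_mul_norm_le (A B : SeqSpace R) : ∑' n, ‖A n‖ * ‖B n‖ ≤ ‖A‖ * ‖B‖ := by
  have h := Real.inner_le_Lp_mul_Lq_tsum_of_nonneg (f := fun n => ‖A n‖) (g := fun n => ‖B n‖)
    (p := 2) (q := 2) Real.HolderConjugate.two_two (fun _ => norm_nonneg _) (fun _ => norm_nonneg _)
    (by simpa using seqSpace_summable_sq A) (by simpa using seqSpace_summable_sq B)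
  refine h.trans (le_of_eq ?_)
  simp only [Real.rpow_ofNat]
  rw [← seqSpace_norm_sq, ← seqSpace_norm_sq, ← Real.sqrt_eq_rpow, ← Real.sqrt_eq_rpow,
    Real.sqrt_sq (norm_nonneg _), Real.sqrt_sq (norm_nonneg _)]

/-- The symmetric bilinear pairing `∑_n ∫ A_n B_n` as a functional of `A`. -/
def bil (B : SeqSpace R) : SeqSpace R →L[ℂ] ℂ :=
  LinearMap.mkContinuous
    { toFun := fun A => ∑' n, ∫ x, A n x * B n x ∂(segMeasure R)
      map_add' := fun A A' => by
        rw [← (summable_integral_mul A B).tsum_add (summable_integral_mul A' B)]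
        congr 1
        ext n
        simp only [lp.coeFn_add, Pi.add_apply, ContinuousMap.add_apply, add_mul]
        exact integral_add (integrable_segFun (A n * B n)) (integrable_segFun (A' n * B n))
      map_smul' := fun c A => by
        simp only [lp.coeFn_smul, Pi.smul_apply, ContinuousMap.smul_apply, smul_eq_mul,
          RingHom.id_apply, mul_assoc, integral_const_mul, tsum_mul_left] } (segLen R * ‖B‖)
    fun A => by
      refine (tsum_of_norm_bounded ((summable_norm_mul_norm A B).mul_left (segLen R)).hasSum
        fun n => norm_integral_mul_le _ _).trans ?_
      rw [tsum_mul_left, mul_assoc, mul_comm ‖B‖]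
      exact mul_le_mul_of_nonneg_left (tsum_norm_mul_norm_le A B) segLen_nonneg

theorem bil_apply (A B : SeqSpace R) :
    bil B A = ∑' n, ∫ x, A n x * B n x ∂(segMeasure R) := rfl

theorem bil_comm (A B : SeqSpace R) : bil B A = bil A B := by
  simp only [bil_apply, mul_comm]

theorem bil_single (n : ℤ) (h : SegFun R) (A : SeqSpace R) :
    bil (lp.single 2 n h) A = ∫ x, A n x * h x ∂(segMeasure R) := by
  rw [bil_apply, tsum_eq_single n]
  · simp
  · intro m hm
    simp [Pi.single_eq_of_ne hm]

theorem bil_shiftMul (g : SegFun R) (j : ℤ) (A B : SeqSpace R) :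
    bil B (shiftMul g j A) = bil (shiftMul g (-j) B) A := by
  rw [bil_apply, bil_apply, ← Equiv.tsum_eq (Equiv.addRight j)]
  congr 1
  ext n
  simp only [Equiv.coe_addRight, shiftMul_apply, ContinuousMap.mul_apply, sub_neg_eq_add,
    add_sub_cancel_right]
  congr 1
  ext x
  ring

/-- The transpose of the shift by j is the shift by -j, and c_{-j} = c_j. This is where evenness of
f in y enters. -/
theorem bil_mulOp {c : ℤ → SegFun R} (hc : Summable fun j => ‖c j‖) (hsymm : ∀ j, c (-j) = c j)
    (A B : SeqSpace R) : bil B (mulOp c A) = bil (mulOp c B) A := by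
  have h1 := (summable_shiftMul hc).hasSum
  have h2 : HasSum (fun j => bil B (shiftMul (c j) j A)) (bil B (mulOp c A)) :=
    (h1.mapL (ContinuousLinearMap.apply ℂ (SeqSpace R) A)).mapL (bil B)
  have h3 : HasSum (fun j => bil A (shiftMul (c j) j B)) (bil A (mulOp c B)) :=
    (h1.mapL (ContinuousLinearMap.apply ℂ (SeqSpace R) B)).mapL (bil A)
  rw [← (Equiv.neg ℤ).hasSum_iff] at h3
  rw [bil_comm A (mulOp c B)]
  refine h2.unique (h3.congr_fun ?_)
  intro j
  simp only [Function.comp_apply, Equiv.neg_apply, hsymm]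
  rw [bil_shiftMul, bil_comm]

/-- Fubini on the square, with the two variables of the symmetric kernel exchanged. -/
theorem bil_kerOp {K : KerAlg R} (hK : ∀ n x ξ, K (n, x, ξ) = K (n, ξ, x)) (A B : SeqSpace R) :
    bil B (kerOp K A) = bil (kerOp K B) A := by
  rw [bil_apply, bil_apply]
  congr 1
  ext n
  simp only [kerOp_apply, kerInt_apply]
  simp only [← integral_mul_const, ← integral_const_mul]
  rw [integral_integral_swap]
  · congr 1
    ext x
    congr 1
    ext ξ
    rw [hK n ξ x]
    ring
  · have hc : Continuous fun p : Set.Icc (-R) R × Set.Icc (-R) R =>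
        K (n, p.1, p.2) * A n p.2 * B n p.1 := by fun_prop
    refine Integrable.of_bound hc.aestronglyMeasurable (‖K‖ * ‖A n‖ * ‖B n‖) ?_
    refine Filter.Eventually.of_forall fun p => ?_
    simp only [norm_mul, Function.uncurry_def]
    gcongr
    · exact K.norm_coe_le_norm _
    · exact (A n).norm_coe_le_norm _
    · exact (B n).norm_coe_le_norm _

end

section

variable {R : ℝ}

/-! ### Analytic dependence of the kernels on the parameters -/

/-- The real part of the system: `kernelH` with the outgoing kernel of the propagating mode
replaced by the real one. -/
def kernelR (μ β : ℝ) (n : ℤ) (x : ℝ) : ℝ :=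
  if n = 0 then -Real.sin (kZero μ β * |x|) / (2 * kZero μ β)
  else if n = -1 then (if μ = 0 then -|x| / 2 else (Real.exp (-μ * |x|) - 1) / (2 * μ))
  else Real.exp (-(kMode μ β n) * |x|) / (2 * kMode μ β n)

theorem kernelR_neg (μ β : ℝ) (n : ℤ) (x : ℝ) : kernelR μ β n (-x) = kernelR μ β n x := by
  simp only [kernelR, abs_neg]

theorem abs_sub_seg_le (x ξ : Set.Icc (-R) R) : |(x : ℝ) - ξ| ≤ 2 * R := by
  rw [abs_le]
  constructor <;> linarith [x.2.1, x.2.2, ξ.2.1, ξ.2.2]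

/-- The element of `KerAlg` given by a family of difference kernels. -/
def kerMk (g : ℤ → ℝ → ℂ) (hg : ∀ n, Continuous (g n)) (C : ℝ)
    (hC : ∀ n t, |t| ≤ 2 * R → ‖g n t‖ ≤ C) : KerAlg R :=
  BoundedContinuousFunction.ofNormedAddCommGroup (fun p => g p.1 ((p.2.1 : ℝ) - p.2.2))
    (by
      refine continuous_prod_of_discrete_left.2 fun n => ?_
      exact (hg n).comp (by fun_prop)) C fun p => hC _ _ (abs_sub_seg_le _ _)

/-- Evaluation at a point as a ring homomorphism. -/
def kerEval (p : ℤ × Set.Icc (-R) R × Set.Icc (-R) R) : KerAlg R →+* ℂ where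
  toFun f := f p
  map_one' := rfl
  map_mul' _ _ := rfl
  map_zero' := rfl
  map_add' _ _ := rfl

theorem ker_exp_apply (f : KerAlg R) (p : ℤ × Set.Icc (-R) R × Set.Icc (-R) R) :
    (NormedSpace.exp f) p = Complex.exp (f p) := by
  have h := NormedSpace.map_exp (f := kerEval p)
    (BoundedContinuousFunction.evalCLM ℂ p).continuous f
  rw [Complex.exp_eq_exp_ℂ]
  exact h

theorem ker_inverse_apply {f : KerAlg R} (hf : IsUnit f)
    (p : ℤ × Set.Icc (-R) R × Set.Icc (-R) R) : (Ring.inverse f) p = (f p)⁻¹ := by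
  have h : (Ring.inverse f * f) p = 1 := by rw [Ring.inverse_mul_cancel f hf]; rfl
  exact eq_inv_of_mul_eq_one_left h

theorem kMode_sq_eq (μ β : ℝ) (n : ℤ) :
    (β + n) ^ 2 - (1 - β) ^ 2 + μ ^ 2 = (n + 1) * (2 * β + n - 1) + μ ^ 2 := by ring

/-- At μ = 0 one has k_n² = (n+1)(2β+n-1). The ratio (n+1)/(2β+n-1) is at most 1 for n ≤ -2 and at
most 3 for n ≥ 2, and it equals 1/β for n = 1, where the mode is close to its cut-off when β is
small. The bound makes 1/k_n and (n+1)/k_n bounded sequences. -/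
theorem sq_le_mul_kMode_sq {β : ℝ} (h0 : 0 < β) (h1 : β < 1 / 2) (μ : ℝ) {n : ℤ} (hn : n ≠ 0)
    (hn' : n ≠ -1) :
    ((n : ℝ) + 1) ^ 2 ≤ (3 + 1 / β) * ((β + n) ^ 2 - (1 - β) ^ 2 + μ ^ 2) := by
  have hb : 0 < 1 / β := by positivity
  have key : ((n : ℝ) + 1) ^ 2 ≤ (3 + 1 / β) * ((n + 1) * (2 * β + n - 1)) := by
    rcases lt_or_ge n 1 with h | h
    · have h2 : n ≤ -2 := by omega
      have h3 : (n : ℝ) ≤ -2 := by exact_mod_cast h2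
      have h4 : ((n : ℝ) + 1) ^ 2 ≤ (n + 1) * (2 * β + n - 1) := by nlinarith
      have h5 : 0 ≤ ((n : ℝ) + 1) ^ 2 := sq_nonneg _
      nlinarith [mul_nonneg hb.le (h5.trans h4)]
    · rcases eq_or_lt_of_le h with h2 | h2
      · subst h2
        have h3 : 1 / β * (4 * β) = 4 := by field_simp
        push_cast
        nlinarith
      · have h3 : (2 : ℝ) ≤ n := by exact_mod_cast h2
        have h4 : ((n : ℝ) + 1) ^ 2 ≤ 3 * ((n + 1) * (2 * β + n - 1)) := by nlinarith
        have h5 : 0 ≤ ((n : ℝ) + 1) * (2 * β + n - 1) := by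
          apply mul_nonneg <;> linarith
        nlinarith [mul_nonneg hb.le h5]
  have : 0 ≤ (3 + 1 / β) * μ ^ 2 := by positivity
  rw [kMode_sq_eq]
  linarith

theorem one_le_sq_of_ne {n : ℤ} (hn' : n ≠ -1) : (1 : ℝ) ≤ ((n : ℝ) + 1) ^ 2 := by
  have h : (1 : ℤ) ≤ (n + 1) ^ 2 := by
    have : 0 < (n + 1) ^ 2 := by
      have : n + 1 ≠ 0 := by omega
      positivity
    omega
  exact_mod_cast h

theorem kMode_arg_pos {β : ℝ} (h0 : 0 < β) (h1 : β < 1 / 2) (μ : ℝ) {n : ℤ} (hn : n ≠ 0)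
    (hn' : n ≠ -1) : 0 < (β + n) ^ 2 - (1 - β) ^ 2 + μ ^ 2 := by
  have h := sq_le_mul_kMode_sq h0 h1 μ hn hn'
  have h2 := one_le_sq_of_ne hn'
  have hb : 0 < 3 + 1 / β := by positivity
  by_contra hc
  nlinarith [mul_nonneg hb.le (sub_nonneg.2 (not_lt.1 hc))]

theorem kMode_pos {β : ℝ} (h0 : 0 < β) (h1 : β < 1 / 2) (μ : ℝ) {n : ℤ} (hn : n ≠ 0)
    (hn' : n ≠ -1) : 0 < kMode μ β n := Real.sqrt_pos.2 (kMode_arg_pos h0 h1 μ hn hn')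

theorem kMode_sq {β : ℝ} (h0 : 0 < β) (h1 : β < 1 / 2) (μ : ℝ) {n : ℤ} (hn : n ≠ 0)
    (hn' : n ≠ -1) : kMode μ β n ^ 2 = (β + n) ^ 2 - (1 - β) ^ 2 + μ ^ 2 :=
  Real.sq_sqrt (kMode_arg_pos h0 h1 μ hn hn').le

/-- The bound for `|n + 1| / k_n`. -/
def modeBound (β : ℝ) : ℝ := √(3 + 1 / β)

theorem abs_succ_le {β : ℝ} (h0 : 0 < β) (h1 : β < 1 / 2) (μ : ℝ) {n : ℤ} (hn : n ≠ 0)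
    (hn' : n ≠ -1) : |(n : ℝ) + 1| ≤ modeBound β * kMode μ β n := by
  rw [modeBound, kMode, ← Real.sqrt_mul (by positivity), ← Real.sqrt_sq_eq_abs]
  exact Real.sqrt_le_sqrt (sq_le_mul_kMode_sq h0 h1 μ hn hn')

theorem one_le_modeBound_mul {β : ℝ} (h0 : 0 < β) (h1 : β < 1 / 2) (μ : ℝ) {n : ℤ} (hn : n ≠ 0)
    (hn' : n ≠ -1) : 1 ≤ modeBound β * kMode μ β n := by
  refine le_trans ?_ (abs_succ_le h0 h1 μ hn hn')
  rw [← one_le_sq_iff_one_le_abs]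
  exact one_le_sq_of_ne hn'

/-- `1 / k_n` at `μ = 0`, extended by `0` to the modes `0` and `-1`. -/
def invMode (β : ℝ) (n : ℤ) : ℝ := if n = 0 ∨ n = -1 then 0 else (kMode 0 β n)⁻¹

theorem abs_invMode_le {β : ℝ} (h0 : 0 < β) (h1 : β < 1 / 2) (n : ℤ) :
    |invMode β n| ≤ modeBound β := by
  have hm : 0 ≤ modeBound β := Real.sqrt_nonneg _
  unfold invMode
  split_ifs with h
  · simpa
  · push Not at h
    have hk := kMode_pos h0 h1 0 h.1 h.2
    rw [abs_of_pos (inv_pos.2 hk), inv_le_iff_one_le_mul₀ hk]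
    exact one_le_modeBound_mul h0 h1 0 h.1 h.2

theorem abs_succ_mul_invMode_le {β : ℝ} (h0 : 0 < β) (h1 : β < 1 / 2) (n : ℤ) :
    |((n : ℝ) + 1) * invMode β n| ≤ modeBound β := by
  have hm : 0 ≤ modeBound β := Real.sqrt_nonneg _
  unfold invMode
  split_ifs with h
  · simpa
  · push Not at h
    have hk := kMode_pos h0 h1 0 h.1 h.2
    rw [abs_mul, abs_of_pos (inv_pos.2 hk), ← div_eq_mul_inv, div_le_iff₀ hk]
    exact abs_succ_le h0 h1 0 h.1 h.2

theorem analyticAt_kZero {p : ℝ × ℝ} (hp : 0 < 1 - 2 * p.2 - p.1 ^ 2) :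
    AnalyticAt ℝ (fun p : ℝ × ℝ => kZero p.1 p.2) p := by
  have h1 : ContDiffAt ℝ ω (fun p : ℝ × ℝ => 1 - 2 * p.2 - p.1 ^ 2) p := by fun_prop
  exact (h1.sqrt hp.ne').analyticAt

end

/-! ### The shift of all decay rates at once -/

section

variable {R : ℝ}

/-- Dividing (k + d)² = k² + 2ky by 2k gives d + κd²/2 = y with κ = 1/k. The left side has
derivative the identity at d = 0, so the inverse function theorem in the Banach algebra solves it
analytically for d. -/
theorem exists_local_quadratic_inverse {𝔸 : Type*} [NormedCommRing 𝔸] [NormedAlgebra ℝ 𝔸]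
    [CompleteSpace 𝔸] (κ : 𝔸) :
    ∃ g : 𝔸 → 𝔸, ContDiffAt ℝ ω g 0 ∧ g 0 = 0 ∧
      ∀ᶠ y in 𝓝 (0 : 𝔸), g y + (1 / 2 : ℝ) • (κ * g y ^ 2) = y := by
  set Φ : 𝔸 → 𝔸 := fun d => d + (1 / 2 : ℝ) • (κ * d ^ 2) with hΦ
  have hΦc : ContDiffAt ℝ ω Φ 0 := by
    have : ContDiff ℝ ω Φ := by
      refine contDiff_id.add (ContDiff.const_smul _ ?_)
      exact contDiff_const.mul (contDiff_id.pow 2)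
    exact this.contDiffAt
  have hΦd : HasFDerivAt Φ ((ContinuousLinearEquiv.refl ℝ 𝔸 : 𝔸 ≃L[ℝ] 𝔸) : 𝔸 →L[ℝ] 𝔸) 0 := by
    have h2 := ((hasFDerivAt_id (𝕜 := ℝ) (0 : 𝔸)).mul (hasFDerivAt_id (𝕜 := ℝ) 0))
    have h3 := (hasFDerivAt_id (𝕜 := ℝ) (0 : 𝔸)).add
      ((h2.const_mul κ).const_smul (1 / 2 : ℝ))
    convert! h3 using 1
    · ext d
      simp [hΦ, sq]
    · ext d
      simp
  have hΦ0 : Φ 0 = 0 := by simp [hΦ]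
  refine ⟨hΦc.localInverse hΦd (by simp), ?_, ?_, ?_⟩
  · have := hΦc.to_localInverse hΦd (by simp)
    rwa [hΦ0] at this
  · have := hΦc.localInverse_apply_image hΦd (by simp)
    rwa [hΦ0] at this
  · have := (hΦc.hasStrictFDerivAt' hΦd (by simp)).eventually_right_inverse
    rwa [hΦ0] at this

/-- Each k_n is analytic in (μ, β), but what is needed is analyticity in the sup norm over n. The
quadratic equation for d = k_n(μ, β) - k_n(0, β₀) has bounded coefficient sequences, although k_n
itself is unbounded, so it can be solved inside `KerAlg`. -/
theorem exists_analytic_mode_shift {β₀ : ℝ} (h0 : 0 < β₀) (h1 : β₀ < 1 / 2) :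
    ∃ (κ : KerAlg R) (d : ℝ × ℝ → KerAlg R),
      (∀ n x ξ, κ (n, x, ξ) = (invMode β₀ n : ℂ)) ∧
      AnalyticAt ℝ d (0, β₀) ∧ d (0, β₀) = 0 ∧
      ∀ᶠ p in 𝓝 ((0 : ℝ), β₀), ∀ (n : ℤ), n ≠ 0 → n ≠ -1 → ∀ x ξ,
        d p (n, x, ξ) = ((kMode p.1 p.2 n - kMode 0 β₀ n : ℝ) : ℂ) := by
  have hcomplex : ∀ (a : ℝ) (C : ℝ), |a| ≤ C → ‖(a : ℂ)‖ ≤ C := fun a C h => by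
    rwa [Complex.norm_real]
  set κ : KerAlg R := kerMk (fun n _ => (invMode β₀ n : ℂ)) (fun _ => continuous_const)
    (modeBound β₀) (fun n _ _ => hcomplex _ _ (abs_invMode_le h0 h1 n)) with hκ
  set N : KerAlg R := kerMk (fun n _ => ((((n : ℝ) + 1) * invMode β₀ n : ℝ) : ℂ))
    (fun _ => continuous_const) (modeBound β₀)
    (fun n _ _ => hcomplex _ _ (abs_succ_mul_invMode_le h0 h1 n)) with hN
  obtain ⟨g, hgc, hg0, hgr⟩ := exists_local_quadratic_inverse κ
  -- Half the increment of k_n², which is (n+1)(β-β₀) + μ²/2, divided by k_n(0, β₀).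
  set y : ℝ × ℝ → KerAlg R := fun p => (p.2 - β₀) • N + (p.1 ^ 2 / 2) • κ with hy
  have hy0 : y (0, β₀) = 0 := by simp [hy]
  have hyc : ContDiff ℝ ω y := by
    have h1 : ContDiff ℝ ω fun p : ℝ × ℝ => p.2 - β₀ := by fun_prop
    have h2 : ContDiff ℝ ω fun p : ℝ × ℝ => p.1 ^ 2 / 2 := by fun_prop
    exact ContDiff.add (h1.smul contDiff_const) (h2.smul contDiff_const)
  refine ⟨κ, fun p => g (y p), fun n x ξ => rfl, ?_, by simp only [hy0, hg0], ?_⟩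
  · refine ContDiffAt.analyticAt ?_
    refine ContDiffAt.comp _ ?_ hyc.contDiffAt
    rwa [hy0]
  have hyt : Filter.Tendsto y (𝓝 (0, β₀)) (𝓝 0) := by
    have := hyc.continuous.tendsto (0, β₀)
    rwa [hy0] at this
  have hgt : Filter.Tendsto (fun p => g (y p)) (𝓝 (0, β₀)) (𝓝 0) := by
    have := hgc.continuousAt.tendsto.comp hyt
    rwa [hg0] at this
  -- Since 1 ≤ `modeBound β₀` · k_n(0, β₀), this smallness forces |d| < k_n(0, β₀) for every n
  -- simultaneously, which selects the positive square root below.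
  have hsm : ∀ᶠ p in 𝓝 ((0 : ℝ), β₀), ‖g (y p)‖ * modeBound β₀ < 1 := by
    have h : Filter.Tendsto (fun p => ‖g (y p)‖ * modeBound β₀) (𝓝 (0, β₀)) (𝓝 0) := by
      simpa using hgt.norm.mul_const (modeBound β₀)
    exact h.eventually (gt_mem_nhds one_pos)
  have hβ : ∀ᶠ p in 𝓝 ((0 : ℝ), β₀), 0 < p.2 ∧ p.2 < 1 / 2 :=
    (continuous_snd.tendsto ((0 : ℝ), β₀)).eventually (Ioo_mem_nhds h0 h1)
  filter_upwards [hyt.eventually hgr, hsm, hβ] with p hp hs hb n hn hn' x ξ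
  have hk0 := kMode_pos h0 h1 0 hn hn'
  have hk := kMode_pos hb.1 hb.2 p.1 hn hn'
  set z : ℂ := g (y p) (n, x, ξ) with hz
  have hinv : invMode β₀ n = (kMode 0 β₀ n)⁻¹ := by simp [invMode, hn, hn']
  have e1 : z + (1 / 2 : ℝ) * ((invMode β₀ n : ℂ) * z ^ 2) =
      (p.2 - β₀) * (((n : ℂ) + 1) * invMode β₀ n) + (p.1 ^ 2 / 2) * invMode β₀ n := by
    have := congrArg (fun F : KerAlg R => F (n, x, ξ)) hp
    have hy' : y p (n, x, ξ) = (p.2 - β₀ : ℝ) • ((((n : ℝ) + 1) * invMode β₀ n : ℝ) : ℂ)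
      + (p.1 ^ 2 / 2 : ℝ) • (invMode β₀ n : ℂ) := rfl
    have hg' : (g (y p) + (1 / 2 : ℝ) • (κ * g (y p) ^ 2)) (n, x, ξ) =
      z + (1 / 2 : ℝ) • ((invMode β₀ n : ℂ) * z ^ 2) := by
      rw [pow_two, pow_two]
      rfl
    simp only [hy', hg', Complex.real_smul] at this
    push_cast at this ⊢
    exact this
  have hk0c : (kMode 0 β₀ n : ℂ) ≠ 0 := by exact_mod_cast hk0.ne'
  have e2 : (kMode 0 β₀ n + z) ^ 2 = (kMode p.1 p.2 n : ℂ) ^ 2 := by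
    have h3 : (kMode p.1 p.2 n : ℂ) ^ 2 = (kMode 0 β₀ n : ℂ) ^ 2 + 2 * (n + 1) * (p.2 - β₀)
        + p.1 ^ 2 := by
      have : kMode p.1 p.2 n ^ 2 = kMode 0 β₀ n ^ 2 + 2 * (n + 1) * (p.2 - β₀) + p.1 ^ 2 := by
        rw [kMode_sq hb.1 hb.2 _ hn hn', kMode_sq h0 h1 _ hn hn']
        ring
      exact_mod_cast this
    rw [h3]
    rw [hinv] at e1
    push_cast at e1
    field_simp at e1
    linear_combination e1
  have hzn : ‖z‖ < kMode 0 β₀ n := by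
    have h4 : ‖z‖ ≤ ‖g (y p)‖ := (g (y p)).norm_coe_le_norm _
    have h5 := one_le_modeBound_mul h0 h1 0 hn hn'
    have h6 : ‖z‖ * modeBound β₀ < 1 :=
      (mul_le_mul_of_nonneg_right h4 (Real.sqrt_nonneg _)).trans_lt hs
    have hm : 0 < modeBound β₀ := by
      by_contra hc
      nlinarith [mul_nonneg (sub_nonneg.2 (not_lt.1 hc)) hk0.le]
    by_contra hc
    nlinarith [mul_le_mul_of_nonneg_left (not_lt.1 hc) hm.le]
  -- The squares agree, so k⁰ + d is plus or minus the new decay rate; the minus sign would need a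
  -- shift with real part below -k⁰.
  rcases sq_eq_sq_iff_eq_or_eq_neg.1 e2 with h | h
  · push_cast
    linear_combination h
  · exfalso
    have hre := congrArg Complex.re h
    simp only [Complex.add_re, Complex.ofReal_re, Complex.neg_re] at hre
    have := (abs_le.1 (Complex.abs_re_le_norm z)).1
    linarith

end

/-! ### Analyticity of the family of real kernels -/

section

variable {R : ℝ}

/-- The element `|x - ξ|`. -/
def kerAbs (R : ℝ) : KerAlg R :=
  kerMk (fun _ t => ((|t| : ℝ) : ℂ)) (fun _ => by fun_prop) (2 * R) fun _ t h => by
    rwa [Complex.norm_real, Real.norm_eq_abs, abs_abs]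

/-- The indicator of the mode `m`. -/
def kerMode (m : ℤ) : KerAlg R :=
  kerMk (fun n _ => if n = m then 1 else 0) (fun _ => continuous_const) 1 fun n _ _ => by
    split_ifs <;> simp

theorem analyticAt_exp_smul {𝔸 : Type*} [NormedRing 𝔸] [NormedAlgebra ℝ 𝔸] [CompleteSpace 𝔸]
    {E : Type*} [NormedAddCommGroup E] [NormedSpace ℝ E] {h : E → ℝ} {p : E}
    (hh : AnalyticAt ℝ h p) (a : 𝔸) : AnalyticAt ℝ (fun q => NormedSpace.exp (h q • a)) p :=
  AnalyticAt.fun_comp (NormedSpace.exp_analytic _) (hh.smul analyticAt_const)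

theorem analyticAt_ringInverse_one_add {𝔸 : Type*} [NormedRing 𝔸] [NormedAlgebra ℝ 𝔸]
    [CompleteSpace 𝔸] {E : Type*} [NormedAddCommGroup E] [NormedSpace ℝ E] {d : E → 𝔸} {p : E}
    (hd : AnalyticAt ℝ d p) (hp : d p = 0) :
    AnalyticAt ℝ (fun q => Ring.inverse (1 + d q)) p := by
  refine AnalyticAt.fun_comp (g := Ring.inverse) ?_ (analyticAt_const.add hd)
  rw [hp, add_zero]
  exact analyticAt_inverse (1 : 𝔸ˣ)

theorem eventually_isUnit_one_add {𝔸 : Type*} [NormedRing 𝔸]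
    [CompleteSpace 𝔸] {E : Type*} [TopologicalSpace E] {d : E → 𝔸} {p : E}
    (hd : ContinuousAt d p) (hp : d p = 0) : ∀ᶠ q in 𝓝 p, IsUnit (1 + d q) := by
  have h : ContinuousAt (fun q => 1 + d q) p := continuousAt_const.add hd
  refine h.eventually (Units.isOpen.mem_nhds ?_)
  simp [hp]

/-- The family `(e^{-μ a} - 1) / μ`, continued analytically to `μ = 0`. -/
theorem exists_analytic_regularized {𝔸 : Type*} [NormedRing 𝔸] [NormedAlgebra ℝ 𝔸]
    [CompleteSpace 𝔸] (a : 𝔸) : ∃ G : ℝ → 𝔸, AnalyticAt ℝ G 0 ∧ G 0 = -a ∧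
      ∀ μ, μ ≠ 0 → G μ = μ⁻¹ • (NormedSpace.exp (μ • -a) - 1) := by
  have h1 : AnalyticAt ℝ (fun μ : ℝ => NormedSpace.exp (μ • -a)) 0 :=
    analyticAt_exp_smul analyticAt_id (-a)
  obtain ⟨p, hp⟩ := h1
  -- The divided difference of an analytic function is analytic across the base point, where its
  -- value is the derivative -a.
  refine ⟨dslope (fun μ : ℝ => NormedSpace.exp (μ • -a)) 0,
    ⟨_, hp.has_fpower_series_dslope_fslope⟩, ?_, fun μ hμ => ?_⟩
  · rw [dslope_same]
    have := (hasDerivAt_exp_smul_const (𝕂 := ℝ) (-a) (0 : ℝ)).deriv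
    rw [this]
    simp
  · rw [dslope_of_ne _ hμ, slope_def_module]
    simp

/-- The family is a sum of three pieces with disjoint sets of modes: the evanescent modes, mode -1
and mode 0. For the evanescent modes, k_n = k⁰_n(1 + dκ) with κ = 1/k⁰_n, hence e^{-k_n|x|}/(2k_n) =
e^{-k⁰_n|x|} · e^{-d|x|} · (κ/2)(1+dκ)⁻¹, where every factor is a bounded family. -/
theorem exists_analytic_kernel {β₀ : ℝ} (h0 : 0 < β₀) (h1 : β₀ < 1 / 2) :
    ∃ K : ℝ × ℝ → KerAlg R, AnalyticAt ℝ K (0, β₀) ∧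
      ∀ᶠ p in 𝓝 ((0 : ℝ), β₀), ∀ n x ξ,
        K p (n, x, ξ) = (kernelR p.1 p.2 n ((x : ℝ) - ξ) : ℂ) := by
  obtain ⟨κ, d, hκ, hd, hd0, hdk⟩ := exists_analytic_mode_shift (R := R) h0 h1
  obtain ⟨G, hG, hG0, hGμ⟩ := exists_analytic_regularized (kerAbs R)
  -- The product k⁰_n|x| is unbounded in n and cannot be exponentiated in the algebra; its
  -- exponential e^{-k⁰_n|x|} ≤ 1 is taken as a fixed element, and only the bounded shift goes
  -- through the exponential series.
  set base : KerAlg R := kerMk (fun n t => ((Real.exp (-(kMode 0 β₀ n) * |t|) : ℝ) : ℂ))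
    (fun n => by fun_prop) 1 (fun n t _ => by
      rw [Complex.norm_real, Real.norm_eq_abs, abs_of_pos (Real.exp_pos _), Real.exp_le_one_iff]
      have : 0 ≤ kMode 0 β₀ n := Real.sqrt_nonneg _
      have := mul_nonneg this (abs_nonneg t)
      linarith) with hbase
  set k : ℝ × ℝ → ℝ := fun p => kZero p.1 p.2 with hk
  have hkpos : 0 < 1 - 2 * β₀ - (0 : ℝ) ^ 2 := by linarith
  have hka : AnalyticAt ℝ k (0, β₀) := analyticAt_kZero hkpos
  have hk0 : k (0, β₀) ≠ 0 := (Real.sqrt_pos.2 hkpos).ne'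
  set K1 : ℝ × ℝ → KerAlg R := fun p =>
    (base * NormedSpace.exp (-(d p * kerAbs R))) *
      (((1 / 2 : ℝ) • κ) * Ring.inverse (1 + d p * κ)) with hK1
  set K2 : ℝ × ℝ → KerAlg R := fun p => kerMode (-1) * ((1 / 2 : ℝ) • G p.1) with hK2
  set E : ℝ × ℝ → KerAlg R := fun p => NormedSpace.exp (k p • (Complex.I • kerAbs R)) with hE
  set E' : ℝ × ℝ → KerAlg R := fun p => NormedSpace.exp (k p • (-(Complex.I • kerAbs R))) with hE'
  -- Euler's formula: -sin θ = (i/2)(e^{iθ} - e^{-iθ}) with θ = k₀|x-ξ|.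
  set K3 : ℝ × ℝ → KerAlg R := fun p =>
    kerMode 0 * ((2 * k p)⁻¹ • ((Complex.I / 2) • (E p - E' p))) with hK3
  have hdκ : AnalyticAt ℝ (fun p => d p * κ) (0, β₀) := hd.mul analyticAt_const
  have hdκ0 : d (0, β₀) * κ = 0 := by rw [hd0, zero_mul]
  refine ⟨fun p => K1 p + K2 p + K3 p, ?_, ?_⟩
  · refine (AnalyticAt.add ?_ ?_).add ?_
    · refine (analyticAt_const.mul ?_).mul (analyticAt_const.mul ?_)
      · exact AnalyticAt.fun_comp (NormedSpace.exp_analytic _) (hd.mul analyticAt_const).neg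
      · exact analyticAt_ringInverse_one_add hdκ hdκ0
    · refine analyticAt_const.mul (analyticAt_const.fun_smul ?_)
      exact AnalyticAt.fun_comp (g := G) (f := fun p : ℝ × ℝ => p.1) hG analyticAt_fst
    · refine analyticAt_const.mul (AnalyticAt.fun_smul ?_ ?_)
      · exact (analyticAt_const.mul hka).inv (mul_ne_zero two_ne_zero hk0)
      · have hs : AnalyticAt ℝ (fun p => E p - E' p) (0, β₀) :=
          (analyticAt_exp_smul hka _).sub (analyticAt_exp_smul hka _)
        exact ((ContinuousLinearMap.lsmul ℝ ℂ (E := KerAlg R) (Complex.I / 2)).analyticAt _).comp hs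
  · have hβ : ∀ᶠ p in 𝓝 ((0 : ℝ), β₀), 0 < p.2 ∧ p.2 < 1 / 2 :=
      (continuous_snd.tendsto ((0 : ℝ), β₀)).eventually (Ioo_mem_nhds h0 h1)
    filter_upwards [hdk, eventually_isUnit_one_add hdκ.continuousAt hdκ0, hβ] with p hp hu hb n x ξ
    have e1 : K1 p (n, x, ξ) = if n = 0 ∨ n = -1 then 0 else
        ((Real.exp (-(kMode p.1 p.2 n) * |(x : ℝ) - ξ|) / (2 * kMode p.1 p.2 n) : ℝ) : ℂ) := by
      have h2 : K1 p (n, x, ξ) = (((Real.exp (-(kMode 0 β₀ n) * |(x : ℝ) - ξ|) : ℝ) : ℂ) *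
          Complex.exp (-(d p (n, x, ξ) * ((|(x : ℝ) - ξ| : ℝ) : ℂ)))) *
          (((1 / 2 : ℝ) • κ (n, x, ξ)) * (1 + d p (n, x, ξ) * κ (n, x, ξ))⁻¹) := by
        have h3 := ker_exp_apply (-(d p * kerAbs R)) (n, x, ξ)
        have h4 := ker_inverse_apply hu (n, x, ξ)
        have h5 : K1 p (n, x, ξ) = (((Real.exp (-(kMode 0 β₀ n) * |(x : ℝ) - ξ|) : ℝ) : ℂ) *
          (NormedSpace.exp (-(d p * kerAbs R))) (n, x, ξ)) *
          (((1 / 2 : ℝ) • κ (n, x, ξ)) * (Ring.inverse (1 + d p * κ)) (n, x, ξ)) := rfl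
        rw [h5, h3, h4]
        rfl
      rw [h2, hκ]
      split_ifs with hn
      · simp [invMode, hn]
      · push Not at hn
        have hk0 := kMode_pos h0 h1 0 hn.1 hn.2
        have hk1 := kMode_pos hb.1 hb.2 p.1 hn.1 hn.2
        rw [hp n hn.1 hn.2]
        have hinv : invMode β₀ n = (kMode 0 β₀ n)⁻¹ := by simp [invMode, hn]
        rw [hinv, ← Complex.ofReal_mul, ← Complex.ofReal_neg, ← Complex.ofReal_exp,
          ← Complex.ofReal_mul, ← Real.exp_add, Complex.real_smul]
        norm_cast
        have e : 1 + (kMode p.1 p.2 n - kMode 0 β₀ n) * (kMode 0 β₀ n)⁻¹ =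
          kMode p.1 p.2 n * (kMode 0 β₀ n)⁻¹ := by field_simp; ring
        rw [e]
        congr 1
        · congr 1
          ring
        · field_simp
    have e2 : K2 p (n, x, ξ) = if n = -1 then ((if p.1 = 0 then -|(x : ℝ) - ξ| / 2 else
        (Real.exp (-p.1 * |(x : ℝ) - ξ|) - 1) / (2 * p.1) : ℝ) : ℂ) else 0 := by
      have h2 : K2 p (n, x, ξ) = (if n = -1 then 1 else 0) * ((1 / 2 : ℝ) • (G p.1) (n, x, ξ)) :=
        rfl
      rw [h2]
      split_ifs with hn hp0
      · rw [hp0, hG0]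
        have : (-kerAbs R) (n, x, ξ) = -((|(x : ℝ) - ξ| : ℝ) : ℂ) := rfl
        rw [this, Complex.real_smul]
        push_cast
        ring
      · rw [hGμ _ hp0]
        have h3 := ker_exp_apply (p.1 • -kerAbs R) (n, x, ξ)
        have h4 : (p.1⁻¹ • (NormedSpace.exp (p.1 • -kerAbs R) - 1)) (n, x, ξ) =
          p.1⁻¹ • ((NormedSpace.exp (p.1 • -kerAbs R)) (n, x, ξ) - 1) := rfl
        have h5 : (p.1 • -kerAbs R) (n, x, ξ) = p.1 • -((|(x : ℝ) - ξ| : ℝ) : ℂ) := rfl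
        rw [h4, h3, h5, Complex.real_smul, Complex.real_smul, Complex.real_smul]
        push_cast
        field_simp
      · simp
    have e3 : K3 p (n, x, ξ) = if n = 0 then
        ((-Real.sin (kZero p.1 p.2 * |(x : ℝ) - ξ|) / (2 * kZero p.1 p.2) : ℝ) : ℂ) else 0 := by
      have h2 : K3 p (n, x, ξ) = (if n = 0 then 1 else 0) * ((2 * k p)⁻¹ • ((Complex.I / 2) •
        (E p (n, x, ξ) - E' p (n, x, ξ)))) := rfl
      have h3 : E p (n, x, ξ) = Complex.exp (k p • (Complex.I • ((|(x : ℝ) - ξ| : ℝ) : ℂ))) :=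
        ker_exp_apply _ _
      have h4 : E' p (n, x, ξ) = Complex.exp (k p • (-(Complex.I • ((|(x : ℝ) - ξ| : ℝ) : ℂ)))) :=
        ker_exp_apply _ _
      rw [h2, h3, h4]
      split_ifs with hn
      · simp only [Complex.real_smul, smul_eq_mul]
        push_cast
        rw [Complex.sin]
        have a1 : (k p : ℂ) * (Complex.I * ((|(x : ℝ) - ξ| : ℝ) : ℂ)) =
          (kZero p.1 p.2 * ((|(x : ℝ) - ξ| : ℝ) : ℂ)) * Complex.I := by simp only [hk]; ring
        have a2 : (k p : ℂ) * -(Complex.I * ((|(x : ℝ) - ξ| : ℝ) : ℂ)) =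
          -(kZero p.1 p.2 * ((|(x : ℝ) - ξ| : ℝ) : ℂ)) * Complex.I := by simp only [hk]; ring
        rw [a1, a2]
        simp only [hk]
        ring
      · simp
    have e4 : (K1 p + K2 p + K3 p) (n, x, ξ) = K1 p (n, x, ξ) + K2 p (n, x, ξ) + K3 p (n, x, ξ) :=
      rfl
    rw [e4, e1, e2, e3, kernelR]
    by_cases hn : n = 0
    · simp [hn]
    · by_cases hn' : n = -1
      · simp [hn']
      · simp [hn, hn']

end

section

variable {R : ℝ}

/-! ### Symmetries of the real system -/

/-- The reflection `x ↦ -x` of the segment. -/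
def segNeg : C(Set.Icc (-R) R, Set.Icc (-R) R) where
  toFun x := ⟨-x, by constructor <;> linarith [x.2.1, x.2.2]⟩
  continuous_toFun := by fun_prop

@[simp] theorem coe_segNeg (x : Set.Icc (-R) R) : ((segNeg x : Set.Icc (-R) R) : ℝ) = -x := rfl

theorem integral_seg_neg (g : Set.Icc (-R) R → ℂ) :
    ∫ x, g (segNeg x) ∂(segMeasure R) = ∫ x, g x ∂(segMeasure R) := by
  rcases le_or_gt 0 R with hR | hR
  · have h : -R ≤ R := by linarith
    have h1 : ∀ x : Set.Icc (-R) R, g x = Set.IccExtend h g x := fun x => by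
      rw [Set.IccExtend_val]
    have h2 : ∀ x : Set.Icc (-R) R, g (segNeg x) = Set.IccExtend h g (-(x : ℝ)) := fun x => by
      rw [h1 (segNeg x), coe_segNeg]
    rw [integral_congr_ae (Filter.Eventually.of_forall h2), integral_seg_eq (fun x => Set.IccExtend h g (-x))]
    have h3 : ∫ x, g x ∂(segMeasure R) = ∫ x in Set.Icc (-R) R, Set.IccExtend h g x := by
      rw [← integral_seg_eq (fun x => Set.IccExtend h g x)]
      exact integral_congr_ae (Filter.Eventually.of_forall h1)
    rw [h3, integral_Icc_eq_integral_Ioc,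
      integral_Icc_eq_integral_Ioc, ← intervalIntegral.integral_of_le h,
      ← intervalIntegral.integral_of_le h, intervalIntegral.integral_comp_neg, neg_neg]
  -- For R < 0 the segment is empty.
  · refine integral_congr_ae (Filter.Eventually.of_forall fun x => ?_)
    linarith [x.2.1, x.2.2]

/-- The symmetries of the Fourier coefficients of the perturbation. -/
structure CoefData (c : ℤ → SegFun R) : Prop where
  summable : Summable fun j => ‖c j‖
  symm : ∀ j, c (-j) = c j
  real : ∀ j, star (c j) = c j
  even : ∀ j x, c j (segNeg x) = c j x

/-- A real, symmetric kernel that is invariant under reflection. -/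
structure KerData (K : KerAlg R) : Prop where
  symm : ∀ n x ξ, K (n, x, ξ) = K (n, ξ, x)
  real : ∀ n x ξ, star (K (n, x, ξ)) = K (n, x, ξ)
  even : ∀ n x ξ, K (n, segNeg x, segNeg ξ) = K (n, x, ξ)

/-- Composition with the reflection. -/
def reflFun : SegFun R →L[ℂ] SegFun R  where
  toFun φ := φ.comp segNeg
  map_add' _ _ := rfl
  map_smul' _ _ := rfl
  cont := ContinuousMap.continuous_precomp segNeg

theorem reflFun_apply (φ : SegFun R) (x : Set.Icc (-R) R) : reflFun φ x = φ (segNeg x) := rfl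

/-- The reflection on the sequence space. -/
def reflSeq : SeqSpace R →L[ℂ] SeqSpace R :=
  permDiag (Equiv.refl ℤ) (fun _ => reflFun) ‖(reflFun : SegFun R →L[ℂ] SegFun R)‖ fun _ => le_rfl

theorem reflSeq_apply (A : SeqSpace R) (n : ℤ) (x : Set.Icc (-R) R) :
    reflSeq A n x = A n (segNeg x) := rfl

theorem mulOp_refl {c : ℤ → SegFun R} (hc : CoefData c) (A : SeqSpace R) :
    mulOp c (reflSeq A) = reflSeq (mulOp c A) := by
  ext m x
  have h1 := hasSum_mulOp hc.summable (reflSeq A) m x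
  have h2 := hasSum_mulOp hc.summable A m (segNeg x)
  refine h1.unique ?_
  rw [reflSeq_apply]
  refine h2.congr_fun fun n => ?_
  rw [reflSeq_apply, hc.even]

theorem kerOp_refl {K : KerAlg R} (hK : KerData K) (A : SeqSpace R) :
    kerOp K (reflSeq A) = reflSeq (kerOp K A) := by
  ext n x
  rw [reflSeq_apply, kerOp_apply, kerOp_apply, kerInt_apply, kerInt_apply,
    ← integral_seg_neg (fun ξ => K (n, segNeg x, ξ) * A n ξ)]
  simp only [hK.even, reflSeq_apply]

theorem mulOp_star {c : ℤ → SegFun R} (hc : CoefData c) (A : SeqSpace R) :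
    mulOp c (star A) = star (mulOp c A) := by
  ext m x
  have h1 := hasSum_mulOp hc.summable (star A) m x
  have h2 := (hasSum_mulOp hc.summable A m x).star
  refine h1.unique (h2.congr_fun fun n => ?_)
  have h3 : star (c (m - n) x) = c (m - n) x := congrArg (fun φ : SegFun R => φ x) (hc.real (m - n))
  rw [star_mul', h3]
  rfl

theorem kerOp_star {K : KerAlg R} (hK : KerData K) (A : SeqSpace R) :
    kerOp K (star A) = star (kerOp K A) := by
  ext n x
  have h : (star (kerOp K A)) n x = star (kerOp K A n x) := rfl
  rw [h, kerOp_apply, kerOp_apply, kerInt_apply, kerInt_apply]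
  have h2 : star (∫ ξ, K (n, x, ξ) * A n ξ ∂(segMeasure R)) =
      ∫ ξ, star (K (n, x, ξ) * A n ξ) ∂(segMeasure R) := (integral_conj).symm
  rw [h2]
  congr 1
  ext ξ
  rw [star_mul', hK.real]
  rfl

/-- The operator `1 - τ M_c K`. -/
def sysOp (c : ℤ → SegFun R) (K : KerAlg R) (τ : ℂ) : SeqSpace R →L[ℂ] SeqSpace R :=
  1 - τ • (mulOp c * kerOp K)

theorem sysOp_apply (c : ℤ → SegFun R) (K : KerAlg R) (τ : ℂ) (A : SeqSpace R) :
    sysOp c K τ A = A - τ • mulOp c (kerOp K A) := rfl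

/-- The resolvent of the real system. -/
def sysRes (c : ℤ → SegFun R) (K : KerAlg R) (τ : ℂ) : SeqSpace R →L[ℂ] SeqSpace R :=
  Ring.inverse (sysOp c K τ)

theorem sysOp_sysRes {c : ℤ → SegFun R} {K : KerAlg R} {τ : ℂ} (hu : IsUnit (sysOp c K τ))
    (A : SeqSpace R) : sysOp c K τ (sysRes c K τ A) = A := by
  have h := Ring.mul_inverse_cancel _ hu
  exact congrArg (fun T : SeqSpace R →L[ℂ] SeqSpace R => T A) h

theorem sysRes_sysOp {c : ℤ → SegFun R} {K : KerAlg R} {τ : ℂ} (hu : IsUnit (sysOp c K τ))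
    (A : SeqSpace R) : sysRes c K τ (sysOp c K τ A) = A := by
  have h := Ring.inverse_mul_cancel _ hu
  exact congrArg (fun T : SeqSpace R →L[ℂ] SeqSpace R => T A) h

theorem sysRes_eq_of {c : ℤ → SegFun R} {K : KerAlg R} {τ : ℂ} (hu : IsUnit (sysOp c K τ))
    {A G : SeqSpace R} (h : sysOp c K τ A = G) : sysRes c K τ G = A := by
  rw [← h, sysRes_sysOp hu]

theorem sysRes_refl {c : ℤ → SegFun R} {K : KerAlg R} {τ : ℂ} (hc : CoefData c) (hK : KerData K)
    (hu : IsUnit (sysOp c K τ)) (G : SeqSpace R) :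
    sysRes c K τ (reflSeq G) = reflSeq (sysRes c K τ G) := by
  refine sysRes_eq_of hu ?_
  rw [sysOp_apply, kerOp_refl hK, mulOp_refl hc, ← map_smul, ← map_sub, ← sysOp_apply,
    sysOp_sysRes hu]

theorem sysRes_star {c : ℤ → SegFun R} {K : KerAlg R} {τ : ℝ} (hc : CoefData c) (hK : KerData K)
    (hu : IsUnit (sysOp c K τ)) (G : SeqSpace R) :
    sysRes c K τ (star G) = star (sysRes c K τ G) := by
  refine sysRes_eq_of hu ?_
  have h : (τ : ℂ) • star (mulOp c (kerOp K (sysRes c K τ G))) =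
      star ((τ : ℂ) • mulOp c (kerOp K (sysRes c K τ G))) := by
    rw [star_smul]
    congr 1
    exact (Complex.conj_ofReal τ).symm
  rw [sysOp_apply, kerOp_star hK, mulOp_star hc, h, ← star_sub, ← sysOp_apply, sysOp_sysRes hu]

/-- The matrix elements `⟨(S M_c (h' e_{n'}))_n h⟩` of the resolvent. -/
def resZ (c : ℤ → SegFun R) (K : KerAlg R) (τ : ℂ) (n : ℤ) (h : SegFun R) (n' : ℤ)
    (h' : SegFun R) : ℂ :=
  pairL n h (sysRes c K τ (mulOp c (lp.single 2 n' h')))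

theorem resZ_eq_bil (c : ℤ → SegFun R) (K : KerAlg R) (τ : ℂ) (n : ℤ) (h : SegFun R) (n' : ℤ)
    (h' : SegFun R) : resZ c K τ n h n' h' =
      bil (lp.single 2 n h) (sysRes c K τ (mulOp c (lp.single 2 n' h'))) := by
  rw [bil_single]
  rfl

/-- With X = M(e' + τKX) and Y = M(e + τKY), symmetry of M turns ⟨e + τKY, X⟩ into ⟨Y, e' + τKX⟩.
The two terms with K agree by symmetry of K and cancel, leaving ⟨e, X⟩ = ⟨Y, e'⟩. Neither M K nor
its resolvent is symmetric by itself; the resolvent applied after M is. -/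
theorem resZ_symm {c : ℤ → SegFun R} {K : KerAlg R} {τ : ℂ} (hc : CoefData c) (hK : KerData K)
    (hu : IsUnit (sysOp c K τ)) (n : ℤ) (h : SegFun R) (n' : ℤ) (h' : SegFun R) :
    resZ c K τ n h n' h' = resZ c K τ n' h' n h := by
  rw [resZ_eq_bil, resZ_eq_bil]
  set e : SeqSpace R := lp.single 2 n h
  set e' : SeqSpace R := lp.single 2 n' h'
  set X := sysRes c K τ (mulOp c e') with hX
  set Y := sysRes c K τ (mulOp c e) with hY
  have hX' : X = mulOp c (e' + τ • kerOp K X) := by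
    have h1 := sysOp_sysRes hu (mulOp c e')
    rw [← hX, sysOp_apply, sub_eq_iff_eq_add] at h1
    rw [map_add, map_smul]
    exact h1
  have hY' : Y = mulOp c (e + τ • kerOp K Y) := by
    have h1 := sysOp_sysRes hu (mulOp c e)
    rw [← hY, sysOp_apply, sub_eq_iff_eq_add] at h1
    rw [map_add, map_smul]
    exact h1
  have h1 : bil (e + τ • kerOp K Y) X = bil Y (e' + τ • kerOp K X) := by
    conv_lhs => rw [hX']
    rw [bil_mulOp hc.summable hc.symm, ← hY']
  have h2 : bil X (kerOp K Y) = bil Y (kerOp K X) := by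
    rw [bil_kerOp hK.symm Y X, bil_comm]
  rw [bil_comm X, map_add, map_add, map_smul, map_smul, h2] at h1
  rw [bil_comm X, add_right_cancel h1, bil_comm]

theorem reflSeq_single (n : ℤ) (h : SegFun R) :
    reflSeq (lp.single 2 n h) = lp.single 2 n (reflFun h) := by
  ext m x
  rw [reflSeq_apply]
  by_cases hm : m = n
  · subst hm
    simp [reflFun_apply]
  · simp [Pi.single_eq_of_ne hm]

theorem star_single (n : ℤ) (h : SegFun R) :
    star (lp.single 2 n h : SeqSpace R) = lp.single 2 n (star h) := by
  ext m x
  have : (star (lp.single 2 n h : SeqSpace R)) m x = star ((lp.single 2 n h : SeqSpace R) m x) := rfl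
  rw [this]
  by_cases hm : m = n
  · subst hm
    simp
  · simp [Pi.single_eq_of_ne hm]

theorem resZ_refl {c : ℤ → SegFun R} {K : KerAlg R} {τ : ℂ} (hc : CoefData c) (hK : KerData K)
    (hu : IsUnit (sysOp c K τ)) (n : ℤ) (h : SegFun R) (n' : ℤ) (h' : SegFun R) :
    resZ c K τ n (reflFun h) n' (reflFun h') = resZ c K τ n h n' h' := by
  rw [resZ, ← reflSeq_single, mulOp_refl hc, sysRes_refl hc hK hu, pairL_apply, resZ, pairL_apply]
  rw [← integral_seg_neg (fun x => (sysRes c K τ (mulOp c (lp.single 2 n' h'))) n x * h x)]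
  rfl

theorem resZ_conj {c : ℤ → SegFun R} {K : KerAlg R} {τ : ℝ} (hc : CoefData c) (hK : KerData K)
    (hu : IsUnit (sysOp c K τ)) (n : ℤ) (h : SegFun R) (n' : ℤ) (h' : SegFun R) :
    resZ c K τ n (star h) n' (star h') = star (resZ c K τ n h n' h') := by
  rw [resZ, ← star_single, mulOp_star hc, sysRes_star hc hK hu, pairL_apply, resZ, pairL_apply]
  have h2 : star (∫ x, (sysRes c K τ (mulOp c (lp.single 2 n' h'))) n x * h x ∂(segMeasure R)) =
      ∫ x, star ((sysRes c K τ (mulOp c (lp.single 2 n' h'))) n x * h x) ∂(segMeasure R) :=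
    (integral_conj).symm
  rw [h2]
  congr 1
  ext x
  rw [star_mul']
  rfl

/-- `cos (k x)` on the segment. -/
def cosFun (R k : ℝ) : SegFun R := ⟨fun x => ((Real.cos (k * x) : ℝ) : ℂ), by fun_prop⟩

/-- `sin (k x)` on the segment. -/
def sinFun (R k : ℝ) : SegFun R := ⟨fun x => ((Real.sin (k * x) : ℝ) : ℂ), by fun_prop⟩

theorem cosFun_apply (k : ℝ) (x : Set.Icc (-R) R) :
    cosFun R k x = ((Real.cos (k * x) : ℝ) : ℂ) := rfl

theorem sinFun_apply (k : ℝ) (x : Set.Icc (-R) R) :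
    sinFun R k x = ((Real.sin (k * x) : ℝ) : ℂ) := rfl

theorem star_cosFun (k : ℝ) : star (cosFun R k) = cosFun R k := by
  ext x
  exact Complex.conj_ofReal _

theorem star_sinFun (k : ℝ) : star (sinFun R k) = sinFun R k := by
  ext x
  exact Complex.conj_ofReal _

theorem reflFun_cosFun (k : ℝ) : reflFun (cosFun R k) = cosFun R k := by
  ext x
  simp [reflFun_apply, cosFun_apply]

theorem reflFun_sinFun (k : ℝ) : reflFun (sinFun R k) = -sinFun R k := by
  ext x
  simp [reflFun_apply, sinFun_apply]

theorem reflFun_one : reflFun (1 : SegFun R) = 1 := by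
  ext x
  simp [reflFun_apply]

theorem resZ_neg_left (c : ℤ → SegFun R) (K : KerAlg R) (τ : ℂ) (n : ℤ) (h : SegFun R) (n' : ℤ)
    (h' : SegFun R) : resZ c K τ n (-h) n' h' = -resZ c K τ n h n' h' := by
  simp [resZ]

/-- Reflection leaves the matrix element unchanged and also flips its sign, because the sine is odd
while h' is even. -/
theorem resZ_sin_left {c : ℤ → SegFun R} {K : KerAlg R} {τ : ℂ} (hc : CoefData c)
    (hK : KerData K) (hu : IsUnit (sysOp c K τ)) (n : ℤ) (k : ℝ) (n' : ℤ) {h' : SegFun R}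
    (hh : reflFun h' = h') : resZ c K τ n (sinFun R k) n' h' = 0 := by
  have h1 := resZ_refl hc hK hu n (sinFun R k) n' h'
  rw [hh, reflFun_sinFun, resZ_neg_left] at h1
  linear_combination (-1 / 2 : ℂ) * h1

theorem resZ_sin_right {c : ℤ → SegFun R} {K : KerAlg R} {τ : ℂ} (hc : CoefData c)
    (hK : KerData K) (hu : IsUnit (sysOp c K τ)) (n : ℤ) (k : ℝ) (n' : ℤ) {h : SegFun R}
    (hh : reflFun h = h) : resZ c K τ n h n' (sinFun R k) = 0 := by
  rw [resZ_symm hc hK hu, resZ_sin_left hc hK hu _ _ _ hh]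

theorem resZ_real {c : ℤ → SegFun R} {K : KerAlg R} {τ : ℝ} (hc : CoefData c) (hK : KerData K)
    (hu : IsUnit (sysOp c K τ)) (n : ℤ) {h : SegFun R} (n' : ℤ) {h' : SegFun R}
    (hh : star h = h) (hh' : star h' = h') :
    resZ c K τ n h n' h' = ((resZ c K τ n h n' h').re : ℂ) := by
  have h1 := resZ_conj hc hK hu n h n' h'
  rw [hh, hh'] at h1
  exact (Complex.conj_eq_iff_re.1 h1.symm).symm

end

section

variable {R : ℝ}

/-! ### The full system as a rank two perturbation of the real one -/

/-- Applying the two functionals to the equation gives two scalar equations for c A and s A. They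
are uncoupled because c W = s V = 0, and each is solved by one division. -/
theorem rank_two_solve {E : Type*} [AddCommGroup E] [Module ℂ E] (c s : E →ₗ[ℂ] ℂ) (V W G A : E)
    (z C D : ℂ) (hcV : c V = C) (hcW : c W = 0) (hsV : s V = 0) (hsW : s W = D)
    (h1 : 1 - z * C ≠ 0) (h2 : 1 - z * D ≠ 0) :
    A - z • (c A • V + s A • W) = G ↔
      A = G + z • ((c G / (1 - z * C)) • V + (s G / (1 - z * D)) • W) := by
  constructor
  · intro h
    have hc : c A = c G / (1 - z * C) := by
      rw [eq_div_iff h1, ← h]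
      simp only [map_sub, map_add, map_smul, hcV, hcW, smul_eq_mul]
      ring
    have hs : s A = s G / (1 - z * D) := by
      rw [eq_div_iff h2, ← h]
      simp only [map_sub, map_add, map_smul, hsV, hsW, smul_eq_mul]
      ring
    rw [← hc, ← hs, ← h]
    abel
  · intro h
    have hc : c A = c G / (1 - z * C) := by
      rw [h]
      simp only [map_add, map_smul, hcV, hcW, smul_eq_mul]
      field_simp
      ring
    have hs : s A = s G / (1 - z * D) := by
      rw [h]
      simp only [map_add, map_smul, hsV, hsW, smul_eq_mul]
      field_simp
      ring
    rw [hc, hs]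
    conv_lhs => rw [h]
    abel

/-- The parameter `t = ε γ / k₀`. -/
def parT (ε μ β : ℝ) : ℝ := ε * gam μ β / kZero μ β

/-- The parameter `τ = 2 γ ε`. -/
def parTau (ε μ β : ℝ) : ℝ := 2 * gam μ β * ε

/-- Coefficients, kernel and invertibility for the system with parameters `ε, μ, β`. -/
structure SysData (f : ℝ × ℝ → ℝ) (ε μ β : ℝ) (c : ℤ → SegFun R) (K : KerAlg R) : Prop where
  coef : CoefData c
  coef_eq : ∀ j x, c j x = fCoeff f j x
  ker_eq : ∀ n x ξ, K (n, x, ξ) = (kernelR μ β n ((x : ℝ) - ξ) : ℂ)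
  pos : 0 < 1 - 2 * β - μ ^ 2
  unit : IsUnit (sysOp c K (parTau ε μ β))

variable {f : ℝ × ℝ → ℝ} {ε μ β : ℝ} {c : ℤ → SegFun R} {K : KerAlg R}

theorem kerData_of_eq (hK : ∀ n x ξ, K (n, x, ξ) = (kernelR μ β n ((x : ℝ) - ξ) : ℂ)) :
    KerData K where
  symm n x ξ := by rw [hK, hK, ← kernelR_neg, neg_sub]
  real n x ξ := by rw [hK]; exact Complex.conj_ofReal _
  even n x ξ := by
    rw [hK, hK, coe_segNeg, coe_segNeg, ← kernelR_neg]
    congr 3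
    ring

theorem kZero_pos (hpos : 0 < 1 - 2 * β - μ ^ 2) : 0 < kZero μ β := Real.sqrt_pos.2 hpos

/-- The imaginary part of the outgoing kernel is cos(k₀|x-ξ|)/(2k₀). Cosine being even, the absolute
value disappears and the addition theorem separates the variables; the real part -sin(k₀|x-ξ|)/(2k₀)
is kept in `kernelR`. -/
theorem kernelH_eq (hpos : 0 < 1 - 2 * β - μ ^ 2) (n : ℤ) (x ξ : ℝ) :
    kernelH μ β n (x - ξ) = (kernelR μ β n (x - ξ) : ℂ) + if n = 0 then
      Complex.I / (2 * kZero μ β) * (Real.cos (kZero μ β * x) * Real.cos (kZero μ β * ξ) +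
        Real.sin (kZero μ β * x) * Real.sin (kZero μ β * ξ)) else 0 := by
  have hk : (kZero μ β : ℂ) ≠ 0 := by exact_mod_cast (kZero_pos hpos).ne'
  by_cases hn : n = 0
  · simp only [kernelH, kernelR, hn, if_true]
    have h1 : Real.cos (kZero μ β * x) * Real.cos (kZero μ β * ξ) +
        Real.sin (kZero μ β * x) * Real.sin (kZero μ β * ξ) =
        Real.cos (kZero μ β * |x - ξ|) := by
      rw [← Real.cos_sub, ← mul_sub, ← Real.cos_abs (kZero μ β * (x - ξ)), abs_mul,
        abs_of_pos (kZero_pos hpos)]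
    have h2 : (Real.cos (kZero μ β * x) : ℂ) * Real.cos (kZero μ β * ξ) +
        Real.sin (kZero μ β * x) * Real.sin (kZero μ β * ξ) =
        (Real.cos (kZero μ β * |x - ξ|) : ℂ) := by exact_mod_cast h1
    rw [h2]
    have h3 : Complex.I * (kZero μ β : ℂ) * (|x - ξ| : ℝ) =
      ((kZero μ β * |x - ξ| : ℝ) : ℂ) * Complex.I := by push_cast; ring
    rw [h3, Complex.exp_mul_I]
    push_cast
    field_simp
    linear_combination (Complex.sin (kZero μ β * ((|x - ξ| : ℝ) : ℂ))) * Complex.I_sq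
  · by_cases hn' : n = -1
    · simp only [kernelH, kernelR, hn']
      by_cases hμ : μ = 0 <;> simp [hμ]
    · simp [kernelH, kernelR, hn, hn']

theorem seqSingle_ne {n m : ℤ} (h : m ≠ n) (φ : SegFun R) : (lp.single 2 n φ : SeqSpace R) m = 0 :=
  lp.single_apply_ne (E := fun _ : ℤ => SegFun R) 2 n φ h

theorem seqSingle_self (n : ℤ) (φ : SegFun R) : (lp.single 2 n φ : SeqSpace R) n = φ :=
  lp.single_apply_self (E := fun _ : ℤ => SegFun R) 2 n φ

/-- The moment `⟨φ cos(k x)⟩` of the propagating mode. -/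
def momC (R k : ℝ) : SeqSpace R →L[ℂ] ℂ := pairL 0 (cosFun R k)

/-- The moment `⟨φ sin(k x)⟩` of the propagating mode. -/
def momS (R k : ℝ) : SeqSpace R →L[ℂ] ℂ := pairL 0 (sinFun R k)

theorem conv_kernelH (hpos : 0 < 1 - 2 * β - μ ^ 2)
    (hK : ∀ n x ξ, K (n, x, ξ) = (kernelR μ β n ((x : ℝ) - ξ) : ℂ)) (A : SeqSpace R) (n : ℤ)
    (x : Set.Icc (-R) R) :
    conv (kernelH μ β n) (A n) x = (kerOp K A + (Complex.I / (2 * kZero μ β)) •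
      lp.single 2 0 (momC R (kZero μ β) A • cosFun R (kZero μ β) +
        momS R (kZero μ β) A • sinFun R (kZero μ β)) : SeqSpace R) n x := by
  have h1 : conv (kernelH μ β n) (A n) x = kerInt K n (A n) x + if n = 0 then
      Complex.I / (2 * kZero μ β) * (Real.cos (kZero μ β * x) * momC R (kZero μ β) A +
        Real.sin (kZero μ β * x) * momS R (kZero μ β) A) else 0 := by
    unfold conv
    simp only [kernelH_eq hpos]
    by_cases hn : n = 0
    · subst hn
      simp only [if_true]
      have e : ∀ ξ : Set.Icc (-R) R, ((kernelR μ β 0 ((x : ℝ) - ξ) : ℂ) +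
          Complex.I / (2 * kZero μ β) * (Real.cos (kZero μ β * x) * Real.cos (kZero μ β * ξ) +
          Real.sin (kZero μ β * x) * Real.sin (kZero μ β * ξ))) * A 0 ξ =
          K (0, x, ξ) * A 0 ξ + (Complex.I / (2 * kZero μ β) * Real.cos (kZero μ β * x) *
            (A 0 ξ * cosFun R (kZero μ β) ξ) + Complex.I / (2 * kZero μ β) *
            Real.sin (kZero μ β * x) * (A 0 ξ * sinFun R (kZero μ β) ξ)) := fun ξ => by
        rw [hK, cosFun_apply, sinFun_apply]
        ring
      rw [integral_congr_ae (Filter.Eventually.of_forall e)]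
      have i1 := integrable_kernel_mul K 0 (A 0) x
      have i2 : Integrable (fun ξ => Complex.I / (2 * kZero μ β) * Real.cos (kZero μ β * x) *
          (A 0 ξ * cosFun R (kZero μ β) ξ)) (segMeasure R) :=
        (integrable_segFun (A 0 * cosFun R (kZero μ β))).const_mul _
      have i3 : Integrable (fun ξ => Complex.I / (2 * kZero μ β) * Real.sin (kZero μ β * x) *
          (A 0 ξ * sinFun R (kZero μ β) ξ)) (segMeasure R) :=
        (integrable_segFun (A 0 * sinFun R (kZero μ β))).const_mul _
      have i23 : Integrable (fun ξ => Complex.I / (2 * kZero μ β) * Real.cos (kZero μ β * x) *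
          (A 0 ξ * cosFun R (kZero μ β) ξ) + Complex.I / (2 * kZero μ β) *
          Real.sin (kZero μ β * x) * (A 0 ξ * sinFun R (kZero μ β) ξ)) (segMeasure R) := i2.add i3
      rw [integral_add i1 i23, integral_add i2 i3, integral_const_mul, integral_const_mul,
        kerInt_apply]
      simp only [momC, momS, pairL_apply]
      ring
    · simp only [hn, if_false, add_zero, kerInt_apply, hK]
  rw [h1]
  have h2 : (kerOp K A + (Complex.I / (2 * kZero μ β)) •
      lp.single 2 0 (momC R (kZero μ β) A • cosFun R (kZero μ β) +
        momS R (kZero μ β) A • sinFun R (kZero μ β)) : SeqSpace R) n x = kerInt K n (A n) x +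
      (Complex.I / (2 * kZero μ β)) * ((lp.single 2 0 (momC R (kZero μ β) A • cosFun R (kZero μ β) +
        momS R (kZero μ β) A • sinFun R (kZero μ β)) : SeqSpace R) n x) := rfl
  rw [h2]
  congr 1
  by_cases hn : n = 0
  · subst hn
    simp only [if_true, seqSingle_self, ContinuousMap.add_apply, ContinuousMap.smul_apply,
      cosFun_apply, sinFun_apply, smul_eq_mul]
    ring
  · rw [seqSingle_ne hn]
    simp [hn]

/-- The source `M_c (e_n h)`. -/
def src (c : ℤ → SegFun R) (n : ℤ) (h : SegFun R) : SeqSpace R := mulOp c (lp.single 2 n h)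

theorem src_apply (hc : Summable fun j => ‖c j‖) (n : ℤ) (h : SegFun R) (m : ℤ)
    (x : Set.Icc (-R) R) : src c n h m x = h x * c (m - n) x := by
  refine (hasSum_mulOp hc (lp.single 2 n h) m x).unique ?_
  have h1 := hasSum_single (f := fun n' => (lp.single 2 n h : SeqSpace R) n' x * c (m - n') x) n
    fun n' hn => by rw [seqSingle_ne hn, ContinuousMap.zero_apply, zero_mul]
  rwa [seqSingle_self] at h1

theorem opT_eq (hd : SysData f ε μ β c K) (A : SeqSpace R) (m : ℤ) (x : Set.Icc (-R) R) :
    opT f R μ β A m x = 2 * (gam μ β : ℂ) * mulOp c (kerOp K A + (Complex.I / (2 * kZero μ β)) •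
      lp.single 2 0 (momC R (kZero μ β) A • cosFun R (kZero μ β) +
        momS R (kZero μ β) A • sinFun R (kZero μ β)) : SeqSpace R) m x := by
  unfold opT
  congr 1
  rw [← (hasSum_mulOp hd.coef.summable _ m x).tsum_eq]
  congr 1
  ext n
  rw [conv_kernelH hd.pos hd.ker_eq, hd.coef_eq]

/-- The complex part of the system is exposed as a rank two perturbation of the real operator; its
coefficient is 2γε · i/(2k₀) = it. -/
theorem solves_iff (hd : SysData f ε μ β c K) (g : ℤ → Set.Icc (-R) R → ℂ) (A : SeqSpace R) :
    Solves f R ε μ β g A ↔ ∀ m x, (sysOp c K (parTau ε μ β) A - (Complex.I * parT ε μ β) •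
      (momC R (kZero μ β) A • src c 0 (cosFun R (kZero μ β)) +
        momS R (kZero μ β) A • src c 0 (sinFun R (kZero μ β)))) m x = g m x := by
  have hk : (kZero μ β : ℂ) ≠ 0 := by exact_mod_cast (kZero_pos hd.pos).ne'
  unfold Solves
  refine forall_congr' fun m => forall_congr' fun x => ?_
  rw [opT_eq hd, map_add, map_smul, lp.single_add, map_add, lp.single_smul, lp.single_smul,
    map_smul, map_smul]
  have h1 : (sysOp c K (parTau ε μ β) A - (Complex.I * parT ε μ β) •
      (momC R (kZero μ β) A • src c 0 (cosFun R (kZero μ β)) +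
        momS R (kZero μ β) A • src c 0 (sinFun R (kZero μ β)))) m x =
      (A m x - (parTau ε μ β : ℂ) * (mulOp c (kerOp K A) m x)) - (Complex.I * parT ε μ β) *
        (momC R (kZero μ β) A * src c 0 (cosFun R (kZero μ β)) m x +
        momS R (kZero μ β) A * src c 0 (sinFun R (kZero μ β)) m x) := rfl
  have h2 : (mulOp c (kerOp K A) + (Complex.I / (2 * kZero μ β)) •
      (momC R (kZero μ β) A • mulOp c (lp.single 2 0 (cosFun R (kZero μ β))) +
        momS R (kZero μ β) A • mulOp c (lp.single 2 0 (sinFun R (kZero μ β)))) : SeqSpace R) m x =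
      mulOp c (kerOp K A) m x + (Complex.I / (2 * kZero μ β)) *
        (momC R (kZero μ β) A * src c 0 (cosFun R (kZero μ β)) m x +
        momS R (kZero μ β) A * src c 0 (sinFun R (kZero μ β)) m x) := rfl
  rw [h1, h2]
  have h3 : (parT ε μ β : ℂ) = ε * gam μ β / kZero μ β := by simp [parT]
  have h4 : (parTau ε μ β : ℂ) = 2 * gam μ β * ε := by simp [parTau]
  rw [h3, h4]
  have h5 : ∀ a b d e : ℂ, a - ε * (2 * gam μ β * (b + Complex.I / (2 * kZero μ β) * d)) =
    a - 2 * gam μ β * ε * b - Complex.I * (ε * gam μ β / kZero μ β) * d := fun a b d e => by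
    field_simp
    ring
  rw [h5 _ _ _ 0]

/-! ### Explicit solution -/

/-- The matrix elements `F_r, q, C, D` of the real system. -/
def elF (c : ℤ → SegFun R) (K : KerAlg R) (ε μ β : ℝ) : ℝ :=
  (resZ c K (parTau ε μ β) (-1) 1 (-1) 1).re

/-- A matrix element of the resolvent of the real system. -/
def elq (c : ℤ → SegFun R) (K : KerAlg R) (ε μ β : ℝ) : ℝ :=
  (resZ c K (parTau ε μ β) (-1) 1 0 (cosFun R (kZero μ β))).re

/-- A matrix element of the resolvent of the real system. -/
def elC (c : ℤ → SegFun R) (K : KerAlg R) (ε μ β : ℝ) : ℝ :=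
  (resZ c K (parTau ε μ β) 0 (cosFun R (kZero μ β)) 0 (cosFun R (kZero μ β))).re

/-- A matrix element of the resolvent of the real system. -/
def elD (c : ℤ → SegFun R) (K : KerAlg R) (ε μ β : ℝ) : ℝ :=
  (resZ c K (parTau ε μ β) 0 (sinFun R (kZero μ β)) 0 (sinFun R (kZero μ β))).re

theorem star_one_segFun : star (1 : SegFun R) = 1 := star_one _

/-- The real part is 1. Hence the rank two correction is invertible whatever the real values of t, C
and D, and invertibility of 1 - εT̂ follows from that of the real operator alone. -/
theorem one_sub_I_mul_ne_zero (t C : ℝ) : (1 : ℂ) - Complex.I * t * C ≠ 0 := by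
  intro h
  have := congrArg Complex.re h
  simp at this

theorem SysData.ker (hd : SysData f ε μ β c K) : KerData K := kerData_of_eq hd.ker_eq

/-- The solution of the system with right-hand side `G`. -/
def fullSol (c : ℤ → SegFun R) (K : KerAlg R) (ε μ β : ℝ) (G : SeqSpace R) : SeqSpace R :=
  sysRes c K (parTau ε μ β) G + (Complex.I * parT ε μ β) •
    ((momC R (kZero μ β) (sysRes c K (parTau ε μ β) G) /
        (1 - Complex.I * parT ε μ β * elC c K ε μ β)) •
        sysRes c K (parTau ε μ β) (src c 0 (cosFun R (kZero μ β))) +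
      (momS R (kZero μ β) (sysRes c K (parTau ε μ β) G) /
        (1 - Complex.I * parT ε μ β * elD c K ε μ β)) •
        sysRes c K (parTau ε μ β) (src c 0 (sinFun R (kZero μ β))))

/-- After applying the real resolvent, the perturbation is spanned by the responses to the cosine
and sine sources. The cosine moment of the sine response and the sine moment of the cosine response
vanish by parity, while the diagonal moments are the real numbers C and D. -/
theorem solves_iff_eq_fullSol (hd : SysData f ε μ β c K) (G A : SeqSpace R) :
    Solves f R ε μ β (fun m x => G m x) A ↔ A = fullSol c K ε μ β G := by
  rw [solves_iff hd]
  set z : ℂ := Complex.I * parT ε μ β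
  set S := sysRes c K (parTau ε μ β)
  set cA := momC R (kZero μ β) A
  set sA := momS R (kZero μ β) A
  set gc := src c 0 (cosFun R (kZero μ β))
  set gs := src c 0 (sinFun R (kZero μ β))
  have h1 : (∀ m x, (sysOp c K (parTau ε μ β) A - z • (cA • gc + sA • gs)) m x = G m x) ↔
      sysOp c K (parTau ε μ β) A - z • (cA • gc + sA • gs) = G := by
    constructor
    · intro h
      ext m x
      exact h m x
    · rintro h m x
      rw [h]
  have h2 : sysOp c K (parTau ε μ β) A - z • (cA • gc + sA • gs) = G ↔
      A - z • (cA • S gc + sA • S gs) = S G := by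
    constructor
    · intro h
      rw [← h, map_sub, sysRes_sysOp hd.unit, map_smul, map_add, map_smul, map_smul]
    · intro h
      have := congrArg (sysOp c K (parTau ε μ β)) h
      rwa [sysOp_sysRes hd.unit, map_sub, map_smul, map_add, map_smul, map_smul,
        sysOp_sysRes hd.unit, sysOp_sysRes hd.unit] at this
  rw [h1, h2]
  refine rank_two_solve (momC R (kZero μ β)).toLinearMap (momS R (kZero μ β)).toLinearMap (S gc)
    (S gs) (S G) A z (elC c K ε μ β) (elD c K ε μ β) ?_ ?_ ?_ ?_ (one_sub_I_mul_ne_zero _ _)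
    (one_sub_I_mul_ne_zero _ _)
  · exact resZ_real hd.coef hd.ker hd.unit 0 0 (star_cosFun _) (star_cosFun _)
  · exact resZ_sin_right hd.coef hd.ker hd.unit 0 _ 0 (reflFun_cosFun _)
  · exact resZ_sin_left hd.coef hd.ker hd.unit 0 _ 0 (reflFun_cosFun _)
  · exact resZ_real hd.coef hd.ker hd.unit 0 0 (star_sinFun _) (star_sinFun _)

theorem SysData.regular (hd : SysData f ε μ β c K) : Regular f R ε μ β := by
  refine ⟨hd.pos, fun G => ⟨fullSol c K ε μ β G, ?_, ?_⟩⟩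
  · exact (solves_iff_eq_fullSol hd G _).2 rfl
  · intro A hA
    exact (solves_iff_eq_fullSol hd G A).1 hA

/-- `resolv` is defined by choice of a solution; existence and uniqueness of the solution identify
the chosen one. -/
theorem resolv_eq (hd : SysData f ε μ β c K) {g : ℤ → Set.Icc (-R) R → ℂ} {G : SeqSpace R}
    (hg : ∀ m x, g m x = G m x) : resolv f R ε μ β g = fullSol c K ε μ β G := by
  have e : g = fun m x => G m x := by
    ext m x
    exact hg m x
  rw [e]
  have h : Solves f R ε μ β (fun m x => G m x) (resolv f R ε μ β (fun m x => G m x)) :=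
    Classical.epsilon_spec (p := Solves f R ε μ β (fun m x => G m x))
      ⟨fullSol c K ε μ β G, (solves_iff_eq_fullSol hd G _).2 rfl⟩
  exact (solves_iff_eq_fullSol hd G _).1 h

end

/-! ### The quantities F, Q, P±, a and b in terms of the real matrix elements -/

section

variable {R : ℝ} {f : ℝ × ℝ → ℝ} {ε μ β : ℝ} {c : ℤ → SegFun R} {K : KerAlg R}

/-- The plane wave source as an element of the sequence space. -/
def waveSrc (c : ℤ → SegFun R) (k : ℝ) : SeqSpace R :=
  src c 0 (cosFun R k) + Complex.I • src c 0 (sinFun R k)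

theorem gOne_eq (hd : SysData f ε μ β c K) (m : ℤ) (x : Set.Icc (-R) R) :
    gOne f R μ β m x = waveSrc c (kZero μ β) m x := by
  have h : waveSrc c (kZero μ β) m x = src c 0 (cosFun R (kZero μ β)) m x +
    Complex.I * src c 0 (sinFun R (kZero μ β)) m x := rfl
  rw [h, src_apply hd.coef.summable, src_apply hd.coef.summable, cosFun_apply, sinFun_apply, gOne,
    sub_zero, hd.coef_eq]
  have h3 : Complex.I * (kZero μ β : ℂ) * ((x : ℝ) : ℂ) =
      ((kZero μ β * x : ℝ) : ℂ) * Complex.I := by push_cast; ring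
  rw [h3, Complex.exp_mul_I]
  push_cast
  ring

theorem gTwo_eq (hd : SysData f ε μ β c K) (m : ℤ) (x : Set.Icc (-R) R) :
    gTwo f R m x = src c (-1) 1 m x := by
  rw [src_apply hd.coef.summable, gTwo, sub_neg_eq_add, hd.coef_eq, ContinuousMap.one_apply,
    one_mul]

/-- The table of three functionals against three sources. Parity annihilates the four mixed entries
with a sine, and symmetry of the resolvent makes both off-diagonal even entries equal to q. -/
theorem moment_values (hd : SysData f ε μ β c K) :
    pairL (-1) 1 (sysRes c K (parTau ε μ β) (src c (-1) 1)) = (elF c K ε μ β : ℂ) ∧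
    pairL (-1) 1 (sysRes c K (parTau ε μ β) (src c 0 (cosFun R (kZero μ β)))) =
      (elq c K ε μ β : ℂ) ∧
    pairL (-1) 1 (sysRes c K (parTau ε μ β) (src c 0 (sinFun R (kZero μ β)))) = 0 ∧
    momC R (kZero μ β) (sysRes c K (parTau ε μ β) (src c (-1) 1)) = (elq c K ε μ β : ℂ) ∧
    momC R (kZero μ β) (sysRes c K (parTau ε μ β) (src c 0 (cosFun R (kZero μ β)))) =
      (elC c K ε μ β : ℂ) ∧
    momC R (kZero μ β) (sysRes c K (parTau ε μ β) (src c 0 (sinFun R (kZero μ β)))) = 0 ∧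
    momS R (kZero μ β) (sysRes c K (parTau ε μ β) (src c (-1) 1)) = 0 ∧
    momS R (kZero μ β) (sysRes c K (parTau ε μ β) (src c 0 (cosFun R (kZero μ β)))) = 0 ∧
    momS R (kZero μ β) (sysRes c K (parTau ε μ β) (src c 0 (sinFun R (kZero μ β)))) =
      (elD c K ε μ β : ℂ) := by
  refine ⟨?_, ?_, ?_, ?_, ?_, ?_, ?_, ?_, ?_⟩
  · exact resZ_real hd.coef hd.ker hd.unit _ _ star_one_segFun star_one_segFun
  · exact resZ_real hd.coef hd.ker hd.unit _ _ star_one_segFun (star_cosFun _)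
  · exact resZ_sin_right hd.coef hd.ker hd.unit _ _ _ reflFun_one
  · exact (resZ_symm hd.coef hd.ker hd.unit _ _ _ _).trans
      (resZ_real hd.coef hd.ker hd.unit _ _ star_one_segFun (star_cosFun _))
  · exact resZ_real hd.coef hd.ker hd.unit _ _ (star_cosFun _) (star_cosFun _)
  · exact resZ_sin_right hd.coef hd.ker hd.unit _ _ _ (reflFun_cosFun _)
  · exact resZ_sin_left hd.coef hd.ker hd.unit _ _ _ reflFun_one
  · exact resZ_sin_left hd.coef hd.ker hd.unit _ _ _ (reflFun_cosFun _)
  · exact resZ_real hd.coef hd.ker hd.unit _ _ (star_sinFun _) (star_sinFun _)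

theorem fullSol_two (hd : SysData f ε μ β c K) : fullSol c K ε μ β (src c (-1) 1) =
    sysRes c K (parTau ε μ β) (src c (-1) 1) + (Complex.I * parT ε μ β * (elq c K ε μ β /
      (1 - Complex.I * parT ε μ β * elC c K ε μ β))) •
      sysRes c K (parTau ε μ β) (src c 0 (cosFun R (kZero μ β))) := by
  obtain ⟨-, -, -, h4, -, -, h7, -, -⟩ := moment_values hd
  rw [fullSol, h4, h7, zero_div, zero_smul, add_zero, smul_smul]

theorem fullSol_one (hd : SysData f ε μ β c K) : fullSol c K ε μ β (waveSrc c (kZero μ β)) =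
    (1 - Complex.I * parT ε μ β * elC c K ε μ β)⁻¹ •
      sysRes c K (parTau ε μ β) (src c 0 (cosFun R (kZero μ β))) +
    (Complex.I * (1 - Complex.I * parT ε μ β * elD c K ε μ β)⁻¹) •
      sysRes c K (parTau ε μ β) (src c 0 (sinFun R (kZero μ β))) := by
  obtain ⟨-, -, -, -, h5, h6, -, h8, h9⟩ := moment_values hd
  have hC := one_sub_I_mul_ne_zero (parT ε μ β) (elC c K ε μ β)
  have hD := one_sub_I_mul_ne_zero (parT ε μ β) (elD c K ε μ β)
  rw [fullSol, waveSrc]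
  simp only [map_add, map_smul, h5, h6, h8, h9, smul_eq_mul, mul_zero, add_zero, zero_add,
    smul_add, smul_smul]
  set V := sysRes c K (parTau ε μ β) (src c 0 (cosFun R (kZero μ β)))
  set W := sysRes c K (parTau ε μ β) (src c 0 (sinFun R (kZero μ β)))
  -- Both identities are 1 + zC/(1-zC) = 1/(1-zC), with z = it, the second one multiplied by i and
  -- with D in place of C.
  have e1 : (1 - Complex.I * parT ε μ β * elC c K ε μ β : ℂ)⁻¹ = 1 + Complex.I * parT ε μ β *
      (elC c K ε μ β / (1 - Complex.I * parT ε μ β * elC c K ε μ β)) := by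
    field_simp
    ring
  have e2 : (Complex.I * (1 - Complex.I * parT ε μ β * elD c K ε μ β : ℂ)⁻¹) = Complex.I +
      Complex.I * parT ε μ β *
      (Complex.I * elD c K ε μ β / (1 - Complex.I * parT ε μ β * elD c K ε μ β)) := by
    field_simp
    ring
  rw [e1, e2, add_smul, add_smul, one_smul]
  abel

theorem mean_eq_pairL (A : SeqSpace R) (n : ℤ) :
    ∫ x, A n x ∂(segMeasure R) = pairL n 1 A := by
  rw [pairL_apply]
  simp

theorem exp_moment (k : ℝ) (A : SeqSpace R) :
    ∫ x : Set.Icc (-R) R, A 0 x * Complex.exp (Complex.I * (k : ℂ) * ((x : ℝ) : ℂ))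
      ∂(segMeasure R) = momC R k A + Complex.I * momS R k A := by
  have e : ∀ x : Set.Icc (-R) R, A 0 x * Complex.exp (Complex.I * (k : ℂ) * ((x : ℝ) : ℂ)) =
      A 0 x * cosFun R k x + Complex.I * (A 0 x * sinFun R k x) := fun x => by
    have h3 : Complex.I * (k : ℂ) * ((x : ℝ) : ℂ) =
      ((k * x : ℝ) : ℂ) * Complex.I := by push_cast; ring
    rw [h3, Complex.exp_mul_I, cosFun_apply, sinFun_apply]
    push_cast
    ring
  have i1 : Integrable (fun x => A 0 x * cosFun R k x) (segMeasure R) :=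
    integrable_segFun (A 0 * cosFun R k)
  have i2 : Integrable (fun x => A 0 x * sinFun R k x) (segMeasure R) :=
    integrable_segFun (A 0 * sinFun R k)
  rw [integral_congr_ae (Filter.Eventually.of_forall e), integral_add i1 (i2.const_mul _),
    integral_const_mul]
  rfl

theorem exp_moment_neg (k : ℝ) (A : SeqSpace R) :
    ∫ x : Set.Icc (-R) R, A 0 x * Complex.exp (-(Complex.I * (k : ℂ) * ((x : ℝ) : ℂ)))
      ∂(segMeasure R) = momC R k A - Complex.I * momS R k A := by
  have h := exp_moment (-k) A
  have h1 : momC R (-k) A = momC R k A := by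
    have : cosFun R (-k) = cosFun R k := by ext x; simp [cosFun_apply]
    rw [momC, this, momC]
  have h2 : momS R (-k) A = -momS R k A := by
    have : sinFun R (-k) = -sinFun R k := by ext x; simp [sinFun_apply]
    rw [momS, this, momS]
    simp
  rw [h1, h2] at h
  rw [mul_neg, ← sub_eq_add_neg] at h
  rw [← h]
  congr 1
  ext x
  congr 2
  push_cast
  ring

theorem funF_eq (hd : SysData f ε μ β c K) : funF f R ε μ β = elF c K ε μ β +
    Complex.I * parT ε μ β * (elq c K ε μ β ^ 2 /
      (1 - Complex.I * parT ε μ β * elC c K ε μ β)) := by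
  obtain ⟨h1, h2, -, -, -, -, -, -, -⟩ := moment_values hd
  rw [funF, resolv_eq hd (gTwo_eq hd), mean_eq_pairL, fullSol_two hd, map_add, map_smul, h1, h2,
    smul_eq_mul]
  ring

theorem funQ_eq (hd : SysData f ε μ β c K) : funQ f R ε μ β =
    elq c K ε μ β / (1 - Complex.I * parT ε μ β * elC c K ε μ β) := by
  obtain ⟨-, h2, h3, -, -, -, -, -, -⟩ := moment_values hd
  rw [funQ, resolv_eq hd (gOne_eq hd), mean_eq_pairL, fullSol_one hd, map_add, map_smul, map_smul,
    h2, h3, smul_zero, add_zero, smul_eq_mul]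
  ring

theorem mom_fullSol_one (hd : SysData f ε μ β c K) :
    momC R (kZero μ β) (fullSol c K ε μ β (waveSrc c (kZero μ β))) =
      elC c K ε μ β / (1 - Complex.I * parT ε μ β * elC c K ε μ β) ∧
    momS R (kZero μ β) (fullSol c K ε μ β (waveSrc c (kZero μ β))) =
      Complex.I * (elD c K ε μ β / (1 - Complex.I * parT ε μ β * elD c K ε μ β)) := by
  obtain ⟨-, -, -, -, h5, h6, -, h8, h9⟩ := moment_values hd
  rw [fullSol_one hd]
  simp only [map_add, map_smul, h5, h6, h8, h9, smul_eq_mul]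
  constructor <;> ring

/-- Reciprocity: the cosine moment in mode 0 of the response to the mode -1 source equals Q, the
mean in mode -1 of the response to the incident wave. This is why only Q² occurs in a and b. -/
theorem mom_fullSol_two (hd : SysData f ε μ β c K) :
    momC R (kZero μ β) (fullSol c K ε μ β (src c (-1) 1)) =
      elq c K ε μ β / (1 - Complex.I * parT ε μ β * elC c K ε μ β) ∧
    momS R (kZero μ β) (fullSol c K ε μ β (src c (-1) 1)) = 0 := by
  obtain ⟨-, -, -, h4, h5, -, h7, h8, -⟩ := moment_values hd
  have hC := one_sub_I_mul_ne_zero (parT ε μ β) (elC c K ε μ β)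
  rw [fullSol_two hd]
  simp only [map_add, map_smul, h4, h5, h7, h8, smul_eq_mul]
  constructor
  · field_simp
    ring
  · simp

theorem funPplus_eq (hd : SysData f ε μ β c K) : funPplus f R ε μ β =
    elC c K ε μ β / (1 - Complex.I * parT ε μ β * elC c K ε μ β) -
      elD c K ε μ β / (1 - Complex.I * parT ε μ β * elD c K ε μ β) := by
  rw [funPplus, resolv_eq hd (gOne_eq hd), exp_moment, (mom_fullSol_one hd).1,
    (mom_fullSol_one hd).2]
  linear_combination (elD c K ε μ β / (1 - Complex.I * parT ε μ β * elD c K ε μ β) : ℂ) *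
    Complex.I_sq

theorem funPminus_eq (hd : SysData f ε μ β c K) : funPminus f R ε μ β =
    elC c K ε μ β / (1 - Complex.I * parT ε μ β * elC c K ε μ β) +
      elD c K ε μ β / (1 - Complex.I * parT ε μ β * elD c K ε μ β) := by
  rw [funPminus, resolv_eq hd (gOne_eq hd), exp_moment_neg, (mom_fullSol_one hd).1,
    (mom_fullSol_one hd).2]
  linear_combination (-elD c K ε μ β / (1 - Complex.I * parT ε μ β * elD c K ε μ β) : ℂ) *
    Complex.I_sq

/-- `λ = ν - γ F_r`. -/
def elLam (c : ℤ → SegFun R) (K : KerAlg R) (ε ν β : ℝ) : ℝ :=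
  ν - gam (ε * ν) β * elF c K ε (ε * ν) β

/-- The real function whose zeros are those of `a`. -/
def redA (c : ℤ → SegFun R) (K : KerAlg R) (ε ν β : ℝ) : ℝ :=
  elLam c K ε ν β * (elC c K ε (ε * ν) β - elD c K ε (ε * ν) β) +
    gam (ε * ν) β * elq c K ε (ε * ν) β ^ 2

/-- The real function whose zeros are those of `b`. -/
def redB (c : ℤ → SegFun R) (K : KerAlg R) (ε ν β : ℝ) : ℝ :=
  elLam c K ε ν β * (1 + parT ε (ε * ν) β ^ 2 * elC c K ε (ε * ν) β * elD c K ε (ε * ν) β) +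
    parT ε (ε * ν) β ^ 2 * gam (ε * ν) β * elq c K ε (ε * ν) β ^ 2 * elD c K ε (ε * ν) β

variable {ν : ℝ}

theorem funEll_eq (hd : SysData f ε (ε * ν) β c K) : funEll f R ε ν β = elLam c K ε ν β -
    Complex.I * parT ε (ε * ν) β * gam (ε * ν) β * (elq c K ε (ε * ν) β ^ 2 /
      (1 - Complex.I * parT ε (ε * ν) β * elC c K ε (ε * ν) β)) := by
  rw [funEll, funF_eq hd, elLam]
  push_cast
  ring

theorem prefactor_eq : Complex.I * (kZero μ β : ℂ)⁻¹ * (ε : ℂ) * (gam μ β : ℂ) =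
    Complex.I * parT ε μ β := by
  rw [parT]
  push_cast
  ring

/-- With z = it, P⁺ = (C-D)/((1-zC)(1-zD)). The terms in q² are γq²/(1-zC)² times 1 - z(C-D)/(1-zD)
= (1-zC)/(1-zD), so the double factor (1-zC)² cancels and the remaining numerator is real. -/
theorem funA_eq (hd : SysData f ε (ε * ν) β c K) : funA f R ε ν β =
    Complex.I * parT ε (ε * ν) β * redA c K ε ν β /
      ((1 - Complex.I * parT ε (ε * ν) β * elC c K ε (ε * ν) β) *
        (1 - Complex.I * parT ε (ε * ν) β * elD c K ε (ε * ν) β)) := by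
  have hC := one_sub_I_mul_ne_zero (parT ε (ε * ν) β) (elC c K ε (ε * ν) β)
  have hD := one_sub_I_mul_ne_zero (parT ε (ε * ν) β) (elD c K ε (ε * ν) β)
  rw [funA, prefactor_eq, funPplus_eq hd, funQ_eq hd, funEll_eq hd, redA]
  push_cast
  field_simp
  ring

/-- Here 1 + zP⁻ = (1 - z²CD)/((1-zC)(1-zD)), and the terms in q² collapse to -z²γq²D over the same
denominator. Only z² = -t² survives in the numerator, which is therefore real. -/
theorem funB_eq (hd : SysData f ε (ε * ν) β c K) : funB f R ε ν β = redB c K ε ν β /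
      ((1 - Complex.I * parT ε (ε * ν) β * elC c K ε (ε * ν) β) *
        (1 - Complex.I * parT ε (ε * ν) β * elD c K ε (ε * ν) β)) := by
  have hC := one_sub_I_mul_ne_zero (parT ε (ε * ν) β) (elC c K ε (ε * ν) β)
  have hD := one_sub_I_mul_ne_zero (parT ε (ε * ν) β) (elD c K ε (ε * ν) β)
  rw [funB, prefactor_eq, funPminus_eq hd, funQ_eq hd, funEll_eq hd, redB]
  push_cast
  have hI : Complex.I ^ 2 = -1 := Complex.I_sq
  generalize (parT ε (ε * ν) β : ℂ) = t at *
  generalize (elC c K ε (ε * ν) β : ℂ) = C at *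
  generalize (elD c K ε (ε * ν) β : ℂ) = D at *
  generalize (elLam c K ε ν β : ℂ) = l at *
  generalize (gam (ε * ν) β : ℂ) = g at *
  generalize (elq c K ε (ε * ν) β : ℂ) = q at *
  -- Everything is rewritten in z = it, so that the identity becomes one between rational functions
  -- and i can be forgotten.
  have ht : t ^ 2 = -(Complex.I * t) ^ 2 := by rw [mul_pow, hI]; ring
  rw [ht]
  generalize Complex.I * t = z at *
  field_simp
  ring

/-- If ℓ = 0 then λ(1 - itC) = itγq². The real part gives λ = 0, and then the imaginary part gives
tγq² = 0. The quantity ℓ is the denominator of both scattering coefficients. -/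
theorem funEll_ne_zero (hd : SysData f ε (ε * ν) β c K) (ht : parT ε (ε * ν) β ≠ 0)
    (hg : gam (ε * ν) β ≠ 0) (hq : elq c K ε (ε * ν) β ≠ 0) : funEll f R ε ν β ≠ 0 := by
  have hC := one_sub_I_mul_ne_zero (parT ε (ε * ν) β) (elC c K ε (ε * ν) β)
  rw [funEll_eq hd]
  intro h
  rw [sub_eq_zero, mul_div_assoc', eq_div_iff hC] at h
  have hre := congrArg Complex.re h
  have him := congrArg Complex.im h
  simp [pow_two] at hre him
  rw [hre] at him
  simp [ht, hg, hq] at him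

end

section

variable {R : ℝ} {f : ℝ × ℝ → ℝ}

/-! ### Fourier coefficients of the perturbation -/

/-- The hypotheses on the perturbation. -/
structure Perturbation (f : ℝ × ℝ → ℝ) (R : ℝ) : Prop where
  smooth : ContDiff ℝ ∞ f
  per : ∀ x y : ℝ, f (x, y + 2 * Real.pi) = f (x, y)
  supp : ∀ x y : ℝ, R < |x| → f (x, y) = 0
  even_x : ∀ x y : ℝ, f (-x, y) = f (x, y)
  even_y : ∀ x y : ℝ, f (x, -y) = f (x, y)

theorem continuous_fCoeff (hf : Continuous f) (j : ℤ) : Continuous (fCoeff f j) := by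
  unfold fCoeff
  refine intervalIntegral.continuous_parametric_intervalIntegral_of_continuous' ?_ _ _
  have : Continuous fun p : ℝ × ℝ => Complex.exp (-(Complex.I * j * p.2)) * (f (p.1, p.2) : ℂ) := by
    fun_prop
  exact this

theorem Perturbation.cont (hf : Perturbation f R) : Continuous f := hf.smooth.continuous

/-- At |x| = R the value is a limit along points sx with s ↓ 1, where f vanishes. Vanishing at the
endpoints makes extensions by zero continuous later on. -/
theorem Perturbation.zero_of_le (hf : Perturbation f R) (hR : 0 < R) {x : ℝ} (hx : R ≤ |x|)
    (y : ℝ) : f (x, y) = 0 := by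
  have h1 : Filter.Tendsto (fun s : ℝ => f (s * x, y)) (𝓝[>] 1) (𝓝 (f (1 * x, y))) := by
    have hc : Continuous fun s : ℝ => f (s * x, y) := hf.cont.comp (by fun_prop)
    exact (hc.tendsto 1).mono_left nhdsWithin_le_nhds
  have h2 : (fun s : ℝ => f (s * x, y)) =ᶠ[𝓝[>] 1] fun _ => 0 := by
    filter_upwards [self_mem_nhdsWithin] with s hs
    refine hf.supp _ _ ?_
    rw [abs_mul, abs_of_pos (zero_lt_one.trans hs)]
    have hs' : (1 : ℝ) < s := hs
    nlinarith
  have h3 := tendsto_nhds_unique (h1.congr' h2) tendsto_const_nhds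
  simpa using h3

theorem Perturbation.fCoeff_zero (hf : Perturbation f R) (hR : 0 < R) (j : ℤ) {x : ℝ}
    (hx : R ≤ |x|) : fCoeff f j x = 0 := by
  simp [fCoeff, hf.zero_of_le hR hx]

/-- The partial derivative in `y` of a real function. -/
def derivY (f : ℝ × ℝ → ℝ) (p : ℝ × ℝ) : ℝ := fderiv ℝ f p (0, 1)

theorem contDiff_derivY (hf : ContDiff ℝ ∞ f) : ContDiff ℝ ∞ (derivY f) := by
  have h1 : ContDiff ℝ ∞ (fderiv ℝ f) := hf.fderiv_right (by simp)
  exact h1.clm_apply contDiff_const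

theorem hasDerivAt_derivY (hf : ContDiff ℝ ∞ f) (x y : ℝ) :
    HasDerivAt (fun s => f (x, s)) (derivY f (x, y)) y := by
  have h1 : HasFDerivAt f (fderiv ℝ f (x, y)) (x, y) :=
    (hf.differentiable (by simp)).differentiableAt.hasFDerivAt
  have h2 : HasDerivAt (fun s : ℝ => (x, s)) ((0 : ℝ), (1 : ℝ)) y :=
    (hasDerivAt_const y x).prodMk (hasDerivAt_id y)
  exact h1.comp_hasDerivAt y h2

theorem derivY_per (hf : ContDiff ℝ ∞ f) {T : ℝ} (hper : ∀ x y : ℝ, f (x, y + T) = f (x, y))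
    (x y : ℝ) : derivY f (x, y + T) = derivY f (x, y) := by
  have h1 := (hasDerivAt_derivY hf x (y + T)).comp_add_const y T
  have h2 : (fun s => f (x, s + T)) = fun s => f (x, s) := by
    ext s
    exact hper x s
  rw [h2] at h1
  exact h1.unique (hasDerivAt_derivY hf x y)

theorem exp_int_two_pi (j : ℤ) : Complex.exp (-(Complex.I * j * ((2 * Real.pi : ℝ) : ℂ))) = 1 := by
  rw [Complex.exp_eq_one_iff]
  refine ⟨-j, ?_⟩
  push_cast
  ring

theorem fCoeff_derivY (hf : ContDiff ℝ ∞ f)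
    (hper : ∀ x y : ℝ, f (x, y + 2 * Real.pi) = f (x, y)) (j : ℤ) (x : ℝ) :
    fCoeff (derivY f) j x = Complex.I * j * fCoeff f j x := by
  have hu : ∀ y ∈ Set.uIcc 0 (2 * Real.pi), HasDerivAt (fun y : ℝ =>
      Complex.exp (-(Complex.I * j * y)))
      (Complex.exp (-(Complex.I * j * y)) * -(Complex.I * j)) y := fun y _ => by
    have h1 : HasDerivAt (fun y : ℝ => -(Complex.I * j * (y : ℂ))) (-(Complex.I * j)) y := by
      have := ((hasDerivAt_id y).ofReal_comp.const_mul (Complex.I * j)).fun_neg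
      simpa using this
    exact h1.cexp
  have hv : ∀ y ∈ Set.uIcc 0 (2 * Real.pi), HasDerivAt (fun y : ℝ => (f (x, y) : ℂ))
      (derivY f (x, y) : ℂ) y := fun y _ => (hasDerivAt_derivY hf x y).ofReal_comp
  have hfc := hf.continuous
  have hgc := (contDiff_derivY hf).continuous
  have h := intervalIntegral.integral_mul_deriv_eq_deriv_mul hu hv
    (Continuous.intervalIntegrable (by fun_prop) _ _)
    (Continuous.intervalIntegrable (by fun_prop) _ _)
  have h2 : f (x, 2 * Real.pi) = f (x, 0) := by simpa using hper x 0
  unfold fCoeff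
  rw [h, exp_int_two_pi, h2]
  simp only [Complex.ofReal_zero, mul_zero, neg_zero, Complex.exp_zero, sub_self, zero_sub]
  rw [← intervalIntegral.integral_const_mul, ← intervalIntegral.integral_neg]
  congr 1
  ext y
  ring

theorem norm_fCoeff_le {g : ℝ × ℝ → ℝ} {C x : ℝ} (hg : ∀ y, |g (x, y)| ≤ C) (j : ℤ) :
    ‖fCoeff g j x‖ ≤ C * (2 * Real.pi) := by
  have h := intervalIntegral.norm_integral_le_of_norm_le_const (a := 0) (b := 2 * Real.pi)
    (f := fun y : ℝ => Complex.exp (-(Complex.I * j * y)) * (g (x, y) : ℂ)) (C := C) fun y _ => by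
    have h1 : ‖Complex.exp (-(Complex.I * j * y))‖ = 1 := by
      have : -(Complex.I * j * (y : ℂ)) = ((-(j * y) : ℝ) : ℂ) * Complex.I := by push_cast; ring
      rw [this, Complex.norm_exp_ofReal_mul_I]
    rw [norm_mul, h1, one_mul, Complex.norm_real]
    exact hg y
  rwa [sub_zero, abs_of_pos Real.two_pi_pos] at h

theorem exists_bound_of_per {g : ℝ × ℝ → ℝ} (hg : Continuous g)
    (hper : ∀ x y : ℝ, g (x, y + 2 * Real.pi) = g (x, y)) (R : ℝ) :
    ∃ C, ∀ x y, |x| ≤ R → |g (x, y)| ≤ C := by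
  obtain ⟨C, hC⟩ := ((isCompact_Icc (a := -R) (b := R)).prod
    (isCompact_Icc (a := 0) (b := 2 * Real.pi))).exists_bound_of_continuousOn hg.continuousOn
  refine ⟨C, fun x y hx => ?_⟩
  have hp : Function.Periodic (fun y => g (x, y)) (2 * Real.pi) := fun y => hper x y
  obtain ⟨y', hy', he⟩ := hp.exists_mem_Ico₀ Real.two_pi_pos y
  have he' : g (x, y) = g (x, y') := he
  rw [he']
  exact hC (x, y') ⟨abs_le.1 hx, hy'.1, hy'.2.le⟩

/-- Two integrations by parts in y, without boundary terms by periodicity, with a bound on the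
second derivative that is uniform in x; for |x| ≥ R the coefficient is zero. -/
theorem Perturbation.exists_decay (hf : Perturbation f R) (hR : 0 < R) :
    ∃ C, 0 ≤ C ∧ ∀ (j : ℤ) x, j ≠ 0 → ‖fCoeff f j x‖ ≤ C * (1 / (j : ℝ) ^ 2) := by
  have h1 := contDiff_derivY hf.smooth
  have p1 := derivY_per hf.smooth hf.per
  obtain ⟨C, hC⟩ := exists_bound_of_per (contDiff_derivY h1).continuous
    (derivY_per h1 p1) R
  have hC0 : 0 ≤ C := (abs_nonneg _).trans (hC 0 0 (by simpa using hR.le))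
  refine ⟨C * (2 * Real.pi), by positivity, fun j x hj => ?_⟩
  rcases le_or_gt R |x| with hx | hx
  · rw [hf.fCoeff_zero hR j hx, norm_zero]
    positivity
  · have h2 : fCoeff (derivY (derivY f)) j x = -(j : ℂ) ^ 2 * fCoeff f j x := by
      rw [fCoeff_derivY h1 p1, fCoeff_derivY hf.smooth hf.per]
      linear_combination ((j : ℂ) ^ 2 * fCoeff f j x) * Complex.I_sq
    have h3 := norm_fCoeff_le (fun y => hC x y hx.le) j
    rw [h2, norm_mul, norm_neg, norm_pow, Complex.norm_intCast, sq_abs] at h3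
    have hj2 : 0 < (j : ℝ) ^ 2 := by positivity
    rw [mul_one_div, le_div_iff₀ hj2]
    linarith

/-- A summable majorant of the Fourier coefficients. -/
theorem Perturbation.exists_majorant (hf : Perturbation f R) (hR : 0 < R) :
    ∃ b : ℤ → ℝ, Summable b ∧ (∀ j, 0 ≤ b j) ∧ ∀ j x, ‖fCoeff f j x‖ ≤ b j := by
  obtain ⟨C, hC0, hC⟩ := hf.exists_decay hR
  obtain ⟨C', hC'⟩ := exists_bound_of_per hf.cont hf.per R
  have hC'0 : 0 ≤ C' := (abs_nonneg _).trans (hC' 0 0 (by simpa using hR.le))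
  have hs : Summable fun j : ℤ => C * (1 / (j : ℝ) ^ 2) :=
    (Real.summable_one_div_int_pow.2 (by norm_num)).mul_left C
  refine ⟨fun j => C * (1 / (j : ℝ) ^ 2) + if j = 0 then C' * (2 * Real.pi) else 0, ?_, ?_, ?_⟩
  · refine hs.add (summable_of_ne_finset_zero (s := {0}) fun j hj => ?_)
    rw [Finset.mem_singleton] at hj
    simp [hj]
  · intro j
    have : 0 ≤ C' * (2 * Real.pi) := by positivity
    dsimp only
    split_ifs <;> positivity
  · intro j x
    by_cases hj : j = 0
    · rcases le_or_gt R |x| with hx | hx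
      · rw [hf.fCoeff_zero hR j hx, norm_zero]
        have : 0 ≤ C' * (2 * Real.pi) := by positivity
        dsimp only
        split_ifs
        positivity
      · have := norm_fCoeff_le (fun y => hC' x y hx.le) j
        simpa [hj] using this
    · simpa [hj] using hC j x hj

/-- Substitute y ↦ 2π - y and use evenness together with periodicity. -/
theorem fCoeff_neg_index (hper : ∀ x y : ℝ, f (x, y + 2 * Real.pi) = f (x, y))
    (heven : ∀ x y : ℝ, f (x, -y) = f (x, y)) (j : ℤ) (x : ℝ) :
    fCoeff f (-j) x = fCoeff f j x := by
  have h := intervalIntegral.integral_comp_sub_left (a := 0) (b := 2 * Real.pi)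
    (fun y : ℝ => Complex.exp (-(Complex.I * j * y)) * (f (x, y) : ℂ)) (2 * Real.pi)
  rw [sub_self, sub_zero] at h
  unfold fCoeff
  rw [← h]
  congr 1
  ext y
  have h1 : f (x, 2 * Real.pi - y) = f (x, y) := by
    rw [← heven x y, ← hper x (-y)]
    congr 2
    ring
  rw [h1]
  congr 1
  have h2 : -(Complex.I * j * ((2 * Real.pi - y : ℝ) : ℂ)) =
    -(Complex.I * j * ((2 * Real.pi : ℝ) : ℂ)) + -(Complex.I * ((-j : ℤ) : ℂ) * (y : ℂ)) := by
    push_cast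
    ring
  rw [h2, Complex.exp_add, exp_int_two_pi, one_mul]

theorem conj_fCoeff (j : ℤ) (x : ℝ) : star (fCoeff f j x) = fCoeff f (-j) x := by
  unfold fCoeff
  rw [intervalIntegral.integral_of_le Real.two_pi_pos.le,
    intervalIntegral.integral_of_le Real.two_pi_pos.le]
  refine (integral_conj).symm.trans ?_
  congr 1
  ext y
  rw [map_mul, Complex.conj_ofReal, ← Complex.exp_conj]
  congr 2
  simp

/-- The Fourier coefficients as elements of `C([-R, R])`. -/
def coefFun (hf : Continuous f) (R : ℝ) (j : ℤ) : SegFun R :=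
  ⟨fun x => fCoeff f j x, (continuous_fCoeff hf j).comp continuous_subtype_val⟩

theorem coefFun_apply (hf : Continuous f) (j : ℤ) (x : Set.Icc (-R) R) :
    coefFun hf R j x = fCoeff f j x := rfl

theorem Perturbation.coefData (hf : Perturbation f R) (hR : 0 < R) :
    CoefData (coefFun hf.cont R) where
  summable := by
    obtain ⟨b, hb, hb0, hbj⟩ := hf.exists_majorant hR
    refine Summable.of_nonneg_of_le (fun _ => norm_nonneg _) (fun j => ?_) hb
    exact (ContinuousMap.norm_le _ (hb0 j)).2 fun x => hbj j x
  symm j := by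
    ext x
    exact fCoeff_neg_index hf.per hf.even_y j x
  real j := by
    ext x
    exact (conj_fCoeff j x).trans (fCoeff_neg_index hf.per hf.even_y j x)
  even j x := by
    simp only [coefFun_apply, coe_segNeg, fCoeff, hf.even_x]

/-- Fourier expansion in `y`. -/
theorem Perturbation.hasSum_fourier (hf : Perturbation f R) (hR : 0 < R) (x y : ℝ) :
    HasSum (fun j : ℤ => fCoeff f j x * Complex.exp (Complex.I * j * y))
      (2 * Real.pi * (f (x, y) : ℂ)) := by
  have : Fact (0 < 2 * Real.pi) := ⟨Real.two_pi_pos⟩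
  have hp : Function.Periodic (fun y => (f (x, y) : ℂ)) (2 * Real.pi) := fun y => by
    simp only [hf.per]
  have hcx : Continuous fun y => (f (x, y) : ℂ) := by
    have := hf.cont
    fun_prop
  set g : C(AddCircle (2 * Real.pi), ℂ) := ⟨hp.lift, by
    exact hcx.quotient_lift _⟩ with hg
  have hgy : ∀ y : ℝ, g (y : AddCircle (2 * Real.pi)) = f (x, y) := fun y => rfl
  have hco : ∀ j, fourierCoeff g j = (1 / (2 * Real.pi) : ℝ) • fCoeff f j x := fun j => by
    rw [fourierCoeff_eq_intervalIntegral g j 0, zero_add, fCoeff]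
    congr 2
    ext y
    rw [fourier_coe_apply, smul_eq_mul, hgy]
    congr 2
    push_cast
    have : (Real.pi : ℂ) ≠ 0 := by exact_mod_cast Real.pi_ne_zero
    field_simp
  have hs : Summable (fourierCoeff g) := by
    obtain ⟨b, hb, hb0, hbj⟩ := hf.exists_majorant hR
    have : fourierCoeff g = fun j => (1 / (2 * Real.pi) : ℝ) • fCoeff f j x := funext hco
    rw [this]
    exact (Summable.of_norm_bounded hb fun j => hbj j x).const_smul _
  have h := (has_pointwise_sum_fourier_series_of_summable hs (y : AddCircle (2 * Real.pi))).mul_left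
    ((2 * Real.pi : ℝ) : ℂ)
  rw [hgy] at h
  have hpi : (Real.pi : ℂ) ≠ 0 := by exact_mod_cast Real.pi_ne_zero
  convert! h using 1
  · ext j
    rw [hco, fourier_coe_apply, Complex.real_smul, smul_eq_mul]
    push_cast
    have e : 2 * (Real.pi : ℂ) * Complex.I * j * y / (2 * Real.pi) = Complex.I * j * y := by
      field_simp
    rw [e]
    field_simp
  · push_cast
    ring

end

section

/-! ### The scalar equation `ν = G(ε, ε ν, β)` -/

/-- The implicit function theorem for ν - G(ε, εν, β), whose derivative in ν is 1 at ε = 0 because ν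
enters G only through εν. The last clause, uniqueness among all solutions bounded by N, does not
follow from local uniqueness near ν₀; it comes from a Lipschitz bound on G and makes gluing
possible. -/
theorem exists_local_solution {G : ℝ × ℝ × ℝ → ℝ} {β₀ : ℝ} (hG : AnalyticAt ℝ G (0, 0, β₀))
    {P : ℝ × ℝ × ℝ → Prop} (hP : ∀ᶠ p in 𝓝 ((0 : ℝ), (0 : ℝ), β₀), P p) :
    ∃ (W : Set (ℝ × ℝ)) (N : ℝ) (ν : ℝ × ℝ → ℝ), IsOpen W ∧ (0, β₀) ∈ W ∧
      AnalyticOnNhd ℝ ν W ∧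
      (∀ p ∈ W, |ν p| ≤ N ∧ ν p = G (p.1, p.1 * ν p, p.2) ∧ P (p.1, p.1 * ν p, p.2)) ∧
      ∀ p ∈ W, ∀ a b : ℝ, |a| ≤ N → |b| ≤ N → a = G (p.1, p.1 * a, p.2) →
        b = G (p.1, p.1 * b, p.2) → a = b := by
  set ν₀ := G (0, 0, β₀) with hν₀
  set F : (ℝ × ℝ) × ℝ → ℝ := fun v => v.2 - G (v.1.1, v.1.1 * v.2, v.1.2) with hF
  set u : (ℝ × ℝ) × ℝ := ((0, β₀), ν₀) with hu
  have hFu : F u = 0 := by simp [hF, hu, hν₀]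
  have hin : ContDiffAt ℝ ω (fun v : (ℝ × ℝ) × ℝ => (v.1.1, v.1.1 * v.2, v.1.2)) u := by fun_prop
  have hFc : ContDiffAt ℝ ω F u := by
    refine contDiffAt_snd.sub (ContDiffAt.comp u ?_ hin)
    have : ((u.1.1, u.1.1 * u.2, u.1.2) : ℝ × ℝ × ℝ) = (0, 0, β₀) := by simp [hu]
    rw [this]
    exact hG.contDiffAt
  have hinv : (fderiv ℝ F u ∘L .inr ℝ (ℝ × ℝ) ℝ).IsInvertible := by
    have h1 : HasFDerivAt F (fderiv ℝ F u) u := (hFc.differentiableAt (by simp)).hasFDerivAt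
    have h2 : HasDerivAt (fun s : ℝ => (((0 : ℝ), β₀), s)) (((0 : ℝ), (0 : ℝ)), (1 : ℝ)) ν₀ :=
      (hasDerivAt_const ν₀ ((0 : ℝ), β₀)).prodMk (hasDerivAt_id ν₀)
    have h3 : HasDerivAt (fun s : ℝ => F ((0, β₀), s)) (fderiv ℝ F u ((0, 0), 1)) ν₀ :=
      HasFDerivAt.comp_hasDerivAt (f := fun s : ℝ => (((0 : ℝ), β₀), s)) ν₀ h1 h2
    have h4 : HasDerivAt (fun s : ℝ => F ((0, β₀), s)) 1 ν₀ := by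
      have : (fun s : ℝ => F ((0, β₀), s)) = fun s => s - ν₀ := by
        ext s
        simp [hF, hν₀]
      rw [this]
      exact (hasDerivAt_id ν₀).sub_const ν₀
    have h5 := h3.unique h4
    have h6 : fderiv ℝ F u ∘L .inr ℝ (ℝ × ℝ) ℝ = ContinuousLinearMap.id ℝ ℝ := by
      ext
      exact h5
    rw [h6]
    exact ⟨ContinuousLinearEquiv.refl ℝ ℝ, rfl⟩
  have hω : (ω : ℕ∞ω) ≠ 0 := by simp
  set ν := hFc.implicitFunction hω hinv with hν
  have hνc : ContDiffAt ℝ ω ν (0, β₀) := hFc.contDiffAt_implicitFunction hω hinv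
  have hν0 : ν (0, β₀) = ν₀ := hFc.implicitFunction_apply_self hω hinv
  have hνe : ∀ᶠ p in 𝓝 ((0 : ℝ), β₀), F (p, ν p) = 0 := by
    have := hFc.eventually_apply_implicitFunction hω hinv
    rwa [hFu] at this
  -- Any bound above |ν₀| would do; the neighbourhood is shrunk so that the solution stays below it.
  set N := |ν₀| + 1 with hN
  have hNpos : 0 < N := by positivity
  have hνN : ∀ᶠ p in 𝓝 ((0 : ℝ), β₀), |ν p| < N := by
    have h := hνc.continuousAt.abs
    have h2 : |ν (0, β₀)| < N := by rw [hν0]; linarith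
    exact h.eventually (gt_mem_nhds h2)
  have hνP : ∀ᶠ p in 𝓝 ((0 : ℝ), β₀), P (p.1, p.1 * ν p, p.2) := by
    have h1 : ContinuousAt (fun p : ℝ × ℝ => (p.1, p.1 * ν p, p.2)) (0, β₀) :=
      continuousAt_fst.prodMk ((continuousAt_fst.mul hνc.continuousAt).prodMk continuousAt_snd)
    have h2 : Filter.Tendsto (fun p : ℝ × ℝ => (p.1, p.1 * ν p, p.2)) (𝓝 (0, β₀))
        (𝓝 (0, 0, β₀)) := by
      have := h1.tendsto
      simpa using this
    exact h2.eventually hP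
  obtain ⟨L, s, hs, hLip⟩ := (hG.contDiffAt (n := 1)).exists_lipschitzOnWith
  obtain ⟨r, hr, hrs⟩ := Metric.mem_nhds_iff.1 hs
  have hsmall : ∀ᶠ p : ℝ × ℝ in 𝓝 ((0 : ℝ), β₀), |p.1| < r ∧ |p.1| * N < r ∧ |p.2 - β₀| < r ∧
      |p.1| * L < 1 := by
    have c1 : Filter.Tendsto (fun p : ℝ × ℝ => |p.1|) (𝓝 ((0 : ℝ), β₀)) (𝓝 0) := by
      have : Continuous fun p : ℝ × ℝ => |p.1| := by fun_prop
      simpa using this.tendsto ((0 : ℝ), β₀)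
    have c2 : Filter.Tendsto (fun p : ℝ × ℝ => |p.1| * N) (𝓝 ((0 : ℝ), β₀)) (𝓝 0) := by
      simpa using c1.mul_const N
    have c3 : Filter.Tendsto (fun p : ℝ × ℝ => |p.2 - β₀|) (𝓝 ((0 : ℝ), β₀)) (𝓝 0) := by
      have : Continuous fun p : ℝ × ℝ => |p.2 - β₀| := by fun_prop
      simpa using this.tendsto ((0 : ℝ), β₀)
    have c4 : Filter.Tendsto (fun p : ℝ × ℝ => |p.1| * L) (𝓝 ((0 : ℝ), β₀)) (𝓝 0) := by
      simpa using c1.mul_const (L : ℝ)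
    filter_upwards [c1.eventually (gt_mem_nhds hr), c2.eventually (gt_mem_nhds hr),
      c3.eventually (gt_mem_nhds hr), c4.eventually (gt_mem_nhds one_pos)] with p h1 h2 h3 h4
    exact ⟨h1, h2, h3, h4⟩
  have hall := (hνc.analyticAt.eventually_analyticAt.and (hνe.and (hνN.and (hνP.and hsmall))))
  obtain ⟨W, hW, hWo, hW0⟩ := eventually_nhds_iff.1 hall
  refine ⟨W, N, ν, hWo, hW0, fun p hp => (hW p hp).1, fun p hp => ?_,
    fun p hp a b ha hb hea heb => ?_⟩
  · obtain ⟨-, h2, h3, h4, -⟩ := hW p hp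
    exact ⟨h3.le, by simpa [hF, sub_eq_zero] using h2, h4⟩
  · obtain ⟨-, -, -, -, h1, h2, h3, h4⟩ := hW p hp
    have hmem : ∀ x : ℝ, |x| ≤ N → ((p.1, p.1 * x, p.2) : ℝ × ℝ × ℝ) ∈ s := fun x hx => by
      refine hrs ?_
      rw [Metric.mem_ball, Prod.dist_eq, Prod.dist_eq, max_lt_iff, max_lt_iff]
      refine ⟨by simpa [Real.dist_eq] using h1, ?_, by simpa [Real.dist_eq] using h3⟩
      rw [Real.dist_eq, sub_zero, abs_mul]
      exact (mul_le_mul_of_nonneg_left hx (abs_nonneg _)).trans_lt h2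
    -- The two arguments of G differ only in the middle entry, by ε(a - b), so |a - b| ≤ L|ε||a - b|
    -- with L|ε| < 1.
    have hd := hLip.dist_le_mul _ (hmem a ha) _ (hmem b hb)
    rw [← hea, ← heb, Prod.dist_eq, Prod.dist_eq] at hd
    simp only [dist_self, Real.dist_eq] at hd
    rw [max_eq_right (by positivity), max_eq_left (by positivity), ← mul_sub, abs_mul] at hd
    by_contra hne
    have hpos : 0 < |a - b| := abs_pos.2 (sub_ne_zero.2 hne)
    nlinarith

/-- On an overlap of two patches, both solutions are bounded by the larger of the two constants N,
so uniqueness in the patch with the larger constant identifies them. No connectedness of overlaps or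
of U is needed. -/
theorem exists_global_solution {G : ℝ × ℝ × ℝ → ℝ} {U : Set ℝ}
    (hG : ∀ β₀ ∈ U, AnalyticAt ℝ G (0, 0, β₀)) {P : ℝ × ℝ × ℝ → Prop}
    (hP : ∀ β₀ ∈ U, ∀ᶠ p in 𝓝 ((0 : ℝ), (0 : ℝ), β₀), P p) :
    ∃ (Ω : Set (ℝ × ℝ)) (ν : ℝ × ℝ → ℝ), IsOpen Ω ∧ (∀ β₀ ∈ U, ((0 : ℝ), β₀) ∈ Ω) ∧
      AnalyticOnNhd ℝ ν Ω ∧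
      ∀ p ∈ Ω, ν p = G (p.1, p.1 * ν p, p.2) ∧ P (p.1, p.1 * ν p, p.2) := by
  choose W N ν hWo hW0 hνa hνs hνu using fun β₀ : U =>
    exists_local_solution (hG β₀ β₀.2) (hP β₀ β₀.2)
  have hcompat : ∀ (i j : U) (p : ℝ × ℝ), p ∈ W i → p ∈ W j → ν i p = ν j p := by
    have key : ∀ (i j : U) (p : ℝ × ℝ), N i ≤ N j → p ∈ W i → p ∈ W j → ν i p = ν j p :=
      fun i j p hij hi hj => hνu j p hj _ _ ((hνs i p hi).1.trans hij) (hνs j p hj).1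
        (hνs i p hi).2.1 (hνs j p hj).2.1
    intro i j p hi hj
    rcases le_total (N i) (N j) with h | h
    · exact key i j p h hi hj
    · exact (key j i p h hj hi).symm
  classical
  set μ : ℝ × ℝ → ℝ := fun p => if h : ∃ i, p ∈ W i then ν h.choose p else 0 with hμ
  have hμi : ∀ i p, p ∈ W i → μ p = ν i p := fun i p hp => by
    have h : ∃ i, p ∈ W i := ⟨i, hp⟩
    simp only [hμ, h, dite_true]
    exact hcompat _ _ _ h.choose_spec hp
  refine ⟨⋃ i, W i, μ, isOpen_iUnion hWo, fun β₀ hβ => Set.mem_iUnion.2 ⟨⟨β₀, hβ⟩, hW0 _⟩, ?_, ?_⟩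
  · intro p hp
    obtain ⟨i, hi⟩ := Set.mem_iUnion.1 hp
    refine (hνa i p hi).congr ?_
    filter_upwards [(hWo i).mem_nhds hi] with q hq using (hμi i q hq).symm
  · intro p hp
    obtain ⟨i, hi⟩ := Set.mem_iUnion.1 hp
    rw [hμi i p hi]
    exact (hνs i p hi).2

end

section

variable {R : ℝ}

/-! ### Analyticity of the matrix elements -/

/-- The kernel of the real system. -/
def kerSel (R μ β : ℝ) : KerAlg R :=
  Classical.epsilon fun K => ∀ n x ξ, K (n, x, ξ) = (kernelR μ β n ((x : ℝ) - ξ) : ℂ)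

/-- An element of `KerAlg` is determined by its values, so the chosen kernel coincides near (0, β₀)
with the analytic family. The choice provides one function of (μ, β) that serves every base point
β₀. -/
theorem kerSel_analytic {β₀ : ℝ} (h0 : 0 < β₀) (h1 : β₀ < 1 / 2) :
    AnalyticAt ℝ (fun p : ℝ × ℝ => kerSel R p.1 p.2) (0, β₀) ∧
      ∀ᶠ p : ℝ × ℝ in 𝓝 (0, β₀), ∀ n x ξ,
        kerSel R p.1 p.2 (n, x, ξ) = (kernelR p.1 p.2 n ((x : ℝ) - ξ) : ℂ) := by
  obtain ⟨K, hK, hKe⟩ := exists_analytic_kernel (R := R) h0 h1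
  have h2 : ∀ᶠ p : ℝ × ℝ in 𝓝 (0, β₀), ∀ n x ξ,
      kerSel R p.1 p.2 (n, x, ξ) = (kernelR p.1 p.2 n ((x : ℝ) - ξ) : ℂ) := by
    filter_upwards [hKe] with p hp
    exact Classical.epsilon_spec (p := fun K : KerAlg R => ∀ n x ξ,
      K (n, x, ξ) = (kernelR p.1 p.2 n ((x : ℝ) - ξ) : ℂ)) ⟨K p, hp⟩
  refine ⟨hK.congr ?_, h2⟩
  filter_upwards [hKe, h2] with p hp hp'
  ext ⟨n, x, ξ⟩
  rw [hp, hp']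

/-- Application of operators is a bounded bilinear map over ℂ; scalars are restricted because the
parameters are real. -/
theorem analyticAt_clm_apply {V E F : Type*} [NormedAddCommGroup V] [NormedSpace ℝ V]
    [NormedAddCommGroup E] [NormedSpace ℂ E] [NormedAddCommGroup F] [NormedSpace ℂ F]
    [NormedSpace ℝ E] [IsScalarTower ℝ ℂ E] [NormedSpace ℝ F] [IsScalarTower ℝ ℂ F]
    [CompleteSpace F]
    {T : V → E →L[ℂ] F} {v : V → E} {p : V} (hT : AnalyticAt ℝ T p) (hv : AnalyticAt ℝ v p) :
    AnalyticAt ℝ (fun q => T q (v q)) p := by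
  have h1 : ContDiff ℂ ω fun x : (E →L[ℂ] F) × E => x.1 x.2 := isBoundedBilinearMap_apply.contDiff
  have h2 : AnalyticAt ℝ (fun x : (E →L[ℂ] F) × E => x.1 x.2) (T p, v p) :=
    (h1.contDiffAt.analyticAt).restrictScalars
  exact h2.comp (f := fun q => (T q, v q)) (hT.prod hv)

theorem analyticAt_clm_const {V E F : Type*} [NormedAddCommGroup V] [NormedSpace ℝ V]
    [NormedAddCommGroup E] [NormedSpace ℂ E] [NormedAddCommGroup F] [NormedSpace ℂ F]
    [NormedSpace ℝ E] [IsScalarTower ℝ ℂ E] [NormedSpace ℝ F] [IsScalarTower ℝ ℂ F]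
    [CompleteSpace F] (T : E →L[ℂ] F) {v : V → E} {p : V} (hv : AnalyticAt ℝ v p) :
    AnalyticAt ℝ (fun q => T (v q)) p :=
  analyticAt_clm_apply analyticAt_const hv

/-- Evaluation at a point as a ring homomorphism. -/
def segEval (x : Set.Icc (-R) R) : SegFun R →+* ℂ where
  toFun f := f x
  map_one' := rfl
  map_mul' _ _ := rfl
  map_zero' := rfl
  map_add' _ _ := rfl

theorem seg_exp_apply (f : SegFun R) (x : Set.Icc (-R) R) :
    (NormedSpace.exp f) x = Complex.exp (f x) := by
  have h := NormedSpace.map_exp (f := segEval x) (ContinuousMap.evalCLM ℂ x).continuous f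
  rw [Complex.exp_eq_exp_ℂ]
  exact h

/-- The coordinate function. -/
def segId (R : ℝ) : SegFun R := ⟨fun x => ((x : ℝ) : ℂ), by fun_prop⟩

/-- Written with exponentials in the Banach algebra of continuous functions, the cosine depends
analytically on k in the sup norm. -/
theorem cosFun_eq (k : ℝ) : cosFun R k = (1 / 2 : ℂ) •
    (NormedSpace.exp (k • (Complex.I • segId R)) + NormedSpace.exp (k • (-(Complex.I • segId R)))) := by
  ext x
  have h1 := seg_exp_apply (k • (Complex.I • segId R)) x
  have h2 := seg_exp_apply (k • (-(Complex.I • segId R))) x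
  rw [ContinuousMap.smul_apply, ContinuousMap.add_apply, h1, h2]
  have e1 : (k • (Complex.I • segId R)) x = ((k * x : ℝ) : ℂ) * Complex.I := by
    have : (k • (Complex.I • segId R)) x = k • (Complex.I * ((x : ℝ) : ℂ)) := rfl
    rw [this, Complex.real_smul]
    push_cast
    ring
  have e2 : (k • (-(Complex.I • segId R))) x = -((k * x : ℝ) : ℂ) * Complex.I := by
    have : (k • (-(Complex.I • segId R))) x = k • (-(Complex.I * ((x : ℝ) : ℂ))) := rfl
    rw [this, Complex.real_smul]
    push_cast
    ring
  rw [e1, e2, cosFun_apply, Complex.ofReal_cos, Complex.cos, smul_eq_mul]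
  ring

theorem sinFun_eq (k : ℝ) : sinFun R k = (-Complex.I / 2 : ℂ) •
    (NormedSpace.exp (k • (Complex.I • segId R)) - NormedSpace.exp (k • (-(Complex.I • segId R)))) := by
  ext x
  have h1 := seg_exp_apply (k • (Complex.I • segId R)) x
  have h2 := seg_exp_apply (k • (-(Complex.I • segId R))) x
  rw [ContinuousMap.smul_apply, ContinuousMap.sub_apply, h1, h2]
  have e1 : (k • (Complex.I • segId R)) x = ((k * x : ℝ) : ℂ) * Complex.I := by
    have : (k • (Complex.I • segId R)) x = k • (Complex.I * ((x : ℝ) : ℂ)) := rfl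
    rw [this, Complex.real_smul]
    push_cast
    ring
  have e2 : (k • (-(Complex.I • segId R))) x = -((k * x : ℝ) : ℂ) * Complex.I := by
    have : (k • (-(Complex.I • segId R))) x = k • (-(Complex.I * ((x : ℝ) : ℂ))) := rfl
    rw [this, Complex.real_smul]
    push_cast
    ring
  rw [e1, e2, sinFun_apply, Complex.ofReal_sin, Complex.sin, smul_eq_mul]
  ring

theorem analyticAt_cosFun {V : Type*} [NormedAddCommGroup V] [NormedSpace ℝ V] {k : V → ℝ} {p : V}
    (hk : AnalyticAt ℝ k p) : AnalyticAt ℝ (fun q => cosFun R (k q)) p := by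
  simp only [cosFun_eq]
  exact analyticAt_clm_const ((1 / 2 : ℂ) • ContinuousLinearMap.id ℂ (SegFun R))
    ((analyticAt_exp_smul hk _).fun_add (analyticAt_exp_smul hk _))

theorem analyticAt_sinFun {V : Type*} [NormedAddCommGroup V] [NormedSpace ℝ V] {k : V → ℝ} {p : V}
    (hk : AnalyticAt ℝ k p) : AnalyticAt ℝ (fun q => sinFun R (k q)) p := by
  simp only [sinFun_eq]
  exact analyticAt_clm_const ((-Complex.I / 2 : ℂ) • ContinuousLinearMap.id ℂ (SegFun R))
    ((analyticAt_exp_smul hk _).fun_sub (analyticAt_exp_smul hk _))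

theorem analyticAt_param_kZero {β₀ : ℝ} (h1 : β₀ < 1 / 2) :
    AnalyticAt ℝ (fun p : ℝ × ℝ × ℝ => kZero p.2.1 p.2.2) (0, 0, β₀) := by
  have hp : 0 < 1 - 2 * ((0 : ℝ), β₀).2 - ((0 : ℝ), β₀).1 ^ 2 := by
    have : 0 < 1 - 2 * β₀ - (0 : ℝ) ^ 2 := by linarith
    exact this
  exact AnalyticAt.comp (g := fun p : ℝ × ℝ => kZero p.1 p.2) (f := fun p : ℝ × ℝ × ℝ => p.2)
    (analyticAt_kZero hp) analyticAt_snd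

end

/-! ### Analyticity of the resolvent and of its matrix elements; their values without perturbation
-/

section

variable {R : ℝ} {f : ℝ × ℝ → ℝ} {β₀ : ℝ}

theorem analyticAt_gam (p : ℝ × ℝ × ℝ) :
    AnalyticAt ℝ (fun p : ℝ × ℝ × ℝ => gam p.2.1 p.2.2) p := by
  unfold gam
  have : ContDiff ℝ ω fun p : ℝ × ℝ × ℝ => ((1 - p.2.2) ^ 2 - p.2.1 ^ 2) / (4 * Real.pi) := by
    fun_prop
  exact this.contDiffAt.analyticAt

theorem analyticAt_parTau (p : ℝ × ℝ × ℝ) :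
    AnalyticAt ℝ (fun p : ℝ × ℝ × ℝ => parTau p.1 p.2.1 p.2.2) p :=
  (analyticAt_const.mul (analyticAt_gam p)).mul analyticAt_fst

theorem analyticAt_parT (h1 : β₀ < 1 / 2) :
    AnalyticAt ℝ (fun p : ℝ × ℝ × ℝ => parT p.1 p.2.1 p.2.2) (0, 0, β₀) := by
  refine (analyticAt_fst.mul (analyticAt_gam _)).div (analyticAt_param_kZero h1) ?_
  refine (kZero_pos (μ := 0) (β := β₀) ?_).ne'
  linarith

theorem analyticAt_one_sub_smul_mul {𝔸 V : Type*} [NormedRing 𝔸] [NormedAlgebra ℂ 𝔸]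
    [NormedAddCommGroup V] [NormedSpace ℝ V] (M : 𝔸) {τ : V → ℂ} {T : V → 𝔸} {p : V}
    (hτ : AnalyticAt ℝ τ p) (hT : AnalyticAt ℝ T p) :
    AnalyticAt ℝ (fun q => 1 - τ q • (M * T q)) p :=
  analyticAt_const.fun_sub (hτ.fun_smul (analyticAt_const.fun_mul hT))

theorem analyticAt_sysOp (c : ℤ → SegFun R) (h0 : 0 < β₀) (h1 : β₀ < 1 / 2) :
    AnalyticAt ℝ (fun p : ℝ × ℝ × ℝ => sysOp c (kerSel R p.2.1 p.2.2) (parTau p.1 p.2.1 p.2.2))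
      (0, 0, β₀) := by
  have hk : AnalyticAt ℝ (fun p : ℝ × ℝ × ℝ => kerSel R p.2.1 p.2.2) (0, 0, β₀) :=
    AnalyticAt.comp (g := fun p : ℝ × ℝ => kerSel R p.1 p.2) (f := fun p : ℝ × ℝ × ℝ => p.2)
      (kerSel_analytic h0 h1).1 analyticAt_snd
  have hop : AnalyticAt ℝ (fun p : ℝ × ℝ × ℝ => kerOp (kerSel R p.2.1 p.2.2)) (0, 0, β₀) :=
    analyticAt_clm_const (E := KerAlg R) (F := SeqSpace R →L[ℂ] SeqSpace R) kerOp hk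
  have hτ : AnalyticAt ℝ (fun p : ℝ × ℝ × ℝ => ((parTau p.1 p.2.1 p.2.2 : ℝ) : ℂ)) (0, 0, β₀) :=
    (Complex.ofRealCLM.analyticAt _).comp (analyticAt_parTau _)
  exact analyticAt_one_sub_smul_mul (𝔸 := SeqSpace R →L[ℂ] SeqSpace R) (mulOp c) hτ hop

theorem sysOp_zero (c : ℤ → SegFun R) (K : KerAlg R) : sysOp c K 0 = 1 := by
  rw [sysOp, zero_smul, sub_zero]

theorem parTau_zero (μ β : ℝ) : parTau 0 μ β = 0 := by simp [parTau]

/-- At ε = 0 the factor τ = 2γε vanishes and the operator is the identity, near which inversion is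
analytic. No norm estimate for the system is required. -/
theorem analyticAt_sysRes (c : ℤ → SegFun R) (h0 : 0 < β₀) (h1 : β₀ < 1 / 2) :
    AnalyticAt ℝ (fun p : ℝ × ℝ × ℝ => sysRes c (kerSel R p.2.1 p.2.2) (parTau p.1 p.2.1 p.2.2))
      (0, 0, β₀) := by
  have h := analyticAt_ringInverse_one_add (𝔸 := SeqSpace R →L[ℂ] SeqSpace R)
    ((analyticAt_sysOp c h0 h1).fun_sub (analyticAt_const (v := 1)))
    (by simp only [parTau_zero, Complex.ofReal_zero, sysOp_zero, sub_self])
  simp only [add_sub_cancel] at h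
  exact h

theorem eventually_isUnit_sysOp (c : ℤ → SegFun R) (h0 : 0 < β₀) (h1 : β₀ < 1 / 2) :
    ∀ᶠ p : ℝ × ℝ × ℝ in 𝓝 (0, 0, β₀),
      IsUnit (sysOp c (kerSel R p.2.1 p.2.2) (parTau p.1 p.2.1 p.2.2)) := by
  have h := eventually_isUnit_one_add (𝔸 := SeqSpace R →L[ℂ] SeqSpace R)
    ((analyticAt_sysOp c h0 h1).fun_sub (analyticAt_const (v := 1))).continuousAt
    (by simp only [parTau_zero, Complex.ofReal_zero, sysOp_zero, sub_self])
  simp only [add_sub_cancel] at h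
  exact h

theorem analyticAt_resZ (c : ℤ → SegFun R) (h0 : 0 < β₀) (h1 : β₀ < 1 / 2) (n n' : ℤ)
    {h h' : ℝ × ℝ × ℝ → SegFun R} (hh : AnalyticAt ℝ h (0, 0, β₀))
    (hh' : AnalyticAt ℝ h' (0, 0, β₀)) :
    AnalyticAt ℝ (fun p : ℝ × ℝ × ℝ => (resZ c (kerSel R p.2.1 p.2.2) (parTau p.1 p.2.1 p.2.2)
      n (h p) n' (h' p)).re) (0, 0, β₀) := by
  refine AnalyticAt.fun_comp (g := Complex.re) (Complex.reCLM.analyticAt _) ?_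
  unfold resZ
  refine analyticAt_clm_apply (analyticAt_clm_const (E := SegFun R) (F := SeqSpace R →L[ℂ] ℂ) (pairL n) hh)
    (analyticAt_clm_apply (analyticAt_sysRes c h0 h1) (analyticAt_clm_const (mulOp c) ?_))
  exact analyticAt_clm_const (lp.singleContinuousLinearMap ℂ (fun _ : ℤ => SegFun R) 2 n') hh'

theorem analyticAt_elF (c : ℤ → SegFun R) (h0 : 0 < β₀) (h1 : β₀ < 1 / 2) :
    AnalyticAt ℝ (fun p : ℝ × ℝ × ℝ => elF c (kerSel R p.2.1 p.2.2) p.1 p.2.1 p.2.2) (0, 0, β₀) :=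
  analyticAt_resZ c h0 h1 _ _ analyticAt_const analyticAt_const

theorem analyticAt_elq (c : ℤ → SegFun R) (h0 : 0 < β₀) (h1 : β₀ < 1 / 2) :
    AnalyticAt ℝ (fun p : ℝ × ℝ × ℝ => elq c (kerSel R p.2.1 p.2.2) p.1 p.2.1 p.2.2) (0, 0, β₀) :=
  analyticAt_resZ c h0 h1 _ _ analyticAt_const (analyticAt_cosFun (analyticAt_param_kZero h1))

theorem analyticAt_elC (c : ℤ → SegFun R) (h0 : 0 < β₀) (h1 : β₀ < 1 / 2) :
    AnalyticAt ℝ (fun p : ℝ × ℝ × ℝ => elC c (kerSel R p.2.1 p.2.2) p.1 p.2.1 p.2.2) (0, 0, β₀) :=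
  analyticAt_resZ c h0 h1 _ _ (analyticAt_cosFun (analyticAt_param_kZero h1))
    (analyticAt_cosFun (analyticAt_param_kZero h1))

theorem analyticAt_elD (c : ℤ → SegFun R) (h0 : 0 < β₀) (h1 : β₀ < 1 / 2) :
    AnalyticAt ℝ (fun p : ℝ × ℝ × ℝ => elD c (kerSel R p.2.1 p.2.2) p.1 p.2.1 p.2.2) (0, 0, β₀) :=
  analyticAt_resZ c h0 h1 _ _ (analyticAt_sinFun (analyticAt_param_kZero h1))
    (analyticAt_sinFun (analyticAt_param_kZero h1))

/-! ### Values at `ε = 0` -/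

/-- Evenness in x kills the sine part of the Fourier integral, and f_j vanishes outside [-R, R]. -/
theorem fTilde_eq (hf : Perturbation f R) (hR : 0 < R) (j : ℤ) (ξ : ℝ) :
    fTilde f j ξ = ∫ x, coefFun hf.cont R j x * cosFun R ξ x ∂(segMeasure R) := by
  have h1 : fTilde f j ξ = ∫ x in Set.Icc (-R) R, Complex.exp (-(Complex.I * ξ * x)) * fCoeff f j x := by
    refine (setIntegral_eq_integral_of_forall_compl_eq_zero fun x hx => ?_).symm
    rw [hf.fCoeff_zero hR, mul_zero]
    by_contra hc
    exact hx (abs_le.1 (not_le.1 hc).le)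
  rw [h1, ← integral_seg_eq (fun x : ℝ => Complex.exp (-(Complex.I * ξ * x)) * fCoeff f j x)]
  have e : ∀ x : Set.Icc (-R) R, Complex.exp (-(Complex.I * ξ * ((x : ℝ) : ℂ))) * fCoeff f j x =
      coefFun hf.cont R j x * cosFun R ξ x - Complex.I * (coefFun hf.cont R j x * sinFun R ξ x) :=
    fun x => by
    have h3 : -(Complex.I * ξ * ((x : ℝ) : ℂ)) = -((ξ * x : ℝ) : ℂ) * Complex.I := by
      push_cast
      ring
    rw [h3, Complex.exp_mul_I, cosFun_apply, sinFun_apply, coefFun_apply, Complex.cos_neg,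
      Complex.sin_neg]
    push_cast
    ring
  have i1 : Integrable (fun x => coefFun hf.cont R j x * cosFun R ξ x) (segMeasure R) :=
    integrable_segFun (coefFun hf.cont R j * cosFun R ξ)
  have i2 : Integrable (fun x => coefFun hf.cont R j x * sinFun R ξ x) (segMeasure R) :=
    integrable_segFun (coefFun hf.cont R j * sinFun R ξ)
  have h4 : ∫ x, coefFun hf.cont R j x * sinFun R ξ x ∂(segMeasure R) = 0 := by
    have h5 := integral_seg_neg (fun x => coefFun hf.cont R j x * sinFun R ξ x)
    have h6 : ∀ x : Set.Icc (-R) R, coefFun hf.cont R j (segNeg x) * sinFun R ξ (segNeg x) =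
        -(coefFun hf.cont R j x * sinFun R ξ x) := fun x => by
      rw [(hf.coefData hR).even, sinFun_apply, sinFun_apply, coe_segNeg]
      simp
    rw [integral_congr_ae (Filter.Eventually.of_forall h6), integral_neg] at h5
    linear_combination (-1 / 2 : ℂ) * h5
  rw [integral_congr_ae (Filter.Eventually.of_forall e), integral_sub i1 (i2.const_mul _),
    integral_const_mul, h4, mul_zero, sub_zero]

theorem fTilde_real (hf : Perturbation f R) (hR : 0 < R) (j : ℤ) (ξ : ℝ) :
    fTilde f j ξ = ((fTilde f j ξ).re : ℂ) := by
  refine (Complex.conj_eq_iff_re.1 ?_).symm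
  rw [fTilde_eq hf hR]
  refine (integral_conj).symm.trans ?_
  congr 1
  ext x
  rw [map_mul]
  congr 1
  · exact congrArg (fun φ : SegFun R => φ x) ((hf.coefData hR).real j)
  · exact Complex.conj_ofReal _

theorem continuous_fTilde (hf : Perturbation f R) (hR : 0 < R) (j : ℤ) :
    Continuous fun ξ => fTilde f j ξ := by
  have h1 : (fun ξ => fTilde f j ξ) =
      fun ξ => pairL 0 (cosFun R ξ) (lp.single 2 0 (coefFun hf.cont R j)) := by
    ext ξ
    rw [fTilde_eq hf hR, pairL_apply, seqSingle_self]
  rw [h1]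
  refine continuous_iff_continuousAt.2 fun ξ => ?_
  exact (analyticAt_clm_apply (analyticAt_clm_const (E := SegFun R) (F := SeqSpace R →L[ℂ] ℂ) (pairL 0)
    (analyticAt_cosFun analyticAt_id))
    analyticAt_const).continuousAt

theorem isOpen_goodBeta (hf : Perturbation f R) (hR : 0 < R) : IsOpen (goodBeta f) := by
  have hk : Continuous kappa := by
    unfold kappa
    fun_prop
  have h1 : IsOpen {β : ℝ | fTilde f 1 (kappa β) ≠ 0} :=
    isOpen_ne.preimage ((continuous_fTilde hf hR 1).comp hk)
  have h2 : IsOpen {β : ℝ | fTilde f 0 (2 * kappa β) ≠ 0} :=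
    isOpen_ne.preimage ((continuous_fTilde hf hR 0).comp (continuous_const.mul hk))
  exact isOpen_Ioi.inter (isOpen_Iio.inter (h1.inter h2))

theorem resZ_zero (c : ℤ → SegFun R) (K : KerAlg R) (n : ℤ) (h : SegFun R) (n' : ℤ)
    (h' : SegFun R) : resZ c K 0 n h n' h' = pairL n h (src c n' h') := by
  rw [resZ, sysRes, sysOp_zero, Ring.inverse_one]
  rfl

theorem resZ_zero_eq (hf : Perturbation f R) (hR : 0 < R) (K : KerAlg R) (n : ℤ) (h : SegFun R)
    (n' : ℤ) (h' : SegFun R) : resZ (coefFun hf.cont R) K 0 n h n' h' =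
      ∫ x, coefFun hf.cont R (n - n') x * (h * h') x ∂(segMeasure R) := by
  rw [resZ_zero, pairL_apply]
  congr 1
  ext x
  rw [src_apply (hf.coefData hR).summable, ContinuousMap.mul_apply]
  ring

theorem kZero_zero (β : ℝ) : kZero 0 β = kappa β := by simp [kZero, kappa]

theorem cosFun_zero : cosFun R 0 = 1 := by
  ext x
  simp [cosFun_apply]

theorem elF_zero (hf : Perturbation f R) (hR : 0 < R) (K : KerAlg R) (μ β : ℝ) :
    elF (coefFun hf.cont R) K 0 μ β = (fTilde f 0 0).re := by
  rw [elF, parTau_zero, Complex.ofReal_zero, resZ_zero_eq hf hR, fTilde_eq hf hR, cosFun_zero,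
    mul_one, sub_self]

theorem elq_zero (hf : Perturbation f R) (hR : 0 < R) (K : KerAlg R) (β : ℝ) :
    elq (coefFun hf.cont R) K 0 0 β = (fTilde f 1 (kappa β)).re := by
  have h := (hf.coefData hR).symm 1
  rw [elq, parTau_zero, Complex.ofReal_zero, resZ_zero_eq hf hR, fTilde_eq hf hR, one_mul,
    kZero_zero, sub_zero, h]

/-- cos² κx - sin² κx = cos 2κx, which is how the doubled frequency 2κ arises. -/
theorem elC_sub_elD_zero (hf : Perturbation f R) (hR : 0 < R) (K : KerAlg R) (β : ℝ) :
    elC (coefFun hf.cont R) K 0 0 β - elD (coefFun hf.cont R) K 0 0 β =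
      (fTilde f 0 (2 * kappa β)).re := by
  rw [elC, elD, parTau_zero, Complex.ofReal_zero, resZ_zero_eq hf hR, resZ_zero_eq hf hR,
    fTilde_eq hf hR, kZero_zero, sub_zero, ← Complex.sub_re, ← integral_sub]
  · congr 2
    ext x
    simp only [ContinuousMap.mul_apply, cosFun_apply, sinFun_apply]
    rw [← mul_sub, mul_assoc 2 (kappa β) (x : ℝ), Real.cos_two_mul']
    push_cast
    ring
  · exact integrable_segFun (coefFun hf.cont R 0 * (cosFun R (kappa β) * cosFun R (kappa β)))
  · exact integrable_segFun (coefFun hf.cont R 0 * (sinFun R (kappa β) * sinFun R (kappa β)))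

theorem fTilde_zero_pos (hvol : 0 < ∫ x : ℝ, ∫ y in (0 : ℝ)..(2 * Real.pi), f (x, y)) :
    0 < (fTilde f 0 0).re := by
  have h1 : fTilde f 0 0 = ((∫ x : ℝ, ∫ y in (0 : ℝ)..(2 * Real.pi), f (x, y) : ℝ) : ℂ) := by
    unfold fTilde fCoeff
    rw [← integral_complex_ofReal]
    congr 1
    ext x
    rw [← intervalIntegral.integral_ofReal]
    simp
  rw [h1, Complex.ofReal_re]
  exact hvol

end

section

variable {R : ℝ} {f : ℝ × ℝ → ℝ} {β₀ : ℝ}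

/-! ### The functions `ν_a` and `ν_b` -/

/-- The right-hand side of the equation for `ν_a`. -/
def rhsA (c : ℤ → SegFun R) (p : ℝ × ℝ × ℝ) : ℝ :=
  gam p.2.1 p.2.2 * elF c (kerSel R p.2.1 p.2.2) p.1 p.2.1 p.2.2 -
    gam p.2.1 p.2.2 * elq c (kerSel R p.2.1 p.2.2) p.1 p.2.1 p.2.2 ^ 2 /
      (elC c (kerSel R p.2.1 p.2.2) p.1 p.2.1 p.2.2 - elD c (kerSel R p.2.1 p.2.2) p.1 p.2.1 p.2.2)

/-- The right-hand side of the equation for `ν_b`. -/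
def rhsB (c : ℤ → SegFun R) (p : ℝ × ℝ × ℝ) : ℝ :=
  gam p.2.1 p.2.2 * elF c (kerSel R p.2.1 p.2.2) p.1 p.2.1 p.2.2 -
    parT p.1 p.2.1 p.2.2 ^ 2 * gam p.2.1 p.2.2 *
      elq c (kerSel R p.2.1 p.2.2) p.1 p.2.1 p.2.2 ^ 2 *
      elD c (kerSel R p.2.1 p.2.2) p.1 p.2.1 p.2.2 /
      (1 + parT p.1 p.2.1 p.2.2 ^ 2 * elC c (kerSel R p.2.1 p.2.2) p.1 p.2.1 p.2.2 *
        elD c (kerSel R p.2.1 p.2.2) p.1 p.2.1 p.2.2)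

theorem parT_zero (μ β : ℝ) : parT 0 μ β = 0 := by simp [parT]

theorem analyticAt_rhsA (c : ℤ → SegFun R) (h0 : 0 < β₀) (h1 : β₀ < 1 / 2)
    (hne : elC c (kerSel R 0 β₀) 0 0 β₀ - elD c (kerSel R 0 β₀) 0 0 β₀ ≠ 0) :
    AnalyticAt ℝ (rhsA c) (0, 0, β₀) :=
  ((analyticAt_gam _).mul (analyticAt_elF c h0 h1)).sub
    (((analyticAt_gam _).mul ((analyticAt_elq c h0 h1).pow 2)).div
      ((analyticAt_elC c h0 h1).sub (analyticAt_elD c h0 h1)) hne)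

theorem analyticAt_rhsB_denom (c : ℤ → SegFun R) (h0 : 0 < β₀) (h1 : β₀ < 1 / 2) :
    AnalyticAt ℝ (fun p : ℝ × ℝ × ℝ => 1 + parT p.1 p.2.1 p.2.2 ^ 2 *
      elC c (kerSel R p.2.1 p.2.2) p.1 p.2.1 p.2.2 *
      elD c (kerSel R p.2.1 p.2.2) p.1 p.2.1 p.2.2) (0, 0, β₀) :=
  analyticAt_const.add ((((analyticAt_parT h1).pow 2).mul (analyticAt_elC c h0 h1)).mul
    (analyticAt_elD c h0 h1))

theorem analyticAt_rhsB (c : ℤ → SegFun R) (h0 : 0 < β₀) (h1 : β₀ < 1 / 2) :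
    AnalyticAt ℝ (rhsB c) (0, 0, β₀) := by
  refine ((analyticAt_gam _).mul (analyticAt_elF c h0 h1)).sub
    ((((((analyticAt_parT h1).pow 2).mul (analyticAt_gam _)).mul
      ((analyticAt_elq c h0 h1).pow 2)).mul (analyticAt_elD c h0 h1)).div
      (analyticAt_rhsB_denom c h0 h1) ?_)
  simp [parT_zero]

/-- Parameters for which the system is regular and all the denominators are nonzero. -/
structure GoodParam (hf : Continuous f) (R ε μ β : ℝ) : Prop where
  beta : β ∈ goodBeta f
  sys : SysData f ε μ β (coefFun hf R) (kerSel R μ β)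
  gam_pos : 0 < gam μ β
  q_ne : elq (coefFun hf R) (kerSel R μ β) ε μ β ≠ 0
  denA : elC (coefFun hf R) (kerSel R μ β) ε μ β - elD (coefFun hf R) (kerSel R μ β) ε μ β ≠ 0
  denB : 1 + parT ε μ β ^ 2 * elC (coefFun hf R) (kerSel R μ β) ε μ β *
    elD (coefFun hf R) (kerSel R μ β) ε μ β ≠ 0

theorem elCD_ne_zero (hf : Perturbation f R) (hR : 0 < R) (hβ : β₀ ∈ goodBeta f) :
    elC (coefFun hf.cont R) (kerSel R 0 β₀) 0 0 β₀ -
      elD (coefFun hf.cont R) (kerSel R 0 β₀) 0 0 β₀ ≠ 0 := by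
  rw [elC_sub_elD_zero hf hR]
  intro h
  refine hβ.2.2.2 ?_
  rw [fTilde_real hf hR, h, Complex.ofReal_zero]

theorem elq_ne_zero (hf : Perturbation f R) (hR : 0 < R) (hβ : β₀ ∈ goodBeta f) :
    elq (coefFun hf.cont R) (kerSel R 0 β₀) 0 0 β₀ ≠ 0 := by
  rw [elq_zero hf hR]
  intro h
  refine hβ.2.2.1 ?_
  rw [fTilde_real hf hR, h, Complex.ofReal_zero]

theorem gam_zero_pos (h1 : β₀ < 1 / 2) : 0 < gam 0 β₀ := by
  have : 0 < 1 - β₀ := by linarith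
  unfold gam
  have hpi := Real.pi_pos
  simp only [ne_eq, OfNat.ofNat_ne_zero, not_false_eq_true, zero_pow, sub_zero]
  positivity

/-- Every requirement is an open condition, by continuity of the analytic matrix elements, and holds
at (0, 0, β₀) by the definition of `goodBeta`. -/
theorem eventually_goodParam (hf : Perturbation f R) (hR : 0 < R) (hβ : β₀ ∈ goodBeta f) :
    ∀ᶠ p : ℝ × ℝ × ℝ in 𝓝 (0, 0, β₀), GoodParam hf.cont R p.1 p.2.1 p.2.2 := by
  have h0 := hβ.1
  have h1 := hβ.2.1
  set c := coefFun hf.cont R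
  have e1 : ∀ᶠ p : ℝ × ℝ × ℝ in 𝓝 (0, 0, β₀), p.2.2 ∈ goodBeta f := by
    have hc : Continuous fun p : ℝ × ℝ × ℝ => p.2.2 := by fun_prop
    exact (hc.tendsto (0, 0, β₀)).eventually ((isOpen_goodBeta hf hR).mem_nhds hβ)
  have e2 : ∀ᶠ p : ℝ × ℝ × ℝ in 𝓝 (0, 0, β₀), ∀ n x ξ,
      kerSel R p.2.1 p.2.2 (n, x, ξ) = (kernelR p.2.1 p.2.2 n ((x : ℝ) - ξ) : ℂ) := by
    have hc : Continuous fun p : ℝ × ℝ × ℝ => p.2 := by fun_prop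
    exact (hc.tendsto (0, 0, β₀)).eventually (kerSel_analytic h0 h1).2
  have e3 : ∀ᶠ p : ℝ × ℝ × ℝ in 𝓝 (0, 0, β₀), 0 < 1 - 2 * p.2.2 - p.2.1 ^ 2 := by
    have hc : Continuous fun p : ℝ × ℝ × ℝ => 1 - 2 * p.2.2 - p.2.1 ^ 2 := by fun_prop
    refine (hc.tendsto (0, 0, β₀)).eventually (lt_mem_nhds ?_)
    simp only
    linarith
  have e4 : ∀ᶠ p : ℝ × ℝ × ℝ in 𝓝 (0, 0, β₀), 0 < gam p.2.1 p.2.2 :=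
    (analyticAt_gam (0, 0, β₀)).continuousAt.eventually (lt_mem_nhds (gam_zero_pos h1))
  have e5 := (analyticAt_elq c h0 h1).continuousAt.eventually_ne (elq_ne_zero hf hR hβ)
  have e6 := ((analyticAt_elC c h0 h1).sub (analyticAt_elD c h0 h1)).continuousAt.eventually_ne
    (elCD_ne_zero hf hR hβ)
  have e7 : ∀ᶠ p : ℝ × ℝ × ℝ in 𝓝 (0, 0, β₀), 1 + parT p.1 p.2.1 p.2.2 ^ 2 *
      elC c (kerSel R p.2.1 p.2.2) p.1 p.2.1 p.2.2 *
      elD c (kerSel R p.2.1 p.2.2) p.1 p.2.1 p.2.2 ≠ 0 :=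
    (analyticAt_rhsB_denom c h0 h1).continuousAt.eventually_ne (by simp [parT_zero])
  filter_upwards [e1, e2, e3, eventually_isUnit_sysOp c h0 h1, e4, e5, e6, e7] with
    p p1 p2 p3 p3' p4 p5 p6 p7
  exact ⟨p1, ⟨hf.coefData hR, fun _ _ => rfl, p2, p3, p3'⟩, p4, p5, p6, p7⟩

theorem redA_eq_zero {hf : Continuous f} {ε ν β : ℝ} (hp : GoodParam hf R ε (ε * ν) β)
    (h : ν = rhsA (coefFun hf R) (ε, ε * ν, β)) :
    redA (coefFun hf R) (kerSel R (ε * ν) β) ε ν β = 0 := by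
  have hd := hp.denA
  simp only [rhsA] at h
  rw [redA, elLam]
  set F := elF (coefFun hf R) (kerSel R (ε * ν) β) ε (ε * ν) β
  set q := elq (coefFun hf R) (kerSel R (ε * ν) β) ε (ε * ν) β
  set CD := elC (coefFun hf R) (kerSel R (ε * ν) β) ε (ε * ν) β -
    elD (coefFun hf R) (kerSel R (ε * ν) β) ε (ε * ν) β
  set g := gam (ε * ν) β
  have h2 : ν - g * F = -(g * q ^ 2 / CD) := by linarith
  rw [h2]
  field_simp
  ring

theorem redB_eq_zero {hf : Continuous f} {ε ν β : ℝ} (hp : GoodParam hf R ε (ε * ν) β)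
    (h : ν = rhsB (coefFun hf R) (ε, ε * ν, β)) :
    redB (coefFun hf R) (kerSel R (ε * ν) β) ε ν β = 0 := by
  have hd := hp.denB
  simp only [rhsB] at h
  rw [redB, elLam]
  set F := elF (coefFun hf R) (kerSel R (ε * ν) β) ε (ε * ν) β
  set q := elq (coefFun hf R) (kerSel R (ε * ν) β) ε (ε * ν) β
  set D := elD (coefFun hf R) (kerSel R (ε * ν) β) ε (ε * ν) β
  set E := 1 + parT ε (ε * ν) β ^ 2 * elC (coefFun hf R) (kerSel R (ε * ν) β) ε (ε * ν) β * D
  set g := gam (ε * ν) β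
  set t := parT ε (ε * ν) β
  have h2 : ν - g * F = -(t ^ 2 * g * q ^ 2 * D / E) := by linarith
  rw [h2]
  field_simp
  ring

theorem gam_zero (β : ℝ) : gam 0 β = (1 - β) ^ 2 / (4 * Real.pi) := by simp [gam]

/-- The equations redA = 0 and redB = 0 are solved for ν by `rhsA` and `rhsB`, to which the global
solution theorem applies. Both are put on a common domain. -/
theorem exists_resonances (hf : Perturbation f R) (hR : 0 < R) :
    ∃ (Ω : Set (ℝ × ℝ)) (νa νb : ℝ × ℝ → ℝ), IsOpen Ω ∧
      (∀ β ∈ goodBeta f, ((0 : ℝ), β) ∈ Ω) ∧ AnalyticOnNhd ℝ νa Ω ∧ AnalyticOnNhd ℝ νb Ω ∧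
      (∀ ε β : ℝ, (ε, β) ∈ Ω →
        GoodParam hf.cont R ε (ε * νa (ε, β)) β ∧ GoodParam hf.cont R ε (ε * νb (ε, β)) β ∧
        redA (coefFun hf.cont R) (kerSel R (ε * νa (ε, β)) β) ε (νa (ε, β)) β = 0 ∧
        redB (coefFun hf.cont R) (kerSel R (ε * νb (ε, β)) β) ε (νb (ε, β)) β = 0 ∧
        νa (ε, β) ≠ νb (ε, β)) ∧
      (∀ β ∈ goodBeta f, νa (0, β) = (1 - β) ^ 2 / (4 * Real.pi) * ((fTilde f 0 0).re -
          (fTilde f 1 (kappa β)).re ^ 2 / (fTilde f 0 (2 * kappa β)).re) ∧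
        νb (0, β) = (1 - β) ^ 2 / (4 * Real.pi) * (fTilde f 0 0).re) := by
  set c := coefFun hf.cont R
  obtain ⟨Ωa, νa, ha1, ha2, ha3, ha4⟩ := exists_global_solution (U := goodBeta f) (G := rhsA c)
    (fun β hβ => analyticAt_rhsA c hβ.1 hβ.2.1 (elCD_ne_zero hf hR hβ))
    (fun β hβ => eventually_goodParam hf hR hβ)
  obtain ⟨Ωb, νb, hb1, hb2, hb3, hb4⟩ := exists_global_solution (U := goodBeta f) (G := rhsB c)
    (fun β hβ => analyticAt_rhsB c hβ.1 hβ.2.1)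
    (fun β hβ => eventually_goodParam hf hR hβ)
  have va : ∀ β ∈ goodBeta f, νa (0, β) = gam 0 β * ((fTilde f 0 0).re -
      (fTilde f 1 (kappa β)).re ^ 2 / (fTilde f 0 (2 * kappa β)).re) := fun β hβ => by
    have h := (ha4 _ (ha2 β hβ)).1
    simp only [zero_mul, rhsA] at h
    rw [h, elF_zero hf hR, elq_zero hf hR, elC_sub_elD_zero hf hR]
    ring
  have vb : ∀ β ∈ goodBeta f, νb (0, β) = gam 0 β * (fTilde f 0 0).re := fun β hβ => by
    have h := (hb4 _ (hb2 β hβ)).1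
    simp only [zero_mul, rhsB, parT_zero] at h
    rw [h, elF_zero hf hR]
    ring
  -- The closed set where the two functions agree is removed. It misses ε = 0, where they differ by
  -- γ f̃₁(κ)²/f̃₀(2κ) ≠ 0.
  refine ⟨(Ωa ∩ Ωb) ∩ (fun p => νa p - νb p) ⁻¹' {0}ᶜ, νa, νb, ?_, ?_, ?_, ?_, ?_, ?_⟩
  · refine ContinuousOn.isOpen_inter_preimage ?_ (ha1.inter hb1) isOpen_compl_singleton
    exact (ha3.continuousOn.mono Set.inter_subset_left).sub
      (hb3.continuousOn.mono Set.inter_subset_right)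
  · intro β hβ
    refine ⟨⟨ha2 β hβ, hb2 β hβ⟩, ?_⟩
    rw [Set.mem_preimage, Set.mem_compl_singleton_iff, va β hβ, vb β hβ]
    have h1 := (gam_zero_pos hβ.2.1).ne'
    have h2 := elq_ne_zero hf hR hβ
    have h3 := elCD_ne_zero hf hR hβ
    rw [elq_zero hf hR] at h2
    rw [elC_sub_elD_zero hf hR] at h3
    have h4 : gam 0 β * ((fTilde f 0 0).re - (fTilde f 1 (kappa β)).re ^ 2 /
        (fTilde f 0 (2 * kappa β)).re) - gam 0 β * (fTilde f 0 0).re =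
        -(gam 0 β * ((fTilde f 1 (kappa β)).re ^ 2 / (fTilde f 0 (2 * kappa β)).re)) := by ring
    rw [h4]
    exact neg_ne_zero.2 (mul_ne_zero h1 (div_ne_zero (pow_ne_zero 2 h2) h3))
  · exact ha3.mono fun p hp => hp.1.1
  · exact hb3.mono fun p hp => hp.1.2
  · intro ε β hp
    have h1 := ha4 _ hp.1.1
    have h2 := hb4 _ hp.1.2
    refine ⟨h1.2, h2.2, redA_eq_zero h1.2 h1.1, redB_eq_zero h2.2 h2.1, ?_⟩
    exact sub_ne_zero.1 hp.2
  · intro β hβ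
    rw [va β hβ, vb β hβ, gam_zero]
    exact ⟨rfl, rfl⟩

theorem isBigO_sub_of_analyticAt {ν : ℝ × ℝ → ℝ} {β : ℝ} (h : AnalyticAt ℝ ν (0, β)) {z : ℂ}
    (hz : (ν (0, β) : ℂ) = z) :
    (fun ε : ℝ => (ν (ε, β) : ℂ) - z) =O[𝓝 (0 : ℝ)] (fun ε : ℝ => ε) := by
  have h1 : DifferentiableAt ℝ (fun ε : ℝ => ν (ε, β)) 0 :=
    DifferentiableAt.comp (g := ν) (f := fun ε : ℝ => (ε, β)) 0 h.differentiableAt (by fun_prop)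
  have h2 := h1.isBigO_sub
  simp only [sub_zero] at h2
  refine Asymptotics.IsBigO.trans (Asymptotics.isBigO_of_le _ fun ε => ?_) h2
  rw [← hz, ← Complex.ofReal_sub, Complex.norm_real]

end

section

variable {β : ℝ}

/-! ### The strip -/

theorem stripMeasure_eq :
    stripMeasure = (volume : Measure ℝ).prod (volume.restrict (Set.Ioo (0 : ℝ) (2 * Real.pi))) := by
  rw [stripMeasure, Measure.volume_eq_prod, ← Measure.prod_restrict, Measure.restrict_univ]

theorem ae_strip_mem : ∀ᵐ p ∂stripMeasure, p.2 ∈ Set.Ioo (0 : ℝ) (2 * Real.pi) := by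
  have h := ae_restrict_mem (μ := (volume : Measure (ℝ × ℝ)))
    (MeasurableSet.univ.prod (measurableSet_Ioo (a := (0 : ℝ)) (b := 2 * Real.pi)))
  filter_upwards [h] with p hp
  exact hp.2

theorem stripMeasure_prod_univ (S : Set ℝ) :
    stripMeasure (S ×ˢ Set.univ) = volume S * ENNReal.ofReal (2 * Real.pi) := by
  rw [stripMeasure_eq, Measure.prod_prod]
  simp

/-- The measure sees only 0 < y < 2π, so a continuous function vanishing for large |x| is bounded on
a set of finite measure, although its support need not be compact in the plane. -/
theorem memLp_of_vanish {g : ℝ × ℝ → ℂ} (hg : Continuous g)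
    (hv : ∃ M : ℝ, ∀ x y : ℝ, M < |x| → g (x, y) = 0) (q : ENNReal) : MemLp g q stripMeasure := by
  obtain ⟨M, hM⟩ := hv
  obtain ⟨C, hC⟩ := (isCompact_Icc.prod isCompact_Icc :
    IsCompact (Set.Icc (-M) M ×ˢ Set.Icc (0 : ℝ) (2 * Real.pi))).exists_bound_of_continuousOn
      hg.continuousOn
  have hS : MeasurableSet (Set.Icc (-M) M ×ˢ (Set.univ : Set ℝ)) :=
    measurableSet_Icc.prod MeasurableSet.univ
  have h1 : g = (Set.Icc (-M) M ×ˢ (Set.univ : Set ℝ)).indicator g := by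
    ext p
    by_cases hp : p ∈ Set.Icc (-M) M ×ˢ (Set.univ : Set ℝ)
    · rw [Set.indicator_of_mem hp]
    · rw [Set.indicator_of_notMem hp]
      refine hM p.1 p.2 ?_
      by_contra h
      exact hp ⟨abs_le.1 (not_lt.1 h), trivial⟩
  rw [h1, memLp_indicator_iff_restrict hS]
  have : IsFiniteMeasure (stripMeasure.restrict (Set.Icc (-M) M ×ˢ (Set.univ : Set ℝ))) := by
    refine ⟨?_⟩
    rw [Measure.restrict_apply_univ, stripMeasure_prod_univ, Real.volume_Icc]
    exact ENNReal.mul_lt_top ENNReal.ofReal_lt_top ENNReal.ofReal_lt_top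
  refine MemLp.of_bound hg.aestronglyMeasurable C ?_
  filter_upwards [ae_restrict_mem hS, ae_restrict_of_ae ae_strip_mem] with p hp hp2
  exact hC p ⟨hp.1, Set.Ioo_subset_Icc_self hp2⟩

theorem integrable_of_vanish {g : ℝ × ℝ → ℂ} (hg : Continuous g)
    (hv : ∃ M : ℝ, ∀ x y : ℝ, M < |x| → g (x, y) = 0) : Integrable g stripMeasure :=
  memLp_one_iff_integrable.1 (memLp_of_vanish hg hv 1)

theorem integrable_mul_conj {g h : ℝ × ℝ → ℂ} (hg : MemLp g 2 stripMeasure)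
    (hh : MemLp h 2 stripMeasure) :
    Integrable (fun p => g p * (starRingEnd ℂ) (h p)) stripMeasure :=
  hg.integrable_mul hh.star

theorem integrable_mul_conj_of_vanish {g h : ℝ × ℝ → ℂ} (hg : Continuous g) (hh : Continuous h)
    (hv : ∃ M : ℝ, ∀ x y : ℝ, M < |x| → h (x, y) = 0) :
    Integrable (fun p => g p * (starRingEnd ℂ) (h p)) stripMeasure := by
  obtain ⟨M, hM⟩ := hv
  refine integrable_of_vanish (hg.mul (Complex.continuous_conj.comp hh)) ⟨M, fun x y hxy => ?_⟩
  rw [hM x y hxy, map_zero, mul_zero]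

/-! ### Test functions -/

theorem hasDerivAt_dX {Φ : ℝ × ℝ → ℂ} (h : ContDiff ℝ ∞ Φ) (x y : ℝ) :
    HasDerivAt (fun s : ℝ => Φ (s, y)) (dX Φ (x, y)) x := by
  have h1 : Differentiable ℝ fun s : ℝ => Φ (s, y) :=
    (h.comp (contDiff_id.prodMk contDiff_const)).differentiable (by simp)
  exact (h1 x).hasDerivAt

theorem hasDerivAt_dY {Φ : ℝ × ℝ → ℂ} (h : ContDiff ℝ ∞ Φ) (x y : ℝ) :
    HasDerivAt (fun s : ℝ => Φ (x, s)) (dY Φ (x, y)) y := by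
  have h1 : Differentiable ℝ fun s : ℝ => Φ (x, s) :=
    (h.comp (contDiff_const.prodMk contDiff_id)).differentiable (by simp)
  exact (h1 y).hasDerivAt

theorem dX_eq_fderiv {Φ : ℝ × ℝ → ℂ} (h : ContDiff ℝ ∞ Φ) :
    dX Φ = fun p => fderiv ℝ Φ p (1, 0) := by
  ext ⟨x, y⟩
  have h1 := (h.differentiable (by simp) (x, y)).hasFDerivAt
  have h2 : HasDerivAt (fun s : ℝ => (s, y)) ((1 : ℝ), (0 : ℝ)) x :=
    (hasDerivAt_id x).prodMk (hasDerivAt_const x y)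
  exact (hasDerivAt_dX h x y).unique (h1.comp_hasDerivAt x h2)

theorem dY_eq_fderiv {Φ : ℝ × ℝ → ℂ} (h : ContDiff ℝ ∞ Φ) :
    dY Φ = fun p => fderiv ℝ Φ p (0, 1) := by
  ext ⟨x, y⟩
  have h1 := (h.differentiable (by simp) (x, y)).hasFDerivAt
  have h2 : HasDerivAt (fun s : ℝ => (x, s)) ((0 : ℝ), (1 : ℝ)) y :=
    (hasDerivAt_const y x).prodMk (hasDerivAt_id y)
  exact (hasDerivAt_dY h x y).unique (h1.comp_hasDerivAt y h2)

theorem continuous_dX {Φ : ℝ × ℝ → ℂ} (h : ContDiff ℝ ∞ Φ) : Continuous (dX Φ) := by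
  rw [dX_eq_fderiv h]
  exact (h.continuous_fderiv (by simp)).clm_apply continuous_const

theorem continuous_dY {Φ : ℝ × ℝ → ℂ} (h : ContDiff ℝ ∞ Φ) : Continuous (dY Φ) := by
  rw [dY_eq_fderiv h]
  exact (h.continuous_fderiv (by simp)).clm_apply continuous_const

theorem dX_add {Φ Ψ : ℝ × ℝ → ℂ} (h : ContDiff ℝ ∞ Φ) (h' : ContDiff ℝ ∞ Ψ) :
    dX (Φ + Ψ) = dX Φ + dX Ψ := by
  ext ⟨x, y⟩
  exact ((hasDerivAt_dX h x y).add (hasDerivAt_dX h' x y)).deriv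

theorem dY_add {Φ Ψ : ℝ × ℝ → ℂ} (h : ContDiff ℝ ∞ Φ) (h' : ContDiff ℝ ∞ Ψ) :
    dY (Φ + Ψ) = dY Φ + dY Ψ := by
  ext ⟨x, y⟩
  exact ((hasDerivAt_dY h x y).add (hasDerivAt_dY h' x y)).deriv

theorem dX_sub {Φ Ψ : ℝ × ℝ → ℂ} (h : ContDiff ℝ ∞ Φ) (h' : ContDiff ℝ ∞ Ψ) :
    dX (Φ - Ψ) = dX Φ - dX Ψ := by
  ext ⟨x, y⟩
  exact ((hasDerivAt_dX h x y).sub (hasDerivAt_dX h' x y)).deriv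

theorem dY_sub {Φ Ψ : ℝ × ℝ → ℂ} (h : ContDiff ℝ ∞ Φ) (h' : ContDiff ℝ ∞ Ψ) :
    dY (Φ - Ψ) = dY Φ - dY Ψ := by
  ext ⟨x, y⟩
  exact ((hasDerivAt_dY h x y).sub (hasDerivAt_dY h' x y)).deriv

namespace IsTest

variable {Φ Ψ : ℝ × ℝ → ℂ}

theorem vanish_dX (h : IsTest β Φ) : ∃ M : ℝ, ∀ x y : ℝ, M < |x| → dX Φ (x, y) = 0 := by
  obtain ⟨M, hM⟩ := h.vanish
  refine ⟨M, fun x y hx => ?_⟩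
  have h1 : (fun s : ℝ => Φ (s, y)) =ᶠ[𝓝 x] fun _ => 0 := by
    filter_upwards [(continuous_abs.tendsto x).eventually (lt_mem_nhds hx)] with s hs
    exact hM s y hs
  exact (hasDerivAt_dX h.smooth x y).unique ((hasDerivAt_const x (0 : ℂ)).congr_of_eventuallyEq h1)

theorem vanish_dY (h : IsTest β Φ) : ∃ M : ℝ, ∀ x y : ℝ, M < |x| → dY Φ (x, y) = 0 := by
  obtain ⟨M, hM⟩ := h.vanish
  refine ⟨M, fun x y hx => ?_⟩
  have h1 : (fun s : ℝ => Φ (x, s)) = fun _ => 0 := funext fun s => hM x s hx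
  have h2 := hasDerivAt_dY h.smooth x y
  rw [h1] at h2
  exact h2.unique (hasDerivAt_const y (0 : ℂ))

theorem memLp (h : IsTest β Φ) : MemLp Φ 2 stripMeasure :=
  memLp_of_vanish h.smooth.continuous h.vanish 2

theorem memLp_dX (h : IsTest β Φ) : MemLp (dX Φ) 2 stripMeasure :=
  memLp_of_vanish (continuous_dX h.smooth) h.vanish_dX 2

theorem memLp_dY (h : IsTest β Φ) : MemLp (dY Φ) 2 stripMeasure :=
  memLp_of_vanish (continuous_dY h.smooth) h.vanish_dY 2

theorem zero : IsTest β 0 where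
  smooth := contDiff_const
  bc x := by simp
  bc_dY x := by
    have : dY (0 : ℝ × ℝ → ℂ) = 0 := by
      ext p
      simp [dY]
    simp [this]
  vanish := ⟨0, fun _ _ _ => rfl⟩

theorem add (h : IsTest β Φ) (h' : IsTest β Ψ) : IsTest β (Φ + Ψ) where
  smooth := h.smooth.add h'.smooth
  bc x := by
    simp only [Pi.add_apply]
    rw [h.bc, h'.bc, mul_add]
  bc_dY x := by
    rw [dY_add h.smooth h'.smooth]
    simp only [Pi.add_apply]
    rw [h.bc_dY, h'.bc_dY, mul_add]
  vanish := by
    obtain ⟨M, hM⟩ := h.vanish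
    obtain ⟨M', hM'⟩ := h'.vanish
    refine ⟨max M M', fun x y hx => ?_⟩
    rw [Pi.add_apply, hM x y ((le_max_left _ _).trans_lt hx),
      hM' x y ((le_max_right _ _).trans_lt hx), add_zero]

theorem sub (h : IsTest β Φ) (h' : IsTest β Ψ) : IsTest β (Φ - Ψ) where
  smooth := h.smooth.sub h'.smooth
  bc x := by
    simp only [Pi.sub_apply]
    rw [h.bc, h'.bc, mul_sub]
  bc_dY x := by
    rw [dY_sub h.smooth h'.smooth]
    simp only [Pi.sub_apply]
    rw [h.bc_dY, h'.bc_dY, mul_sub]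
  vanish := by
    obtain ⟨M, hM⟩ := h.vanish
    obtain ⟨M', hM'⟩ := h'.vanish
    refine ⟨max M M', fun x y hx => ?_⟩
    rw [Pi.sub_apply, hM x y ((le_max_left _ _).trans_lt hx),
      hM' x y ((le_max_right _ _).trans_lt hx), sub_zero]

theorem integrable_mul (h : IsTest β Φ) {g : ℝ × ℝ → ℂ} (hg : Continuous g) :
    Integrable (fun p => g p * (starRingEnd ℂ) (Φ p)) stripMeasure :=
  integrable_mul_conj_of_vanish hg h.smooth.continuous h.vanish

theorem integrable_mul_dX (h : IsTest β Φ) {g : ℝ × ℝ → ℂ} (hg : Continuous g) :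
    Integrable (fun p => g p * (starRingEnd ℂ) (dX Φ p)) stripMeasure :=
  integrable_mul_conj_of_vanish hg (continuous_dX h.smooth) h.vanish_dX

theorem integrable_mul_dY (h : IsTest β Φ) {g : ℝ × ℝ → ℂ} (hg : Continuous g) :
    Integrable (fun p => g p * (starRingEnd ℂ) (dY Φ p)) stripMeasure :=
  integrable_mul_conj_of_vanish hg (continuous_dY h.smooth) h.vanish_dY

end IsTest

/-! ### Modes -/

/-- The function `y ↦ e^{i s y}`. -/
def modeE (s y : ℝ) : ℂ := Complex.exp (Complex.I * (s * y))

theorem contDiff_modeE (s : ℝ) : ContDiff ℝ ∞ (modeE s) := by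
  have h : ContDiff ℝ ∞ fun y : ℝ => (y : ℂ) := Complex.ofRealCLM.contDiff
  exact (contDiff_const.mul (contDiff_const.mul h)).cexp

@[fun_prop] theorem continuous_modeE (s : ℝ) : Continuous (modeE s) := (contDiff_modeE s).continuous

theorem hasDerivAt_modeE (s y : ℝ) : HasDerivAt (modeE s) (Complex.I * s * modeE s y) y := by
  have h1 : HasDerivAt (fun y : ℝ => Complex.I * (s * (y : ℂ))) (Complex.I * (s * 1)) y :=
    ((Complex.ofRealCLM.hasDerivAt (x := y)).const_mul _).const_mul _
  have h2 := h1.cexp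
  rw [mul_one, mul_comm] at h2
  exact h2

theorem norm_modeE (s y : ℝ) : ‖modeE s y‖ = 1 := by
  rw [modeE, mul_comm, ← Complex.ofReal_mul, Complex.norm_exp_ofReal_mul_I]

theorem modeE_mul_conj (s y : ℝ) : modeE s y * (starRingEnd ℂ) (modeE s y) = 1 := by
  rw [Complex.mul_conj, Complex.normSq_eq_norm_sq, norm_modeE]
  simp

theorem modeE_zero (s : ℝ) : modeE s 0 = 1 := by simp [modeE]

theorem modeE_two_pi (β : ℝ) (n : ℤ) :
    modeE (β + n) (2 * Real.pi) = Complex.exp (2 * Real.pi * Complex.I * β) := by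
  have : Complex.I * (((β + n : ℝ) : ℂ) * ((2 * Real.pi : ℝ) : ℂ)) =
      2 * Real.pi * Complex.I * β + n * (2 * Real.pi * Complex.I) := by
    push_cast
    ring
  rw [modeE, this, Complex.exp_add, Complex.exp_int_mul_two_pi_mul_I, mul_one]

theorem isTest_mode (β : ℝ) (n : ℤ) {u : ℝ → ℂ} (hu : ContDiff ℝ ∞ u)
    (hv : ∃ M : ℝ, ∀ x : ℝ, M < |x| → u x = 0) :
    IsTest β (fun p => u p.1 * modeE (β + n) p.2) where
  smooth := (hu.comp contDiff_fst).mul ((contDiff_modeE _).comp contDiff_snd)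
  bc x := by
    simp only
    rw [modeE_two_pi, modeE_zero]
    ring
  bc_dY x := by
    have h : ∀ y, dY (fun p => u p.1 * modeE (β + n) p.2) (x, y) =
        u x * (Complex.I * ((β + n : ℝ) : ℂ) * modeE (β + n) y) := fun y =>
      ((hasDerivAt_modeE (β + n) y).const_mul (u x)).deriv
    rw [h, h, modeE_two_pi, modeE_zero]
    ring
  vanish := by
    obtain ⟨M, hM⟩ := hv
    exact ⟨M, fun x y hx => by simp only; rw [hM x hx, zero_mul]⟩

theorem dX_mode {u u' : ℝ → ℂ} (hu : ∀ x, HasDerivAt u (u' x) x) (s : ℝ) (p : ℝ × ℝ) :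
    dX (fun p => u p.1 * modeE s p.2) p = u' p.1 * modeE s p.2 :=
  ((hu p.1).mul_const (modeE s p.2)).deriv

theorem dY_mode (u : ℝ → ℂ) (s : ℝ) (p : ℝ × ℝ) :
    dY (fun p => u p.1 * modeE s p.2) p = u p.1 * (Complex.I * s * modeE s p.2) :=
  ((hasDerivAt_modeE s p.2).const_mul (u p.1)).deriv

theorem hasDerivAt_conj {u : ℝ → ℂ} {u' : ℂ} {x : ℝ} (h : HasDerivAt u u' x) :
    HasDerivAt (fun x => (starRingEnd ℂ) (u x)) ((starRingEnd ℂ) u') x :=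
  h.star

theorem integrable_line {g : ℝ → ℂ} (hg : Continuous g) (hv : ∃ M : ℝ, ∀ x, M < |x| → g x = 0) :
    Integrable g := by
  obtain ⟨M, hM⟩ := hv
  refine hg.integrable_of_hasCompactSupport
    (HasCompactSupport.intro (isCompact_Icc (a := -M) (b := M)) fun x hx => hM x ?_)
  by_contra h
  exact hx (abs_le.1 (not_lt.1 h))

theorem integral_dX_conj {Φ : ℝ × ℝ → ℂ} (hΦ : IsTest β Φ) {u u' : ℝ → ℂ}
    (hu : ∀ x, HasDerivAt u (u' x) x) (hc : Continuous u') (y : ℝ) :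
    ∫ x, u x * (starRingEnd ℂ) (dX Φ (x, y)) = -∫ x, u' x * (starRingEnd ℂ) (Φ (x, y)) := by
  have hcu : Continuous u := continuous_iff_continuousAt.2 fun x => (hu x).continuousAt
  obtain ⟨M, hM⟩ := hΦ.vanish
  obtain ⟨M', hM'⟩ := hΦ.vanish_dX
  have c1 := hΦ.smooth.continuous
  have c2 := continuous_dX hΦ.smooth
  have i1 : ∀ g : ℝ → ℂ, Continuous g →
      Integrable (fun x => g x * (starRingEnd ℂ) (Φ (x, y))) := fun g hg =>
    integrable_line (hg.mul (Complex.continuous_conj.comp (by fun_prop)))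
      ⟨M, fun x hx => by rw [hM x y hx, map_zero, mul_zero]⟩
  have i2 : Integrable (fun x => u x * (starRingEnd ℂ) (dX Φ (x, y))) :=
    integrable_line (hcu.mul (Complex.continuous_conj.comp (by fun_prop)))
      ⟨M', fun x hx => by rw [hM' x y hx, map_zero, mul_zero]⟩
  exact integral_mul_deriv_eq_deriv_mul_of_integrable (fun x _ => hu x)
    (fun x _ => hasDerivAt_conj (hasDerivAt_dX hΦ.smooth x y)) i2 (i1 _ hc) (i1 _ hcu)

/-- Integration by parts in y. The boundary terms at 0 and 2π cancel because the mode and Φ acquire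
the same factor e^{2πiβ}, of modulus 1, and Φ is conjugated. -/
theorem integral_dY_conj {Φ : ℝ × ℝ → ℂ} (hΦ : IsTest β Φ) (n : ℤ) (x : ℝ) :
    ∫ y in Set.Ioo (0 : ℝ) (2 * Real.pi),
      Complex.I * ((β + n : ℝ) : ℂ) * modeE (β + n) y * (starRingEnd ℂ) (dY Φ (x, y)) =
    ∫ y in Set.Ioo (0 : ℝ) (2 * Real.pi),
      ((β + n : ℝ) : ℂ) ^ 2 * modeE (β + n) y * (starRingEnd ℂ) (Φ (x, y)) := by
  have hpi : (0 : ℝ) ≤ 2 * Real.pi := by positivity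
  simp only [← integral_Ioc_eq_integral_Ioo, ← intervalIntegral.integral_of_le hpi]
  have c2 := continuous_dY hΦ.smooth
  have h := intervalIntegral.integral_mul_deriv_eq_deriv_mul (a := 0) (b := 2 * Real.pi)
    (fun y _ => (hasDerivAt_modeE (β + n) y).const_mul (Complex.I * ((β + n : ℝ) : ℂ)))
    (fun y _ => hasDerivAt_conj (hasDerivAt_dY hΦ.smooth x y))
    (Continuous.intervalIntegrable (by fun_prop) _ _)
    (Continuous.intervalIntegrable (Complex.continuous_conj.comp (by fun_prop)) _ _)
  have hb : modeE (β + n) (2 * Real.pi) * (starRingEnd ℂ) (Φ (x, 2 * Real.pi)) =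
      (starRingEnd ℂ) (Φ (x, 0)) := by
    rw [hΦ.bc, map_mul, ← mul_assoc, ← modeE_two_pi β n, modeE_mul_conj, one_mul]
  rw [h, mul_assoc, hb, modeE_zero, mul_one, sub_self, zero_sub, ← intervalIntegral.integral_neg]
  refine intervalIntegral.integral_congr fun y _ => ?_
  linear_combination (-((β + n : ℝ) : ℂ) ^ 2 * modeE (β + n) y * (starRingEnd ℂ) (Φ (x, y))) *
    Complex.I_sq

theorem integral_strip {g : ℝ × ℝ → ℂ} (hg : Integrable g stripMeasure) :
    ∫ p, g p ∂stripMeasure = ∫ x, ∫ y in Set.Ioo (0 : ℝ) (2 * Real.pi), g (x, y) := by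
  rw [stripMeasure_eq] at hg ⊢
  exact integral_prod _ hg

theorem integral_strip_symm {g : ℝ × ℝ → ℂ} (hg : Integrable g stripMeasure) :
    ∫ p, g p ∂stripMeasure = ∫ y in Set.Ioo (0 : ℝ) (2 * Real.pi), ∫ x, g (x, y) := by
  rw [stripMeasure_eq] at hg ⊢
  exact integral_prod_symm _ hg

/-- Green's formula for a single mode. -/
theorem integral_mode {Φ : ℝ × ℝ → ℂ} (hΦ : IsTest β Φ) (n : ℤ) {u u' u'' : ℝ → ℂ}
    (hu : ∀ x, HasDerivAt u (u' x) x) (hu' : ∀ x, HasDerivAt u' (u'' x) x)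
    (hc : Continuous u'') :
    ∫ p, (u' p.1 * modeE (β + n) p.2 * (starRingEnd ℂ) (dX Φ p) +
      u p.1 * (Complex.I * ((β + n : ℝ) : ℂ) * modeE (β + n) p.2) * (starRingEnd ℂ) (dY Φ p))
        ∂stripMeasure =
    ∫ p, (-u'' p.1 + ((β + n : ℝ) : ℂ) ^ 2 * u p.1) * modeE (β + n) p.2 *
      (starRingEnd ℂ) (Φ p) ∂stripMeasure := by
  have hcu : Continuous u := continuous_iff_continuousAt.2 fun x => (hu x).continuousAt
  have hcu' : Continuous u' := continuous_iff_continuousAt.2 fun x => (hu' x).continuousAt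
  have i1 := hΦ.integrable_mul_dX (g := fun p => u' p.1 * modeE (β + n) p.2) (by fun_prop)
  have i2 := hΦ.integrable_mul_dY
    (g := fun p => u p.1 * (Complex.I * ((β + n : ℝ) : ℂ) * modeE (β + n) p.2)) (by fun_prop)
  have i3 := hΦ.integrable_mul (g := fun p => -u'' p.1 * modeE (β + n) p.2) (by fun_prop)
  have i4 := hΦ.integrable_mul
    (g := fun p => ((β + n : ℝ) : ℂ) ^ 2 * u p.1 * modeE (β + n) p.2) (by fun_prop)
  have e : ∀ p : ℝ × ℝ, (-u'' p.1 + ((β + n : ℝ) : ℂ) ^ 2 * u p.1) * modeE (β + n) p.2 *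
      (starRingEnd ℂ) (Φ p) = -u'' p.1 * modeE (β + n) p.2 * (starRingEnd ℂ) (Φ p) +
        ((β + n : ℝ) : ℂ) ^ 2 * u p.1 * modeE (β + n) p.2 * (starRingEnd ℂ) (Φ p) := fun p => by
    ring
  rw [integral_add i1 i2, integral_congr_ae (Filter.Eventually.of_forall e), integral_add i3 i4]
  congr 1
  · rw [integral_strip_symm i1, integral_strip_symm i3]
    refine integral_congr_ae (Filter.Eventually.of_forall fun y => ?_)
    have h := integral_dX_conj hΦ hu' hc y
    calc ∫ x, u' x * modeE (β + n) y * (starRingEnd ℂ) (dX Φ (x, y))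
        = ∫ x, modeE (β + n) y * (u' x * (starRingEnd ℂ) (dX Φ (x, y))) :=
          integral_congr_ae (Filter.Eventually.of_forall fun x => by simp only; ring)
      _ = ∫ x, -modeE (β + n) y * (u'' x * (starRingEnd ℂ) (Φ (x, y))) := by
          rw [integral_const_mul, integral_const_mul, h]
          ring
      _ = _ := integral_congr_ae (Filter.Eventually.of_forall fun x => by simp only; ring)
  · rw [integral_strip i2, integral_strip i4]
    refine integral_congr_ae (Filter.Eventually.of_forall fun x => ?_)
    have h := integral_dY_conj hΦ n x
    calc ∫ y in Set.Ioo (0 : ℝ) (2 * Real.pi),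
          u x * (Complex.I * ((β + n : ℝ) : ℂ) * modeE (β + n) y) * (starRingEnd ℂ) (dY Φ (x, y))
        = ∫ y in Set.Ioo (0 : ℝ) (2 * Real.pi), u x *
          (Complex.I * ((β + n : ℝ) : ℂ) * modeE (β + n) y * (starRingEnd ℂ) (dY Φ (x, y))) :=
          integral_congr_ae (Filter.Eventually.of_forall fun x => by simp only; ring)
      _ = ∫ y in Set.Ioo (0 : ℝ) (2 * Real.pi), u x *
          (((β + n : ℝ) : ℂ) ^ 2 * modeE (β + n) y * (starRingEnd ℂ) (Φ (x, y))) := by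
          rw [integral_const_mul, integral_const_mul, h]
      _ = _ := integral_congr_ae (Filter.Eventually.of_forall fun x => by simp only; ring)

end

section

variable {β : ℝ}

/-! ### Square-integrable functions on the strip -/

theorem norm_integral_mul_conj_le {g h : ℝ × ℝ → ℂ} (hg : MemLp g 2 stripMeasure)
    (hh : MemLp h 2 stripMeasure) :
    ‖∫ p, g p * (starRingEnd ℂ) (h p) ∂stripMeasure‖ ≤
      (eLpNorm g 2 stripMeasure).toReal * (eLpNorm h 2 stripMeasure).toReal := by
  have h1 : inner ℂ (hh.toLp h) (hg.toLp g) =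
      ∫ p, g p * (starRingEnd ℂ) (h p) ∂stripMeasure := by
    rw [L2.inner_def]
    refine integral_congr_ae ?_
    filter_upwards [hh.coeFn_toLp, hg.coeFn_toLp] with p e1 e2
    rw [e1, e2, RCLike.inner_apply]
  rw [← h1, mul_comm, ← Lp.norm_toLp g hg, ← Lp.norm_toLp h hh]
  exact norm_inner_le_norm _ _

theorem tendsto_integral_mul_conj {g w : ℝ × ℝ → ℂ} {φ : ℕ → ℝ × ℝ → ℂ}
    (hg : MemLp g 2 stripMeasure) (hw : MemLp w 2 stripMeasure)
    (hφ : ∀ n, MemLp (φ n) 2 stripMeasure)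
    (h : Filter.Tendsto (fun n => eLpNorm (φ n - w) 2 stripMeasure) Filter.atTop (𝓝 0)) :
    Filter.Tendsto (fun n => ∫ p, g p * (starRingEnd ℂ) (φ n p) ∂stripMeasure) Filter.atTop
      (𝓝 (∫ p, g p * (starRingEnd ℂ) (w p) ∂stripMeasure)) := by
  rw [tendsto_iff_norm_sub_tendsto_zero]
  have h1 : Filter.Tendsto (fun n => (eLpNorm g 2 stripMeasure).toReal *
      (eLpNorm (φ n - w) 2 stripMeasure).toReal) Filter.atTop (𝓝 0) := by
    have := ((ENNReal.tendsto_toReal ENNReal.zero_ne_top).comp h).const_mul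
      (eLpNorm g 2 stripMeasure).toReal
    simpa using this
  refine squeeze_zero (fun _ => norm_nonneg _) (fun n => ?_) h1
  refine le_trans (le_of_eq ?_) (norm_integral_mul_conj_le hg ((hφ n).sub hw))
  rw [← integral_sub (integrable_mul_conj hg (hφ n)) (integrable_mul_conj hg hw)]
  congr 2
  ext p
  rw [Pi.sub_apply, map_sub, mul_sub]

theorem IsTest.inH1 {Φ : ℝ × ℝ → ℂ} (h : IsTest β Φ) : InH1 β Φ (dX Φ) (dY Φ) := by
  refine ⟨h.memLp, h.memLp_dX, h.memLp_dY, fun _ => Φ, fun _ => h, ?_, ?_, ?_⟩ <;> simp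

theorem tendsto_eLpNorm_of_eq_sub {a b c : ℕ → ℝ × ℝ → ℂ}
    (ha : ∀ n, AEStronglyMeasurable (a n) stripMeasure)
    (hb : ∀ n, AEStronglyMeasurable (b n) stripMeasure) (hc : ∀ n, c n = a n - b n)
    (ta : Filter.Tendsto (fun n => eLpNorm (a n) 2 stripMeasure) Filter.atTop (𝓝 0))
    (tb : Filter.Tendsto (fun n => eLpNorm (b n) 2 stripMeasure) Filter.atTop (𝓝 0)) :
    Filter.Tendsto (fun n => eLpNorm (c n) 2 stripMeasure) Filter.atTop (𝓝 0) := by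
  refine tendsto_of_tendsto_of_tendsto_of_le_of_le tendsto_const_nhds (by simpa using ta.add tb)
    (fun _ => zero_le) fun n => ?_
  rw [hc]
  exact eLpNorm_sub_le (ha n) (hb n) (by norm_num)

theorem InH1.sub {w wx wy v vx vy : ℝ × ℝ → ℂ} (h : InH1 β w wx wy) (h' : InH1 β v vx vy) :
    InH1 β (w - v) (wx - vx) (wy - vy) := by
  obtain ⟨m1, m2, m3, φ, hφ, t1, t2, t3⟩ := h
  obtain ⟨n1, n2, n3, ψ, hψ, s1, s2, s3⟩ := h'
  refine ⟨m1.sub n1, m2.sub n2, m3.sub n3, fun n => φ n - ψ n, fun n => (hφ n).sub (hψ n), ?_, ?_,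
    ?_⟩
  · exact tendsto_eLpNorm_of_eq_sub (fun n => ((hφ n).memLp.sub m1).1)
      (fun n => ((hψ n).memLp.sub n1).1) (fun n => sub_sub_sub_comm _ _ _ _) t1 s1
  · exact tendsto_eLpNorm_of_eq_sub (fun n => ((hφ n).memLp_dX.sub m2).1)
      (fun n => ((hψ n).memLp_dX.sub n2).1)
      (fun n => by rw [dX_sub (hφ n).smooth (hψ n).smooth, sub_sub_sub_comm]) t2 s2
  · exact tendsto_eLpNorm_of_eq_sub (fun n => ((hφ n).memLp_dY.sub m3).1)
      (fun n => ((hψ n).memLp_dY.sub n3).1)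
      (fun n => by rw [dY_sub (hφ n).smooth (hψ n).smooth, sub_sub_sub_comm]) t3 s3

theorem InH1.add {w wx wy v vx vy : ℝ × ℝ → ℂ} (h : InH1 β w wx wy) (h' : InH1 β v vx vy) :
    InH1 β (w + v) (wx + vx) (wy + vy) := by
  have h0 : InH1 β 0 0 0 := by
    have := (IsTest.zero (β := β)).inH1
    have e1 : dX (0 : ℝ × ℝ → ℂ) = 0 := by
      ext p
      simp [dX]
    have e2 : dY (0 : ℝ × ℝ → ℂ) = 0 := by
      ext p
      simp [dY]
    rwa [e1, e2] at this
  have := h.sub (h0.sub h')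
  simpa only [zero_sub, sub_neg_eq_add] using this

/-! ### The weak form -/

/-- Functions that can be integrated against continuous functions vanishing for large `|x|`. -/
def Pairs (g : ℝ × ℝ → ℂ) : Prop :=
  ∀ φ : ℝ × ℝ → ℂ, Continuous φ → (∃ M : ℝ, ∀ x y : ℝ, M < |x| → φ (x, y) = 0) →
    Integrable (fun p => g p * (starRingEnd ℂ) (φ p)) stripMeasure

theorem Pairs.of_memLp {g : ℝ × ℝ → ℂ} (h : MemLp g 2 stripMeasure) : Pairs g :=
  fun _ hφ hv => integrable_mul_conj h (memLp_of_vanish hφ hv 2)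

theorem Pairs.of_continuous {g : ℝ × ℝ → ℂ} (h : Continuous g) : Pairs g :=
  fun _ hφ hv => integrable_mul_conj_of_vanish h hφ hv

theorem Pairs.add {g h : ℝ × ℝ → ℂ} (hg : Pairs g) (hh : Pairs h) : Pairs (g + h) :=
  fun φ hφ hv => ((hg φ hφ hv).add (hh φ hφ hv)).congr (Filter.Eventually.of_forall fun p => by
    simp only [Pi.add_apply, add_mul])

theorem Pairs.mul {g ρ : ℝ × ℝ → ℂ} (hg : Pairs g) (hρ : Continuous ρ) :
    Pairs (fun p => ρ p * g p) := by
  intro φ hφ hv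
  obtain ⟨M, hM⟩ := hv
  have h := hg (fun p => (starRingEnd ℂ) (ρ p) * φ p)
    ((Complex.continuous_conj.comp hρ).mul hφ) ⟨M, fun x y hx => by rw [hM x y hx, mul_zero]⟩
  refine h.congr (Filter.Eventually.of_forall fun p => ?_)
  simp only [map_mul, Complex.conj_conj]
  ring

/-- The sesquilinear form of the operator `-∇² - ρ`. -/
def weakForm (ρ u ux uy Φ : ℝ × ℝ → ℂ) : ℂ :=
  ∫ p, (ux p * (starRingEnd ℂ) (dX Φ p) + uy p * (starRingEnd ℂ) (dY Φ p)) ∂stripMeasure -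
    ∫ p, ρ p * u p * (starRingEnd ℂ) (Φ p) ∂stripMeasure

theorem weakForm_add {ρ u ux uy v vx vy Φ : ℝ × ℝ → ℂ} (hρ : Continuous ρ) (hΦ : IsTest β Φ)
    (hu : Pairs u) (hux : Pairs ux) (huy : Pairs uy) (hv : Pairs v) (hvx : Pairs vx)
    (hvy : Pairs vy) :
    weakForm ρ (u + v) (ux + vx) (uy + vy) Φ = weakForm ρ u ux uy Φ + weakForm ρ v vx vy Φ := by
  have i1 := (hux _ (continuous_dX hΦ.smooth) hΦ.vanish_dX).add
    (huy _ (continuous_dY hΦ.smooth) hΦ.vanish_dY)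
  have i2 := (hvx _ (continuous_dX hΦ.smooth) hΦ.vanish_dX).add
    (hvy _ (continuous_dY hΦ.smooth) hΦ.vanish_dY)
  have i3 := (hu.mul hρ) _ hΦ.smooth.continuous hΦ.vanish
  have i4 := (hv.mul hρ) _ hΦ.smooth.continuous hΦ.vanish
  have e1 := integral_add i1 i2
  have e2 := integral_add i3 i4
  simp only [Pi.add_apply] at e1
  simp only [weakForm]
  rw [show ∀ a b c d : ℂ, a - b + (c - d) = (a + c) - (b + d) from fun a b c d => by ring, ← e1,
    ← e2]
  congr 1
  · congr 1
    ext p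
    simp only [Pi.add_apply]
    ring
  · congr 1
    ext p
    simp only [Pi.add_apply]
    ring

theorem weakForm_neg (ρ u ux uy Φ : ℝ × ℝ → ℂ) :
    weakForm ρ (-u) (-ux) (-uy) Φ = -weakForm ρ u ux uy Φ := by
  simp only [weakForm]
  rw [show ∀ a b : ℂ, -(a - b) = -a - -b from fun a b => by ring, ← integral_neg, ← integral_neg]
  congr 1
  · congr 1
    ext p
    simp only [Pi.neg_apply]
    ring
  · congr 1
    ext p
    simp only [Pi.neg_apply]
    ring

theorem integral_mul_conj_self_im {g : ℝ × ℝ → ℂ} {ρ : ℝ × ℝ → ℝ} :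
    (∫ p, (ρ p : ℂ) * g p * (starRingEnd ℂ) (g p) ∂stripMeasure).im = 0 := by
  have : ∀ p, (ρ p : ℂ) * g p * (starRingEnd ℂ) (g p) = ((ρ p * Complex.normSq (g p) : ℝ) : ℂ) :=
    fun p => by
      rw [mul_assoc, Complex.mul_conj]
      push_cast
      rfl
  rw [integral_congr_ae (Filter.Eventually.of_forall this), integral_complex_ofReal]
  exact Complex.ofReal_im _

/-- If `W` solves the weak problem with source `-g`, the flux `∫ g W̄` is real. -/
theorem flux_im_eq_zero {ρ : ℝ × ℝ → ℝ} (hρ : Continuous ρ) {C : ℝ} (hC : ∀ p, |ρ p| ≤ C)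
    {W Wx Wy g : ℝ × ℝ → ℂ} (hW : InH1 β W Wx Wy) (hg : MemLp g 2 stripMeasure)
    (h : ∀ Φ, IsTest β Φ → weakForm (fun p => (ρ p : ℂ)) W Wx Wy Φ +
      ∫ p, g p * (starRingEnd ℂ) (Φ p) ∂stripMeasure = 0) :
    (∫ p, g p * (starRingEnd ℂ) (W p) ∂stripMeasure).im = 0 := by
  obtain ⟨m1, m2, m3, φ, hφ, t1, t2, t3⟩ := hW
  have m4 : MemLp (fun p => (ρ p : ℂ) * W p) 2 stripMeasure := by
    refine MemLp.of_le_mul (c := C) m1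
      ((Complex.continuous_ofReal.comp hρ).aestronglyMeasurable.mul m1.1)
      (Filter.Eventually.of_forall fun p => ?_)
    rw [norm_mul, Complex.norm_real, Real.norm_eq_abs]
    exact mul_le_mul_of_nonneg_right (hC p) (norm_nonneg _)
  -- W is not itself an admissible test function; the weak identity is tested with the
  -- approximations φ_n and passed to the limit.
  have l1 := tendsto_integral_mul_conj m2 m2 (fun n => (hφ n).memLp_dX) t2
  have l2 := tendsto_integral_mul_conj m3 m3 (fun n => (hφ n).memLp_dY) t3
  have l3 := tendsto_integral_mul_conj m4 m1 (fun n => (hφ n).memLp) t1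
  have l4 := tendsto_integral_mul_conj hg m1 (fun n => (hφ n).memLp) t1
  have l5 := ((l1.add l2).sub l3).add l4
  have e : ∀ n, ((∫ p, Wx p * (starRingEnd ℂ) (dX (φ n) p) ∂stripMeasure) +
      (∫ p, Wy p * (starRingEnd ℂ) (dY (φ n) p) ∂stripMeasure) -
      ∫ p, (ρ p : ℂ) * W p * (starRingEnd ℂ) (φ n p) ∂stripMeasure) +
      ∫ p, g p * (starRingEnd ℂ) (φ n p) ∂stripMeasure = 0 := fun n => by
    rw [← h (φ n) (hφ n), weakForm,
      integral_add (integrable_mul_conj m2 (hφ n).memLp_dX)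
        (integrable_mul_conj m3 (hφ n).memLp_dY)]
  simp only [e] at l5
  -- The limit says ∫|∇W|² - ∫ρ|W|² + ∫ g W̄ = 0, and the first two terms are real.
  have h0 := tendsto_nhds_unique l5 tendsto_const_nhds
  have h1 := congrArg Complex.im h0
  have r1 := integral_mul_conj_self_im (g := Wx) (ρ := fun _ => 1)
  have r2 := integral_mul_conj_self_im (g := Wy) (ρ := fun _ => 1)
  have r3 := integral_mul_conj_self_im (g := W) (ρ := ρ)
  simp only [Complex.ofReal_one, one_mul] at r1 r2
  simp only [Complex.add_im, Complex.sub_im, r1, r2, r3, Complex.zero_im] at h1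
  linarith

end

section

variable {β : ℝ}

/-! ### Truncated waves -/

theorem contDiff_smoothTransition : ContDiff ℝ ∞ Real.smoothTransition :=
  Real.smoothTransition.contDiff (n := ⊤)

theorem contDiff_deriv_smoothTransition : ContDiff ℝ ∞ (deriv Real.smoothTransition) :=
  (contDiff_infty_iff_deriv.1 contDiff_smoothTransition).2

theorem contDiff_deriv_deriv_smoothTransition :
    ContDiff ℝ ∞ (deriv (deriv Real.smoothTransition)) :=
  (contDiff_infty_iff_deriv.1 contDiff_deriv_smoothTransition).2

theorem hasDerivAt_smoothTransition (x : ℝ) :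
    HasDerivAt Real.smoothTransition (deriv Real.smoothTransition x) x :=
  ((contDiff_infty_iff_deriv.1 contDiff_smoothTransition).1 x).hasDerivAt

theorem hasDerivAt_deriv_smoothTransition (x : ℝ) :
    HasDerivAt (deriv Real.smoothTransition) (deriv (deriv Real.smoothTransition) x) x :=
  ((contDiff_infty_iff_deriv.1 contDiff_deriv_smoothTransition).1 x).hasDerivAt

theorem eventuallyEq_smoothTransition {x : ℝ} (hx : x ∉ Set.Icc (0 : ℝ) 1) :
    ∃ a : ℝ, Real.smoothTransition =ᶠ[𝓝 x] fun _ => a := by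
  rcases lt_or_ge x 0 with h | h
  · exact ⟨0, by filter_upwards [gt_mem_nhds h] with s hs using
      Real.smoothTransition.zero_of_nonpos hs.le⟩
  · have h1 : 1 < x := by
      by_contra h2
      exact hx ⟨h, not_lt.1 h2⟩
    exact ⟨1, by filter_upwards [lt_mem_nhds h1] with s hs using
      Real.smoothTransition.one_of_one_le hs.le⟩

theorem deriv_smoothTransition_eq_zero {x : ℝ} (hx : x ∉ Set.Icc (0 : ℝ) 1) :
    deriv Real.smoothTransition x = 0 := by
  obtain ⟨a, ha⟩ := eventuallyEq_smoothTransition hx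
  rw [ha.deriv_eq]
  simp

theorem deriv_deriv_smoothTransition_eq_zero {x : ℝ} (hx : x ∉ Set.Icc (0 : ℝ) 1) :
    deriv (deriv Real.smoothTransition) x = 0 := by
  have h : deriv Real.smoothTransition =ᶠ[𝓝 x] fun _ => 0 := by
    filter_upwards [isClosed_Icc.isOpen_compl.mem_nhds hx] with s hs
    exact deriv_smoothTransition_eq_zero hs
  rw [h.deriv_eq]
  simp

theorem exists_bound_deriv_smoothTransition : ∃ C : ℝ, 0 ≤ C ∧
    (∀ x, |deriv Real.smoothTransition x| ≤ C) ∧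
    ∀ x, |deriv (deriv Real.smoothTransition) x| ≤ C := by
  obtain ⟨C, hC⟩ := (isCompact_Icc (a := (0 : ℝ)) (b := 1)).exists_bound_of_continuousOn
    contDiff_deriv_smoothTransition.continuous.continuousOn
  obtain ⟨D, hD⟩ := (isCompact_Icc (a := (0 : ℝ)) (b := 1)).exists_bound_of_continuousOn
    contDiff_deriv_deriv_smoothTransition.continuous.continuousOn
  refine ⟨max 0 (max C D), le_max_left _ _, fun x => ?_, fun x => ?_⟩
  · by_cases hx : x ∈ Set.Icc (0 : ℝ) 1
    · exact (hC x hx).trans ((le_max_left _ _).trans (le_max_right _ _))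
    · rw [deriv_smoothTransition_eq_zero hx, abs_zero]
      exact le_max_left _ _
  · by_cases hx : x ∈ Set.Icc (0 : ℝ) 1
    · exact (hD x hx).trans ((le_max_right _ _).trans (le_max_right _ _))
    · rw [deriv_deriv_smoothTransition_eq_zero hx, abs_zero]
      exact le_max_left _ _

/-- The wave `e^{ikx}`, cut off to `x > M`. -/
def waveR (k M x : ℝ) : ℂ := (Real.smoothTransition (x - M) : ℂ) * modeE k x

/-- The derivative of `waveR`. -/
def waveR' (k M x : ℝ) : ℂ :=
  ((deriv Real.smoothTransition (x - M) : ℝ) : ℂ) * modeE k x +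
    (Real.smoothTransition (x - M) : ℂ) * (Complex.I * k * modeE k x)

/-- The source `-(∂² + k²) waveR`. -/
def waveSource (k M x : ℝ) : ℂ :=
  -(((deriv (deriv Real.smoothTransition) (x - M) : ℝ) : ℂ) +
    2 * Complex.I * k * ((deriv Real.smoothTransition (x - M) : ℝ) : ℂ)) * modeE k x

theorem contDiff_waveR (k M : ℝ) : ContDiff ℝ ∞ (waveR k M) :=
  (Complex.ofRealCLM.contDiff.comp
    (contDiff_smoothTransition.comp (contDiff_id.sub contDiff_const))).mul (contDiff_modeE k)

theorem continuous_waveSource (k M : ℝ) : Continuous (waveSource k M) := by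
  have h1 := contDiff_deriv_smoothTransition.continuous
  have h2 := contDiff_deriv_deriv_smoothTransition.continuous
  unfold waveSource
  fun_prop

theorem hasDerivAt_comp_sub {u : ℝ → ℝ} {u' M x : ℝ} (h : HasDerivAt u u' (x - M)) :
    HasDerivAt (fun x : ℝ => (u (x - M) : ℂ)) (u' : ℂ) x :=
  HasDerivAt.ofReal_comp (HasDerivAt.comp_sub_const x M h)

theorem hasDerivAt_waveR (k M x : ℝ) : HasDerivAt (waveR k M) (waveR' k M x) x :=
  (hasDerivAt_comp_sub (hasDerivAt_smoothTransition (x - M))).mul (hasDerivAt_modeE k x)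

theorem hasDerivAt_waveR' (k M x : ℝ) :
    HasDerivAt (waveR' k M) (-waveSource k M x - (k : ℂ) ^ 2 * waveR k M x) x := by
  have h1 := (hasDerivAt_comp_sub (hasDerivAt_deriv_smoothTransition (x - M))).mul
    (hasDerivAt_modeE k x)
  have h2 := (hasDerivAt_comp_sub (hasDerivAt_smoothTransition (x - M))).mul
    ((hasDerivAt_modeE k x).const_mul (Complex.I * k))
  convert! h1.add h2 using 1
  simp only [waveSource, waveR]
  linear_combination (-(Real.smoothTransition (x - M) : ℂ) * (k : ℂ) ^ 2 * modeE k x) *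
    Complex.I_sq

theorem waveR_eq_zero (k : ℝ) {M x : ℝ} (h : x ≤ M) : waveR k M x = 0 := by
  rw [waveR, Real.smoothTransition.zero_of_nonpos (by linarith)]
  simp

theorem waveR_eq (k : ℝ) {M x : ℝ} (h : M + 1 ≤ x) : waveR k M x = modeE k x := by
  rw [waveR, Real.smoothTransition.one_of_one_le (by linarith)]
  simp

theorem waveSource_eq_zero (k : ℝ) {M x : ℝ} (h : x ∉ Set.Icc M (M + 1)) :
    waveSource k M x = 0 := by
  have h1 : x - M ∉ Set.Icc (0 : ℝ) 1 := fun h1 => h ⟨by linarith [h1.1], by linarith [h1.2]⟩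
  rw [waveSource, deriv_smoothTransition_eq_zero h1, deriv_deriv_smoothTransition_eq_zero h1]
  simp

theorem exists_bound_waveSource (k : ℝ) : ∃ C : ℝ, 0 ≤ C ∧ ∀ M x, ‖waveSource k M x‖ ≤ C := by
  obtain ⟨C, h0, h1, h2⟩ := exists_bound_deriv_smoothTransition
  refine ⟨C + 2 * |k| * C, by positivity, fun M x => ?_⟩
  rw [waveSource, norm_mul, norm_modeE, mul_one, norm_neg]
  refine (norm_add_le _ _).trans (add_le_add ?_ ?_)
  · rw [Complex.norm_real]
    exact h2 _
  · rw [norm_mul, norm_mul, norm_mul, Complex.norm_I, Complex.norm_real, Complex.norm_real]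
    simp only [Complex.norm_ofNat, mul_one, Real.norm_eq_abs]
    exact mul_le_mul_of_nonneg_left (h1 _) (by positivity)

/-- Energy flux of the truncated wave. -/
theorem integral_flux (k : ℝ) {M : ℝ} (hM : 1 ≤ M) :
    (∫ x, waveSource k M x * (starRingEnd ℂ) (waveR k 0 x - waveR k M x)).im = -k := by
  have hint : Integrable fun x =>
      waveSource k M x * (starRingEnd ℂ) (waveR k 0 x - waveR k M x) := by
    refine integrable_line ((continuous_waveSource k M).mul (Complex.continuous_conj.comp
      ((contDiff_waveR k 0).continuous.sub (contDiff_waveR k M).continuous)))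
      ⟨M + 1, fun x hx => ?_⟩
    rw [waveSource_eq_zero k, zero_mul]
    intro h
    rw [abs_of_nonneg (by linarith [h.1])] at hx
    linarith [h.2]
  -- Because M ≥ 1, the first wave is the full e^{ikx} wherever the source lives. With χ the shifted
  -- cut-off, the phases cancel, the χ'' term is real, and what is left is -2kχ'(1-χ).
  have e : ∀ x, (waveSource k M x * (starRingEnd ℂ) (waveR k 0 x - waveR k M x)).im =
      -(2 * k) * (deriv Real.smoothTransition (x - M) * (1 - Real.smoothTransition (x - M))) := by
    intro x
    by_cases hx : x ∈ Set.Icc M (M + 1)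
    · have e1 : waveR k 0 x - waveR k M x =
          ((1 - Real.smoothTransition (x - M) : ℝ) : ℂ) * modeE k x := by
        rw [waveR_eq k (by linarith [hx.1]), waveR]
        push_cast
        ring
      have e2 : waveSource k M x * (starRingEnd ℂ) (waveR k 0 x - waveR k M x) =
          -(((deriv (deriv Real.smoothTransition) (x - M) : ℝ) : ℂ) +
            2 * Complex.I * k * ((deriv Real.smoothTransition (x - M) : ℝ) : ℂ)) *
            ((1 - Real.smoothTransition (x - M) : ℝ) : ℂ) := by
        rw [e1, waveSource, map_mul, Complex.conj_ofReal]
        linear_combination (-(((deriv (deriv Real.smoothTransition) (x - M) : ℝ) : ℂ) +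
            2 * Complex.I * k * ((deriv Real.smoothTransition (x - M) : ℝ) : ℂ)) *
            ((1 - Real.smoothTransition (x - M) : ℝ) : ℂ)) * modeE_mul_conj k x
      rw [e2, Complex.im_mul_ofReal]
      simp
      ring
    · have h1 : x - M ∉ Set.Icc (0 : ℝ) 1 := fun h1 => hx ⟨by linarith [h1.1], by linarith [h1.2]⟩
      rw [waveSource_eq_zero k hx, deriv_smoothTransition_eq_zero h1]
      simp
  have him := integral_im hint
  simp only [RCLike.im_to_complex] at him
  rw [← him]
  simp only [e]
  rw [integral_const_mul]
  -- χ - χ²/2 is a primitive of χ'(1-χ); it rises from 0 to 1/2, so the flux is -k.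
  have hd : ∀ x, HasDerivAt
      (fun x => Real.smoothTransition (x - M) - Real.smoothTransition (x - M) ^ 2 / 2)
      (deriv Real.smoothTransition (x - M) * (1 - Real.smoothTransition (x - M))) x := by
    intro x
    have h1 := HasDerivAt.comp_sub_const x M (hasDerivAt_smoothTransition (x - M))
    convert! h1.sub ((h1.pow 2).div_const 2) using 1
    ring
  have hcd := contDiff_deriv_smoothTransition.continuous
  have hi : Integrable fun x =>
      deriv Real.smoothTransition (x - M) * (1 - Real.smoothTransition (x - M)) := by
    refine Continuous.integrable_of_hasCompactSupport (by fun_prop)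
      (HasCompactSupport.intro (isCompact_Icc (a := M) (b := M + 1)) fun x hx => ?_)
    rw [deriv_smoothTransition_eq_zero, zero_mul]
    exact fun h1 => hx ⟨by linarith [h1.1], by linarith [h1.2]⟩
  have hb : Filter.Tendsto
      (fun x => Real.smoothTransition (x - M) - Real.smoothTransition (x - M) ^ 2 / 2)
      Filter.atBot (𝓝 0) := by
    refine tendsto_const_nhds.congr' ?_
    filter_upwards [Filter.eventually_le_atBot M] with x hx
    rw [Real.smoothTransition.zero_of_nonpos (by linarith)]
    simp
  have ht : Filter.Tendsto
      (fun x => Real.smoothTransition (x - M) - Real.smoothTransition (x - M) ^ 2 / 2)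
      Filter.atTop (𝓝 (1 / 2)) := by
    refine tendsto_const_nhds.congr' ?_
    filter_upwards [Filter.eventually_ge_atTop (M + 1)] with x hx
    rw [Real.smoothTransition.one_of_one_le (by linarith)]
    norm_num
  rw [integral_of_hasDerivAt_of_tendsto hd hi hb ht]
  ring

/-- `τ h(x) + ρ h(-x)`. -/
def twoSided (τ ρ : ℂ) (h : ℝ → ℂ) (x : ℝ) : ℂ := τ * h x + ρ * h (-x)

theorem hasDerivAt_twoSided (τ ρ : ℂ) {h h' : ℝ → ℂ} (hh : ∀ x, HasDerivAt h (h' x) x) (x : ℝ) :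
    HasDerivAt (twoSided τ ρ h) (twoSided τ (-ρ) h' x) x := by
  have h1 : HasDerivAt (fun x => h (-x)) (-(h' (-x))) x := by
    have h2 := (hh (-x)).scomp x (hasDerivAt_neg x)
    rw [neg_one_smul] at h2
    exact h2
  convert! ((hh x).const_mul τ).add (h1.const_mul ρ) using 1
  simp only [twoSided]
  ring

theorem contDiff_twoSided (τ ρ : ℂ) {h : ℝ → ℂ} (hh : ContDiff ℝ ∞ h) :
    ContDiff ℝ ∞ (twoSided τ ρ h) :=
  (contDiff_const.mul hh).add (contDiff_const.mul (hh.comp contDiff_neg))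

theorem farField_eq (β k : ℝ) (r t : ℂ) (p : ℝ × ℝ) :
    farField β k r t p =
      (twoSided t r (waveR k 0) p.1 + (Real.smoothTransition (-p.1) : ℂ) * modeE k p.1) *
        modeE β p.2 := by
  have e1 : Complex.exp (Complex.I * (β * p.2 + k * p.1)) = modeE k p.1 * modeE β p.2 := by
    rw [modeE, modeE, ← Complex.exp_add]
    congr 1
    ring
  have e2 : Complex.exp (Complex.I * (β * p.2 - k * p.1)) = modeE k (-p.1) * modeE β p.2 := by
    rw [modeE, modeE, ← Complex.exp_add]
    congr 1
    push_cast
    ring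
  rw [farField, e1, e2, twoSided, waveR, waveR, sub_zero, sub_zero]
  ring

theorem contDiff_farField (β k : ℝ) (r t : ℂ) : ContDiff ℝ ∞ (farField β k r t) := by
  have h : farField β k r t = fun p =>
      (twoSided t r (waveR k 0) p.1 + (Real.smoothTransition (-p.1) : ℂ) * modeE k p.1) *
        modeE β p.2 := funext (farField_eq β k r t)
  rw [h]
  have h1 : ContDiff ℝ ∞ fun x : ℝ => (Real.smoothTransition (-x) : ℂ) :=
    Complex.ofRealCLM.contDiff.comp (contDiff_smoothTransition.comp contDiff_neg)
  have h2 : ContDiff ℝ ∞ fun x : ℝ =>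
      twoSided t r (waveR k 0) x + (Real.smoothTransition (-x) : ℂ) * modeE k x :=
    (contDiff_twoSided t r (contDiff_waveR k 0)).add (h1.mul (contDiff_modeE k))
  exact (h2.comp contDiff_fst).mul ((contDiff_modeE β).comp contDiff_snd)

end

section

variable {R : ℝ} {f : ℝ × ℝ → ℝ} {β : ℝ}

/-! ### Uniqueness of the scattering coefficients -/

/-- The potential `ω² (1 + ε f)`. -/
def potential (f : ℝ × ℝ → ℝ) (ε μ β : ℝ) (p : ℝ × ℝ) : ℝ :=
  ((1 - β) ^ 2 - μ ^ 2) * (1 + ε * f p)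

theorem continuous_potential (hf : Continuous f) (ε μ β : ℝ) :
    Continuous (potential f ε μ β) := by
  unfold potential
  fun_prop

theorem integral_potential (f : ℝ × ℝ → ℝ) (ε μ β : ℝ) (Ψ Φ : ℝ × ℝ → ℂ) :
    ∫ p, (potential f ε μ β p : ℂ) * Ψ p * (starRingEnd ℂ) (Φ p) ∂stripMeasure =
      (((1 - β) ^ 2 - μ ^ 2 : ℝ) : ℂ) *
        ∫ p, (1 + (ε : ℂ) * (f p : ℂ)) * Ψ p * (starRingEnd ℂ) (Φ p) ∂stripMeasure := by
  rw [← integral_const_mul]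
  refine integral_congr_ae (Filter.Eventually.of_forall fun p => ?_)
  simp only [potential]
  push_cast
  ring

theorem isScatteringSolution_iff (f : ℝ × ℝ → ℝ) (ε μ β : ℝ) (Ψ : ℝ × ℝ → ℂ) (r t : ℂ) :
    IsScatteringSolution f ε μ β Ψ r t ↔ ∃ wx wy : ℝ × ℝ → ℂ,
      InH1 β (Ψ - farField β (kZero μ β) r t) wx wy ∧ ∀ Φ : ℝ × ℝ → ℂ, IsTest β Φ →
        weakForm (fun p => (potential f ε μ β p : ℂ)) Ψ (dX (farField β (kZero μ β) r t) + wx)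
          (dY (farField β (kZero μ β) r t) + wy) Φ = 0 := by
  simp only [weakForm, sub_eq_zero, integral_potential]
  rfl

theorem Perturbation.exists_bound (hf : Perturbation f R) : ∃ C : ℝ, ∀ p, |f p| ≤ C := by
  obtain ⟨C, hC⟩ := (isCompact_Icc.prod isCompact_Icc :
    IsCompact (Set.Icc (-R) R ×ˢ Set.Icc (0 : ℝ) (2 * Real.pi))).exists_bound_of_continuousOn
      hf.cont.continuousOn
  refine ⟨max C 0, fun p => ?_⟩
  by_cases hx : R < |p.1|
  · have : f p = 0 := hf.supp p.1 p.2 hx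
    rw [this, abs_zero]
    exact le_max_right _ _
  · have hp : Function.Periodic (fun y => f (p.1, y)) (2 * Real.pi) := fun y => hf.per p.1 y
    obtain ⟨y, hy, he⟩ := hp.exists_mem_Ico₀ (by positivity) p.2
    have h2 : f p = f (p.1, y) := he
    rw [h2]
    exact (hC (p.1, y) ⟨abs_le.1 (not_lt.1 hx), ⟨hy.1, hy.2.le⟩⟩).trans (le_max_left _ _)

theorem integral_strip_mode (h : ℝ → ℂ) (β : ℝ) :
    ∫ p : ℝ × ℝ, h p.1 * (modeE β p.2 * (starRingEnd ℂ) (modeE β p.2)) ∂stripMeasure =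
      2 * Real.pi * ∫ x, h x := by
  rw [stripMeasure_eq, integral_prod_mul (f := h)
    (g := fun y => modeE β y * (starRingEnd ℂ) (modeE β y)), mul_comm]
  simp only [modeE_mul_conj]
  congr 1
  rw [setIntegral_const]
  simp [Real.pi_pos.le]

theorem isTest_mode_zero (β : ℝ) {u : ℝ → ℂ} (hu : ContDiff ℝ ∞ u)
    (hv : ∃ M : ℝ, ∀ x : ℝ, M < |x| → u x = 0) :
    IsTest β (fun p => u p.1 * modeE β p.2) := by
  simpa using isTest_mode β 0 hu hv

theorem integral_mode_zero {Φ : ℝ × ℝ → ℂ} (hΦ : IsTest β Φ) {u u' u'' : ℝ → ℂ}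
    (hu : ∀ x, HasDerivAt u (u' x) x) (hu' : ∀ x, HasDerivAt u' (u'' x) x)
    (hc : Continuous u'') :
    ∫ p, (u' p.1 * modeE β p.2 * (starRingEnd ℂ) (dX Φ p) +
      u p.1 * (Complex.I * (β : ℂ) * modeE β p.2) * (starRingEnd ℂ) (dY Φ p)) ∂stripMeasure =
    ∫ p, (-u'' p.1 + (β : ℂ) ^ 2 * u p.1) * modeE β p.2 * (starRingEnd ℂ) (Φ p) ∂stripMeasure := by
  simpa using integral_mode hΦ 0 hu hu' hc

/-- The weak form of a truncated outgoing wave. -/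
theorem weakForm_truncated (hf : Perturbation f R) {ε μ M : ℝ} (hpos : 0 < 1 - 2 * β - μ ^ 2)
    (hM : R ≤ M) (τ ρ : ℂ) {Φ : ℝ × ℝ → ℂ} (hΦ : IsTest β Φ) :
    weakForm (fun p => (potential f ε μ β p : ℂ))
      (fun p => twoSided τ ρ (waveR (kZero μ β) M) p.1 * modeE β p.2)
      (dX fun p => twoSided τ ρ (waveR (kZero μ β) M) p.1 * modeE β p.2)
      (dY fun p => twoSided τ ρ (waveR (kZero μ β) M) p.1 * modeE β p.2) Φ =
    ∫ p, twoSided τ ρ (waveSource (kZero μ β) M) p.1 * modeE β p.2 *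
      (starRingEnd ℂ) (Φ p) ∂stripMeasure := by
  set k := kZero μ β with hk
  have hk2 : k ^ 2 = 1 - 2 * β - μ ^ 2 := Real.sq_sqrt hpos.le
  have d1 := hasDerivAt_twoSided τ ρ (hasDerivAt_waveR k M)
  have d2 := hasDerivAt_twoSided τ (-ρ) (hasDerivAt_waveR' k M)
  have cs := continuous_waveSource k M
  have cw := (contDiff_waveR k M).continuous
  have c2 : Continuous (twoSided τ (- -ρ)
      fun x => -waveSource k M x - (k : ℂ) ^ 2 * waveR k M x) := by
    unfold twoSided
    fun_prop
  have ex : dX (fun p => twoSided τ ρ (waveR k M) p.1 * modeE β p.2) =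
      fun p => twoSided τ (-ρ) (waveR' k M) p.1 * modeE β p.2 := funext fun p => dX_mode d1 β p
  have ey : dY (fun p => twoSided τ ρ (waveR k M) p.1 * modeE β p.2) =
      fun p => twoSided τ ρ (waveR k M) p.1 * (Complex.I * β * modeE β p.2) :=
    funext fun p => dY_mode _ β p
  have cu : Continuous (twoSided τ ρ (waveR k M)) :=
    (contDiff_twoSided τ ρ (contDiff_waveR k M)).continuous
  rw [weakForm, ex, ey, integral_mode_zero hΦ d1 d2 c2, ← integral_sub]
  · refine integral_congr_ae (Filter.Eventually.of_forall fun p => ?_)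
    -- Since M ≥ R, the truncated wave vanishes for |x| ≤ R, the only place where f can be nonzero;
    -- the potential acts as the constant ω² = k² + β².
    have hpot : (potential f ε μ β p : ℂ) * twoSided τ ρ (waveR k M) p.1 =
        (((1 - β) ^ 2 - μ ^ 2 : ℝ) : ℂ) * twoSided τ ρ (waveR k M) p.1 := by
      by_cases hx : R < |p.1|
      · have : f p = 0 := hf.supp p.1 p.2 hx
        rw [potential, this, mul_zero, add_zero, mul_one]
      · have h1 := abs_le.1 (not_lt.1 hx)
        rw [twoSided, waveR_eq_zero k (by linarith [h1.2]), waveR_eq_zero k (by linarith [h1.1])]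
        simp
    have hk3 : (((1 - β) ^ 2 - μ ^ 2 : ℝ) : ℂ) = (k : ℂ) ^ 2 + (β : ℂ) ^ 2 := by
      rw [← Complex.ofReal_pow, hk2]
      push_cast
      ring
    simp only
    rw [← mul_assoc (potential f ε μ β p : ℂ), hpot, hk3]
    simp only [twoSided]
    ring
  · exact hΦ.integrable_mul (by fun_prop)
  · have := Complex.continuous_ofReal.comp (continuous_potential hf.cont ε μ β)
    exact hΦ.integrable_mul
      (g := fun p => (potential f ε μ β p : ℂ) * (twoSided τ ρ (waveR k M) p.1 * modeE β p.2))
      (this.mul (by fun_prop))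

theorem twoSided_waveSource_eq_zero (k : ℝ) (τ ρ : ℂ) {M x : ℝ}
    (h : x ∉ Set.Icc M (M + 1) ∪ Set.Icc (-(M + 1)) (-M)) :
    twoSided τ ρ (waveSource k M) x = 0 := by
  have h1 : x ∉ Set.Icc M (M + 1) := fun h1 => h (Or.inl h1)
  have h2 : -x ∉ Set.Icc M (M + 1) := fun h2 =>
    h (Or.inr ⟨by linarith [h2.2], by linarith [h2.1]⟩)
  rw [twoSided, waveSource_eq_zero k h1, waveSource_eq_zero k h2]
  simp

/-- The source lies on two slabs of width one and is bounded independently of M. Uniformity in M is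
used when M is sent far out in the proof of uniqueness. -/
theorem exists_bound_eLpNorm_source (k : ℝ) (τ ρ : ℂ) (β : ℝ) : ∃ C : ENNReal, C ≠ ⊤ ∧
    ∀ M : ℝ, eLpNorm (fun p : ℝ × ℝ => twoSided τ ρ (waveSource k M) p.1 * modeE β p.2) 2
      stripMeasure ≤ C := by
  obtain ⟨B, hB0, hB⟩ := exists_bound_waveSource k
  refine ⟨‖((‖τ‖ + ‖ρ‖) * B : ℝ)‖ₑ * (2 * ENNReal.ofReal (2 * Real.pi)) ^ (1 / (2 : ℝ)),
    ENNReal.mul_ne_top enorm_ne_top (ENNReal.rpow_ne_top_of_nonneg (by norm_num)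
      (ENNReal.mul_ne_top (by simp) ENNReal.ofReal_ne_top)), fun M => ?_⟩
  set S := (Set.Icc M (M + 1) ∪ Set.Icc (-(M + 1)) (-M)) ×ˢ (Set.univ : Set ℝ)
  have h1 : eLpNorm (fun p : ℝ × ℝ => twoSided τ ρ (waveSource k M) p.1 * modeE β p.2) 2
      stripMeasure ≤ eLpNorm (S.indicator fun _ => ((‖τ‖ + ‖ρ‖) * B : ℝ)) 2 stripMeasure := by
    refine eLpNorm_mono fun p => ?_
    rw [norm_mul, norm_modeE, mul_one]
    by_cases hp : p ∈ S
    · rw [Set.indicator_of_mem hp, Real.norm_of_nonneg (by positivity), add_mul]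
      refine (norm_add_le _ _).trans (add_le_add ?_ ?_)
      · rw [norm_mul]
        exact mul_le_mul_of_nonneg_left (hB _ _) (norm_nonneg _)
      · rw [norm_mul]
        exact mul_le_mul_of_nonneg_left (hB _ _) (norm_nonneg _)
    · rw [Set.indicator_of_notMem hp,
        twoSided_waveSource_eq_zero k τ ρ (fun h => hp ⟨h, trivial⟩)]
      simp
  refine h1.trans ((eLpNorm_indicator_const_le _ _).trans ?_)
  have hS : stripMeasure S ≤ 2 * ENNReal.ofReal (2 * Real.pi) := by
    rw [stripMeasure_prod_univ]
    refine mul_le_mul' ((measure_union_le _ _).trans ?_) le_rfl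
    rw [Real.volume_Icc, Real.volume_Icc, show M + 1 - M = 1 by ring,
      show -M - -(M + 1) = 1 by ring, ENNReal.ofReal_one]
    norm_num
  rw [ENNReal.toReal_ofNat]
  exact mul_le_mul' le_rfl (ENNReal.rpow_le_rpow hS (by norm_num))

theorem vanish_truncated (k : ℝ) (τ ρ : ℂ) (M : ℝ) (hM : 0 ≤ M) (x : ℝ) (hx : M + 1 < |x|) :
    twoSided τ ρ (fun x => waveR k 0 x - waveR k M x) x = 0 := by
  have h : ∀ y : ℝ, M + 1 < |y| → waveR k 0 y - waveR k M y = 0 := fun y hy => by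
    rcases le_or_gt y 0 with h1 | h1
    · rw [waveR_eq_zero k h1, waveR_eq_zero k (h1.trans hM), sub_zero]
    · rw [abs_of_pos h1] at hy
      rw [waveR_eq k (by linarith), waveR_eq k hy.le, sub_self]
  rw [twoSided, h x hx, h (-x) (by rwa [abs_neg])]
  simp

/-- Right-going and left-going parts have disjoint supports, so no cross term in τρ̄ appears; each
side contributes its own one-dimensional flux, and the integral over y the factor 2π. -/
theorem flux_truncated (k : ℝ) (τ ρ : ℂ) (β : ℝ) {M : ℝ} (hM : 1 ≤ M) :
    (∫ p : ℝ × ℝ, twoSided τ ρ (waveSource k M) p.1 * modeE β p.2 * (starRingEnd ℂ)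
      (twoSided τ ρ (fun x => waveR k 0 x - waveR k M x) p.1 * modeE β p.2) ∂stripMeasure).im =
    -(2 * Real.pi * k * (‖τ‖ ^ 2 + ‖ρ‖ ^ 2)) := by
  have e : ∀ p : ℝ × ℝ, twoSided τ ρ (waveSource k M) p.1 * modeE β p.2 * (starRingEnd ℂ)
      (twoSided τ ρ (fun x => waveR k 0 x - waveR k M x) p.1 * modeE β p.2) =
      (twoSided τ ρ (waveSource k M) p.1 * (starRingEnd ℂ)
        (twoSided τ ρ (fun x => waveR k 0 x - waveR k M x) p.1)) *
        (modeE β p.2 * (starRingEnd ℂ) (modeE β p.2)) := fun p => by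
    rw [map_mul]
    ring
  set d : ℝ → ℂ := fun x => waveR k 0 x - waveR k M x with hd
  have hdc : Continuous d := (contDiff_waveR k 0).continuous.sub (contDiff_waveR k M).continuous
  have d0 : ∀ x, x ≤ 0 → d x = 0 := fun x hx => by
    rw [hd]
    simp only
    rw [waveR_eq_zero k hx, waveR_eq_zero k (by linarith), sub_zero]
  have s0 : ∀ x, x ≤ 0 → waveSource k M x = 0 := fun x hx =>
    waveSource_eq_zero k fun h => by linarith [h.1]
  rw [integral_congr_ae (Filter.Eventually.of_forall e), integral_strip_mode (fun x =>
    twoSided τ ρ (waveSource k M) x * (starRingEnd ℂ) (twoSided τ ρ d x))]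
  have e2 : ∀ x, twoSided τ ρ (waveSource k M) x * (starRingEnd ℂ) (twoSided τ ρ d x) =
      ((‖τ‖ ^ 2 : ℝ) : ℂ) * (waveSource k M x * (starRingEnd ℂ) (d x)) +
      ((‖ρ‖ ^ 2 : ℝ) : ℂ) * (waveSource k M (-x) * (starRingEnd ℂ) (d (-x))) := by
    intro x
    have h1 : ((‖τ‖ ^ 2 : ℝ) : ℂ) = τ * (starRingEnd ℂ) τ := by
      rw [Complex.mul_conj, Complex.normSq_eq_norm_sq]
    have h2 : ((‖ρ‖ ^ 2 : ℝ) : ℂ) = ρ * (starRingEnd ℂ) ρ := by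
      rw [Complex.mul_conj, Complex.normSq_eq_norm_sq]
    rw [h1, h2]
    simp only [twoSided, map_add, map_mul]
    rcases le_total x 0 with hx | hx
    · rw [d0 x hx, s0 x hx]
      simp
      ring
    · rw [d0 (-x) (by linarith), s0 (-x) (by linarith)]
      simp
      ring
  have hint : Integrable fun x => waveSource k M x * (starRingEnd ℂ) (d x) := by
    refine integrable_line ((continuous_waveSource k M).mul (Complex.continuous_conj.comp hdc))
      ⟨M + 1, fun x hx => ?_⟩
    rw [waveSource_eq_zero k, zero_mul]
    intro h
    rw [abs_of_nonneg (by linarith [h.1])] at hx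
    linarith [h.2]
  have hfl := integral_flux k hM
  rw [integral_congr_ae (Filter.Eventually.of_forall e2),
    integral_add (hint.const_mul _) (hint.comp_neg.const_mul _), integral_const_mul,
    integral_const_mul, integral_neg_eq_self (fun x => waveSource k M x * (starRingEnd ℂ) (d x)),
    ← add_mul, ← Complex.ofReal_add, ← mul_assoc]
  have : (2 * Real.pi : ℂ) * ((‖τ‖ ^ 2 + ‖ρ‖ ^ 2 : ℝ) : ℂ) =
      ((2 * Real.pi * (‖τ‖ ^ 2 + ‖ρ‖ ^ 2) : ℝ) : ℂ) := by push_cast; ring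
  rw [this, Complex.im_ofReal_mul, hfl]
  ring

/-- The scattering coefficients are determined by the parameters. -/
theorem scattering_unique (hf : Perturbation f R) {ε μ : ℝ} (hpos : 0 < 1 - 2 * β - μ ^ 2)
    {Ψ₁ Ψ₂ : ℝ × ℝ → ℂ} {r₁ t₁ r₂ t₂ : ℂ} (h1 : IsScatteringSolution f ε μ β Ψ₁ r₁ t₁)
    (h2 : IsScatteringSolution f ε μ β Ψ₂ r₂ t₂) : r₁ = r₂ ∧ t₁ = t₂ := by
  obtain ⟨wx₁, wy₁, hw₁, hs₁⟩ := (isScatteringSolution_iff f ε μ β Ψ₁ r₁ t₁).1 h1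
  obtain ⟨wx₂, wy₂, hw₂, hs₂⟩ := (isScatteringSolution_iff f ε μ β Ψ₂ r₂ t₂).1 h2
  have hk : 0 < kZero μ β := kZero_pos hpos
  set k := kZero μ β with hkdef
  set far₁ := farField β k r₁ t₁ with hf1
  set far₂ := farField β k r₂ t₂ with hf2
  have cf1 : ContDiff ℝ ∞ far₁ := contDiff_farField β k r₁ t₁
  have cf2 : ContDiff ℝ ∞ far₂ := contDiff_farField β k r₂ t₂
  set τ := t₁ - t₂ with hτ
  set ρ := r₁ - r₂ with hρ
  have hw := hw₁.sub hw₂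
  have hρc : Continuous fun p => (potential f ε μ β p : ℂ) :=
    Complex.continuous_ofReal.comp (continuous_potential hf.cont ε μ β)
  obtain ⟨C, hC⟩ := hf.exists_bound
  obtain ⟨B, hBt, hB⟩ := exists_bound_eLpNorm_source k τ ρ β
  -- Subtracting the solutions removes the incident wave and leaves a homogeneous problem with
  -- outgoing amplitudes τ and ρ.
  have hdiff : ∀ Φ, IsTest β Φ → weakForm (fun p => (potential f ε μ β p : ℂ)) (Ψ₁ - Ψ₂)
      (dX (far₁ - far₂) + (wx₁ - wx₂)) (dY (far₁ - far₂) + (wy₁ - wy₂)) Φ = 0 := fun Φ hΦ => by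
    have p1 : Pairs Ψ₁ := by
      have := (Pairs.of_memLp hw₁.1).add (Pairs.of_continuous cf1.continuous)
      rwa [sub_add_cancel] at this
    have p2 : Pairs Ψ₂ := by
      have := (Pairs.of_memLp hw₂.1).add (Pairs.of_continuous cf2.continuous)
      rwa [sub_add_cancel] at this
    have hneg : ∀ {g : ℝ × ℝ → ℂ}, Pairs g → Pairs (-g) := fun {g} hg => by
      have := hg.mul (ρ := fun _ => -1) continuous_const
      simp only [neg_one_mul] at this
      exact this
    have h := weakForm_add hρc hΦ p1
      ((Pairs.of_continuous (continuous_dX cf1)).add (Pairs.of_memLp hw₁.2.1))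
      ((Pairs.of_continuous (continuous_dY cf1)).add (Pairs.of_memLp hw₁.2.2.1)) (hneg p2)
      (hneg ((Pairs.of_continuous (continuous_dX cf2)).add (Pairs.of_memLp hw₂.2.1)))
      (hneg ((Pairs.of_continuous (continuous_dY cf2)).add (Pairs.of_memLp hw₂.2.2.1)))
    rw [weakForm_neg, hs₁ Φ hΦ, hs₂ Φ hΦ, neg_zero, add_zero] at h
    rw [← h, dX_sub cf1 cf2, dY_sub cf1 cf2]
    congr 1 <;> abel
  -- The outgoing field is split at distance M as U + Q, with U a test function and Q starting
  -- beyond M. Then U + w is in H¹ and satisfies the weak problem with the source of Q as right-hand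
  -- side. The flux identity makes the total flux real, and the contribution of U is known
  -- explicitly, so the contribution of w must compensate it.
  have key : ∀ M : ℝ, R ≤ M → 1 ≤ M → (∫ p : ℝ × ℝ, twoSided τ ρ (waveSource k M) p.1 *
      modeE β p.2 * (starRingEnd ℂ) ((Ψ₁ - far₁ - (Ψ₂ - far₂)) p) ∂stripMeasure).im =
      2 * Real.pi * k * (‖τ‖ ^ 2 + ‖ρ‖ ^ 2) := by
    intro M hMR hM1
    set U : ℝ × ℝ → ℂ :=
      fun p => twoSided τ ρ (fun x => waveR k 0 x - waveR k M x) p.1 * modeE β p.2 with hU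
    set Q : ℝ × ℝ → ℂ := fun p => twoSided τ ρ (waveR k M) p.1 * modeE β p.2 with hQ
    have hUt : IsTest β U := isTest_mode_zero β
      (contDiff_twoSided τ ρ ((contDiff_waveR k 0).sub (contDiff_waveR k M)))
      ⟨M + 1, vanish_truncated k τ ρ M (by linarith)⟩
    have hQs : ContDiff ℝ ∞ Q :=
      ((contDiff_twoSided τ ρ (contDiff_waveR k M)).comp contDiff_fst).mul
        ((contDiff_modeE β).comp contDiff_snd)
    have hfar : far₁ - far₂ = U + Q := by
      ext p
      simp only [Pi.sub_apply, Pi.add_apply, hf1, hf2, farField_eq, hU, hQ, twoSided, hτ, hρ]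
      ring
    have hW := hUt.inH1.add hw
    have hgc : Continuous fun p : ℝ × ℝ => twoSided τ ρ (waveSource k M) p.1 * modeE β p.2 := by
      have := continuous_waveSource k M
      unfold twoSided
      fun_prop
    have hgv : ∀ x y : ℝ, M + 1 < |x| → twoSided τ ρ (waveSource k M) x * modeE β y = 0 := by
      intro x y hx
      rw [twoSided_waveSource_eq_zero k τ ρ, zero_mul]
      rintro (h | h)
      · rw [abs_of_nonneg (by linarith [h.1])] at hx
        linarith [h.2]
      · rw [abs_of_nonpos (by linarith [h.2])] at hx
        linarith [h.1]
    have hg : MemLp (fun p : ℝ × ℝ => twoSided τ ρ (waveSource k M) p.1 * modeE β p.2) 2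
        stripMeasure := memLp_of_vanish hgc ⟨M + 1, hgv⟩ 2
    have hpb : ∀ p, |potential f ε μ β p| ≤ |(1 - β) ^ 2 - μ ^ 2| * (1 + |ε| * C) := fun p => by
      rw [potential, abs_mul]
      refine mul_le_mul_of_nonneg_left ((abs_add_le _ _).trans ?_) (abs_nonneg _)
      rw [abs_one, abs_mul]
      exact add_le_add le_rfl (mul_le_mul_of_nonneg_left (hC p) (abs_nonneg _))
    have hfl := flux_im_eq_zero (continuous_potential hf.cont ε μ β) hpb hW hg fun Φ hΦ => by
      have h3 := hdiff Φ hΦ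
      have e1 : Ψ₁ - Ψ₂ = (U + (Ψ₁ - far₁ - (Ψ₂ - far₂))) + Q := by
        have : U = far₁ - far₂ - Q := by rw [hfar]; abel
        rw [this]
        abel
      have e2 : dX (far₁ - far₂) + (wx₁ - wx₂) = (dX U + (wx₁ - wx₂)) + dX Q := by
        rw [hfar, dX_add hUt.smooth hQs]
        abel
      have e3 : dY (far₁ - far₂) + (wy₁ - wy₂) = (dY U + (wy₁ - wy₂)) + dY Q := by
        rw [hfar, dY_add hUt.smooth hQs]
        abel
      rw [e1, e2, e3, weakForm_add hρc hΦ (Pairs.of_memLp hW.1) (Pairs.of_memLp hW.2.1)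
        (Pairs.of_memLp hW.2.2.1) (Pairs.of_continuous hQs.continuous)
        (Pairs.of_continuous (continuous_dX hQs)) (Pairs.of_continuous (continuous_dY hQs))] at h3
      rw [← weakForm_truncated hf hpos hMR τ ρ hΦ]
      exact h3
    have hsplit : ∫ p : ℝ × ℝ, twoSided τ ρ (waveSource k M) p.1 * modeE β p.2 *
        (starRingEnd ℂ) ((U + (Ψ₁ - far₁ - (Ψ₂ - far₂))) p) ∂stripMeasure =
        (∫ p : ℝ × ℝ, twoSided τ ρ (waveSource k M) p.1 * modeE β p.2 *
          (starRingEnd ℂ) (U p) ∂stripMeasure) +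
        ∫ p : ℝ × ℝ, twoSided τ ρ (waveSource k M) p.1 * modeE β p.2 *
          (starRingEnd ℂ) ((Ψ₁ - far₁ - (Ψ₂ - far₂)) p) ∂stripMeasure := by
      rw [← integral_add (integrable_mul_conj hg hUt.memLp) (integrable_mul_conj hg hw.1)]
      refine integral_congr_ae (Filter.Eventually.of_forall fun p => ?_)
      simp only [Pi.add_apply, map_add]
      ring
    rw [hsplit, Complex.add_im, flux_truncated k τ ρ β hM1] at hfl
    linarith
  -- The left side does not depend on M. For a test function φ_n close to w, take M beyond its
  -- support: the source then does not meet φ_n, and the flux is at most B‖φ_n - w‖, which tends to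
  -- 0.
  have hle : 2 * Real.pi * k * (‖τ‖ ^ 2 + ‖ρ‖ ^ 2) ≤ 0 := by
    obtain ⟨m1, -, -, φ, hφ, t1, -, -⟩ := hw
    have ht : Filter.Tendsto (fun n => B.toReal * (eLpNorm
        (φ n - (Ψ₁ - far₁ - (Ψ₂ - far₂))) 2 stripMeasure).toReal) Filter.atTop (𝓝 0) := by
      have := ((ENNReal.tendsto_toReal ENNReal.zero_ne_top).comp t1).const_mul B.toReal
      simpa using this
    refine ge_of_tendsto' ht fun n => ?_
    obtain ⟨N, hN⟩ := (hφ n).vanish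
    set M := max (max R 1) (N + 1)
    have hMR : R ≤ M := (le_max_left _ _).trans (le_max_left _ _)
    have hM1 : 1 ≤ M := (le_max_right _ _).trans (le_max_left _ _)
    have hMN : N + 1 ≤ M := le_max_right _ _
    rw [← key M hMR hM1]
    have hg : MemLp (fun p : ℝ × ℝ => twoSided τ ρ (waveSource k M) p.1 * modeE β p.2) 2
        stripMeasure := by
      have := continuous_waveSource k M
      refine ⟨Continuous.aestronglyMeasurable (by unfold twoSided; fun_prop),
        (hB M).trans_lt hBt.lt_top⟩
    have h0 : ∀ p : ℝ × ℝ, twoSided τ ρ (waveSource k M) p.1 * modeE β p.2 *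
        (starRingEnd ℂ) (φ n p) = 0 := fun p => by
      by_cases hp : N < |p.1|
      · have : φ n p = 0 := hN p.1 p.2 hp
        rw [this, map_zero, mul_zero]
      · rw [twoSided_waveSource_eq_zero k τ ρ, zero_mul, zero_mul]
        have hp' := abs_le.1 (not_lt.1 hp)
        rintro (h | h)
        · linarith [h.1]
        · linarith [h.2]
    have e : ∫ p : ℝ × ℝ, twoSided τ ρ (waveSource k M) p.1 * modeE β p.2 *
        (starRingEnd ℂ) ((Ψ₁ - far₁ - (Ψ₂ - far₂)) p) ∂stripMeasure =
        -∫ p : ℝ × ℝ, twoSided τ ρ (waveSource k M) p.1 * modeE β p.2 *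
        (starRingEnd ℂ) ((φ n - (Ψ₁ - far₁ - (Ψ₂ - far₂))) p) ∂stripMeasure := by
      rw [← integral_neg]
      refine integral_congr_ae (Filter.Eventually.of_forall fun p => ?_)
      simp only
      rw [Pi.sub_apply (φ n), map_sub, mul_sub, h0]
      ring
    rw [e]
    refine (Complex.im_le_norm _).trans ?_
    rw [norm_neg]
    refine (norm_integral_mul_conj_le hg ((hφ n).memLp.sub m1)).trans ?_
    exact mul_le_mul_of_nonneg_right (ENNReal.toReal_mono hBt (hB M)) ENNReal.toReal_nonneg
  have hpk : 0 < 2 * Real.pi * k := by positivity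
  have hz : ‖τ‖ ^ 2 + ‖ρ‖ ^ 2 ≤ 0 := by
    by_contra h
    exact absurd hle (not_le.2 (mul_pos hpk (not_le.1 h)))
  have h5 : ‖τ‖ = 0 := by nlinarith [sq_nonneg ‖τ‖, sq_nonneg ‖ρ‖]
  have h6 : ‖ρ‖ = 0 := by nlinarith [sq_nonneg ‖τ‖, sq_nonneg ‖ρ‖]
  exact ⟨sub_eq_zero.1 (norm_eq_zero.1 h6), sub_eq_zero.1 (norm_eq_zero.1 h5)⟩

end

section

variable {β c : ℝ}

/-! ### Approximation by test functions -/

/-- The weight `e^{-c|x|}`. -/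
def decay (c x : ℝ) : ℝ := Real.exp (-c * |x|)

theorem decay_pos (c x : ℝ) : 0 < decay c x := Real.exp_pos _

theorem continuous_decay (c : ℝ) : Continuous (decay c) := by
  unfold decay
  fun_prop

theorem integrable_decay (hc : 0 < c) : Integrable (decay c) := by
  rw [← integrableOn_univ, ← Set.Iic_union_Ioi (a := (0 : ℝ))]
  refine IntegrableOn.union ?_ ?_
  · refine (integrableOn_exp_mul_Iic hc 0).congr_fun (fun x hx => ?_) measurableSet_Iic
    simp only [decay]
    rw [abs_of_nonpos hx]
    ring_nf
  · refine (integrableOn_exp_mul_Ioi (neg_lt_zero.2 hc) 0).congr_fun (fun x hx => ?_)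
      measurableSet_Ioi
    simp only [decay]
    rw [abs_of_pos hx]

theorem memLp_decay (hc : 0 < c) : MemLp (fun p : ℝ × ℝ => decay c p.1) 2 stripMeasure := by
  have hm : Continuous fun p : ℝ × ℝ => decay c p.1 := (continuous_decay c).comp continuous_fst
  rw [memLp_two_iff_integrable_sq hm.aestronglyMeasurable, stripMeasure_eq]
  have h := (integrable_decay (c := 2 * c) (by linarith)).comp_fst
    (volume.restrict (Set.Ioo (0 : ℝ) (2 * Real.pi)))
  refine h.congr (Filter.Eventually.of_forall fun p => ?_)
  simp only [decay]
  rw [← Real.exp_nat_mul]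
  congr 1
  push_cast
  ring

/-- `w`, with gradient `(wx, wy)`, can be approximated by test functions within `δ e^{-c|x|}`. -/
def WeightApprox (β c : ℝ) (w wx wy : ℝ × ℝ → ℂ) : Prop :=
  ∀ δ : ℝ, 0 < δ → ∃ φ, IsTest β φ ∧ ∀ p : ℝ × ℝ, ‖φ p - w p‖ ≤ δ * decay c p.1 ∧
    ‖dX φ p - wx p‖ ≤ δ * decay c p.1 ∧ ‖dY φ p - wy p‖ ≤ δ * decay c p.1

/-- The weight e^{-c|x|} is square-integrable on the strip, so weighted uniform convergence implies
L² convergence; measurability of w is inherited from the pointwise limit. -/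
theorem memLp_and_tendsto_of_decay (hc : 0 < c) {w : ℝ × ℝ → ℂ} {φ : ℕ → ℝ × ℝ → ℂ}
    (hφ : ∀ n, MemLp (φ n) 2 stripMeasure)
    (h : ∀ n p, ‖φ n p - w p‖ ≤ 1 / ((n : ℝ) + 1) * decay c p.1) :
    MemLp w 2 stripMeasure ∧
      Filter.Tendsto (fun n => eLpNorm (φ n - w) 2 stripMeasure) Filter.atTop (𝓝 0) := by
  have hd := memLp_decay hc
  have hlim : ∀ p, Filter.Tendsto (fun n => φ n p) Filter.atTop (𝓝 (w p)) := fun p => by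
    rw [tendsto_iff_norm_sub_tendsto_zero]
    refine squeeze_zero (fun _ => norm_nonneg _) (fun n => h n p) ?_
    simpa using tendsto_one_div_add_atTop_nhds_zero_nat.mul_const (decay c p.1)
  have hm : AEStronglyMeasurable w stripMeasure :=
    aestronglyMeasurable_of_tendsto_ae Filter.atTop (fun n => (hφ n).1)
      (Filter.Eventually.of_forall hlim)
  have hle : ∀ n p, ‖(φ n - w) p‖ ≤ 1 / ((n : ℝ) + 1) * ‖decay c p.1‖ := fun n p => by
    rw [Real.norm_of_nonneg (decay_pos c p.1).le]
    exact h n p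
  constructor
  · have h1 : MemLp (φ 0 - w) 2 stripMeasure :=
      MemLp.of_le_mul hd ((hφ 0).1.sub hm) (Filter.Eventually.of_forall (hle 0))
    have := (hφ 0).sub h1
    rwa [sub_sub_cancel] at this
  · have h2 : ∀ n, eLpNorm (φ n - w) 2 stripMeasure ≤ ENNReal.ofReal (1 / ((n : ℝ) + 1)) *
        eLpNorm (fun p : ℝ × ℝ => decay c p.1) 2 stripMeasure := fun n =>
      eLpNorm_le_mul_eLpNorm_of_ae_le_mul (Filter.Eventually.of_forall (hle n)) 2
    refine tendsto_of_tendsto_of_tendsto_of_le_of_le tendsto_const_nhds ?_ (fun _ => zero_le) h2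
    have h3 := ENNReal.tendsto_ofReal tendsto_one_div_add_atTop_nhds_zero_nat
    rw [ENNReal.ofReal_zero] at h3
    have h4 := ENNReal.Tendsto.mul_const h3 (Or.inr hd.2.ne)
    rwa [zero_mul] at h4

theorem WeightApprox.inH1 (hc : 0 < c) {w wx wy : ℝ × ℝ → ℂ} (h : WeightApprox β c w wx wy) :
    InH1 β w wx wy := by
  choose φ h1 h2 using fun n : ℕ => h (1 / ((n : ℝ) + 1)) (by positivity)
  have a1 := memLp_and_tendsto_of_decay hc (fun n => (h1 n).memLp) fun n p => (h2 n p).1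
  have a2 := memLp_and_tendsto_of_decay hc (fun n => (h1 n).memLp_dX) fun n p => (h2 n p).2.1
  have a3 := memLp_and_tendsto_of_decay hc (fun n => (h1 n).memLp_dY) fun n p => (h2 n p).2.2
  exact ⟨a1.1, a2.1, a3.1, φ, h1, a1.2, a2.2, a3.2⟩

theorem dX_zero : dX (0 : ℝ × ℝ → ℂ) = 0 := by
  ext p
  simp [dX]

theorem dY_zero : dY (0 : ℝ × ℝ → ℂ) = 0 := by
  ext p
  simp [dY]

theorem WeightApprox.zero : WeightApprox β c 0 0 0 := fun δ hδ =>
  ⟨0, IsTest.zero, fun p => by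
    have := (mul_pos hδ (decay_pos c p.1)).le
    simp [dX_zero, dY_zero, this]⟩

theorem norm_add_sub_add_le {a b a' b' : ℂ} {δ d : ℝ} (h : ‖a - a'‖ ≤ δ / 2 * d)
    (h' : ‖b - b'‖ ≤ δ / 2 * d) : ‖a + b - (a' + b')‖ ≤ δ * d := by
  rw [add_sub_add_comm]
  refine (norm_add_le _ _).trans ?_
  linarith

theorem WeightApprox.add {w wx wy v vx vy : ℝ × ℝ → ℂ} (h : WeightApprox β c w wx wy)
    (h' : WeightApprox β c v vx vy) : WeightApprox β c (w + v) (wx + vx) (wy + vy) := by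
  intro δ hδ
  obtain ⟨φ, h1, h2⟩ := h (δ / 2) (by linarith)
  obtain ⟨ψ, h3, h4⟩ := h' (δ / 2) (by linarith)
  refine ⟨φ + ψ, h1.add h3, fun p => ?_⟩
  rw [dX_add h1.smooth h3.smooth, dY_add h1.smooth h3.smooth]
  exact ⟨norm_add_sub_add_le (h2 p).1 (h4 p).1, norm_add_sub_add_le (h2 p).2.1 (h4 p).2.1,
    norm_add_sub_add_le (h2 p).2.2 (h4 p).2.2⟩

/-- A smooth cut-off with uniformly bounded derivative. -/
theorem exists_cutoff : ∃ D : ℝ, 0 ≤ D ∧ ∀ M : ℝ, 0 ≤ M → ∃ η η' : ℝ → ℝ, ContDiff ℝ ∞ η ∧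
    (∀ x, HasDerivAt η (η' x) x) ∧ (∀ x, 0 ≤ η x ∧ η x ≤ 1) ∧ (∀ x, |η' x| ≤ D) ∧
    (∀ x, |x| < M → η x = 1 ∧ η' x = 0) ∧ ∀ x, M + 1 < |x| → η x = 0 ∧ η' x = 0 := by
  obtain ⟨C, hC0, hC, -⟩ := exists_bound_deriv_smoothTransition
  refine ⟨2 * C, by linarith, fun M hM => ?_⟩
  refine ⟨fun x => Real.smoothTransition (M + 1 - x) * Real.smoothTransition (M + 1 + x),
    fun x => -deriv Real.smoothTransition (M + 1 - x) * Real.smoothTransition (M + 1 + x) +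
      Real.smoothTransition (M + 1 - x) * deriv Real.smoothTransition (M + 1 + x), ?_, ?_, ?_, ?_,
    ?_, ?_⟩
  · exact (contDiff_smoothTransition.comp (contDiff_const.sub contDiff_id)).mul
      (contDiff_smoothTransition.comp (contDiff_const.add contDiff_id))
  · intro x
    exact (HasDerivAt.comp_const_sub (M + 1) x (hasDerivAt_smoothTransition (M + 1 - x))).mul
      (HasDerivAt.comp_const_add (M + 1) x (hasDerivAt_smoothTransition (M + 1 + x)))
  · intro x
    have a1 := Real.smoothTransition.nonneg (M + 1 - x)
    have a2 := Real.smoothTransition.nonneg (M + 1 + x)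
    exact ⟨mul_nonneg a1 a2, mul_le_one₀ (Real.smoothTransition.le_one _) a2
      (Real.smoothTransition.le_one _)⟩
  · intro x
    have h : ∀ y z : ℝ, |deriv Real.smoothTransition y * Real.smoothTransition z| ≤ C :=
      fun y z => by
        rw [abs_mul, abs_of_nonneg (Real.smoothTransition.nonneg z)]
        exact (mul_le_of_le_one_right (abs_nonneg _) (Real.smoothTransition.le_one z)).trans (hC y)
    refine (abs_add_le _ _).trans ?_
    rw [neg_mul, abs_neg, mul_comm (Real.smoothTransition (M + 1 - x)), two_mul]
    exact add_le_add (h _ _) (h _ _)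
  · intro x hx
    have hx' := abs_lt.1 hx
    beta_reduce
    rw [Real.smoothTransition.one_of_one_le (by linarith [hx'.2]),
      Real.smoothTransition.one_of_one_le (by linarith [hx'.1]),
      deriv_smoothTransition_eq_zero (fun h => by linarith [h.2, hx'.2]),
      deriv_smoothTransition_eq_zero (fun h => by linarith [h.2, hx'.1])]
    norm_num
  · intro x hx
    beta_reduce
    rcases lt_abs.1 hx with h | h
    · rw [Real.smoothTransition.zero_of_nonpos (x := M + 1 - x) (by linarith),
        deriv_smoothTransition_eq_zero (x := M + 1 - x) (fun h' => by linarith [h'.1])]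
      simp
    · rw [Real.smoothTransition.zero_of_nonpos (x := M + 1 + x) (by linarith),
        deriv_smoothTransition_eq_zero (x := M + 1 + x) (fun h' => by linarith [h'.1])]
      simp

theorem decay_two_mul (c x : ℝ) : decay (2 * c) x = decay c x * decay c x := by
  rw [decay, decay, ← Real.exp_add]
  congr 1
  ring

theorem decay_le_of_le (hc : 0 ≤ c) {x y : ℝ} (h : |x| ≤ |y|) : decay c y ≤ decay c x :=
  Real.exp_le_exp.2 (by nlinarith)

theorem tendsto_decay (hc : 0 < c) : Filter.Tendsto (decay c) Filter.atTop (𝓝 0) := by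
  have h : Filter.Tendsto (fun x : ℝ => Real.exp (-c * x)) Filter.atTop (𝓝 0) :=
    Real.tendsto_exp_atBot.comp (Filter.tendsto_id.const_mul_atTop_of_neg (neg_lt_zero.2 hc))
  refine h.congr' ?_
  filter_upwards [Filter.eventually_ge_atTop 0] with x hx
  rw [decay, abs_of_nonneg hx]

theorem tendsto_decay_cocompact (hc : 0 < c) :
    Filter.Tendsto (decay c) (Filter.cocompact ℝ) (𝓝 0) := by
  have h := (tendsto_decay hc).comp (tendsto_norm_cocompact_atTop (E := ℝ))
  refine h.congr fun x => ?_
  simp [decay]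

/-- The derivative is smoothed uniformly and then integrated, so function and derivative are
approximated together. The error of the primitive grows like δ|x|, which is harmless after a
cut-off. -/
theorem exists_smooth_primitive {v v' : ℝ → ℂ} (hv : ∀ x, HasDerivAt v (v' x) x)
    (hu : UniformContinuous v') {δ : ℝ} (hδ : 0 < δ) : ∃ V h : ℝ → ℂ, ContDiff ℝ ∞ V ∧
      (∀ x, HasDerivAt V (h x) x) ∧ (∀ x, ‖h x - v' x‖ ≤ δ) ∧ ∀ x, ‖V x - v x‖ ≤ δ * |x| := by
  obtain ⟨h, hs, hh⟩ := hu.exists_contDiff_dist_le hδ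
  have hhle : ∀ x, ‖h x - v' x‖ ≤ δ := fun x => by
    rw [← dist_eq_norm]
    exact (hh x).le
  have hV : ∀ x, HasDerivAt (fun x => v 0 + ∫ t in (0 : ℝ)..x, h t) (h x) x := fun x =>
    (intervalIntegral.integral_hasDerivAt_right (hs.continuous.intervalIntegrable _ _)
      (hs.continuous.stronglyMeasurableAtFilter _ _) hs.continuous.continuousAt).const_add (v 0)
  refine ⟨fun x => v 0 + ∫ t in (0 : ℝ)..x, h t, h, ?_, hV, hhle, fun x => ?_⟩
  · rw [contDiff_infty_iff_deriv]
    refine ⟨fun x => (hV x).differentiableAt, ?_⟩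
    have : deriv (fun x => v 0 + ∫ t in (0 : ℝ)..x, h t) = h := funext fun x => (hV x).deriv
    rw [this]
    exact hs
  · have h1 : ∫ t in (0 : ℝ)..x, v' t = v x - v 0 :=
      intervalIntegral.integral_eq_sub_of_hasDerivAt (fun t _ => hv t)
        (hu.continuous.intervalIntegrable _ _)
    have h2 : v 0 + (∫ t in (0 : ℝ)..x, h t) - v x = ∫ t in (0 : ℝ)..x, (h t - v' t) := by
      rw [intervalIntegral.integral_sub (hs.continuous.intervalIntegrable _ _)
        (hu.continuous.intervalIntegrable _ _), h1]
      ring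
    simp only
    rw [h2]
    have := intervalIntegral.norm_integral_le_of_norm_le_const (a := 0) (b := x) (C := δ)
      (f := fun t => h t - v' t) fun t _ => hhle t
    rwa [sub_zero] at this

/-- Approximation of a decaying `C¹` function on the line. -/
theorem exists_smooth_approx (hc : 0 < c) {v v' : ℝ → ℂ} (hv : ∀ x, HasDerivAt v (v' x) x)
    (hv' : Continuous v') {C : ℝ} (h0 : ∀ x, ‖v x‖ ≤ C * decay (2 * c) x)
    (h1 : ∀ x, ‖v' x‖ ≤ C * decay (2 * c) x) {δ : ℝ} (hδ : 0 < δ) :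
    ∃ ψ ψ' : ℝ → ℂ, ContDiff ℝ ∞ ψ ∧ (∀ x, HasDerivAt ψ (ψ' x) x) ∧
      (∃ M : ℝ, ∀ x : ℝ, M < |x| → ψ x = 0) ∧
      ∀ x, ‖ψ x - v x‖ ≤ δ * decay c x ∧ ‖ψ' x - v' x‖ ≤ δ * decay c x := by
  have hC : 0 ≤ C := by
    have := (norm_nonneg _).trans (h0 0)
    by_contra hneg
    exact absurd this (not_le.2 (mul_neg_of_neg_of_pos (not_le.1 hneg) (decay_pos _ _)))
  obtain ⟨D, hD, hcut⟩ := exists_cutoff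
  -- Beyond M the function is already negligible: v decays like e^{-2c|x|}, while the error is only
  -- measured against e^{-c|x|}.
  have hM : ∃ M : ℝ, 0 ≤ M ∧ (D + 1) * C * decay c M ≤ δ / 2 := by
    have ht := (tendsto_decay hc).const_mul ((D + 1) * C)
    rw [mul_zero] at ht
    obtain ⟨M, hM⟩ := ((ht.eventually (gt_mem_nhds (half_pos hδ))).and
      (Filter.eventually_ge_atTop 0)).exists
    exact ⟨M, hM.2, hM.1.le⟩
  obtain ⟨M, hM0, hM⟩ := hM
  obtain ⟨η, η', hηs, hηd, hη01, hη'D, hηin, hηout⟩ := hcut M hM0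
  have huc : UniformContinuous v' := by
    refine hv'.uniformContinuous_of_tendsto_cocompact (x := 0) ?_
    refine squeeze_zero_norm h1 ?_
    simpa using (tendsto_decay_cocompact (c := 2 * c) (by linarith)).const_mul C
  -- Inside |x| ≤ M + 1 the errors are at most De(M+1) from η'(V-v), e(M+1) from η(V-v) and e from
  -- η(h-v'). Their sum is eB, and e is chosen to make this half the allowance at the worst point
  -- |x| = M + 1.
  set B := (D + 1) * (M + 1) + 1 with hB
  have hBpos : 0 < B := by positivity
  set e := δ / 2 * decay c (M + 1) / B with he
  have hepos : 0 < e := by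
    have := decay_pos c (M + 1)
    positivity
  obtain ⟨V, h, hVs, hVd, hh, hVv⟩ := exists_smooth_primitive hv huc hepos
  have hout : ∀ x, M ≤ |x| → C * decay (2 * c) x ≤ C * decay c M * decay c x := fun x hx => by
    rw [decay_two_mul, mul_assoc]
    refine mul_le_mul_of_nonneg_left (mul_le_mul_of_nonneg_right ?_ (decay_pos _ _).le) hC
    exact decay_le_of_le hc.le (by rwa [abs_of_nonneg hM0])
  have hin : ∀ x, |x| ≤ M + 1 → e * B ≤ δ / 2 * decay c x := fun x hx => by
    rw [he, div_mul_cancel₀ _ hBpos.ne']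
    refine mul_le_mul_of_nonneg_left (decay_le_of_le hc.le ?_) (by linarith)
    rwa [abs_of_nonneg (by linarith : (0 : ℝ) ≤ M + 1)]
  have hM' : ∀ x, (D + 1) * (C * decay c M * decay c x) ≤ δ / 2 * decay c x := fun x => by
    rw [← mul_assoc, ← mul_assoc]
    exact mul_le_mul_of_nonneg_right hM (decay_pos _ _).le
  have hr : ∀ r : ℝ, HasDerivAt (fun x => (η x : ℂ)) (η' r : ℂ) r := fun r => (hηd r).ofReal_comp
  refine ⟨fun x => (η x : ℂ) * V x, fun x => (η' x : ℂ) * V x + (η x : ℂ) * h x,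
    (Complex.ofRealCLM.contDiff.comp hηs).mul hVs, fun x => (hr x).mul (hVd x),
    ⟨M + 1, fun x hx => by simp only; rw [(hηout x hx).1, Complex.ofReal_zero, zero_mul]⟩,
    fun x => ?_⟩
  have e1 : (η x : ℂ) * V x - v x = (η x : ℂ) * (V x - v x) - ((1 - η x : ℝ) : ℂ) * v x := by
    push_cast
    ring
  have e2 : (η' x : ℂ) * V x + (η x : ℂ) * h x - v' x = ((η' x : ℂ) * (V x - v x) +
      (η x : ℂ) * (h x - v' x)) + ((η' x : ℂ) * v x - ((1 - η x : ℝ) : ℂ) * v' x) := by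
    push_cast
    ring
  simp only
  rw [e1, e2]
  have n1 : ‖(η x : ℂ)‖ ≤ 1 := by
    rw [Complex.norm_real, Real.norm_of_nonneg (hη01 x).1]
    exact (hη01 x).2
  have n2 : ‖((1 - η x : ℝ) : ℂ)‖ ≤ 1 := by
    rw [Complex.norm_real, Real.norm_of_nonneg (by linarith [(hη01 x).2])]
    linarith [(hη01 x).1]
  have n3 : ‖(η' x : ℂ)‖ ≤ D := by
    rw [Complex.norm_real]
    exact hη'D x
  have inner : ‖(η x : ℂ) * (V x - v x)‖ ≤ δ / 2 * decay c x ∧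
      ‖(η' x : ℂ) * (V x - v x) + (η x : ℂ) * (h x - v' x)‖ ≤ δ / 2 * decay c x := by
    rcases le_or_gt |x| (M + 1) with hx | hx
    · have b1 : ‖V x - v x‖ ≤ e * (M + 1) :=
        (hVv x).trans (mul_le_mul_of_nonneg_left hx hepos.le)
      have hpos : 0 ≤ e * (M + 1) := by positivity
      have hDe : 0 ≤ D * (e * (M + 1)) := by positivity
      have b2 := hin x hx
      have b3 : e * B = D * (e * (M + 1)) + e * (M + 1) + e := by
        rw [hB]
        ring
      constructor
      · rw [norm_mul]
        have := mul_le_mul n1 b1 (norm_nonneg _) zero_le_one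
        linarith
      · refine (norm_add_le _ _).trans ?_
        rw [norm_mul, norm_mul]
        have t1 := mul_le_mul n3 b1 (norm_nonneg _) hD
        have t2 := mul_le_mul n1 (hh x) (norm_nonneg _) zero_le_one
        linarith
    · rw [(hηout x hx).1, (hηout x hx).2]
      have := (decay_pos c x).le
      simp only [Complex.ofReal_zero, zero_mul, add_zero, norm_zero]
      exact ⟨by positivity, by positivity⟩
  have outer : ‖((1 - η x : ℝ) : ℂ) * v x‖ ≤ δ / 2 * decay c x ∧
      ‖(η' x : ℂ) * v x - ((1 - η x : ℝ) : ℂ) * v' x‖ ≤ δ / 2 * decay c x := by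
    rcases lt_or_ge |x| M with hx | hx
    · rw [(hηin x hx).1, (hηin x hx).2]
      have := (decay_pos c x).le
      simp only [sub_self, Complex.ofReal_zero, zero_mul, norm_zero]
      exact ⟨by positivity, by positivity⟩
    · have b0 := (h0 x).trans (hout x hx)
      have b1 := (h1 x).trans (hout x hx)
      have b2 := hM' x
      have hnn : 0 ≤ C * decay c M * decay c x := (norm_nonneg _).trans b0
      have hDn := mul_nonneg hD hnn
      constructor
      · rw [norm_mul]
        have := mul_le_mul n2 b0 (norm_nonneg _) zero_le_one
        linarith
      · refine (norm_sub_le _ _).trans ?_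
        rw [norm_mul, norm_mul]
        have t1 := mul_le_mul n3 b0 (norm_nonneg _) hD
        have t2 := mul_le_mul n2 b1 (norm_nonneg _) zero_le_one
        linarith
  exact ⟨(norm_sub_le _ _).trans (by linarith [inner.1, outer.1]),
    (norm_add_le _ _).trans (by linarith [inner.2, outer.2])⟩

theorem weightApprox_mode (hc : 0 < c) (n : ℤ) {v v' : ℝ → ℂ} (hv : ∀ x, HasDerivAt v (v' x) x)
    (hv' : Continuous v') {C : ℝ} (h0 : ∀ x, ‖v x‖ ≤ C * decay (2 * c) x)
    (h1 : ∀ x, ‖v' x‖ ≤ C * decay (2 * c) x) :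
    WeightApprox β c (fun p => v p.1 * modeE (β + n) p.2) (fun p => v' p.1 * modeE (β + n) p.2)
      (fun p => v p.1 * (Complex.I * ((β + n : ℝ) : ℂ) * modeE (β + n) p.2)) := by
  intro δ hδ
  have hs : 0 < 1 + |β + n| := by positivity
  obtain ⟨ψ, ψ', p1, p2, p3, p4⟩ := exists_smooth_approx hc hv hv' h0 h1
    (δ := δ / (1 + |β + n|)) (by positivity)
  have hle : δ / (1 + |β + n|) ≤ δ := div_le_self hδ.le (by linarith [abs_nonneg (β + n)])
  refine ⟨_, isTest_mode β n p1 p3, fun p => ?_⟩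
  have hd := (decay_pos c p.1).le
  rw [dX_mode p2, dY_mode, ← sub_mul, ← sub_mul, ← sub_mul, norm_mul, norm_mul, norm_mul,
    norm_mul, norm_mul, norm_modeE, mul_one, mul_one, mul_one, Complex.norm_I, one_mul,
    Complex.norm_real, Real.norm_eq_abs]
  have h2 := mul_le_mul_of_nonneg_right hle hd
  refine ⟨(p4 p.1).1.trans h2, (p4 p.1).2.trans h2, ?_⟩
  calc ‖ψ p.1 - v p.1‖ * |β + n| ≤ (δ / (1 + |β + n|) * decay c p.1) * (1 + |β + n|) :=
        mul_le_mul (p4 p.1).1 (by linarith) (abs_nonneg _) (by positivity)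
    _ = δ * decay c p.1 := by field_simp

theorem norm_tsum_sub_sum_le {a : ℤ → ℂ} {b : ℤ → ℝ} {d δ : ℝ} (hb : Summable b) (hd : 0 ≤ d)
    (h : ∀ n, ‖a n‖ ≤ b n * d) {S : Finset ℤ} (hS : ∑' n : {x // x ∉ S}, b n ≤ δ) :
    ‖∑ n ∈ S, a n - ∑' n, a n‖ ≤ δ * d := by
  have ha : Summable a := Summable.of_norm_bounded (hb.mul_right d) h
  rw [← ha.sum_add_tsum_subtype_compl S, sub_add_cancel_left, norm_neg]
  have h1 : HasSum (fun n : {x // x ∉ S} => b n * d) ((∑' n : {x // x ∉ S}, b n) * d) :=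
    (hb.subtype _).hasSum.mul_right d
  exact (tsum_of_norm_bounded h1 fun n => h n).trans (mul_le_mul_of_nonneg_right hS hd)

theorem WeightApprox.of_forall_close {w wx wy : ℝ × ℝ → ℂ}
    (h : ∀ δ : ℝ, 0 < δ → ∃ v vx vy : ℝ × ℝ → ℂ, WeightApprox β c v vx vy ∧
      ∀ p : ℝ × ℝ, ‖v p - w p‖ ≤ δ * decay c p.1 ∧
        ‖vx p - wx p‖ ≤ δ * decay c p.1 ∧ ‖vy p - wy p‖ ≤ δ * decay c p.1) :
    WeightApprox β c w wx wy := by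
  intro δ hδ
  obtain ⟨v, vx, vy, h1, h2⟩ := h (δ / 2) (by linarith)
  obtain ⟨φ, h3, h4⟩ := h1 (δ / 2) (by linarith)
  have key : ∀ {a b b' : ℂ} {d : ℝ}, ‖a - b‖ ≤ δ / 2 * d → ‖b - b'‖ ≤ δ / 2 * d →
      ‖a - b'‖ ≤ δ * d := fun {a b b' d} e1 e2 => by
    have := norm_sub_le_norm_sub_add_norm_sub a b b'
    linarith
  exact ⟨φ, h3, fun p => ⟨key (h4 p).1 (h2 p).1, key (h4 p).2.1 (h2 p).2.1,
    key (h4 p).2.2 (h2 p).2.2⟩⟩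

/-- A series of modes with summable exponentially decaying coefficients belongs to `H¹`. -/
theorem inH1_tsum (hc : 0 < c) {v v' : ℤ → ℝ → ℂ} (hv : ∀ n x, HasDerivAt (v n) (v' n x) x)
    (hv' : ∀ n, Continuous (v' n)) {b : ℤ → ℝ} (hb : Summable b)
    (h0 : ∀ n x, ‖v n x‖ ≤ b n * decay (2 * c) x)
    (h1 : ∀ n x, ‖v' n x‖ ≤ b n * decay (2 * c) x)
    (h2 : ∀ (n : ℤ) x, |β + n| * ‖v n x‖ ≤ b n * decay (2 * c) x) :
    InH1 β (fun p => ∑' n, v n p.1 * modeE (β + n) p.2)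
      (fun p => ∑' n, v' n p.1 * modeE (β + n) p.2)
      (fun p => ∑' n, v n p.1 * (Complex.I * ((β + n : ℝ) : ℂ) * modeE (β + n) p.2)) := by
  refine WeightApprox.inH1 hc (WeightApprox.of_forall_close fun δ hδ => ?_)
  have hfin : ∀ S : Finset ℤ, WeightApprox β c
      (fun p => ∑ n ∈ S, v n p.1 * modeE (β + n) p.2)
      (fun p => ∑ n ∈ S, v' n p.1 * modeE (β + n) p.2)
      (fun p => ∑ n ∈ S, v n p.1 * (Complex.I * ((β + n : ℝ) : ℂ) * modeE (β + n) p.2)) := by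
    intro S
    induction S using Finset.induction_on with
    | empty =>
      simp only [Finset.sum_empty]
      exact WeightApprox.zero
    | insert n S hn ih =>
      simp only [Finset.sum_insert hn]
      exact (weightApprox_mode hc n (hv n) (hv' n) (h0 n) (h1 n)).add ih
  -- One finite set of modes leaves a tail below δ e^{-c|x|} for the function and both derivatives
  -- at once, since the same sequence b dominates all three.
  obtain ⟨S, hS⟩ := ((tendsto_tsum_compl_atTop_zero b).eventually (gt_mem_nhds hδ)).exists
  refine ⟨_, _, _, hfin S, fun p => ?_⟩
  have hle : ∀ n, b n * decay (2 * c) p.1 ≤ b n * decay c p.1 := fun n => by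
    have hbn : 0 ≤ b n := by
      have := (norm_nonneg _).trans (h0 n 0)
      by_contra hneg
      exact absurd this (not_le.2 (mul_neg_of_neg_of_pos (not_le.1 hneg) (decay_pos _ _)))
    refine mul_le_mul_of_nonneg_left ?_ hbn
    exact Real.exp_le_exp.2 (by nlinarith [abs_nonneg p.1])
  have hd := (decay_pos c p.1).le
  refine ⟨norm_tsum_sub_sum_le hb hd (fun n => ?_) hS.le,
    norm_tsum_sub_sum_le hb hd (fun n => ?_) hS.le, norm_tsum_sub_sum_le hb hd (fun n => ?_) hS.le⟩
  · rw [norm_mul, norm_modeE, mul_one]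
    exact (h0 n p.1).trans (hle n)
  · rw [norm_mul, norm_modeE, mul_one]
    exact (h1 n p.1).trans (hle n)
  · rw [norm_mul, norm_mul, norm_mul, norm_modeE, mul_one, Complex.norm_I, one_mul,
      Complex.norm_real, Real.norm_eq_abs, mul_comm]
    exact (h2 n p.1).trans (hle n)

end

section

variable {R c : ℝ} {a : ℝ → ℂ}

/-! ### Convolution with an exponential on the line -/

/-- `∫_{-R}^R e^{z|x-ξ|} a(ξ) dξ`. -/
def expConv (R : ℝ) (z : ℂ) (a : ℝ → ℂ) (x : ℝ) : ℂ :=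
  ∫ ξ in (-R)..R, Complex.exp (z * (|x - ξ| : ℝ)) * a ξ

/-- `∫_{-R}^x e^{-zξ} a(ξ) dξ`. -/
def leftInt (R : ℝ) (z : ℂ) (a : ℝ → ℂ) (x : ℝ) : ℂ :=
  ∫ ξ in (-R)..x, Complex.exp (-z * ξ) * a ξ

/-- `∫_x^R e^{zξ} a(ξ) dξ`. -/
def rightInt (R : ℝ) (z : ℂ) (a : ℝ → ℂ) (x : ℝ) : ℂ :=
  ∫ ξ in x..R, Complex.exp (z * ξ) * a ξ

/-- The derivative of `expConv`. -/
def expConv' (R : ℝ) (z : ℂ) (a : ℝ → ℂ) (x : ℝ) : ℂ :=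
  z * (Complex.exp (z * x) * leftInt R z a x - Complex.exp (-z * x) * rightInt R z a x)

/-- Split the integral at ξ = x to remove the absolute value. For x outside [-R, R] one of the
pieces runs the wrong way or too far, but only over points where a vanishes. -/
theorem expConv_eq (ha : Continuous a) (h0 : ∀ x, R ≤ |x| → a x = 0) (z : ℂ) (x : ℝ) :
    expConv R z a x = Complex.exp (z * x) * leftInt R z a x +
      Complex.exp (-z * x) * rightInt R z a x := by
  have hi : ∀ p q : ℝ, IntervalIntegrable
      (fun ξ : ℝ => Complex.exp (z * (|x - ξ| : ℝ)) * a ξ) volume p q := fun p q =>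
    Continuous.intervalIntegrable (by fun_prop) p q
  rw [expConv, ← intervalIntegral.integral_add_adjacent_intervals (hi (-R) x) (hi x R), leftInt,
    rightInt, ← intervalIntegral.integral_const_mul, ← intervalIntegral.integral_const_mul]
  congr 1
  · refine intervalIntegral.integral_congr fun ξ hξ => ?_
    rcases le_or_gt ξ x with h | h
    · rw [abs_of_nonneg (sub_nonneg.2 h), ← mul_assoc, ← Complex.exp_add]
      congr 2
      push_cast
      ring
    · rw [h0 ξ, mul_zero, mul_zero, mul_zero]
      rcases Set.mem_uIcc.1 hξ with h2 | h2
      · exact absurd h2.2 (not_le.2 h)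
      · rw [le_abs]
        right
        linarith [h2.2]
  · refine intervalIntegral.integral_congr fun ξ hξ => ?_
    rcases le_or_gt x ξ with h | h
    · rw [abs_of_nonpos (sub_nonpos.2 h), ← mul_assoc, ← Complex.exp_add]
      congr 2
      push_cast
      ring
    · rw [h0 ξ, mul_zero, mul_zero, mul_zero]
      rcases Set.mem_uIcc.1 hξ with h2 | h2
      · exact absurd h2.1 (not_le.2 h)
      · rw [le_abs]
        left
        linarith [h2.1]

theorem hasDerivAt_leftInt (ha : Continuous a) (z : ℂ) (x : ℝ) :
    HasDerivAt (leftInt R z a) (Complex.exp (-z * x) * a x) x := by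
  have hc : Continuous fun ξ : ℝ => Complex.exp (-z * ξ) * a ξ := by fun_prop
  exact intervalIntegral.integral_hasDerivAt_right (hc.intervalIntegrable _ _)
    (hc.stronglyMeasurableAtFilter _ _) hc.continuousAt

theorem hasDerivAt_rightInt (ha : Continuous a) (z : ℂ) (x : ℝ) :
    HasDerivAt (rightInt R z a) (-(Complex.exp (z * x) * a x)) x := by
  have hc : Continuous fun ξ : ℝ => Complex.exp (z * ξ) * a ξ := by fun_prop
  exact intervalIntegral.integral_hasDerivAt_left (hc.intervalIntegrable _ _)
    (hc.stronglyMeasurableAtFilter _ _) hc.continuousAt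

theorem hasDerivAt_exp_mul (z : ℂ) (x : ℝ) :
    HasDerivAt (fun x : ℝ => Complex.exp (z * x)) (z * Complex.exp (z * x)) x := by
  have h := ((Complex.ofRealCLM.hasDerivAt (x := x)).const_mul z).cexp
  rw [mul_comm] at h
  simpa using h

theorem exp_mul_exp_neg (z : ℂ) (x : ℝ) : Complex.exp (z * x) * Complex.exp (-z * x) = 1 := by
  rw [← Complex.exp_add, neg_mul, add_neg_cancel, Complex.exp_zero]

theorem hasDerivAt_expConv (ha : Continuous a) (h0 : ∀ x, R ≤ |x| → a x = 0) (z : ℂ) (x : ℝ) :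
    HasDerivAt (expConv R z a) (expConv' R z a x) x := by
  have h : expConv R z a = fun x : ℝ => Complex.exp (z * x) * leftInt R z a x +
      Complex.exp (-z * x) * rightInt R z a x := funext (expConv_eq ha h0 z)
  rw [h]
  convert! ((hasDerivAt_exp_mul z x).mul (hasDerivAt_leftInt ha z x)).add
    ((hasDerivAt_exp_mul (-z) x).mul (hasDerivAt_rightInt ha z x)) using 1
  rw [expConv']
  ring

/-- Differentiating the limits of integration gives terms ±a(x) that cancel in the first derivative
and add up in the second to 2za(x), the jump of the derivative of e^{z|x|}. -/
theorem hasDerivAt_expConv' (ha : Continuous a) (h0 : ∀ x, R ≤ |x| → a x = 0) (z : ℂ) (x : ℝ) :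
    HasDerivAt (expConv' R z a) (z ^ 2 * expConv R z a x + 2 * z * a x) x := by
  convert! (((hasDerivAt_exp_mul z x).mul (hasDerivAt_leftInt (R := R) ha z x)).sub
    ((hasDerivAt_exp_mul (-z) x).mul (hasDerivAt_rightInt (R := R) ha z x))).const_mul z using 1
  rw [expConv_eq ha h0]
  linear_combination (-2 * z * a x) * exp_mul_exp_neg z x

theorem leftInt_of_le (h0 : ∀ x, R ≤ |x| → a x = 0) (z : ℂ) {x : ℝ} (hx : x ≤ -R) :
    leftInt R z a x = 0 := by
  rw [leftInt, ← intervalIntegral.integral_zero (μ := volume) (a := -R) (b := x)]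
  refine intervalIntegral.integral_congr fun ξ hξ => ?_
  rw [Set.uIcc_of_ge hx] at hξ
  rw [h0 ξ (by rw [le_abs]; right; linarith [hξ.2]), mul_zero]

theorem leftInt_of_ge (ha : Continuous a) (h0 : ∀ x, R ≤ |x| → a x = 0) (z : ℂ) {x : ℝ}
    (hx : R ≤ x) : leftInt R z a x = leftInt R z a R := by
  have hc : Continuous fun ξ : ℝ => Complex.exp (-z * ξ) * a ξ := by fun_prop
  rw [leftInt, leftInt, ← intervalIntegral.integral_add_adjacent_intervals
    (hc.intervalIntegrable (-R) R) (hc.intervalIntegrable R x), add_eq_left,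
    ← intervalIntegral.integral_zero (μ := volume) (a := R) (b := x)]
  refine intervalIntegral.integral_congr fun ξ hξ => ?_
  rw [Set.uIcc_of_le hx] at hξ
  rw [h0 ξ (by rw [le_abs]; left; exact hξ.1), mul_zero]

theorem rightInt_eq_leftInt (z : ℂ) (a : ℝ → ℂ) (x : ℝ) :
    rightInt R z a x = leftInt R z (fun ξ => a (-ξ)) (-x) := by
  have h := intervalIntegral.integral_comp_neg (a := -R) (b := -x)
    (fun ξ : ℝ => Complex.exp (z * ξ) * a ξ)
  rw [neg_neg, neg_neg] at h
  rw [rightInt, leftInt, ← h]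
  refine intervalIntegral.integral_congr fun ξ _ => ?_
  push_cast
  ring_nf

/-- In the range of integration ξ ≤ min(x, R), hence x - ξ ≥ |x| - R, and |e^{z(x-ξ)}| ≤
e^{cR}e^{-c|x|}. For x ≤ -R the integral vanishes. -/
theorem norm_leftInt_le (hR : 0 < R) (ha : Continuous a) (h0 : ∀ x, R ≤ |x| → a x = 0) {B : ℝ}
    (hB : ∀ x, ‖a x‖ ≤ B) {z : ℂ} (hc : 0 ≤ c) (hz : z.re ≤ -c) (x : ℝ) :
    ‖Complex.exp (z * x) * leftInt R z a x‖ ≤ 2 * R * (Real.exp (c * R) * B) * decay c x := by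
  have hB0 : 0 ≤ B := (norm_nonneg _).trans (hB 0)
  have hd := (decay_pos c x).le
  rcases le_or_gt x (-R) with hx | hx
  · rw [leftInt_of_le h0 z hx, mul_zero, norm_zero]
    positivity
  · have e : leftInt R z a x = leftInt R z a (min x R) := by
      rcases le_total x R with h | h
      · rw [min_eq_left h]
      · rw [min_eq_right h, leftInt_of_ge ha h0 z h]
    rw [e, leftInt, ← intervalIntegral.integral_const_mul]
    have hle : -R ≤ min x R := le_min hx.le (by linarith)
    refine (intervalIntegral.norm_integral_le_of_norm_le_const
      (C := Real.exp (c * R) * decay c x * B) fun ξ hξ => ?_).trans ?_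
    · rw [Set.uIoc_of_le hle] at hξ
      have h1 : ξ ≤ x := hξ.2.trans (min_le_left _ _)
      have h2 : ξ ≤ R := hξ.2.trans (min_le_right _ _)
      rw [← mul_assoc, ← Complex.exp_add, norm_mul]
      refine mul_le_mul ?_ (hB ξ) (norm_nonneg _) (by positivity)
      rw [Complex.norm_exp, decay, ← Real.exp_add, Real.exp_le_exp]
      have h3 : (z * x + -z * ξ).re = z.re * (x - ξ) := by
        simp
        ring
      rw [h3]
      have h4 : |x| - R ≤ x - ξ := by
        rcases le_total 0 x with h | h
        · rw [abs_of_nonneg h]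
          linarith
        · rw [abs_of_nonpos h]
          linarith
      have h5 : z.re * (x - ξ) ≤ -c * (x - ξ) := mul_le_mul_of_nonneg_right hz (by linarith)
      nlinarith
    · have h6 : |min x R - -R| ≤ 2 * R := by
        rw [abs_of_nonneg (by linarith)]
        linarith [min_le_right x R]
      calc Real.exp (c * R) * decay c x * B * |min x R - -R|
          ≤ Real.exp (c * R) * decay c x * B * (2 * R) :=
            mul_le_mul_of_nonneg_left h6 (by positivity)
        _ = _ := by ring

theorem decay_neg (c x : ℝ) : decay c (-x) = decay c x := by rw [decay, decay, abs_neg]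

theorem norm_rightInt_le (hR : 0 < R) (ha : Continuous a) (h0 : ∀ x, R ≤ |x| → a x = 0) {B : ℝ}
    (hB : ∀ x, ‖a x‖ ≤ B) {z : ℂ} (hc : 0 ≤ c) (hz : z.re ≤ -c) (x : ℝ) :
    ‖Complex.exp (-z * x) * rightInt R z a x‖ ≤ 2 * R * (Real.exp (c * R) * B) * decay c x := by
  have h := norm_leftInt_le hR (a := fun ξ => a (-ξ)) (by fun_prop)
    (fun x hx => h0 (-x) (by rwa [abs_neg])) (fun x => hB (-x)) hc hz (-x)
  rw [decay_neg] at h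
  rw [rightInt_eq_leftInt]
  convert! h using 3
  push_cast
  ring_nf

theorem norm_expConv_le (hR : 0 < R) (ha : Continuous a) (h0 : ∀ x, R ≤ |x| → a x = 0) {B : ℝ}
    (hB : ∀ x, ‖a x‖ ≤ B) {z : ℂ} (hc : 0 ≤ c) (hz : z.re ≤ -c) (x : ℝ) :
    ‖expConv R z a x‖ ≤ 4 * R * (Real.exp (c * R) * B) * decay c x ∧
      ‖expConv' R z a x‖ ≤ ‖z‖ * (4 * R * (Real.exp (c * R) * B) * decay c x) := by
  have h1 := norm_leftInt_le hR ha h0 hB hc hz x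
  have h2 := norm_rightInt_le hR ha h0 hB hc hz x
  constructor
  · rw [expConv_eq ha h0]
    refine (norm_add_le _ _).trans ?_
    linarith
  · rw [expConv', norm_mul]
    refine mul_le_mul_of_nonneg_left ((norm_sub_le _ _).trans ?_) (norm_nonneg _)
    linarith

theorem expConv_of_ge (ha : Continuous a) (h0 : ∀ x, R ≤ |x| → a x = 0) (z : ℂ) {x : ℝ}
    (hx : R ≤ x) : expConv R z a x =
      Complex.exp (z * x) * ∫ ξ in (-R)..R, Complex.exp (-z * ξ) * a ξ := by
  rw [expConv_eq ha h0, leftInt_of_ge ha h0 z hx, rightInt_eq_leftInt,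
    leftInt_of_le (fun x hx => h0 (-x) (by rwa [abs_neg])) z (by linarith), mul_zero, add_zero,
    leftInt]

theorem expConv_of_le (ha : Continuous a) (h0 : ∀ x, R ≤ |x| → a x = 0) (z : ℂ) {x : ℝ}
    (hx : x ≤ -R) : expConv R z a x =
      Complex.exp (-z * x) * ∫ ξ in (-R)..R, Complex.exp (z * ξ) * a ξ := by
  have e : (∫ ξ in (-R)..R, Complex.exp (z * ξ) * a ξ) = rightInt R z a (-R) := rfl
  rw [expConv_eq ha h0, leftInt_of_le h0 z hx, mul_zero, zero_add, e, rightInt_eq_leftInt,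
    rightInt_eq_leftInt, neg_neg,
    leftInt_of_ge (a := fun ξ => a (-ξ)) (by fun_prop)
      (fun x hx => h0 (-x) (by rwa [abs_neg])) z (by linarith)]

end

section

variable {R : ℝ} {f : ℝ × ℝ → ℝ} {ε μ β c : ℝ} {a : ℤ → ℝ → ℂ} {B : ℤ → ℝ}

/-! ### Solutions of the scattering problem given by their modes -/

/-- Equality holds for n = -1, the critical mode. Consequently every mode n ≠ 0 decays at least at
the rate μ. -/
theorem sq_le_beta_add_sq (h0 : 0 < β) (h1 : β < 1 / 2) {n : ℤ} (hn : n ≠ 0) :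
    (1 - β) ^ 2 ≤ (β + n) ^ 2 := by
  rcases lt_or_gt_of_ne hn with h | h
  · have : (n : ℝ) ≤ -1 := by exact_mod_cast (show n ≤ -1 by omega)
    nlinarith
  · have : (1 : ℝ) ≤ n := by exact_mod_cast (show 1 ≤ n by omega)
    nlinarith

theorem kMode_sq_of_ne (h0 : 0 < β) (h1 : β < 1 / 2) (μ : ℝ) {n : ℤ} (hn : n ≠ 0) :
    kMode μ β n ^ 2 = (β + n) ^ 2 - (1 - β) ^ 2 + μ ^ 2 :=
  Real.sq_sqrt (by linarith [sq_le_beta_add_sq h0 h1 hn, sq_nonneg μ])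

theorem le_kMode (h0 : 0 < β) (h1 : β < 1 / 2) {n : ℤ} (hn : n ≠ 0) (μ : ℝ) :
    μ ≤ kMode μ β n :=
  Real.le_sqrt_of_sq_le (by linarith [sq_le_beta_add_sq h0 h1 hn])

/-- (β+n)² = k_n² + (1-β)² - μ² ≤ k_n² + 1, and 1 ≤ (k_n/μ)² because k_n ≥ μ. It controls the
y-derivative of a mode by its decay rate. -/
theorem abs_beta_add_le (h0 : 0 < β) (h1 : β < 1 / 2) (hμ : 0 < μ) {n : ℤ} (hn : n ≠ 0) :
    |β + n| ≤ kMode μ β n * (1 + 1 / μ) := by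
  have hk := le_kMode h0 h1 hn μ
  have hk0 : 0 < kMode μ β n := hμ.trans_le hk
  refine abs_le_of_sq_le_sq ?_ (by positivity)
  have h2 : 1 ≤ kMode μ β n / μ := (one_le_div hμ).2 hk
  have h3 : kMode μ β n * (1 + 1 / μ) = kMode μ β n + kMode μ β n / μ := by ring
  rw [h3]
  have h4 := kMode_sq_of_ne h0 h1 μ hn
  nlinarith [sq_nonneg μ]

/-- The amplitude of the `n`-th mode generated by the sources `a`, including the incident wave. -/
def modeU (R μ β : ℝ) (a : ℤ → ℝ → ℂ) (n : ℤ) (x : ℝ) : ℂ :=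
  if n = 0 then modeE (kZero μ β) x +
    Complex.I / (2 * kZero μ β) * expConv R (Complex.I * kZero μ β) (a 0) x
  else expConv R (-(kMode μ β n : ℂ)) (a n) x / (2 * kMode μ β n)

/-- The derivative of `modeU`. -/
def modeU' (R μ β : ℝ) (a : ℤ → ℝ → ℂ) (n : ℤ) (x : ℝ) : ℂ :=
  if n = 0 then Complex.I * kZero μ β * modeE (kZero μ β) x +
    Complex.I / (2 * kZero μ β) * expConv' R (Complex.I * kZero μ β) (a 0) x
  else expConv' R (-(kMode μ β n : ℂ)) (a n) x / (2 * kMode μ β n)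

theorem modeU_zero (R μ β : ℝ) (a : ℤ → ℝ → ℂ) : modeU R μ β a 0 = fun x =>
    modeE (kZero μ β) x +
      Complex.I / (2 * kZero μ β) * expConv R (Complex.I * kZero μ β) (a 0) x := rfl

theorem modeU'_zero (R μ β : ℝ) (a : ℤ → ℝ → ℂ) : modeU' R μ β a 0 = fun x =>
    Complex.I * kZero μ β * modeE (kZero μ β) x +
      Complex.I / (2 * kZero μ β) * expConv' R (Complex.I * kZero μ β) (a 0) x := rfl

theorem modeU_of_ne (R μ β : ℝ) (a : ℤ → ℝ → ℂ) {n : ℤ} (hn : n ≠ 0) :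
    modeU R μ β a n = fun x =>
      expConv R (-(kMode μ β n : ℂ)) (a n) x / (2 * kMode μ β n) := by
  ext x
  rw [modeU, if_neg hn]

theorem modeU'_of_ne (R μ β : ℝ) (a : ℤ → ℝ → ℂ) {n : ℤ} (hn : n ≠ 0) :
    modeU' R μ β a n = fun x =>
      expConv' R (-(kMode μ β n : ℂ)) (a n) x / (2 * kMode μ β n) := by
  ext x
  rw [modeU', if_neg hn]

/-- Sources that generate a solution of the scattering problem. -/
structure ModeSystem (f : ℝ × ℝ → ℝ) (R ε μ β : ℝ) (a : ℤ → ℝ → ℂ) (B : ℤ → ℝ) : Prop where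
  beta_pos : 0 < β
  beta_lt : β < 1 / 2
  mu_pos : 0 < μ
  pos : 0 < 1 - 2 * β - μ ^ 2
  cont : ∀ n, Continuous (a n)
  zero : ∀ n x, R ≤ |x| → a n x = 0
  bound : ∀ n x, ‖a n x‖ ≤ B n
  summable : Summable B
  source : ∀ m x, a m x =
    2 * gam μ β * ε * ∑' n : ℤ, fCoeff f (m - n) x * modeU R μ β a n x

/-- The transmission coefficient. -/
def coefT (R μ β : ℝ) (a : ℤ → ℝ → ℂ) : ℂ :=
  1 + Complex.I / (2 * kZero μ β) *
    ∫ ξ in (-R)..R, Complex.exp (-(Complex.I * kZero μ β) * ξ) * a 0 ξ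

/-- The reflection coefficient. -/
def coefR (R μ β : ℝ) (a : ℤ → ℝ → ℂ) : ℂ :=
  Complex.I / (2 * kZero μ β) *
    ∫ ξ in (-R)..R, Complex.exp (Complex.I * kZero μ β * ξ) * a 0 ξ

/-- The far field of the propagating mode. -/
def farMode (k : ℝ) (r t : ℂ) (x : ℝ) : ℂ :=
  twoSided t r (waveR k 0) x + (Real.smoothTransition (-x) : ℂ) * modeE k x

theorem contDiff_farMode (k : ℝ) (r t : ℂ) : ContDiff ℝ ∞ (farMode k r t) := by
  have h1 : ContDiff ℝ ∞ fun x : ℝ => (Real.smoothTransition (-x) : ℂ) :=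
    Complex.ofRealCLM.contDiff.comp (contDiff_smoothTransition.comp contDiff_neg)
  exact (contDiff_twoSided t r (contDiff_waveR k 0)).add (h1.mul (contDiff_modeE k))

theorem hasDerivAt_farMode (k : ℝ) (r t : ℂ) (x : ℝ) :
    HasDerivAt (farMode k r t) (deriv (farMode k r t) x) x :=
  ((contDiff_infty_iff_deriv.1 (contDiff_farMode k r t)).1 x).hasDerivAt

theorem exists_decay_bound {g : ℝ → ℂ} (hg : Continuous g) (hc : 0 ≤ c)
    (h : ∃ M : ℝ, ∀ x, M < |x| → g x = 0) : ∃ L : ℝ, 0 ≤ L ∧ ∀ x, ‖g x‖ ≤ L * decay c x := by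
  obtain ⟨M, hM⟩ := h
  obtain ⟨C, hC⟩ := (isCompact_Icc (a := -M) (b := M)).exists_bound_of_continuousOn hg.continuousOn
  have hd := decay_pos c M
  refine ⟨|C| / decay c M, by positivity, fun x => ?_⟩
  have hx := decay_pos c x
  by_cases h : M < |x|
  · rw [hM x h, norm_zero]
    positivity
  · have hx' := not_lt.1 h
    refine (hC x (abs_le.1 hx')).trans ((le_abs_self C).trans ?_)
    have h1 : decay c M ≤ decay c x := decay_le_of_le hc (hx'.trans (le_abs_self M))
    calc |C| = |C| / decay c M * decay c M := by field_simp
      _ ≤ _ := mul_le_mul_of_nonneg_left h1 (by positivity)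

namespace ModeSystem

theorem bound_nonneg (hs : ModeSystem f R ε μ β a B) (n : ℤ) : 0 ≤ B n :=
  (norm_nonneg _).trans (hs.bound n 0)

theorem hasDerivAt_modeU (hs : ModeSystem f R ε μ β a B) (n : ℤ) (x : ℝ) :
    HasDerivAt (modeU R μ β a n) (modeU' R μ β a n x) x := by
  by_cases hn : n = 0
  · subst hn
    have h := (hasDerivAt_modeE (kZero μ β) x).add ((hasDerivAt_expConv (hs.cont 0) (hs.zero 0)
      (Complex.I * kZero μ β) x).const_mul (Complex.I / (2 * kZero μ β)))
    rw [modeU_zero, modeU'_zero]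
    exact h
  · have h := (hasDerivAt_expConv (hs.cont n) (hs.zero n) (-(kMode μ β n : ℂ)) x).div_const
      (2 * (kMode μ β n : ℂ))
    rw [modeU_of_ne _ _ _ _ hn, modeU'_of_ne _ _ _ _ hn]
    exact h

theorem hasDerivAt_modeU' (hs : ModeSystem f R ε μ β a B) (n : ℤ) (x : ℝ) :
    HasDerivAt (modeU' R μ β a n) ((((β + n) ^ 2 - ((1 - β) ^ 2 - μ ^ 2) : ℝ) : ℂ) *
      modeU R μ β a n x - a n x) x := by
  by_cases hn : n = 0
  · subst hn
    have hk := kZero_pos hs.pos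
    have hk2 : kZero μ β ^ 2 = 1 - 2 * β - μ ^ 2 := Real.sq_sqrt hs.pos.le
    have hk' : (kZero μ β : ℂ) ≠ 0 := Complex.ofReal_ne_zero.2 hk.ne'
    have h := ((hasDerivAt_modeE (kZero μ β) x).const_mul (Complex.I * kZero μ β)).add
      ((hasDerivAt_expConv' (hs.cont 0) (hs.zero 0)
      (Complex.I * kZero μ β) x).const_mul (Complex.I / (2 * kZero μ β)))
    have e : (((β + (0 : ℤ)) ^ 2 - ((1 - β) ^ 2 - μ ^ 2) : ℝ) : ℂ) = -(kZero μ β : ℂ) ^ 2 := by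
      rw [← Complex.ofReal_pow, hk2]
      push_cast
      ring
    rw [modeU'_zero, e, modeU_zero]
    convert! h using 1
    field_simp
    simp only [Complex.I_sq]
    ring
  · have hk : 0 < kMode μ β n := hs.mu_pos.trans_le (le_kMode hs.beta_pos hs.beta_lt hn μ)
    have hk' : (kMode μ β n : ℂ) ≠ 0 := Complex.ofReal_ne_zero.2 hk.ne'
    have h := (hasDerivAt_expConv' (hs.cont n) (hs.zero n) (-(kMode μ β n : ℂ)) x).div_const
      (2 * (kMode μ β n : ℂ))
    have e : (((β + n) ^ 2 - ((1 - β) ^ 2 - μ ^ 2) : ℝ) : ℂ) = (kMode μ β n : ℂ) ^ 2 := by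
      rw [← Complex.ofReal_pow, kMode_sq_of_ne hs.beta_pos hs.beta_lt μ hn]
      push_cast
      ring
    rw [modeU'_of_ne _ _ _ _ hn, e, modeU_of_ne _ _ _ _ hn]
    convert! h using 1
    field_simp
    ring

theorem continuous_modeU (hs : ModeSystem f R ε μ β a B) (n : ℤ) :
    Continuous (modeU R μ β a n) :=
  continuous_iff_continuousAt.2 fun x => (hs.hasDerivAt_modeU n x).continuousAt

theorem continuous_modeU' (hs : ModeSystem f R ε μ β a B) (n : ℤ) :
    Continuous (modeU' R μ β a n) :=
  continuous_iff_continuousAt.2 fun x => (hs.hasDerivAt_modeU' n x).continuousAt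

/-- Exponential decay of the evanescent modes. -/
theorem bound_of_ne (hs : ModeSystem f R ε μ β a B) (hR : 0 < R) {n : ℤ} (hn : n ≠ 0) (x : ℝ) :
    ‖modeU R μ β a n x‖ ≤ (1 + 1 / μ) * (2 * R * Real.exp (μ * R)) * B n * decay μ x ∧
    ‖modeU' R μ β a n x‖ ≤ (1 + 1 / μ) * (2 * R * Real.exp (μ * R)) * B n * decay μ x ∧
    |β + n| * ‖modeU R μ β a n x‖ ≤
      (1 + 1 / μ) * (2 * R * Real.exp (μ * R)) * B n * decay μ x := by
  have hμ := hs.mu_pos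
  have hle := le_kMode hs.beta_pos hs.beta_lt hn μ
  have hk : 0 < kMode μ β n := hμ.trans_le hle
  obtain ⟨h1, h2⟩ := norm_expConv_le hR (hs.cont n) (hs.zero n) (hs.bound n)
    (z := -(kMode μ β n : ℂ)) hμ.le (by simpa using hle) x
  set X := 4 * R * (Real.exp (μ * R) * B n) * decay μ x with hX
  have hXe : (1 + 1 / μ) * (2 * R * Real.exp (μ * R)) * B n * decay μ x = (1 + 1 / μ) * (X / 2) := by
    rw [hX]
    ring
  have hX0 : 0 ≤ X := (norm_nonneg _).trans h1
  have hn2 : ‖(2 * (kMode μ β n : ℂ))‖ = 2 * kMode μ β n := by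
    rw [norm_mul, Complex.norm_real, Real.norm_of_nonneg hk.le]
    simp
  have hnk : ‖-(kMode μ β n : ℂ)‖ = kMode μ β n := by
    rw [norm_neg, Complex.norm_real, Real.norm_of_nonneg hk.le]
  rw [hnk] at h2
  rw [hXe, modeU, modeU', if_neg hn, if_neg hn, norm_div, norm_div, hn2]
  have b1 : ‖expConv R (-(kMode μ β n : ℂ)) (a n) x‖ / (2 * kMode μ β n) ≤
      X / (2 * kMode μ β n) := div_le_div_of_nonneg_right h1 (by linarith)
  refine ⟨b1.trans ?_, ?_, ?_⟩
  · calc X / (2 * kMode μ β n) ≤ X / (2 * μ) :=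
        div_le_div_of_nonneg_left hX0 (by linarith) (by linarith)
      _ = 1 / μ * (X / 2) := by field_simp
      _ ≤ _ := mul_le_mul_of_nonneg_right (by linarith) (by linarith)
  · calc ‖expConv' R (-(kMode μ β n : ℂ)) (a n) x‖ / (2 * kMode μ β n) ≤
        kMode μ β n * X / (2 * kMode μ β n) := div_le_div_of_nonneg_right h2 (by linarith)
      _ = 1 * (X / 2) := by field_simp
      _ ≤ _ := by
        refine mul_le_mul_of_nonneg_right ?_ (by linarith)
        have : 0 < 1 / μ := by positivity
        linarith
  · calc |β + n| * (‖expConv R (-(kMode μ β n : ℂ)) (a n) x‖ / (2 * kMode μ β n)) ≤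
        kMode μ β n * (1 + 1 / μ) * (X / (2 * kMode μ β n)) :=
          mul_le_mul (abs_beta_add_le hs.beta_pos hs.beta_lt hμ hn) b1 (by positivity)
            (by positivity)
      _ = _ := by field_simp

/-- The propagating mode has a purely imaginary exponent, so the convolution estimate is used with
rate c = 0 and gives boundedness without decay. -/
theorem bound_zero (hs : ModeSystem f R ε μ β a B) (hR : 0 < R) : ∃ L : ℝ, 0 ≤ L ∧ ∀ x,
    ‖modeU R μ β a 0 x‖ ≤ L ∧ ‖modeU' R μ β a 0 x‖ ≤ L ∧ |β| * ‖modeU R μ β a 0 x‖ ≤ L := by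
  set z : ℂ := Complex.I * kZero μ β
  set w : ℂ := Complex.I / (2 * kZero μ β)
  set X := 4 * R * (Real.exp (0 * R) * B 0) * 1
  have hX : 0 ≤ X := by
    have := hs.bound_nonneg 0
    positivity
  have hb : ∀ x, ‖expConv R z (a 0) x‖ ≤ X ∧ ‖expConv' R z (a 0) x‖ ≤ ‖z‖ * X := fun x => by
    have h := norm_expConv_le hR (hs.cont 0) (hs.zero 0) (hs.bound 0) (z := z) le_rfl
      (by simp [z]) x
    have hd : decay 0 x = 1 := by simp [decay]
    rwa [hd] at h
  have h1 : ∀ x, ‖modeU R μ β a 0 x‖ ≤ 1 + ‖w‖ * X := fun x => by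
    rw [modeU, if_pos rfl]
    refine (norm_add_le _ _).trans ?_
    rw [norm_modeE, norm_mul]
    exact add_le_add le_rfl (mul_le_mul_of_nonneg_left (hb x).1 (norm_nonneg _))
  have h2 : ∀ x, ‖modeU' R μ β a 0 x‖ ≤ ‖z‖ + ‖w‖ * (‖z‖ * X) := fun x => by
    rw [modeU'_zero]
    refine (norm_add_le _ _).trans ?_
    rw [norm_mul z, norm_modeE, mul_one, norm_mul w]
    exact add_le_add le_rfl (mul_le_mul_of_nonneg_left (hb x).2 (norm_nonneg _))
  refine ⟨(1 + ‖w‖ * X) + (‖z‖ + ‖w‖ * (‖z‖ * X)) + |β| * (1 + ‖w‖ * X), by positivity,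
    fun x => ⟨(h1 x).trans ?_, (h2 x).trans ?_,
      (mul_le_mul_of_nonneg_left (h1 x) (abs_nonneg _)).trans ?_⟩⟩
  · have : 0 ≤ (‖z‖ + ‖w‖ * (‖z‖ * X)) + |β| * (1 + ‖w‖ * X) := by positivity
    linarith
  · have : 0 ≤ (1 + ‖w‖ * X) + |β| * (1 + ‖w‖ * X) := by positivity
    linarith
  · have : 0 ≤ (1 + ‖w‖ * X) + (‖z‖ + ‖w‖ * (‖z‖ * X)) := by positivity
    linarith

theorem exists_bound (hs : ModeSystem f R ε μ β a B) (hR : 0 < R) : ∃ b : ℤ → ℝ, Summable b ∧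
    ∀ n x, ‖modeU R μ β a n x‖ ≤ b n ∧ ‖modeU' R μ β a n x‖ ≤ b n ∧
      |β + n| * ‖modeU R μ β a n x‖ ≤ b n := by
  obtain ⟨L, hL0, hL⟩ := hs.bound_zero hR
  set K := (1 + 1 / μ) * (2 * R * Real.exp (μ * R))
  have hμ := hs.mu_pos
  have hK : 0 ≤ K := by positivity
  refine ⟨fun n => K * B n + if n = 0 then L else 0,
    (hs.summable.mul_left K).add (summable_of_ne_finset_zero (s := {0}) fun n hn => ?_),
    fun n x => ?_⟩
  · rw [if_neg (by simpa using hn)]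
  · have hB := mul_nonneg hK (hs.bound_nonneg n)
    by_cases hn : n = 0
    · subst hn
      simp only [if_true]
      obtain ⟨l1, l2, l3⟩ := hL x
      rw [Int.cast_zero, add_zero]
      exact ⟨by linarith, by linarith, by linarith⟩
    · simp only [if_neg hn, add_zero]
      obtain ⟨l1, l2, l3⟩ := hs.bound_of_ne hR hn x
      have hd : K * B n * decay μ x ≤ K * B n := by
        refine mul_le_of_le_one_right hB ?_
        rw [decay, Real.exp_le_one_iff]
        nlinarith [abs_nonneg x]
      exact ⟨l1.trans hd, l2.trans hd, l3.trans hd⟩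

/-- Outside the support of the source the convolution is an exact multiple of an outgoing
exponential. For |x| ≥ 1 the cut-offs equal 0 or 1, so mode 0 coincides with the far field and is
not merely asymptotic to it. -/
theorem modeU_zero_eq_farMode (hs : ModeSystem f R ε μ β a B) {x : ℝ} (hx : max R 1 ≤ |x|) :
    modeU R μ β a 0 x = farMode (kZero μ β) (coefR R μ β a) (coefT R μ β a) x := by
  have hR := (le_max_left R 1).trans hx
  have h1 := (le_max_right R 1).trans hx
  have em : ∀ y : ℝ, Complex.exp (Complex.I * kZero μ β * y) = modeE (kZero μ β) y := fun y => by
    rw [modeE, mul_assoc]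
  rw [modeU, if_pos rfl, farMode, twoSided]
  rcases le_total 0 x with h | h
  · rw [abs_of_nonneg h] at hR h1
    rw [expConv_of_ge (hs.cont 0) (hs.zero 0) _ hR, waveR_eq _ (by linarith),
      waveR_eq_zero _ (by linarith), Real.smoothTransition.zero_of_nonpos (by linarith), em, coefT]
    push_cast
    ring
  · rw [abs_of_nonpos h] at hR h1
    have en : Complex.exp (-(Complex.I * kZero μ β) * x) = modeE (kZero μ β) (-x) := by
      rw [← em]
      congr 1
      push_cast
      ring
    rw [expConv_of_le (hs.cont 0) (hs.zero 0) _ (by linarith), waveR_eq_zero _ (by linarith),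
      waveR_eq _ (by linarith), Real.smoothTransition.one_of_one_le (by linarith), en, coefR]
    push_cast
    ring

end ModeSystem

end

/-! ### Summation of the modes to a weak solution -/

section

variable {R : ℝ} {f : ℝ × ℝ → ℝ} {ε μ β c : ℝ} {a : ℤ → ℝ → ℂ} {B : ℤ → ℝ}

theorem hasSum_integral_mul_add {s₁ s₂ : ℤ → ℝ × ℝ → ℂ} (h₁ : ∀ n, Continuous (s₁ n))
    (h₂ : ∀ n, Continuous (s₂ n)) {b : ℤ → ℝ} (hb : Summable b) (hb₁ : ∀ n p, ‖s₁ n p‖ ≤ b n)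
    (hb₂ : ∀ n p, ‖s₂ n p‖ ≤ b n) {θ₁ θ₂ : ℝ × ℝ → ℂ} (i₁ : Integrable θ₁ stripMeasure)
    (i₂ : Integrable θ₂ stripMeasure) :
    HasSum (fun n => ∫ p, (s₁ n p * θ₁ p + s₂ n p * θ₂ p) ∂stripMeasure)
      (∫ p, ((∑' n, s₁ n p) * θ₁ p + (∑' n, s₂ n p) * θ₂ p) ∂stripMeasure) := by
  refine hasSum_integral_of_dominated_convergence (fun n p => b n * (‖θ₁ p‖ + ‖θ₂ p‖))
    (fun n => ?_) (fun n => ?_) ?_ ?_ ?_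
  · exact ((h₁ n).aestronglyMeasurable.mul i₁.1).add ((h₂ n).aestronglyMeasurable.mul i₂.1)
  · refine Filter.Eventually.of_forall fun p => (norm_add_le _ _).trans ?_
    rw [norm_mul, norm_mul, mul_add]
    exact add_le_add (mul_le_mul_of_nonneg_right (hb₁ n p) (norm_nonneg _))
      (mul_le_mul_of_nonneg_right (hb₂ n p) (norm_nonneg _))
  · exact Filter.Eventually.of_forall fun p => hb.mul_right _
  · simp only [tsum_mul_right]
    exact (i₁.norm.add i₂.norm).const_mul _
  · refine Filter.Eventually.of_forall fun p => ?_
    exact ((Summable.of_norm_bounded hb fun n => hb₁ n p).hasSum.mul_right _).add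
      ((Summable.of_norm_bounded hb fun n => hb₂ n p).hasSum.mul_right _)

theorem hasSum_integral_mul {s : ℤ → ℝ × ℝ → ℂ} (h : ∀ n, Continuous (s n))
    {b : ℤ → ℝ} (hb : Summable b) (hb' : ∀ n p, ‖s n p‖ ≤ b n) {θ : ℝ × ℝ → ℂ}
    (i : Integrable θ stripMeasure) :
    HasSum (fun n => ∫ p, s n p * θ p ∂stripMeasure)
      (∫ p, (∑' n, s n p) * θ p ∂stripMeasure) := by
  have := hasSum_integral_mul_add h h hb hb' hb' i (integrable_zero (ℝ × ℝ) ℂ stripMeasure)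
  simpa using this

theorem tsum_add_single {g : ℤ → ℂ} (hg : Summable g) (d : ℂ) :
    (∑' n, g n) + d = ∑' n, (g n + if n = 0 then d else 0) := by
  have h := hg.hasSum.add (hasSum_ite_eq (0 : ℤ) d)
  exact h.tsum_eq.symm

/-- The shear `(m, n) ↦ (m - n, n)`. -/
def intShear : ℤ × ℤ ≃ ℤ × ℤ where
  toFun x := (x.1 - x.2, x.2)
  invFun x := (x.1 + x.2, x.2)
  left_inv x := by simp
  right_inv x := by simp

/-- The product of two absolutely convergent series, summed along the lines j + n = m. -/
theorem hasSum_convolution {g h : ℤ → ℂ} {s t : ℂ} (hg : HasSum g s) (hh : HasSum h t)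
    (hgn : Summable fun n => ‖g n‖) (hhn : Summable fun n => ‖h n‖) :
    HasSum (fun m => ∑' n, g (m - n) * h n) (s * t) := by
  have h1 : HasSum (fun x : ℤ × ℤ => g x.1 * h x.2) (s * t) :=
    hg.mul hh (summable_mul_of_summable_norm hgn hhn)
  have h2 : HasSum ((fun x : ℤ × ℤ => g x.1 * h x.2) ∘ intShear) (s * t) :=
    (Equiv.hasSum_iff intShear).2 h1
  have h3 : ∀ m : ℤ, Summable fun n : ℤ => g (m - n) * h n := fun m =>
    h2.summable.prod_factor m
  have h4 := h2.prod_fiberwise (g := fun m => ∑' n, g (m - n) * h n) fun m => (h3 m).hasSum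
  exact h4

namespace ModeSystem

/-- The sources are the modes of `ω² ε f` times the total field. -/
theorem hasSum_source (hs : ModeSystem f R ε μ β a B) (hf : Perturbation f R) (hR : 0 < R)
    (p : ℝ × ℝ) :
    HasSum (fun n => a n p.1 * modeE (β + n) p.2)
      ((((1 - β) ^ 2 - μ ^ 2 : ℝ) : ℂ) * ε * f p *
        ∑' n : ℤ, modeU R μ β a n p.1 * modeE (β + n) p.2) := by
  obtain ⟨x, y⟩ := p
  obtain ⟨b, hb, hb'⟩ := hs.exists_bound hR
  obtain ⟨d, hd, -, hd'⟩ := hf.exists_majorant hR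
  have hun : Summable fun n : ℤ => ‖modeU R μ β a n x * modeE (β + n) y‖ := by
    refine Summable.of_nonneg_of_le (fun _ => norm_nonneg _) (fun n => ?_) hb
    rw [norm_mul, norm_modeE, mul_one]
    exact (hb' n x).1
  have hfn : Summable fun j : ℤ => ‖fCoeff f j x * Complex.exp (Complex.I * j * y)‖ := by
    refine Summable.of_nonneg_of_le (fun _ => norm_nonneg _) (fun j => ?_) hd
    have : Complex.exp (Complex.I * j * y) = modeE j y := by
      rw [modeE, mul_assoc]
      push_cast
      rfl
    rw [this, norm_mul, norm_modeE, mul_one]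
    exact hd' j x
  have h := (hasSum_convolution (hf.hasSum_fourier hR x y) hun.of_norm.hasSum hfn hun).mul_left
    (2 * (gam μ β : ℂ) * ε)
  have e1 : ∀ m n : ℤ, fCoeff f (m - n) x * Complex.exp (Complex.I * ((m - n : ℤ) : ℂ) * y) *
      (modeU R μ β a n x * modeE (β + n) y) =
      fCoeff f (m - n) x * modeU R μ β a n x * modeE (β + m) y := fun m n => by
    have : Complex.exp (Complex.I * ((m - n : ℤ) : ℂ) * y) * modeE (β + n) y = modeE (β + m) y := by
      rw [modeE, modeE, ← Complex.exp_add]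
      congr 1
      push_cast
      ring
    rw [← this]
    ring
  simp only [e1, tsum_mul_right, ← mul_assoc] at h
  simp only [← hs.source] at h
  convert! h using 1
  simp only [gam]
  push_cast
  have : (Real.pi : ℂ) ≠ 0 := Complex.ofReal_ne_zero.2 Real.pi_ne_zero
  field_simp
  ring

/-- Removing the far field from mode 0 leaves modes that all decay like e^{-μ|x|} with summable
amplitudes, hence a function in H¹. The weak identity is checked mode by mode: Green's formula and
u_n'' = ((β+n)² - ω²)u_n - a_n give ω²u_n + a_n on the right, and the a_n sum to ω²εf times the
field. -/
theorem isScatteringSolution (hs : ModeSystem f R ε μ β a B) (hf : Perturbation f R)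
    (hR : 0 < R) :
    IsScatteringSolution f ε μ β (fun p => ∑' n : ℤ, modeU R μ β a n p.1 * modeE (β + n) p.2)
      (coefR R μ β a) (coefT R μ β a) := by
  obtain ⟨b, hb, hb'⟩ := hs.exists_bound hR
  have hμ := hs.mu_pos
  set k := kZero μ β with hk
  set P := farMode k (coefR R μ β a) (coefT R μ β a) with hP
  have hPd := hasDerivAt_farMode k (coefR R μ β a) (coefT R μ β a)
  have hPs := contDiff_farMode k (coefR R μ β a) (coefT R μ β a)
  have hPs' : ContDiff ℝ ∞ (deriv P) := (contDiff_infty_iff_deriv.1 hPs).2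
  have hfar : farField β k (coefR R μ β a) (coefT R μ β a) = fun p => P p.1 * modeE β p.2 :=
    funext fun p => farField_eq β k _ _ p
  have hfarX : dX (farField β k (coefR R μ β a) (coefT R μ β a)) =
      fun p => deriv P p.1 * modeE β p.2 := by
    rw [hfar]
    exact funext fun p => dX_mode hPd β p
  have hfarY : dY (farField β k (coefR R μ β a) (coefT R μ β a)) =
      fun p => P p.1 * (Complex.I * β * modeE β p.2) := by
    rw [hfar]
    exact funext fun p => dY_mode _ β p
  -- Only mode 0 is corrected, since the far field carries the single harmonic e^{iβy}.
  set v : ℤ → ℝ → ℂ := fun n x => modeU R μ β a n x + if n = 0 then -P x else 0 with hv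
  set v' : ℤ → ℝ → ℂ := fun n x => modeU' R μ β a n x + if n = 0 then -deriv P x else 0 with hv'
  have hvd : ∀ n x, HasDerivAt (v n) (v' n x) x := fun n x => by
    by_cases hn : n = 0
    · subst hn
      simp only [hv, hv', if_true]
      exact (hs.hasDerivAt_modeU 0 x).fun_add (hPd x).fun_neg
    · simp only [hv, hv', if_neg hn, add_zero]
      exact hs.hasDerivAt_modeU n x
  have hvc : ∀ n, Continuous (v' n) := fun n => by
    have := hs.continuous_modeU' n
    by_cases hn : n = 0
    · simp only [hv', if_pos hn]
      exact this.add hPs'.continuous.neg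
    · simp only [hv', if_neg hn, add_zero]
      exact this
  have hv0 : ∀ x, max R 1 < |x| → v 0 x = 0 := fun x hx => by
    simp only [hv, if_true]
    rw [hs.modeU_zero_eq_farMode hx.le, add_neg_cancel]
  have hv0' : ∀ x, max R 1 < |x| → v' 0 x = 0 := fun x hx => by
    have h1 : v 0 =ᶠ[𝓝 x] fun _ => 0 := by
      filter_upwards [(continuous_abs.tendsto x).eventually (lt_mem_nhds hx)] with s hs
      exact hv0 s hs
    exact (hvd 0 x).unique ((hasDerivAt_const x (0 : ℂ)).congr_of_eventuallyEq h1)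
  obtain ⟨L₀, hL₀, hL₀'⟩ := exists_decay_bound (g := v 0) (c := μ)
    (continuous_iff_continuousAt.2 fun x => (hvd 0 x).continuousAt) hμ.le ⟨_, hv0⟩
  obtain ⟨L₁, hL₁, hL₁'⟩ := exists_decay_bound (g := v' 0) (c := μ) (hvc 0) hμ.le ⟨_, hv0'⟩
  set K := (1 + 1 / μ) * (2 * R * Real.exp (μ * R)) with hK
  have hbv : Summable fun n : ℤ => K * B n + if n = 0 then L₀ + L₁ + |β| * L₀ else 0 := by
    refine (hs.summable.mul_left K).add (summable_of_ne_finset_zero (s := {0}) fun n hn => ?_)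
    rw [if_neg (by simpa using hn)]
  have hbd : ∀ n x, ‖v n x‖ ≤ (K * B n + if n = 0 then L₀ + L₁ + |β| * L₀ else 0) * decay μ x ∧
      ‖v' n x‖ ≤ (K * B n + if n = 0 then L₀ + L₁ + |β| * L₀ else 0) * decay μ x ∧
      |β + n| * ‖v n x‖ ≤
        (K * B n + if n = 0 then L₀ + L₁ + |β| * L₀ else 0) * decay μ x := fun n x => by
    have hd := (decay_pos μ x).le
    by_cases hn : n = 0
    · subst hn
      have hB := mul_nonneg (by positivity : 0 ≤ K) (hs.bound_nonneg 0)
      have hβL : 0 ≤ |β| * L₀ := by positivity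
      simp only [if_true, Int.cast_zero, add_zero]
      refine ⟨(hL₀' x).trans (mul_le_mul_of_nonneg_right (by linarith) hd),
        (hL₁' x).trans (mul_le_mul_of_nonneg_right (by linarith) hd),
        (mul_le_mul_of_nonneg_left (hL₀' x) (abs_nonneg β)).trans ?_⟩
      rw [← mul_assoc]
      exact mul_le_mul_of_nonneg_right (by linarith) hd
    · simp only [hv, hv', if_neg hn, add_zero]
      exact hs.bound_of_ne hR hn x
  -- The approximation by test functions gives up half of the decay rate, hence c = μ/2.
  have hH1 := inH1_tsum (β := β) (c := μ / 2) (by linarith) hvd hvc hbv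
    (fun n x => by rw [mul_div_cancel₀ μ two_ne_zero]; exact (hbd n x).1)
    (fun n x => by rw [mul_div_cancel₀ μ two_ne_zero]; exact (hbd n x).2.1)
    (fun n x => by rw [mul_div_cancel₀ μ two_ne_zero]; exact (hbd n x).2.2)
  have su : ∀ p : ℝ × ℝ, Summable fun n : ℤ => modeU R μ β a n p.1 * modeE (β + n) p.2 := fun p =>
    Summable.of_norm_bounded hb fun n => by
      rw [norm_mul, norm_modeE, mul_one]
      exact (hb' n p.1).1
  have nu' : ∀ (n : ℤ) (p : ℝ × ℝ), ‖modeU' R μ β a n p.1 * modeE (β + n) p.2‖ ≤ b n :=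
    fun n p => by
      rw [norm_mul, norm_modeE, mul_one]
      exact (hb' n p.1).2.1
  have nuy : ∀ (n : ℤ) (p : ℝ × ℝ), ‖modeU R μ β a n p.1 *
      (Complex.I * ((β + n : ℝ) : ℂ) * modeE (β + n) p.2)‖ ≤ b n := fun n p => by
    rw [norm_mul, norm_mul, norm_mul, norm_modeE, mul_one, Complex.norm_I, one_mul,
      Complex.norm_real, Real.norm_eq_abs, mul_comm]
    exact (hb' n p.1).2.2
  have ite_mul_mode : ∀ (n : ℤ) (d : ℂ) (y : ℝ), (if n = 0 then -d else 0) * modeE (β + n) y =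
      if n = 0 then -(d * modeE β y) else 0 := fun n d y => by
    by_cases hn : n = 0
    · subst hn
      simp
    · simp [hn]
  have ite_mul_mode' : ∀ (n : ℤ) (d : ℂ) (y : ℝ), (if n = 0 then -d else 0) *
      (Complex.I * ((β + n : ℝ) : ℂ) * modeE (β + n) y) =
      if n = 0 then -(d * (Complex.I * β * modeE β y)) else 0 := fun n d y => by
    by_cases hn : n = 0
    · subst hn
      simp
    · simp [hn]
  have ew : (fun p : ℝ × ℝ => ∑' n : ℤ, v n p.1 * modeE (β + n) p.2) =
      (fun p => ∑' n : ℤ, modeU R μ β a n p.1 * modeE (β + n) p.2) -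
        farField β k (coefR R μ β a) (coefT R μ β a) := by
    ext p
    rw [Pi.sub_apply, hfar, sub_eq_add_neg, tsum_add_single (su p)]
    simp only [hv, add_mul, ite_mul_mode]
  have ewx : dX (farField β k (coefR R μ β a) (coefT R μ β a)) +
      (fun p : ℝ × ℝ => ∑' n : ℤ, v' n p.1 * modeE (β + n) p.2) =
      fun p => ∑' n : ℤ, modeU' R μ β a n p.1 * modeE (β + n) p.2 := by
    ext p
    simp only [Pi.add_apply, hfarX, hv', add_mul, ite_mul_mode]
    rw [← tsum_add_single (Summable.of_norm_bounded hb fun n => nu' n p)]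
    ring
  have ewy : dY (farField β k (coefR R μ β a) (coefT R μ β a)) +
      (fun p : ℝ × ℝ => ∑' n : ℤ, v n p.1 *
        (Complex.I * ((β + n : ℝ) : ℂ) * modeE (β + n) p.2)) =
      fun p => ∑' n : ℤ, modeU R μ β a n p.1 *
        (Complex.I * ((β + n : ℝ) : ℂ) * modeE (β + n) p.2) := by
    ext p
    simp only [Pi.add_apply, hfarY]
    simp only [hv, add_mul (modeU _ _ _ _ _ _), ite_mul_mode']
    rw [← tsum_add_single (Summable.of_norm_bounded hb fun n => nuy n p)]
    ring
  rw [isScatteringSolution_iff]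
  refine ⟨_, _, ew ▸ hH1, fun Φ hΦ => ?_⟩
  rw [ewx, ewy, weakForm, sub_eq_zero]
  have cu := hs.continuous_modeU
  have cu' := hs.continuous_modeU'
  have ca := hs.cont
  have hconj : ∀ {g : ℝ × ℝ → ℂ}, Integrable g stripMeasure →
      Integrable (fun p => (starRingEnd ℂ) (g p)) stripMeasure := fun {g} hg =>
    (LinearIsometryEquiv.integrable_comp_iff Complex.conjLIE).2 hg
  have hL := hasSum_integral_mul_add
    (s₁ := fun (n : ℤ) (p : ℝ × ℝ) => modeU' R μ β a n p.1 * modeE (β + n) p.2)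
    (s₂ := fun (n : ℤ) (p : ℝ × ℝ) => modeU R μ β a n p.1 *
      (Complex.I * ((β + n : ℝ) : ℂ) * modeE (β + n) p.2))
    (fun n => by have := cu' n; fun_prop) (fun n => by have := cu n; fun_prop) hb nu' nuy
    (hconj (integrable_of_vanish (continuous_dX hΦ.smooth) hΦ.vanish_dX))
    (hconj (integrable_of_vanish (continuous_dY hΦ.smooth) hΦ.vanish_dY))
  set W : ℂ := (((1 - β) ^ 2 - μ ^ 2 : ℝ) : ℂ) with hW
  have hRs := hasSum_integral_mul
    (s := fun (n : ℤ) (p : ℝ × ℝ) => (W * modeU R μ β a n p.1 + a n p.1) * modeE (β + n) p.2)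
    (fun n => by have := cu n; have := ca n; fun_prop)
    ((hb.mul_left ‖W‖).add hs.summable) (fun n p => by
      rw [norm_mul, norm_modeE, mul_one]
      refine (norm_add_le _ _).trans (add_le_add ?_ (hs.bound n p.1))
      rw [norm_mul]
      exact mul_le_mul_of_nonneg_left (hb' n p.1).1 (norm_nonneg _))
    (hconj (integrable_of_vanish hΦ.smooth.continuous hΦ.vanish))
  -- Both sides of the weak identity are now series over n; they are compared term by term, and
  -- uniqueness of sums finishes.
  have hterm : (fun n : ℤ => ∫ p : ℝ × ℝ, (modeU' R μ β a n p.1 * modeE (β + n) p.2 *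
      (starRingEnd ℂ) (dX Φ p) + modeU R μ β a n p.1 *
      (Complex.I * ((β + n : ℝ) : ℂ) * modeE (β + n) p.2) * (starRingEnd ℂ) (dY Φ p))
        ∂stripMeasure) = fun n : ℤ => ∫ p : ℝ × ℝ,
      (W * modeU R μ β a n p.1 + a n p.1) * modeE (β + n) p.2 * (starRingEnd ℂ) (Φ p)
        ∂stripMeasure := by
    ext n
    have := cu n
    have := ca n
    rw [integral_mode hΦ n (hs.hasDerivAt_modeU n) (hs.hasDerivAt_modeU' n) (by fun_prop)]
    refine integral_congr_ae (Filter.Eventually.of_forall fun p => ?_)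
    simp only [hW]
    push_cast
    ring
  rw [hterm] at hL
  rw [hL.unique hRs]
  refine integral_congr_ae (Filter.Eventually.of_forall fun p => ?_)
  have h1 := (((su p).hasSum.mul_left W).add (hs.hasSum_source hf hR p)).tsum_eq
  simp only
  rw [← hW] at h1
  have e2 : ∀ n : ℤ, (W * modeU R μ β a n p.1 + a n p.1) * modeE (β + n) p.2 =
      W * (modeU R μ β a n p.1 * modeE (β + n) p.2) + a n p.1 * modeE (β + n) p.2 := fun n => by
    ring
  simp only [e2]
  rw [h1, potential]
  simp only [hW]
  push_cast
  ring

end ModeSystem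

end

section

variable {R : ℝ} {f : ℝ × ℝ → ℝ} {ε μ ν β : ℝ} {c : ℤ → SegFun R} {K : KerAlg R}

/-! ### Solutions of the system generate solutions of the scattering problem -/

/-- Extension by zero. -/
def segExt (φ : SegFun R) (x : ℝ) : ℂ := if h : x ∈ Set.Icc (-R) R then φ ⟨x, h⟩ else 0

theorem segExt_coe (φ : SegFun R) (x : Set.Icc (-R) R) : segExt φ x = φ x := by
  rw [segExt, dif_pos x.2]

theorem segExt_eq_zero {φ : SegFun R} (h0 : ∀ x : Set.Icc (-R) R, R ≤ |(x : ℝ)| → φ x = 0) {x : ℝ}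
    (hx : R ≤ |x|) : segExt φ x = 0 := by
  rw [segExt]
  split_ifs with h
  · exact h0 ⟨x, h⟩ hx
  · rfl

/-- Continuity across ±R is exactly the vanishing of φ at the endpoints. -/
theorem continuous_segExt (hR : 0 < R) {φ : SegFun R}
    (h0 : ∀ x : Set.Icc (-R) R, R ≤ |(x : ℝ)| → φ x = 0) : Continuous (segExt φ) := by
  have hle : -R ≤ R := by linarith
  have e : segExt φ = fun x => if |x| ≤ R then Set.IccExtend hle φ x else 0 := by
    ext x
    by_cases h : x ∈ Set.Icc (-R) R
    · rw [segExt, dif_pos h, if_pos (abs_le.2 h), Set.IccExtend_of_mem hle _ h]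
    · rw [segExt, dif_neg h, if_neg fun h' => h (abs_le.1 h')]
  rw [e]
  refine Continuous.if_le (φ.continuous.Icc_extend') continuous_const continuous_abs
    continuous_const fun x hx => ?_
  have h : x ∈ Set.Icc (-R) R := abs_le.1 hx.le
  rw [Set.IccExtend_of_mem hle _ h]
  exact h0 ⟨x, h⟩ hx.ge

theorem integral_mul_segExt (hR : 0 < R) (g : ℝ → ℂ) (φ : SegFun R) :
    ∫ ξ in (-R)..R, g ξ * segExt φ ξ = ∫ ξ : Set.Icc (-R) R, g ξ * φ ξ ∂(segMeasure R) := by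
  rw [intervalIntegral.integral_of_le (by linarith), ← integral_Icc_eq_integral_Ioc,
    ← integral_seg_eq (fun ξ => g ξ * segExt φ ξ)]
  simp only [segExt_coe]

theorem expConv_segExt (hR : 0 < R) (z : ℂ) (φ : SegFun R) (x : ℝ) :
    expConv R z (segExt φ) x =
      ∫ ξ : Set.Icc (-R) R, Complex.exp (z * (|x - ξ| : ℝ)) * φ ξ ∂(segMeasure R) :=
  integral_mul_segExt hR (fun ξ => Complex.exp (z * (|x - ξ| : ℝ))) φ

theorem norm_expConv_segExt_le (hR : 0 < R) {z : ℂ} (hz : z.re ≤ 0) (φ : SegFun R) (x : ℝ) :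
    ‖expConv R z (segExt φ) x‖ ≤ ‖φ‖ * segLen R := by
  rw [expConv_segExt hR]
  refine norm_integral_seg_le fun ξ => ?_
  rw [norm_mul, Complex.norm_exp]
  refine (mul_le_of_le_one_left (norm_nonneg _) ?_).trans (φ.norm_coe_le_norm _)
  rw [Real.exp_le_one_iff, Complex.re_mul_ofReal]
  exact mul_nonpos_of_nonpos_of_nonneg hz (abs_nonneg _)

/-- For n = -1 the decay rate is μ, and e^{-μ|x|}/(2μ) = H_{-1}(x) + 1/(2μ): the true amplitude
differs from the regularized one by the constant ⟨A_{-1}⟩/(2μ). For n = 0 the difference is the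
incident wave. -/
theorem modeU_segExt (hR : 0 < R) (hμ : 0 < μ) (A : SeqSpace R) (n : ℤ) (x : ℝ) :
    modeU R μ β (fun n => segExt (A n)) n x = conv (kernelH μ β n) (A n) x +
      ((if n = 0 then modeE (kZero μ β) x else 0) +
        if n = -1 then (∫ ξ, A (-1) ξ ∂(segMeasure R)) / (2 * μ) else 0) := by
  by_cases h0 : n = 0
  · subst h0
    rw [modeU_zero, if_pos rfl, if_neg (by decide), add_zero, add_comm]
    simp only [conv, kernelH, if_true, expConv_segExt hR, ← integral_const_mul, mul_assoc]
  rw [modeU_of_ne _ _ _ _ h0, if_neg h0, zero_add]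
  simp only [expConv_segExt hR]
  by_cases h1 : n = -1
  · subst h1
    have hk : kMode μ β (-1) = μ := by
      rw [kMode, show (β + ((-1 : ℤ) : ℝ)) ^ 2 - (1 - β) ^ 2 + μ ^ 2 = μ ^ 2 by push_cast; ring,
        Real.sqrt_sq hμ.le]
    have hi : Integrable (fun ξ : Set.Icc (-R) R => Complex.exp (-(μ : ℂ) * (|x - ξ| : ℝ)) *
        A (-1) ξ) (segMeasure R) :=
      integrable_segFun ⟨fun ξ : Set.Icc (-R) R => Complex.exp (-(μ : ℂ) * (|x - ξ| : ℝ)) *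
        A (-1) ξ, by fun_prop⟩
    rw [if_pos rfl, hk, conv, ← sub_eq_iff_eq_add, ← sub_div, ← integral_sub hi
      (integrable_segFun _), ← integral_div]
    refine integral_congr_ae (Filter.Eventually.of_forall fun ξ => ?_)
    simp only [kernelH, if_neg h0, if_true, if_neg hμ.ne']
    push_cast
    ring
  · rw [if_neg h1, add_zero, conv, ← integral_div]
    refine integral_congr_ae (Filter.Eventually.of_forall fun ξ => ?_)
    simp only [kernelH, if_neg h0, if_neg h1]
    push_cast
    ring

/-- For n ≠ 0 and β < 1/2 one has |n| ≤ 2|β+n|, and |β+n| is controlled by k_n. -/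
theorem inv_kMode_sq_le (h0 : 0 < β) (h1 : β < 1 / 2) (hμ : 0 < μ) {n : ℤ} (hn : n ≠ 0) :
    1 / kMode μ β n ^ 2 ≤ (2 * (1 + 1 / μ)) ^ 2 * (1 / (n : ℝ) ^ 2) := by
  have hk : 0 < kMode μ β n := hμ.trans_le (le_kMode h0 h1 hn μ)
  have hn' : (n : ℝ) ≠ 0 := Int.cast_ne_zero.2 hn
  have h2 : |(n : ℝ)| ≤ 2 * |β + n| := by
    have h3 : (1 : ℝ) ≤ |(n : ℝ)| := by exact_mod_cast Int.one_le_abs hn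
    have h4 := abs_sub_abs_le_abs_sub (n : ℝ) (-β)
    rw [sub_neg_eq_add, add_comm (n : ℝ), abs_neg, abs_of_pos h0] at h4
    linarith
  have h5 : |(n : ℝ)| ≤ 2 * (1 + 1 / μ) * kMode μ β n := by
    linarith [abs_beta_add_le h0 h1 hμ hn]
  rw [mul_one_div, div_le_div_iff₀ (by positivity) (by positivity), one_mul, ← mul_pow]
  exact sq_le_sq' (by linarith [neg_abs_le (n : ℝ)]) ((le_abs_self _).trans h5)

/-- The sources are only square-summable, but the amplitudes are of size ‖A_n‖/k_n with 1/k_n of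
order 1/|n|. The inequality between the arithmetic and geometric means turns the product into a
summable bound. -/
theorem exists_modeU_bound (hR : 0 < R) (h0 : 0 < β) (h1 : β < 1 / 2) (hμ : 0 < μ)
    (A : SeqSpace R) : ∃ W : ℤ → ℝ, Summable W ∧
      ∀ n x, ‖modeU R μ β (fun n => segExt (A n)) n x‖ ≤ W n := by
  set L : ℝ := 1 + ‖Complex.I / (2 * (kZero μ β : ℂ))‖ * (‖A 0‖ * segLen R)
  set D : ℝ := (2 * (1 + 1 / μ)) ^ 2
  have hs : 0 ≤ segLen R := segLen_nonneg
  refine ⟨fun n => segLen R * (‖A n‖ ^ 2 + D * (1 / (n : ℝ) ^ 2)) + if n = 0 then L else 0,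
    (((seqSpace_summable_sq A).add
      ((Real.summable_one_div_int_pow.2 one_lt_two).mul_left D)).mul_left _).add
      (summable_of_ne_finset_zero (s := {0}) fun n hn => ?_), fun n x => ?_⟩
  · rw [if_neg (by simpa using hn)]
  by_cases hn : n = 0
  · subst hn
    have hL : ‖modeU R μ β (fun n => segExt (A n)) 0 x‖ ≤ L := by
      rw [modeU_zero]
      refine (norm_add_le _ _).trans ?_
      rw [norm_modeE, norm_mul]
      exact add_le_add le_rfl (mul_le_mul_of_nonneg_left
        (norm_expConv_segExt_le hR (by simp) _ _) (norm_nonneg _))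
    beta_reduce
    rw [if_pos rfl]
    have : 0 ≤ segLen R * (‖A 0‖ ^ 2 + D * (1 / ((0 : ℤ) : ℝ) ^ 2)) := by positivity
    linarith
  · have hk : 0 < kMode μ β n := hμ.trans_le (le_kMode h0 h1 hn μ)
    beta_reduce
    rw [if_neg hn, add_zero, modeU_of_ne _ _ _ _ hn, norm_div]
    have e : ‖2 * (kMode μ β n : ℂ)‖ = 2 * kMode μ β n := by
      rw [norm_mul, Complex.norm_real, Real.norm_of_nonneg hk.le]
      simp
    rw [e]
    have h2 := inv_kMode_sq_le h0 h1 hμ hn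
    have h3 : ‖A n‖ * (1 / kMode μ β n) ≤ ‖A n‖ ^ 2 + 1 / kMode μ β n ^ 2 := by
      have h4 := sq_nonneg (‖A n‖ - 1 / kMode μ β n)
      have h5 : (1 / kMode μ β n) ^ 2 = 1 / kMode μ β n ^ 2 := by rw [one_div_pow]
      nlinarith [sq_nonneg (‖A n‖), sq_nonneg (1 / kMode μ β n)]
    calc ‖expConv R (-(kMode μ β n : ℂ)) (segExt (A n)) x‖ / (2 * kMode μ β n)
        ≤ ‖A n‖ * segLen R / (2 * kMode μ β n) := div_le_div_of_nonneg_right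
          (norm_expConv_segExt_le hR (by simpa using hk.le) _ _) (by positivity)
      _ ≤ ‖A n‖ * segLen R / kMode μ β n :=
          div_le_div_of_nonneg_left (by positivity) hk (by linarith)
      _ = segLen R * (‖A n‖ * (1 / kMode μ β n)) := by ring
      _ ≤ _ := mul_le_mul_of_nonneg_left (h3.trans (by linarith)) hs

theorem summable_convolution {g h : ℤ → ℝ} (hg : Summable g) (hh : Summable h) :
    Summable fun m => ∑' n, g (m - n) * h n := by
  have hg' : Summable fun n => (g n : ℂ) := Complex.summable_ofReal.2 hg
  have hh' : Summable fun n => (h n : ℂ) := Complex.summable_ofReal.2 hh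
  have := (hasSum_convolution hg'.hasSum hh'.hasSum hg'.norm hh'.norm).summable
  rw [← Complex.summable_ofReal]
  simpa only [Complex.ofReal_tsum, Complex.ofReal_mul] using this

theorem Solves.combine (hd : SysData f ε μ β c K) {g₁ g₂ : ℤ → Set.Icc (-R) R → ℂ}
    {A₁ A₂ : SeqSpace R} (h₁ : Solves f R ε μ β g₁ A₁) (h₂ : Solves f R ε μ β g₂ A₂) (s t : ℂ) :
    Solves f R ε μ β (fun m x => s * (g₁ m x + t * g₂ m x)) (s • (A₁ + t • A₂)) := by
  rw [solves_iff hd] at h₁ h₂ ⊢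
  intro m x
  rw [← h₁, ← h₂]
  simp only [map_smul, map_add]
  set X := sysOp c K (parTau ε μ β) A₁
  set Y := sysOp c K (parTau ε μ β) A₂
  set V := src c 0 (cosFun R (kZero μ β))
  set S := src c 0 (sinFun R (kZero μ β))
  have e : ∀ (C : ℂ) (P Q : SeqSpace R), (P + Q) m x = P m x + Q m x ∧
    (P - Q) m x = P m x - Q m x ∧ (C • P) m x = C * P m x := fun C P Q => ⟨rfl, rfl, rfl⟩
  simp only [(e 0 _ _).1, (e 0 _ _).2.1, (e _ _ 0).2.2, smul_eq_mul]
  ring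

/-- The extension by zero of a solution of the system is a mode system. -/
theorem modeSystem_of_solves (hf : Perturbation f R) (hR : 0 < R) (h0 : 0 < β) (h1 : β < 1 / 2)
    (hμ : 0 < μ) (hpos : 0 < 1 - 2 * β - μ ^ 2) {A : SeqSpace R} {s : ℂ}
    (hA : Solves f R ε μ β
      (fun m x => 2 * gam μ β * ε * (gOne f R μ β m x + s * gTwo f R m x)) A)
    (hs : ∫ ξ, A (-1) ξ ∂(segMeasure R) = 2 * μ * s) :
    ∃ B, ModeSystem f R ε μ β (fun n => segExt (A n)) B := by
  -- Bootstrap: summable amplitudes convolved with the summable coefficients of f give a summable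
  -- bound for the sources, stronger than the square-summability of A.
  obtain ⟨W, hW, hW'⟩ := exists_modeU_bound hR h0 h1 hμ A
  obtain ⟨b, hb, hb0, hb'⟩ := hf.exists_majorant hR
  have hW0 : ∀ n, 0 ≤ W n := fun n => (norm_nonneg _).trans (hW' n 0)
  have hbW : ∀ m : ℤ, Summable fun n => b (m - n) * W n := fun m =>
    Summable.of_nonneg_of_le (fun n => mul_nonneg (hb0 _) (hW0 n))
      (fun n => mul_le_mul_of_nonneg_right (hb.le_tsum _ fun j _ => hb0 j) (hW0 n))
      (hW.mul_left (∑' j, b j))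
  have hle : ∀ (m n : ℤ) (x : ℝ),
      ‖fCoeff f (m - n) x * modeU R μ β (fun n => segExt (A n)) n x‖ ≤ b (m - n) * W n :=
    fun m n x => by
      rw [norm_mul]
      exact mul_le_mul (hb' _ _) (hW' n x) (norm_nonneg _) (hb0 _)
  -- The right-hand side g⁽¹⁾ + s g⁽²⁾ is the contribution of the incident wave in mode 0 and of the
  -- constant s in mode -1. Absorbing it into the sum replaces the regularized amplitudes by the
  -- true ones.
  have hsum : ∀ (m : ℤ) (x : Set.Icc (-R) R), A m x = 2 * gam μ β * ε *
      ∑' n : ℤ, fCoeff f (m - n) x * modeU R μ β (fun n => segExt (A n)) n x := by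
    intro m x
    have i1 := (Summable.of_norm_bounded (hbW m) fun n => hle m n x).hasSum
    have i2 := hasSum_ite_eq (0 : ℤ) (modeE (kZero μ β) x * fCoeff f m x)
    have i3 := hasSum_ite_eq (-1 : ℤ) (s * fCoeff f (m + 1) x)
    have i4 := (i1.sub i2).sub i3
    have e : ∀ n : ℤ, fCoeff f (m - n) x * modeU R μ β (fun n => segExt (A n)) n x -
        (if n = 0 then modeE (kZero μ β) x * fCoeff f m x else 0) -
        (if n = -1 then s * fCoeff f (m + 1) x else 0) =
        conv (kernelH μ β n) (A n) x * fCoeff f (m - n) x := by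
      intro n
      have hμ' : (μ : ℂ) ≠ 0 := Complex.ofReal_ne_zero.2 hμ.ne'
      rw [modeU_segExt hR hμ, hs, show 2 * (μ : ℂ) * s / (2 * μ) = s by field_simp]
      by_cases hn : n = 0
      · subst hn
        simp only [if_true, if_neg (show ¬((0 : ℤ) = -1) by decide), sub_zero]
        ring
      by_cases hn' : n = -1
      · subst hn'
        simp only [if_true, if_neg hn, sub_neg_eq_add]
        ring
      · simp only [if_neg hn, if_neg hn']
        ring
    simp only [e] at i4
    have h := hA m x
    rw [opT, i4.tsum_eq, sub_eq_iff_eq_add] at h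
    rw [h]
    simp only [gOne, gTwo, modeE, mul_assoc Complex.I]
    ring
  -- The sources inherit the vanishing of f at ±R, so their extensions by zero are continuous.
  have hz : ∀ (m : ℤ) (x : Set.Icc (-R) R), R ≤ |(x : ℝ)| → A m x = 0 := fun m x hx => by
    rw [hsum]
    simp only [hf.fCoeff_zero hR _ hx, zero_mul, tsum_zero, mul_zero]
  have hsum' : ∀ (m : ℤ) (x : ℝ), segExt (A m) x = 2 * gam μ β * ε *
      ∑' n : ℤ, fCoeff f (m - n) x * modeU R μ β (fun n => segExt (A n)) n x := by
    intro m x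
    by_cases hx : R ≤ |x|
    · rw [segExt_eq_zero (hz m) hx]
      simp only [hf.fCoeff_zero hR _ hx, zero_mul, tsum_zero, mul_zero]
    · have h := hsum m ⟨x, abs_le.1 (not_le.1 hx).le⟩
      rw [← segExt_coe] at h
      exact h
  exact ⟨fun m => ‖(2 * gam μ β * ε : ℂ)‖ * ∑' n, b (m - n) * W n,
    { beta_pos := h0
      beta_lt := h1
      mu_pos := hμ
      pos := hpos
      cont := fun n => continuous_segExt hR (hz n)
      zero := fun n x hx => segExt_eq_zero (hz n) hx
      bound := fun m x => by
        rw [hsum', norm_mul]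
        exact mul_le_mul_of_nonneg_left
          (tsum_of_norm_bounded (hbW m).hasSum fun n => hle m n x) (norm_nonneg _)
      summable := (summable_convolution hb hW).mul_left _
      source := hsum' }⟩

theorem coefT_segExt (hR : 0 < R) (A : SeqSpace R) :
    coefT R μ β (fun n => segExt (A n)) = 1 + Complex.I / (2 * kZero μ β) *
      (momC R (kZero μ β) A - Complex.I * momS R (kZero μ β) A) := by
  rw [coefT, ← exp_moment_neg,
    integral_mul_segExt hR (fun ξ => Complex.exp (-(Complex.I * kZero μ β) * ξ))]
  simp only [neg_mul, mul_comm (A 0 _)]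

theorem coefR_segExt (hR : 0 < R) (A : SeqSpace R) :
    coefR R μ β (fun n => segExt (A n)) = Complex.I / (2 * kZero μ β) *
      (momC R (kZero μ β) A + Complex.I * momS R (kZero μ β) A) := by
  rw [coefR, ← exp_moment,
    integral_mul_segExt hR (fun ξ => Complex.exp (Complex.I * kZero μ β * ξ))]
  simp only [mul_comm (A 0 _)]

/-- Take A = 2γε(A₁ + sA₂) with A₁ and A₂ the responses to g⁽¹⁾ and g⁽²⁾. The constant s in mode -1
must satisfy 2μs = ⟨A_{-1}⟩ = 2γε(Q + sF), which for μ = εν reads s(ν - γF) = γQ. The far field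
amplitudes of this A are then a/ℓ and b/ℓ with ℓ = ν - γF. -/
theorem exists_scattering (hf : Perturbation f R) (hR : 0 < R) (hε : 0 < ε)
    (hν : 0 < ν) (hp : GoodParam hf.cont R ε (ε * ν) β) :
    ∃ Ψ, IsScatteringSolution f ε (ε * ν) β Ψ (funA f R ε ν β / funEll f R ε ν β)
      (funB f R ε ν β / funEll f R ε ν β) := by
  set μ := ε * ν with hμ
  have hd := hp.sys
  have hk := kZero_pos hd.pos
  have hg := hp.gam_pos
  have ht : parT ε μ β ≠ 0 := by
    rw [parT]
    positivity
  -- Here ε > 0 matters: t ≠ 0, so the imaginary part of ℓ(1 - itC) cannot vanish together with its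
  -- real part.
  have hℓ : funEll f R ε ν β ≠ 0 := funEll_ne_zero hd ht hg.ne' hp.q_ne
  set c := coefFun hf.cont R
  set K := kerSel R μ β
  set A₁ := fullSol c K ε μ β (waveSrc c (kZero μ β)) with hA₁
  set A₂ := fullSol c K ε μ β (src c (-1) 1) with hA₂
  have r₁ : resolv f R ε μ β (gOne f R μ β) = A₁ := resolv_eq hd (gOne_eq hd)
  have r₂ : resolv f R ε μ β (gTwo f R) = A₂ := resolv_eq hd (gTwo_eq hd)
  have s₁ : Solves f R ε μ β (gOne f R μ β) A₁ := by
    have h := (solves_iff_eq_fullSol hd (waveSrc c (kZero μ β)) A₁).2 rfl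
    simpa only [Solves, gOne_eq hd] using h
  have s₂ : Solves f R ε μ β (gTwo f R) A₂ := by
    have h := (solves_iff_eq_fullSol hd (src c (-1) 1) A₂).2 rfl
    simpa only [Solves, gTwo_eq hd] using h
  -- The amplitude of the constant in mode -1 dictated by the consistency condition s(ν - γF) = γQ.
  set s : ℂ := gam μ β * funQ f R ε μ β / funEll f R ε ν β with hs
  set A : SeqSpace R := (2 * gam μ β * ε : ℂ) • (A₁ + s • A₂) with hA
  have hQ : funQ f R ε μ β = pairL (-1) 1 A₁ := by
    rw [funQ, r₁, mean_eq_pairL]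
  have hF : funF f R ε μ β = pairL (-1) 1 A₂ := by
    rw [funF, r₂, mean_eq_pairL]
  have hsℓ : s * (ν - gam μ β * funF f R ε μ β) = gam μ β * funQ f R ε μ β := by
    rw [hs]
    exact div_mul_cancel₀ _ hℓ
  have hmean : ∫ ξ, A (-1) ξ ∂(segMeasure R) = 2 * μ * s := by
    rw [mean_eq_pairL, hA, map_smul, map_add, map_smul, ← hQ, ← hF, hμ]
    push_cast
    simp only [smul_eq_mul]
    linear_combination (-2 * (ε : ℂ)) * hsℓ
  obtain ⟨B, hB⟩ : ∃ B, ModeSystem f R ε μ β (fun n => segExt (A n)) B := modeSystem_of_solves hf hR hp.beta.1 hp.beta.2.1 (mul_pos hε hν) hd.pos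
    (Solves.combine hd s₁ s₂ _ s) hmean
  have hk' : (kZero μ β : ℂ) ≠ 0 := Complex.ofReal_ne_zero.2 hk.ne'
  have hPp : funPplus f R ε μ β = momC R (kZero μ β) A₁ + Complex.I * momS R (kZero μ β) A₁ := by
    rw [funPplus, r₁, exp_moment]
  have hPm : funPminus f R ε μ β = momC R (kZero μ β) A₁ - Complex.I * momS R (kZero μ β) A₁ := by
    rw [funPminus, r₁, exp_moment_neg]
  -- By reciprocity A₂ radiates with amplitude Q, equally to both sides; with s = γQ/ℓ this produces
  -- the term γQ² common to a and b.
  have hm₂ : momC R (kZero μ β) A₂ = funQ f R ε μ β ∧ momS R (kZero μ β) A₂ = 0 := by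
    rw [funQ_eq hd]
    exact mom_fullSol_two hd
  have hT : coefT R μ β (fun n => segExt (A n)) = funB f R ε ν β / funEll f R ε ν β := by
    rw [coefT_segExt hR, hA, map_smul, map_add, map_smul, map_smul, map_add, map_smul, hm₂.1,
      hm₂.2, funB, ← hμ, hPm, eq_div_iff hℓ, hs]
    simp only [smul_eq_mul]
    field_simp
    ring
  have hRc : coefR R μ β (fun n => segExt (A n)) = funA f R ε ν β / funEll f R ε ν β := by
    rw [coefR_segExt hR, hA, map_smul, map_add, map_smul, map_smul, map_add, map_smul, hm₂.1,
      hm₂.2, funA, ← hμ, hPp, eq_div_iff hℓ, hs]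
    simp only [smul_eq_mul]
    field_simp
    ring
  rw [← hT, ← hRc]
  exact ⟨_, hB.isScatteringSolution hf hR⟩

end

/-! ### From the reduced real equations to zeros of a and b -/

section

variable {R : ℝ} {f : ℝ × ℝ → ℝ} {β₀ : ℝ}

theorem GoodParam.funA_eq_zero {hf : Continuous f} {ε ν β : ℝ}
    (hp : GoodParam hf R ε (ε * ν) β)
    (h : redA (coefFun hf R) (kerSel R (ε * ν) β) ε ν β = 0) : funA f R ε ν β = 0 := by
  rw [funA_eq hp.sys, h]
  simp

theorem GoodParam.funB_eq_zero {hf : Continuous f} {ε ν β : ℝ}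
    (hp : GoodParam hf R ε (ε * ν) β)
    (h : redB (coefFun hf R) (kerSel R (ε * ν) β) ε ν β = 0) : funB f R ε ν β = 0 := by
  rw [funB_eq hp.sys, h]
  simp

theorem eventually_mem_and_pos {Ω : Set (ℝ × ℝ)} (hΩ : IsOpen Ω) {ν : ℝ × ℝ → ℝ} {β : ℝ}
    (hβ : ((0 : ℝ), β) ∈ Ω) (hν : ContinuousAt ν (0, β)) (h : 0 < ν (0, β)) :
    ∀ᶠ ε : ℝ in 𝓝[>] (0 : ℝ), 0 < ε ∧ (ε, β) ∈ Ω ∧ 0 < ν (ε, β) := by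
  have hc : Filter.Tendsto (fun ε : ℝ => (ε, β)) (𝓝[>] 0) (𝓝 (0, β)) :=
    (Continuous.tendsto (by fun_prop) (0 : ℝ)).mono_left nhdsWithin_le_nhds
  filter_upwards [self_mem_nhdsWithin, hc.eventually (hΩ.mem_nhds hβ),
    hc.eventually (hν.eventually (lt_mem_nhds h))] with ε h1 h2 h3
  exact ⟨h1, h2, h3⟩

end

end RBScattering
end

theorem mainTheorem4 (f : ℝ × ℝ → ℝ) (R : ℝ) (hR : 0 < R)
    (hsmooth : ContDiff ℝ ∞ f)
    (hper : ∀ x y : ℝ, f (x, y + 2 * Real.pi) = f (x, y))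
    (hsupp : ∀ x y : ℝ, R < |x| → f (x, y) = 0)
    (hvol : 0 < ∫ x : ℝ, ∫ y in (0 : ℝ)..(2 * Real.pi), f (x, y))
    (heven_x : ∀ x y : ℝ, f (-x, y) = f (x, y))
    (heven_y : ∀ x y : ℝ, f (x, -y) = f (x, y)) :
    ∃ (Ω : Set (ℝ × ℝ)) (νa νb : ℝ × ℝ → ℝ),
      IsOpen Ω ∧
      (∀ p ∈ Ω, p.2 ∈ RBScattering.goodBeta f) ∧
      (∀ β ∈ RBScattering.goodBeta f, ((0 : ℝ), β) ∈ Ω) ∧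
      AnalyticOnNhd ℝ νa Ω ∧ AnalyticOnNhd ℝ νb Ω ∧
      (∀ ε β : ℝ, (ε, β) ∈ Ω →
        RBScattering.Regular f R ε (ε * νa (ε, β)) β ∧
        RBScattering.Regular f R ε (ε * νb (ε, β)) β ∧
        RBScattering.funA f R ε (νa (ε, β)) β = 0 ∧
        RBScattering.funB f R ε (νb (ε, β)) β = 0 ∧
        νa (ε, β) ≠ νb (ε, β)) ∧
      (∀ β ∈ RBScattering.goodBeta f,
        (fun ε : ℝ => (νa (ε, β) : ℂ) - (((1 - β) ^ 2 / (4 * Real.pi) : ℝ) : ℂ) *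
            (RBScattering.fTilde f 0 0
              - RBScattering.fTilde f 1 (RBScattering.kappa β) ^ 2
                / RBScattering.fTilde f 0 (2 * RBScattering.kappa β)))
          =O[𝓝 (0 : ℝ)] (fun ε : ℝ => ε) ∧
        (fun ε : ℝ => (νb (ε, β) : ℂ) - (((1 - β) ^ 2 / (4 * Real.pi) : ℝ) : ℂ) *
            RBScattering.fTilde f 0 0)
          =O[𝓝 (0 : ℝ)] (fun ε : ℝ => ε)) ∧
      (∀ β ∈ RBScattering.goodBeta f, 0 < νa (0, β) →
        ∀ᶠ ε : ℝ in 𝓝[>] (0 : ℝ),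
          ((∃ (Ψ : ℝ × ℝ → ℂ) (refl trans : ℂ),
              RBScattering.IsScatteringSolution f ε (ε * νa (ε, β)) β Ψ refl trans) ∧
            (∀ (Ψ : ℝ × ℝ → ℂ) (refl trans : ℂ),
              RBScattering.IsScatteringSolution f ε (ε * νa (ε, β)) β Ψ refl trans →
                refl = 0)) ∧
          ((∃ (Ψ : ℝ × ℝ → ℂ) (refl trans : ℂ),
              RBScattering.IsScatteringSolution f ε (ε * νb (ε, β)) β Ψ refl trans) ∧
            (∀ (Ψ : ℝ × ℝ → ℂ) (refl trans : ℂ),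
              RBScattering.IsScatteringSolution f ε (ε * νb (ε, β)) β Ψ refl trans →
                trans = 0))) := by
  have hf : RBScattering.Perturbation f R := ⟨hsmooth, hper, hsupp, heven_x, heven_y⟩
  obtain ⟨Ω, νa, νb, hΩ, h0, ha, hb, hg, hv⟩ := RBScattering.exists_resonances hf hR
  refine ⟨Ω, νa, νb, hΩ, fun p hp => (hg p.1 p.2 hp).1.beta, h0, ha, hb, ?_, ?_, ?_⟩
  · intro ε β hp
    obtain ⟨g1, g2, g3, g4, g5⟩ := hg ε β hp
    exact ⟨g1.sys.regular, g2.sys.regular, g1.funA_eq_zero g3, g2.funB_eq_zero g4, g5⟩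
  · intro β hβ
    refine ⟨RBScattering.isBigO_sub_of_analyticAt (ha _ (h0 β hβ)) ?_,
      RBScattering.isBigO_sub_of_analyticAt (hb _ (h0 β hβ)) ?_⟩
    · rw [(hv β hβ).1, RBScattering.fTilde_real hf hR 0 0,
        RBScattering.fTilde_real hf hR 1 (RBScattering.kappa β),
        RBScattering.fTilde_real hf hR 0 (2 * RBScattering.kappa β)]
      push_cast
      simp
    · rw [(hv β hβ).2, RBScattering.fTilde_real hf hR 0 0]
      push_cast
      simp
  · intro β hβ hpos
    -- Positivity of ν_b at ε = 0 needs no extra assumption: it is γ times the integral of f. It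
    -- makes μ positive, as decay of mode -1 requires.
    have hposb : 0 < νb (0, β) := by
      rw [(hv β hβ).2, ← RBScattering.gam_zero]
      exact mul_pos (RBScattering.gam_zero_pos hβ.2.1) (RBScattering.fTilde_zero_pos hvol)
    filter_upwards [RBScattering.eventually_mem_and_pos hΩ (h0 β hβ)
        (ha _ (h0 β hβ)).continuousAt hpos,
      RBScattering.eventually_mem_and_pos hΩ (h0 β hβ)
        (hb _ (h0 β hβ)).continuousAt hposb] with ε e1 e2
    obtain ⟨g1, g2, g3, g4, g5⟩ := hg ε β e1.2.1
    obtain ⟨Ψa, s1⟩ := RBScattering.exists_scattering hf hR e1.1 e1.2.2 g1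
    obtain ⟨Ψb, s2⟩ := RBScattering.exists_scattering hf hR e2.1 e2.2.2 g2
    refine ⟨⟨⟨Ψa, _, _, s1⟩, fun Ψ r t hs => ?_⟩, ⟨⟨Ψb, _, _, s2⟩, fun Ψ r t hs => ?_⟩⟩
    -- Any solution has the same coefficients as the constructed one, whose reflection coefficient
    -- is a/ℓ = 0.
    · rw [(RBScattering.scattering_unique hf g1.sys.pos hs s1).1,
        g1.funA_eq_zero g3, zero_div]
    · rw [(RBScattering.scattering_unique hf g2.sys.pos hs s2).2,
        g2.funB_eq_zero g4, zero_div]
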